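/- Let $n\ge 2$. Equip $\mathbb{R}^{n+3}$ with $\langle x,y\rangle=-x_1y_1+x_2y_2+\dots+x_{n+2}y_{n+2}-x_{n+3}y_{n+3}$, let $Q^{n+1}=\{[x]\in\mathbb{P}^{n+2}:\langle x,x\rangle=0\}$ be the Lie quadric and $\Lambda^{2n-1}$ the set of projective lines contained in $Q^{n+1}$. A Legendre submanifold is a map $\lambda=[Z_1,Z_2]:W^{n-1}\to\Lambda^{2n-1}$ on a smooth $(n-1)$-manifold $W$, with $Z_1,Z_2:W\to\mathbb{R}^{n+3}$ smooth, $Z_1(x),Z_2(x)$ linearly independent, $\langle Z_i,Z_j\rangle=0$, $\langle dZ_1(X),Z_2\rangle=0$ for all tangent vectors $X$, and such that $dZ_1(X),dZ_2(X)\in\mathrm{Span}\{Z_1(x),Z_2(x)\}$ only for $X=0$. For $(r,s)\ne(0,0)$ the point $[rZ_1(x)+sZ_2(x)]$ is a curvature sphere at $x$ if its principal space $\{X\in T_xW: r\,dZ_1(X)+s\,dZ_2(X)\in\mathrm{Span}\{Z_1(x),Z_2(x)\}\}$ is nonzero. A curvature sphere map is a smooth map $[K]:W\to\mathbb{P}^{n+2}$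 whose value at every point is a curvature sphere there. A curvature surface is a connected immersed submanifold whose tangent space at each of its points is a principal space. $\lambda$ is Dupin if along each curvature surface the corresponding curvature sphere is constant, and proper Dupin if moreover the number of distinct curvature spheres at $x$ does not depend on $x$. A Lie sphere transformation is a projective transformation of $\mathbb{P}^{n+2}$ taking $Q^{n+1}$ to itself. For $p,\nu\in\mathbb{R}^n$ with $|\nu|=1$, the contact element $(p,\nu)$ is identified with the line on $Q^{n+1}$ spanned by $[(\frac{1+p\cdot p}{2},\frac{1-p\cdot p}{2},p,0)]$ and $[(p\cdot\nu,-p\cdot\nu,\nu,1)]$. Let $1\le k<n$, regard $\mathbb{R}^k$ as a linear subspace of $\mathbb{R}^n$, and let a Dupin submanifold of dimension $k-1$ in $\mathbb{R}^k$ be given by contact elements $(F(x),\eta(x))$. The three standard constructions produce the following sets of contact elements in $\mathbb{R}^n$: (i) the tube of radius $\varepsilon>0$: all $(F(x)+\varepsilon\nu,\nu)$ with $\nu=\cos\theta\,\eta(x)+\sin\theta\,e$, $e\perp\mathbb{R}^k$, $|e|=1$; (ii) the cylinder: all $(F(x)+t,\eta(x))$ with $t\perp\mathbb{R}^k$; (iii)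 the surface of revolution: all $(RF(x),R\eta(x))$ with $R\in O(n)$ fixing pointwise an axis $\mathbb{R}^{k-1}\subset\mathbb{R}^k$. A Legendre submanifold $\lambda: W^{n-1}\to\Lambda^{2n-1}$ is reducible if each point of $W$ has an open neighborhood $U$ and a Lie sphere transformation $\beta$ such that all lines $\beta\lambda(y)$, $y\in U$, belong to the set of contact elements of one such tube, cylinder or surface of revolution. Theorem (Pinkall's reducibility criterion). A connected proper Dupin submanifold $\lambda:W^{n-1}\to\Lambda^{2n-1}$ is reducible if and only if there exists a curvature sphere map $[K]$ of $\lambda$ whose image lies in a linear subspace of $\mathbb{P}^{n+2}$ of codimension two. -/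

import Mathlib

open scoped Manifold ContDiff LinearAlgebra.Projectivization

noncomputable section

namespace LieSphere

/-- Euclidean space `ℝⁿ`. -/
abbrev E (n : ℕ) : Type := EuclideanSpace ℝ (Fin n)

/-- The vector space `ℝ^{n+3}`, with coordinates grouped as
`(x₁, x₂, (x₃, …, x_{n+2}), x_{n+3})`. -/
abbrev LieSpace (n : ℕ) : Type := ℝ × ℝ × E n × ℝ

/-- The Lie scalar product `-x₁y₁ + x₂y₂ + ⋯ + x_{n+2}y_{n+2} - x_{n+3}y_{n+3}`. -/
def lieForm {n : ℕ} (x y : LieSpace n) : ℝ :=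
  -(x.1 * y.1) + x.2.1 * y.2.1 + inner ℝ x.2.2.1 y.2.2.1 - x.2.2.2 * y.2.2.2

/-- A linear automorphism of `ℝ^{n+3}` whose projectivization maps the Lie quadric
`{[x] | ⟨x, x⟩ = 0}` onto itself, that is, it induces a Lie sphere transformation. -/
def IsLieSphereTransformation {n : ℕ} (B : LieSpace n ≃ₗ[ℝ] LieSpace n) : Prop :=
  ∀ v, lieForm (B v) (B v) = 0 ↔ lieForm v v = 0

/-- Lie coordinates of the point sphere `p ∈ ℝⁿ`. -/
def pointSphere {n : ℕ} (p : E n) : LieSpace n :=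
  ((1 + inner ℝ p p) / 2, (1 - inner ℝ p p) / 2, p, 0)

/-- Lie coordinates of the oriented hyperplane through `p` with unit normal `ν`. -/
def orientedPlane {n : ℕ} (p ν : E n) : LieSpace n :=
  (inner ℝ p ν, -inner ℝ p ν, ν, 1)

/-- The line on the Lie quadric (as a plane in `ℝ^{n+3}`) formed by all oriented spheres in
oriented contact at the contact element `(p, ν)`. -/
def contactLine {n : ℕ} (p ν : E n) : Submodule ℝ (LieSpace n) :=
  Submodule.span ℝ {pointSphere p, orientedPlane p ν}

section Legendre

variable {d : ℕ} {M : Type*} [TopologicalSpace M] [ChartedSpace (E d) M]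

/-- The differential at `x` of a map `Z` from a `d`-manifold to the vector space `ℝ^{n+3}`. -/
def differential {n : ℕ} (Z : M → LieSpace n) (x : M) :
    TangentSpace (𝓡 d) x →L[ℝ] LieSpace n :=
  mfderiv (𝓡 d) 𝓘(ℝ, LieSpace n) Z x

variable (d M) in
/-- A Legendre submanifold `x ↦ [Z₁ x, Z₂ x]` of the space of lines on the Lie quadric of
`P^{n+2}`, where `n = d + 1` and `M` is a manifold of dimension `d = n - 1`. A global smooth frame
`Z₁, Z₂` is no restriction: the point sphere and the great sphere on each line provide one. -/
structure LegendreSubmanifold where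
  /-- first spanning map -/
  Z₁ : M → LieSpace (d + 1)
  /-- second spanning map -/
  Z₂ : M → LieSpace (d + 1)
  smooth₁ : ContMDiff (𝓡 d) 𝓘(ℝ, LieSpace (d + 1)) ∞ Z₁
  smooth₂ : ContMDiff (𝓡 d) 𝓘(ℝ, LieSpace (d + 1)) ∞ Z₂
  linearIndependent : ∀ x, LinearIndependent ℝ ![Z₁ x, Z₂ x]
  isotropic₁₁ : ∀ x, lieForm (Z₁ x) (Z₁ x) = 0
  isotropic₂₂ : ∀ x, lieForm (Z₂ x) (Z₂ x) = 0
  isotropic₁₂ : ∀ x, lieForm (Z₁ x) (Z₂ x) = 0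
  immersion : ∀ (x : M) (X : TangentSpace (𝓡 d) x),
    differential Z₁ x X ∈ Submodule.span ℝ {Z₁ x, Z₂ x} →
    differential Z₂ x X ∈ Submodule.span ℝ {Z₁ x, Z₂ x} → X = 0
  contact : ∀ (x : M) (X : TangentSpace (𝓡 d) x), lieForm (differential Z₁ x X) (Z₂ x) = 0

namespace LegendreSubmanifold

variable (L : LegendreSubmanifold d M)

/-- The line on the Lie quadric attached to `x`, as a plane in `ℝ^{n+3}`. -/
def line (x : M) : Submodule ℝ (LieSpace (d + 1)) :=
  Submodule.span ℝ {L.Z₁ x, L.Z₂ x}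

/-- The space of tangent vectors `X` at `x` with `r dZ₁(X) + s dZ₂(X) ∈ Span {Z₁ x, Z₂ x}`. -/
def principalSpace (x : M) (r s : ℝ) : Submodule ℝ (TangentSpace (𝓡 d) x) :=
  (L.line x).comap
    (r • differential L.Z₁ x + s • differential L.Z₂ x : TangentSpace (𝓡 d) x →L[ℝ] _).toLinearMap

/-- `K` is a curvature sphere of `L` at `x`, with principal space `T`. -/
def IsCurvatureSphereAt (x : M) (K : ℙ ℝ (LieSpace (d + 1)))
    (T : Submodule ℝ (TangentSpace (𝓡 d) x)) : Prop :=
  ∃ (r s : ℝ) (h : r • L.Z₁ x + s • L.Z₂ x ≠ 0),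
    K = Projectivization.mk ℝ (r • L.Z₁ x + s • L.Z₂ x) h ∧
    T = L.principalSpace x r s ∧ T ≠ ⊥

/-- The set of curvature spheres of `L` at `x`. -/
def curvatureSpheres (x : M) : Set (ℙ ℝ (LieSpace (d + 1))) :=
  {K | ∃ T, L.IsCurvatureSphereAt x K T}

/-- `i : S → M` is a curvature surface (an immersed submanifold whose tangent space at each point
is a principal space), with corresponding curvature spheres `K`. -/
structure IsCurvatureSurface {m : ℕ} {S : Type} [TopologicalSpace S] [ChartedSpace (E m) S]
    (i : S → M) (K : S → ℙ ℝ (LieSpace (d + 1))) : Prop where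
  smooth : ContMDiff (𝓡 m) (𝓡 d) ∞ i
  injective : Function.Injective i
  immersion : ∀ s, Function.Injective (mfderiv (𝓡 m) (𝓡 d) i s)
  tangent : ∀ s, L.IsCurvatureSphereAt (i s) (K s)
    (LinearMap.range (mfderiv (𝓡 m) (𝓡 d) i s).toLinearMap)

/-- Dupin: along each connected curvature surface, the corresponding curvature sphere is
constant. -/
def IsDupin : Prop :=
  ∀ (m : ℕ) (S : Type) [TopologicalSpace S] [ChartedSpace (E m) S] [IsManifold (𝓡 m) ∞ S]
    [ConnectedSpace S] (i : S → M) (K : S → ℙ ℝ (LieSpace (d + 1))),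
    L.IsCurvatureSurface (m := m) i K → ∀ s t, K s = K t

/-- Proper Dupin: Dupin, and the number `g` of distinct curvature spheres is constant. -/
def IsProperDupin : Prop :=
  L.IsDupin ∧ ∃ g : ℕ, ∀ x, (L.curvatureSpheres x).encard = g

/-- A curvature sphere map: a smooth map to projective space (smooth means that it has smooth
local lifts) whose value at each point is a curvature sphere there. -/
def IsCurvatureSphereMap (K : M → ℙ ℝ (LieSpace (d + 1))) : Prop :=
  (∀ x, K x ∈ L.curvatureSpheres x) ∧
  ∀ x, ∃ (U : Set M) (k : M → LieSpace (d + 1)), IsOpen U ∧ x ∈ U ∧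
    ContMDiffOn (𝓡 d) 𝓘(ℝ, LieSpace (d + 1)) ∞ k U ∧
    ∀ y ∈ U, ∃ h : k y ≠ 0, K y = Projectivization.mk ℝ (k y) h

/-- `F` is the Euclidean projection of `L` and `η` its Euclidean field of unit normals. -/
def HasEuclideanProjection (F η : M → E (d + 1)) : Prop :=
  ∀ x, ‖η x‖ = 1 ∧ L.line x = contactLine (F x) (η x)

end LegendreSubmanifold

end Legendre

section Constructions

/-! In the three constructions `ℝᵏ` is regarded as a subspace of `ℝⁿ` by a linear isometry `ι`, and
`F`, `η` are the Euclidean projection and the field of unit normals of a Legendre submanifold in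
`ℝᵏ`. Each construction is given by its set of oriented contact elements in `ℝⁿ`. -/

variable {M : Type} {k n : ℕ}

/-- The tube of radius `ε` in `ℝⁿ` around the submanifold `F` of `ℝᵏ`: the unit normals are
`ν = cos θ η + sin θ e` with `e` a unit vector orthogonal to `ℝᵏ`, and the tube consists of the
points `F + ε ν`. -/
def tube (ι : E k →ₗᵢ[ℝ] E n) (F η : M → E k) (ε : ℝ) : Set (Submodule ℝ (LieSpace n)) :=
  {ℓ | ∃ (x : M) (θ : ℝ) (e ν : E n), ‖e‖ = 1 ∧ (∀ u, inner ℝ (ι u) e = 0) ∧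
    ν = Real.cos θ • ι (η x) + Real.sin θ • e ∧
    ℓ = contactLine (ι (F x) + ε • ν) ν}

/-- The cylinder in `ℝⁿ` over the submanifold `F` of `ℝᵏ`. -/
def cylinder (ι : E k →ₗᵢ[ℝ] E n) (F η : M → E k) : Set (Submodule ℝ (LieSpace n)) :=
  {ℓ | ∃ (x : M) (t : E n), (∀ u, inner ℝ (ι u) t = 0) ∧
    ℓ = contactLine (ι (F x) + t) (ι (η x))}

/-- The surface of revolution in `ℝⁿ` obtained from the submanifold `F` of `ℝᵏ` by applying all
orthogonal transformations of `ℝⁿ` that fix the axis `a^⊥ = ℝ^{k-1} ⊆ ℝᵏ` pointwise. -/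
def surfaceOfRevolution (ι : E k →ₗᵢ[ℝ] E n) (F η : M → E k) (a : E k) :
    Set (Submodule ℝ (LieSpace n)) :=
  {ℓ | ∃ (x : M) (R : E n ≃ₗᵢ[ℝ] E n), (∀ u, inner ℝ u a = 0 → R (ι u) = ι u) ∧
    ℓ = contactLine (R (ι (F x))) (R (ι (η x)))}

/-- `C` is the set of contact elements of a tube, a cylinder or a surface of revolution in `ℝⁿ`
constructed from the Legendre submanifold of `ℝᵏ` with Euclidean projection `F` and field of unit
normals `η`. -/
def IsStandardConstruction (F η : M → E k) (C : Set (Submodule ℝ (LieSpace n))) : Prop :=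
  ∃ ι : E k →ₗᵢ[ℝ] E n,
    (∃ ε : ℝ, 0 < ε ∧ C = tube ι F η ε) ∨
    C = cylinder ι F η ∨
    (∃ a : E k, ‖a‖ = 1 ∧ C = surfaceOfRevolution ι F η a)

end Constructions

/-- Reducible: near each point, `L` is carried by some Lie sphere transformation to a Legendre
submanifold obtained from a lower-dimensional Dupin submanifold by the tube, cylinder or surface
of revolution construction. -/
def LegendreSubmanifold.IsReducible {d : ℕ} {W : Type*} [TopologicalSpace W]
    [ChartedSpace (E d) W] (L : LegendreSubmanifold d W) : Prop :=
  ∀ x : W, ∃ U : Set W, IsOpen U ∧ x ∈ U ∧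
    ∃ B : LieSpace (d + 1) ≃ₗ[ℝ] LieSpace (d + 1), IsLieSphereTransformation B ∧
    ∃ (c : ℕ) (M : Type) (_ : TopologicalSpace M) (_ : ChartedSpace (E c) M)
      (_ : IsManifold (𝓡 c) ∞ M) (_ : T2Space M) (_ : SecondCountableTopology M)
      (L₀ : LegendreSubmanifold c M) (F η : M → E (c + 1))
      (C : Set (Submodule ℝ (LieSpace (d + 1)))),
      c < d ∧ L₀.IsDupin ∧ L₀.HasEuclideanProjection F η ∧ IsStandardConstruction F η C ∧
      ∀ y ∈ U, (L.line y).map B.toLinearMap ∈ C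

end LieSphere

end

open scoped Manifold ContDiff LinearAlgebra.Projectivization
open Set Filter Topology

/-! ### Analysis: implicit functions, kernels of linear families, constant rank, a touching
argument. -/

section Analysis

/-! The Lie form is positive semidefinite on the orthogonal complement of an isotropic plane, and
its radical there is the plane itself (`IsLieForm.pos`). In a chart the line of the submanifold is
spanned by two vectors `Y`, `Z`, normalized by two linear functionals and such that `Y` is nowhere a
curvature sphere (`LegendreFrame`). Because of the normalization, a derivative that lies in the line
must vanish; `B (dY ·) (dY ·)` becomes a Riemannian metric, and the curvature spheres are `K = Z + σ
Y`, where the `-σ` are the eigenvalues of the symmetric operator that represents `B (dZ ·) (dY ·)`.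
Their constant number forces constant multiplicities and smooth branches `σ` (`exists_branches`).
The Dupin condition says that `dσ` vanishes on the principal space (`Branch.fderiv_eq_zero`), so `K`
has constant rank and its fibres, the leaves, are the curvature surfaces.

Necessity. In each of the three constructions the contact elements contain a sphere that depends
only on the lower dimensional submanifold and lies in a fixed subspace of codimension two
(`IsStandardConstruction.exists_focal`). This sphere moves in the cone over a manifold of dimension
less than that of `W`, so its projective differential has a kernel and it is a curvature sphere
(`exists_fderiv_eq_smul_of_cone`). That gives a curvature sphere in `P` near one point. To spread it
over `W`, unique continuation is needed although everything is only smooth. Along a leaf, however,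
`Y` solves polynomial equations with injective linearization, and the other curvature spheres are
eigenvalues of constant multiplicity of a pencil with analytic coefficients; hence they are real
analytic along the leaf (`LeafCoordinates.analytic_Y`, `LeafCoordinates.analytic_branch`). The
vanishing of a linear functional on a curvature sphere map therefore propagates along all leaves,
and the principal directions span the tangent space (`BranchSystem.unique_continuation`).
Connectedness does the rest, and the local choices agree because the lines cannot stay in a subspace
of codimension two (`not_le_of_isOpen`).

Sufficiency. Let `K` take values in `P`. The complement of `P` is two dimensional, so it contains `e
≠ 0` orthogonal to `Y` at the given point. This `e` is spacelike or lies on the line at that point.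
If it is spacelike, let `f` be a vector of the complement orthogonal to `e`: for `f` spacelike, null
or timelike the submanifold is a surface of revolution, a cylinder or a tube, up to an isometry
provided by Witt's theorem. In each case the submanifold is first sliced by a hyperplane, which
gives a Dupin submanifold of one dimension less. A vector `ν` in the span of `e` and `f` then moves
the line at a neighbouring point, within the isotropic lines that contain `K` and are orthogonal to
`dK`, into that hyperplane. All such lines close to the submanifold belong to it
(`DupinBranch.exists_of_null`), so the moved line belongs to the slice (`DupinBranch.exists_slice`),
and undoing the move is the rotation, translation or change of angle of the construction.

Two points need extra care. For tubes, the poles, where the normal is orthogonal to the hyperplane,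
do not determine the normal of the smaller submanifold; slices through other points of the same leaf
are used, and countably many of them suffice. If `e` lies on the line, there are at most two
curvature spheres; with one the sphere is constant, with two the families are mutually orthogonal,
and both cases are again tubes (`isReducibleAt_of_mem_line`). -/

/-- Regularity can be lifted through a map with injective derivative. -/
theorem contDiffAt_of_comp_of_injective {n : WithTop ℕ∞} (hn : n ≠ 0)
    {S E F : Type*} [NormedAddCommGroup S] [NormedSpace ℝ S]
    [NormedAddCommGroup E] [NormedSpace ℝ E] [FiniteDimensional ℝ E]
    [NormedAddCommGroup F] [NormedSpace ℝ F] [FiniteDimensional ℝ F]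
    {g : E → F} {h : S → E} {t₀ : S} (hg : ContDiffAt ℝ n g (h t₀))
    (hinj : ∀ x, fderiv ℝ g (h t₀) x = 0 → x = 0)
    (hc : ContinuousAt h t₀) (hgh : ContDiffAt ℝ n (fun s => g (h s)) t₀) :
    ContDiffAt ℝ n h t₀ := by
  obtain ⟨l, hl⟩ := (fderiv ℝ g (h t₀)).toLinearMap.exists_leftInverse_of_injective
    (LinearMap.ker_eq_bot'.2 hinj)
  set L : F →L[ℝ] E := l.toContinuousLinearMap with hL
  have hLA : ∀ x, L (fderiv ℝ g (h t₀) x) = x := fun x => LinearMap.congr_fun hl x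
  -- `L ∘ g` has the identity as derivative at `h t₀`, so the inverse function theorem recovers `h`
  -- from `L ∘ g ∘ h`. Continuity of `h` keeps its values in the domain of the inverse.
  have hG : ContDiffAt ℝ n (fun x => L (g x)) (h t₀) := L.contDiff.contDiffAt.comp _ hg
  have hd : HasFDerivAt (fun x => L (g x))
      ((ContinuousLinearEquiv.refl ℝ E : E ≃L[ℝ] E) : E →L[ℝ] E) (h t₀) := by
    have h1 := L.hasFDerivAt.comp (h t₀) (hg.differentiableAt hn).hasFDerivAt
    have h2 : L ∘L fderiv ℝ g (h t₀) = ((ContinuousLinearEquiv.refl ℝ E : E ≃L[ℝ] E) : E →L[ℝ] E) :=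
      ContinuousLinearMap.ext fun x => hLA x
    rw [← h2]
    exact h1
  set e := hG.toOpenPartialHomeomorph _ hd hn with he
  have hmem := hG.mem_toOpenPartialHomeomorph_source hd hn
  have hinv : ContDiffAt ℝ n (hG.localInverse hd hn) (L (g (h t₀))) := hG.to_localInverse hd hn
  have hcomp : ContDiffAt ℝ n (fun s => hG.localInverse hd hn (L (g (h s)))) t₀ :=
    ContDiffAt.comp (g := hG.localInverse hd hn) (f := fun s => L (g (h s))) t₀ hinv
      (L.contDiff.contDiffAt.comp t₀ hgh)
  refine hcomp.congr_of_eventuallyEq ?_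
  filter_upwards [hc (e.open_source.mem_nhds hmem)] with s hs
  exact (e.left_inv hs).symm

/-- Kernels of a family of linear maps: upper semicontinuity of the nullity, and sections through
a given kernel vector when the nullity does not drop. -/
theorem exists_kernel_section {S E F : Type*} [NormedAddCommGroup S] [NormedSpace ℝ S]
    [NormedAddCommGroup E] [NormedSpace ℝ E] [FiniteDimensional ℝ E]
    [NormedAddCommGroup F] [NormedSpace ℝ F] [FiniteDimensional ℝ F]
    (A : S → E →L[ℝ] F) (s₀ : S) (hA : ContinuousAt A s₀) :
    ∃ q : E →L[ℝ] E, (∀ x, A s₀ (q x) = 0) ∧ (∀ x, A s₀ x = 0 → q x = x) ∧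
      (∀ᶠ s in 𝓝 s₀, Module.finrank ℝ (LinearMap.ker (A s).toLinearMap) ≤
        Module.finrank ℝ (LinearMap.ker (A s₀).toLinearMap)) ∧
      ∀ x₀, A s₀ x₀ = 0 → ∃ X : S → E, X s₀ = x₀ ∧ ContinuousAt X s₀ ∧
        ∀ᶠ s in 𝓝 s₀, q (X s) = x₀ ∧
          (Module.finrank ℝ (LinearMap.ker (A s₀).toLinearMap) ≤
            Module.finrank ℝ (LinearMap.ker (A s).toLinearMap) → A s (X s) = 0) ∧
          ∀ n : WithTop ℕ∞, ContDiffAt ℝ n A s → ContDiffAt ℝ n X s := by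
  classical
  set N := LinearMap.ker (A s₀).toLinearMap with hN
  obtain ⟨p, hp⟩ := N.subtype.exists_leftInverse_of_injective N.ker_subtype
  set q : E →L[ℝ] E := (N.subtype ∘ₗ p).toContinuousLinearMap with hq
  have hq0 : ∀ x, A s₀ (q x) = 0 := fun x => (p x).2
  have hq1 : ∀ x, A s₀ x = 0 → q x = x := fun x hx => by
    have := LinearMap.congr_fun hp ⟨x, hx⟩
    exact congrArg Subtype.val this
  have hqq : ∀ x, q (q x) = q x := fun x => hq1 _ (hq0 x)
  set C := LinearMap.ker q.toLinearMap with hC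
  obtain ⟨l, hl⟩ := ((A s₀).toLinearMap ∘ₗ C.subtype).exists_leftInverse_of_injective (by
    rw [LinearMap.ker_eq_bot']
    rintro ⟨x, hx⟩ hx0
    have h1 : q x = 0 := hx
    have h2 : A s₀ x = 0 := hx0
    exact Subtype.ext ((hq1 x h2).symm.trans h1))
  set L : F →L[ℝ] E := (C.subtype ∘ₗ l).toContinuousLinearMap with hL
  have hqL : ∀ x, q (L x) = 0 := fun x => (l x).2
  have hLA : ∀ x, L (A s₀ x) = x - q x := fun x => by
    have h1 : q (x - q x) = 0 := by rw [map_sub, hqq, sub_self]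
    have h2 := LinearMap.congr_fun hl ⟨x - q x, h1⟩
    have h3 : L (A s₀ (x - q x)) = x - q x := congrArg Subtype.val h2
    rwa [map_sub, hq0, sub_zero] at h3
  -- `T` is the identity at `s₀`, hence invertible nearby. On the kernel of `L ∘ A s` it coincides
  -- with `q`, so this kernel injects into `N`: this is the semicontinuity. The section is `(T s)⁻¹
  -- x₀`, which is annihilated by `L ∘ A s`, hence by `A s` once the nullity has not dropped.
  set T : S → E →L[ℝ] E := fun s => L ∘L A s + q with hT
  have hT0 : T s₀ = 1 := by
    ext x; simp [hT, hLA]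
  have hTc : ContinuousAt T s₀ := by
    apply ContinuousAt.add _ continuousAt_const
    exact (ContinuousLinearMap.compL ℝ E F E L).continuous.continuousAt.comp hA
  have hunit : ∀ᶠ s in 𝓝 s₀, IsUnit (T s) := by
    refine hTc.eventually (Units.isOpen.mem_nhds ?_)
    rw [hT0]
    exact isUnit_one
  have hrank : ∀ s, IsUnit (T s) →
      Module.finrank ℝ (LinearMap.ker (L ∘L A s).toLinearMap) ≤ Module.finrank ℝ N := by
    intro s hs
    obtain ⟨u, hu⟩ := hs
    have h1 : ∀ x ∈ LinearMap.ker (L ∘L A s).toLinearMap, q x = T s x := by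
      intro x hx
      have : L (A s x) = 0 := hx
      simp [hT, this]
    refine LinearMap.finrank_le_finrank_of_injective
      (f := p ∘ₗ (LinearMap.ker (L ∘L A s).toLinearMap).subtype) ?_
    rw [← LinearMap.ker_eq_bot, LinearMap.ker_eq_bot']
    rintro ⟨x, hx⟩ hx0
    have h2 : q x = 0 := congrArg Subtype.val hx0
    have h3 : T s x = 0 := by rw [← h1 x hx, h2]
    apply Subtype.ext
    have h4 : (↑u⁻¹ : E →L[ℝ] E) (T s x) = x := by
      rw [← hu]
      exact congrArg (fun f : E →L[ℝ] E => f x) u.inv_mul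
    rw [h3, map_zero] at h4
    exact h4.symm
  have hle : ∀ s, LinearMap.ker (A s).toLinearMap ≤ LinearMap.ker (L ∘L A s).toLinearMap := by
    intro s x hx
    have : A s x = 0 := hx
    change L (A s x) = 0
    rw [this, map_zero]
  refine ⟨q, hq0, hq1, ?_, ?_⟩
  · filter_upwards [hunit] with s hs
    exact (Submodule.finrank_mono (hle s)).trans (hrank s hs)
  · intro x₀ hx₀
    refine ⟨fun s => Ring.inverse (T s) x₀, ?_, ?_, ?_⟩
    · simp [hT0]
    · have h1 : ContinuousAt (Ring.inverse : (E →L[ℝ] E) → _) (T s₀) := by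
        rw [hT0]
        exact NormedRing.inverse_continuousAt (1 : (E →L[ℝ] E)ˣ)
      have h2 : ContinuousAt (fun s => Ring.inverse (T s)) s₀ :=
        ContinuousAt.comp (f := T) (g := Ring.inverse) h1 hTc
      exact h2.clm_apply continuousAt_const
    · filter_upwards [hunit] with s hs
      have hTX : T s (Ring.inverse (T s) x₀) = x₀ := by
        have := congrArg (fun f : E →L[ℝ] E => f x₀) (Ring.mul_inverse_cancel _ hs)
        simpa using this
      set x := Ring.inverse (T s) x₀ with hx
      have hqx : q x = x₀ := by
        have := congrArg q hTX
        rw [hq1 x₀ hx₀] at this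
        simpa [hT, hqL, hqq] using this
      refine ⟨hqx, fun hr => ?_, fun n hn => ?_⟩
      · have h1 : LinearMap.ker (A s).toLinearMap = LinearMap.ker (L ∘L A s).toLinearMap :=
          Submodule.eq_of_le_of_finrank_le (hle s) ((hrank s hs).trans hr)
        have h2 : x ∈ LinearMap.ker (L ∘L A s).toLinearMap := by
          change L (A s x) = 0
          have : L (A s x) + q x = x₀ := hTX
          rw [hqx] at this
          simpa using this
        rw [← h1] at h2
        exact h2
      · obtain ⟨u, hu⟩ := hs
        have h1 : ContDiffAt ℝ n T s :=
          ((ContinuousLinearMap.compL ℝ E F E L).contDiff.contDiffAt.comp s hn).add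
            contDiffAt_const
        have h2 : ContDiffAt ℝ n (Ring.inverse : (E →L[ℝ] E) → _) (T s) := by
          rw [← hu]; exact contDiffAt_ringInverse ℝ u
        exact (ContDiffAt.comp s h2 h1).clm_apply contDiffAt_const

/-- Regularity of an eigenvalue of constant multiplicity of a pencil of linear maps. -/
theorem contDiffAt_eigenvalue {n : WithTop ℕ∞} (hn : n ≠ 0)
    {S E F : Type*} [NormedAddCommGroup S] [NormedSpace ℝ S] [FiniteDimensional ℝ S]
    [NormedAddCommGroup E] [NormedSpace ℝ E] [FiniteDimensional ℝ E]
    [NormedAddCommGroup F] [NormedSpace ℝ F] [FiniteDimensional ℝ F]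
    (G H : S → E →L[ℝ] F) (ρ : S → ℝ) (s₀ : S)
    (hG : ContDiffAt ℝ n G s₀) (hH : ContDiffAt ℝ n H s₀) (hρ : ContinuousAt ρ s₀)
    (φ : F →L[ℝ] ℝ) (hφ : ∀ x, φ ((G s₀ + ρ s₀ • H s₀) x) = 0)
    (hrank : ∀ᶠ s in 𝓝 s₀,
      Module.finrank ℝ (LinearMap.ker (G s₀ + ρ s₀ • H s₀).toLinearMap) ≤
        Module.finrank ℝ (LinearMap.ker (G s + ρ s • H s).toLinearMap))
    (v₀ : E) (hv₀ : (G s₀ + ρ s₀ • H s₀) v₀ = 0) (hne : φ (H s₀ v₀) ≠ 0) :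
    ContDiffAt ℝ n ρ s₀ := by
  obtain ⟨q, hq0, hq1, -, hsec⟩ := exists_kernel_section (fun s => G s + ρ s • H s) s₀
    (hG.continuousAt.add (hρ.smul hH.continuousAt))
  obtain ⟨X, hX0, hXc, hX⟩ := hsec v₀ hv₀
  -- The triple of parameter, eigenvalue and eigenvector solves `g = (s, 0, v₀)`. The last component
  -- fixes the eigenvector within the kernel. In the linearization, `φ` annihilates the contribution
  -- of the eigenvector and isolates the variation of the eigenvalue, so the linearization is
  -- injective.
  set g : S × ℝ × E → S × F × E :=
    fun p => (p.1, (G p.1 + p.2.1 • H p.1) p.2.2, q p.2.2) with hg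
  have hd : ∀ p : S × ℝ × E, p.1 = s₀ → ContDiffAt ℝ n g p := by
    rintro ⟨s, r, x⟩ rfl
    have hG' : ContDiffAt ℝ n (fun p : S × ℝ × E => G p.1) (s, r, x) :=
      ContDiffAt.comp (g := G) (f := Prod.fst) (s, r, x) hG contDiffAt_fst
    have hH' : ContDiffAt ℝ n (fun p : S × ℝ × E => H p.1) (s, r, x) :=
      ContDiffAt.comp (g := H) (f := Prod.fst) (s, r, x) hH contDiffAt_fst
    have h2 : ContDiffAt ℝ n (fun p : S × ℝ × E => p.2.1) (s, r, x) :=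
      contDiffAt_fst.comp (s, r, x) contDiffAt_snd
    have h3 : ContDiffAt ℝ n (fun p : S × ℝ × E => p.2.2) (s, r, x) :=
      contDiffAt_snd.comp (s, r, x) contDiffAt_snd
    exact contDiffAt_fst.prodMk (((hG'.add (h2.smul hH')).clm_apply h3).prodMk
      (q.contDiff.contDiffAt.comp (s, r, x) h3))
  have key : ContDiffAt ℝ n (fun s => (s, ρ s, X s)) s₀ := by
    refine contDiffAt_of_comp_of_injective hn (g := g) (hd _ rfl) ?_ ?_ ?_
    · rintro ⟨ds, dr, dx⟩ h0
      have hGd := (hG.differentiableAt hn).hasFDerivAt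
      have hHd := (hH.differentiableAt hn).hasFDerivAt
      have f1 : HasFDerivAt (fun p : S × ℝ × E => p.1)
          (ContinuousLinearMap.fst ℝ S (ℝ × E)) (s₀, ρ s₀, X s₀) := hasFDerivAt_fst
      have f2 : HasFDerivAt (fun p : S × ℝ × E => p.2)
          (ContinuousLinearMap.snd ℝ S (ℝ × E)) (s₀, ρ s₀, X s₀) := hasFDerivAt_snd
      have h2 : HasFDerivAt (fun p : S × ℝ × E => p.2.1) _ (s₀, ρ s₀, X s₀) := f2.fst
      have h3 : HasFDerivAt (fun p : S × ℝ × E => p.2.2) _ (s₀, ρ s₀, X s₀) := f2.snd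
      have hGd' := HasFDerivAt.comp (g := G) (s₀, ρ s₀, X s₀) hGd f1
      have hHd' := HasFDerivAt.comp (g := H) (s₀, ρ s₀, X s₀) hHd f1
      have hq3 := q.hasFDerivAt.comp (s₀, ρ s₀, X s₀) h3
      have hall : HasFDerivAt g _ (s₀, ρ s₀, X s₀) :=
        f1.prodMk (((hGd'.add (h2.smul hHd')).clm_apply h3).prodMk hq3)
      rw [hall.fderiv] at h0
      have e1 : ds = 0 := congrArg Prod.fst h0
      have e2 := congrArg (fun p => p.2.1) h0
      have e3 : q dx = 0 := congrArg (fun p => p.2.2) h0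
      subst e1
      have e4 : (G s₀ + ρ s₀ • H s₀) dx + dr • H s₀ v₀ = 0 := by
        simpa [hX0] using e2
      have e5 : dr = 0 := by
        have h6 := congrArg φ e4
        rw [map_add, hφ, map_smul, map_zero, zero_add, smul_eq_mul] at h6
        exact (mul_eq_zero.1 h6).resolve_right hne
      subst e5
      rw [zero_smul, add_zero] at e4
      have e6 : dx = 0 := by rw [← hq1 dx e4, e3]
      subst e6
      rfl
    · exact continuousAt_id.prodMk (hρ.prodMk hXc)
    · have : (fun s => g (s, ρ s, X s)) =ᶠ[𝓝 s₀] fun s => (s, 0, v₀) := by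
        filter_upwards [hX, hrank] with s hs hr
        simp only [hg, Prod.mk.injEq, true_and]
        exact ⟨hs.2.1 hr, hs.1⟩
      exact (contDiffAt_id.prodMk (contDiffAt_const.prodMk contDiffAt_const)).congr_of_eventuallyEq
        this
  exact contDiffAt_fst.comp s₀ (contDiffAt_snd.comp s₀ key)

/-- Coordinates adapted to the fibres of a map of constant rank. -/
theorem exists_constant_rank_coordinates {V Λ R D : Type*}
    [NormedAddCommGroup V] [NormedSpace ℝ V] [FiniteDimensional ℝ V]
    [NormedAddCommGroup Λ] [NormedSpace ℝ Λ] [NormedAddCommGroup R] [NormedSpace ℝ R]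
    [NormedAddCommGroup D] [NormedSpace ℝ D] [FiniteDimensional ℝ R] [FiniteDimensional ℝ D]
    (k : V → Λ) (Θ : V → D) (π : Λ →L[ℝ] R) (y₀ : V) (O : Set V) (hO : O ∈ 𝓝 y₀)
    (hk : ∀ y ∈ O, ContDiffAt ℝ ∞ k y) (hΘ : ∀ y ∈ O, ContDiffAt ℝ ∞ Θ y)
    (hinj : ∀ X, π (fderiv ℝ k y₀ X) = 0 → fderiv ℝ Θ y₀ X = 0 → X = 0)
    (hdim : Module.finrank ℝ V = Module.finrank ℝ R + Module.finrank ℝ D)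
    (hker : ∀ y ∈ O, ∀ X, π (fderiv ℝ k y X) = 0 → fderiv ℝ k y X = 0) :
    ∃ e : OpenPartialHomeomorph V (R × D), y₀ ∈ e.source ∧ e.source ⊆ O ∧
      (∀ y ∈ e.source, e y = (π (k y), Θ y)) ∧
      (∀ p ∈ e.target, ContDiffAt ℝ ∞ e.symm p) ∧
      ∃ r > 0, Metric.ball (π (k y₀)) r ×ˢ Metric.ball (Θ y₀) r ⊆ e.target ∧
        ∀ v ∈ Metric.ball (π (k y₀)) r, ∀ t ∈ Metric.ball (Θ y₀) r,
          ∀ t' ∈ Metric.ball (Θ y₀) r, k (e.symm (v, t)) = k (e.symm (v, t')) := by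
  have hy₀ : y₀ ∈ O := mem_of_mem_nhds hO
  set Φ : V → R × D := fun y => (π (k y), Θ y) with hΦ
  have hΦs : ∀ y ∈ O, ContDiffAt ℝ ∞ Φ y := fun y hy =>
    (π.contDiff.contDiffAt.comp y (hk y hy)).prodMk (hΘ y hy)
  have hinf : (∞ : WithTop ℕ∞) ≠ 0 := by simp
  have hΦd : ∀ y ∈ O, HasFDerivAt Φ ((π ∘L fderiv ℝ k y).prod (fderiv ℝ Θ y)) y := fun y hy =>
    (π.hasFDerivAt.comp y ((hk y hy).differentiableAt hinf).hasFDerivAt).prodMk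
      ((hΘ y hy).differentiableAt hinf).hasFDerivAt
  set A := (π ∘L fderiv ℝ k y₀).prod (fderiv ℝ Θ y₀) with hA
  have hAinj : LinearMap.ker A.toLinearMap = ⊥ := by
    rw [LinearMap.ker_eq_bot']
    intro X hX
    exact hinj X (congrArg Prod.fst hX) (congrArg Prod.snd hX)
  set A' : V ≃L[ℝ] R × D := (LinearEquiv.ofInjectiveOfFinrankEq A.toLinearMap
    (LinearMap.ker_eq_bot.1 hAinj) (by simp [hdim])).toContinuousLinearEquiv with hA'
  have hAA : (A' : V →L[ℝ] R × D) = A := by ext X <;> rfl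
  have hd0 : HasFDerivAt Φ (A' : V →L[ℝ] R × D) y₀ := by rw [hAA]; exact hΦd y₀ hy₀
  set e₀ := (hΦs y₀ hy₀).toOpenPartialHomeomorph Φ hd0 hinf with he₀
  have hmem : y₀ ∈ e₀.source := (hΦs y₀ hy₀).mem_toOpenPartialHomeomorph_source hd0 hinf
  -- shrink to where the derivative is invertible
  obtain ⟨O', hO'O, hO'o, hyO'⟩ := mem_nhds_iff.1 hO
  have hcont : ContinuousOn (fun y => fderiv ℝ Φ y) O' := fun y hy =>
    (((hΦs y (hO'O hy)).fderiv_right (m := 0) (by simp)).continuousAt).continuousWithinAt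
  set O'' := O' ∩ (fun y => fderiv ℝ Φ y) ⁻¹' (range ((↑) : (V ≃L[ℝ] R × D) → V →L[ℝ] R × D))
    with hO''
  have hO''o : IsOpen O'' := hcont.isOpen_inter_preimage hO'o (ContinuousLinearEquiv.isOpen)
  have hyO'' : y₀ ∈ O'' := ⟨hyO', ⟨A', hd0.fderiv.symm⟩⟩
  set e := e₀.restrOpen O'' hO''o with he
  have hesrc : e.source = e₀.source ∩ O'' := by simp [he]
  have hye : y₀ ∈ e.source := by rw [hesrc]; exact ⟨hmem, hyO''⟩
  have hecoe : ∀ y, e y = Φ y := fun y => rfl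
  have hsub : e.source ⊆ O := by
    rw [hesrc]; exact fun y hy => hO'O hy.2.1
  have hsymm : ∀ p ∈ e.target, ContDiffAt ℝ ∞ e.symm p := by
    intro p hp
    have hps : e.symm p ∈ e.source := e.map_target hp
    have h1 : e.symm p ∈ O'' := by rw [hesrc] at hps; exact hps.2
    obtain ⟨Lq, hLq⟩ := h1.2
    refine e.contDiffAt_symm (f₀' := Lq) hp ?_ (hΦs _ (hsub hps))
    change HasFDerivAt Φ _ _
    rw [hLq]
    exact (hΦd _ (hsub hps)).differentiableAt.hasFDerivAt
  have hy0t : e y₀ ∈ e.target := e.map_source hye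
  obtain ⟨r, hr, hball⟩ := Metric.isOpen_iff.1 e.open_target _ hy0t
  refine ⟨e, hye, hsub, fun y _ => rfl, hsymm, r, hr, ?_, ?_⟩
  · rw [ball_prod_same]; exact hball
  · have hbox : ∀ v ∈ Metric.ball (π (k y₀)) r, ∀ t ∈ Metric.ball (Θ y₀) r, (v, t) ∈ e.target := by
      intro v hv t ht
      apply hball
      have : (v, t) ∈ Metric.ball (π (k y₀)) r ×ˢ Metric.ball (Θ y₀) r := ⟨hv, ht⟩
      rw [ball_prod_same] at this
      exact this
    intro v hv t ht t' ht'
    have hconv : Convex ℝ (Metric.ball (Θ y₀) r) := convex_ball _ _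
    -- Along a fibre `π ∘ k` is constant, and `hker` turns the vanishing of its derivative into the
    -- vanishing of the derivative of `k`.
    have hder : ∀ τ ∈ Metric.ball (Θ y₀) r,
        HasFDerivWithinAt (fun τ => k (e.symm (v, τ))) (0 : D →L[ℝ] Λ)
          (Metric.ball (Θ y₀) r) τ := by
      intro τ hτ
      have hp := hbox v hv τ hτ
      have hps : e.symm (v, τ) ∈ e.source := e.map_target hp
      have h1 : HasFDerivAt e.symm (fderiv ℝ e.symm (v, τ)) (v, τ) :=
        ((hsymm _ hp).differentiableAt hinf).hasFDerivAt
      have h2 : HasFDerivAt (fun τ => e.symm (v, τ))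
          (fderiv ℝ e.symm (v, τ) ∘L ContinuousLinearMap.inr ℝ R D) τ :=
        HasFDerivAt.comp τ (f := fun τ => (v, τ)) h1 (hasFDerivAt_prodMk_right v τ)
      have h3 := (((hk _ (hsub hps)).differentiableAt hinf).hasFDerivAt).comp τ h2
      have h4 : fderiv ℝ k (e.symm (v, τ)) ∘L (fderiv ℝ e.symm (v, τ) ∘L
          ContinuousLinearMap.inr ℝ R D) = 0 := by
        ext w
        refine hker _ (hsub hps) _ ?_
        have h5 := (hΦd _ (hsub hps)).comp τ h2
        have h6 : (Φ ∘ fun τ => e.symm (v, τ)) =ᶠ[𝓝 τ] fun τ => (v, τ) := by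
          filter_upwards [Metric.isOpen_ball.mem_nhds hτ] with τ' hτ'
          exact e.right_inv (hbox v hv τ' hτ')
        have h7 := (h5.congr_of_eventuallyEq h6.symm).unique (hasFDerivAt_prodMk_right v τ)
        exact congrArg (fun f : D →L[ℝ] R × D => (f w).1) h7
      rw [h4] at h3
      exact h3.hasFDerivWithinAt
    exact hconv.is_const_of_fderivWithin_eq_zero (𝕜 := ℝ)
      (fun τ hτ => (hder τ hτ).differentiableWithinAt)
      (fun τ hτ => (hder τ hτ).fderivWithin (Metric.isOpen_ball.uniqueDiffWithinAt hτ)) ht ht'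

/-- Simultaneous diagonalization of a symmetric form with respect to a positive definite one. -/
theorem exists_simultaneous_diagonalization {V : Type*} [AddCommGroup V] [Module ℝ V]
    [FiniteDimensional ℝ V] (g h : V →ₗ[ℝ] V →ₗ[ℝ] ℝ) (hg : ∀ x y, g x y = g y x)
    (hh : ∀ x y, h x y = h y x) (hpos : ∀ x, 0 ≤ g x x) (hdef : ∀ x, g x x = 0 → x = 0) :
    ∃ (b : Module.Basis (Fin (Module.finrank ℝ V)) ℝ V) (μ : Fin (Module.finrank ℝ V) → ℝ),
      (∀ i x, h (b i) x = μ i * g (b i) x) ∧ ∀ i j, g (b i) (b j) = if i = j then 1 else 0 := by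
  let core : InnerProductSpace.Core ℝ V :=
    { inner := fun x y => g x y
      conj_inner_symm := fun x y => by simp [hg x y]
      re_inner_nonneg := fun x => by simpa using hpos x
      definite := fun x hx => hdef x hx
      add_left := fun x y z => by simp
      smul_left := fun x y r => by simp }
  letI : NormedAddCommGroup V := core.toNormedAddCommGroup
  letI : InnerProductSpace ℝ V := InnerProductSpace.ofCore core.toCore
  have hinner : ∀ x y : V, inner ℝ x y = g x y := fun x y => rfl
  let S : V →ₗ[ℝ] V := ((InnerProductSpace.toDual ℝ V).symm.toLinearEquiv.toLinearMap) ∘ₗ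
    (LinearMap.toContinuousLinearMap (𝕜 := ℝ) (E := V) (F' := ℝ)).toLinearMap ∘ₗ h
  have hS : ∀ x y, inner ℝ (S x) y = h x y := by
    intro x y
    exact InnerProductSpace.toDual_symm_apply (𝕜 := ℝ) (x := y)
      (y := LinearMap.toContinuousLinearMap (h x))
  have hsymm : S.IsSymmetric := by
    intro x y
    rw [hS, real_inner_comm, hS, hh]
  refine ⟨(hsymm.eigenvectorBasis rfl).toBasis, hsymm.eigenvalues rfl, ?_, ?_⟩
  · intro i x
    rw [← hS, ← hinner, OrthonormalBasis.coe_toBasis, hsymm.apply_eigenvectorBasis,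
      real_inner_smul_left]
    rfl
  · intro i j
    rw [← hinner, OrthonormalBasis.coe_toBasis]
    exact orthonormal_iff_ite.1 (hsymm.eigenvectorBasis rfl).orthonormal i j

/-- A nonempty open subset of a ball which can be entered from each of its boundary points in
some direction of every open half space is the whole ball. -/
theorem eq_ball_of_touching {d : ℕ} (c : EuclideanSpace ℝ (Fin d)) (R : ℝ)
    (Z : Set (EuclideanSpace ℝ (Fin d))) (hZo : IsOpen Z) (hne : (Z ∩ Metric.ball c R).Nonempty)
    (h : ∀ y ∈ Metric.ball c R, ∀ w : EuclideanSpace ℝ (Fin d), w ≠ 0 →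
      ∃ (X : EuclideanSpace ℝ (Fin d)) (γ : ℝ → EuclideanSpace ℝ (Fin d)),
        0 < inner ℝ X w ∧ γ 0 = y ∧ HasDerivAt γ X 0 ∧ ∀ᶠ s in 𝓝 0, γ s ∈ Z → y ∈ Z) :
    Metric.ball c R ⊆ Z := by
  by_contra hnot
  have hpre : IsPreconnected (Metric.ball c R) := (convex_ball c R).isPreconnected
  -- a boundary point
  have hbd : ∃ y ∈ Metric.ball c R, y ∉ Z ∧ y ∈ closure Z := by
    by_contra hcon
    push Not at hcon
    refine hnot ?_
    have hsub : Metric.ball c R ⊆ Z ∪ (closure Z)ᶜ := by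
      intro y hy
      by_cases hyZ : y ∈ Z
      · exact Or.inl hyZ
      · exact Or.inr (hcon y hy hyZ)
    refine hpre.subset_left_of_subset_union hZo isClosed_closure.isOpen_compl ?_ hsub ?_
    · exact disjoint_compl_right_iff_subset.2 subset_closure
    · rwa [inter_comm] at hne
  obtain ⟨y₁, hy₁, hy₁Z, hy₁c⟩ := hbd
  obtain ⟨δ, hδ, hδb⟩ := Metric.isOpen_iff.1 Metric.isOpen_ball y₁ hy₁
  obtain ⟨z, hzZ, hzd⟩ := Metric.mem_closure_iff.1 hy₁c (δ / 3) (by positivity)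
  have hZc : IsClosed Zᶜ := hZo.isClosed_compl
  -- The nearest point `y` of the complement satisfies `dist y y₁ ≤ 2 dist z y₁ < δ`, so it still
  -- lies in the ball. The open ball around `z` through `y` is contained in `Z`, and a curve leaving
  -- `y` at an acute angle to `z - y` enters it.
  obtain ⟨y, hyZ, hyd⟩ := hZc.exists_infDist_eq_dist ⟨y₁, hy₁Z⟩ z
  have hdle : dist z y ≤ dist z y₁ := by
    rw [← hyd]; exact Metric.infDist_le_dist_of_mem hy₁Z
  have hyb : y ∈ Metric.ball c R := by
    apply hδb
    rw [Metric.mem_ball]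
    calc dist y y₁ ≤ dist y z + dist z y₁ := dist_triangle _ _ _
      _ < δ := by rw [dist_comm y z]; rw [dist_comm] at hzd; linarith
  have hzy : z - y ≠ 0 := by
    intro h0
    rw [sub_eq_zero] at h0
    exact hyZ (h0 ▸ hzZ)
  obtain ⟨X, γ, hX, hγ0, hγ, hev⟩ := h y hyb (z - y) hzy
  -- the curve enters the ball around z
  have hfun : HasDerivAt (fun s => ‖γ s - z‖ ^ 2) (2 * inner ℝ (γ 0 - z) X) 0 := by
    have := (hγ.sub_const z).norm_sq
    simpa using this
  have hneg : 2 * inner ℝ (γ 0 - z) X < 0 := by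
    rw [hγ0, ← neg_sub z y, inner_neg_left, real_inner_comm]; linarith
  have hlt : ∀ᶠ s in 𝓝[>] (0 : ℝ), ‖γ s - z‖ ^ 2 < ‖γ 0 - z‖ ^ 2 := by
    have h1 := (hasDerivAt_iff_tendsto_slope_zero.1 hfun).mono_left
      (nhdsWithin_mono 0 (fun s (hs : (0 : ℝ) < s) => hs.ne'))
    have h2 := h1.eventually (gt_mem_nhds hneg)
    filter_upwards [h2, self_mem_nhdsWithin] with s hs hs0
    have hs0' : (0 : ℝ) < s := hs0
    simp only [zero_add, smul_eq_mul] at hs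
    have := (mul_neg_iff.1 hs)
    rcases this with ⟨_, h4⟩ | ⟨h3, _⟩
    · linarith
    · exact absurd h3 (not_lt.2 (inv_nonneg.2 hs0'.le))
  obtain ⟨s, hs1, hs2⟩ := (hlt.and (hev.filter_mono nhdsWithin_le_nhds)).exists
  refine hyZ (hs2 ?_)
  by_contra hsZ
  have h3 : dist z y ≤ dist z (γ s) := by
    rw [← hyd]; exact Metric.infDist_le_dist_of_mem hsZ
  rw [hγ0] at hs1
  rw [dist_comm z y, dist_comm z (γ s), dist_eq_norm, dist_eq_norm] at h3
  have := pow_le_pow_left₀ (norm_nonneg _) h3 2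
  linarith

end Analysis

/-! ### Legendre frames: metric, shape operator and principal bases. -/

/-- The properties of the Lie scalar product that the local theory uses. -/
structure IsLieForm {Λ : Type*} [NormedAddCommGroup Λ] [NormedSpace ℝ Λ]
    (B : Λ →L[ℝ] Λ →L[ℝ] ℝ) : Prop where
  symm : ∀ x y, B x y = B y x
  nondeg : ∀ x, (∀ y, B x y = 0) → x = 0
  pos : ∀ a b, LinearIndependent ℝ ![a, b] → B a a = 0 → B a b = 0 → B b b = 0 →
    ∀ v, B v a = 0 → B v b = 0 → 0 ≤ B v v ∧ (B v v = 0 → v ∈ Submodule.span ℝ {a, b})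

/-- A local Legendre map `y ↦ [Y y, Z y]` normalized by two linear functionals, such that `Y` is
nowhere a curvature sphere. -/
structure LegendreFrame {V Λ : Type*} [NormedAddCommGroup V] [NormedSpace ℝ V]
    [NormedAddCommGroup Λ] [NormedSpace ℝ Λ]
    (B : Λ →L[ℝ] Λ →L[ℝ] ℝ) (O : Set V) (Y Z : V → Λ) (n₁ n₂ : Λ →L[ℝ] ℝ) : Prop where
  isOpen : IsOpen O
  smoothY : ∀ y ∈ O, ContDiffAt ℝ ∞ Y y
  smoothZ : ∀ y ∈ O, ContDiffAt ℝ ∞ Z y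
  YY : ∀ y ∈ O, B (Y y) (Y y) = 0
  YZ : ∀ y ∈ O, B (Y y) (Z y) = 0
  ZZ : ∀ y ∈ O, B (Z y) (Z y) = 0
  n₁Y : ∀ y ∈ O, n₁ (Y y) = 1
  n₂Y : ∀ y ∈ O, n₂ (Y y) = 0
  n₁Z : ∀ y ∈ O, n₁ (Z y) = 0
  n₂Z : ∀ y ∈ O, n₂ (Z y) = 1
  contact : ∀ y ∈ O, ∀ X, B (fderiv ℝ Y y X) (Z y) = 0
  inj : ∀ y ∈ O, ∀ X, fderiv ℝ Y y X = 0 → X = 0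

section Calculus

variable {V Λ : Type*} [NormedAddCommGroup V] [NormedSpace ℝ V]
  [NormedAddCommGroup Λ] [NormedSpace ℝ Λ]

theorem fderiv_bilinear (B : Λ →L[ℝ] Λ →L[ℝ] ℝ) {f g : V → Λ} {y : V}
    (hf : DifferentiableAt ℝ f y) (hg : DifferentiableAt ℝ g y) (X : V) :
    fderiv ℝ (fun y => B (f y) (g y)) y X
      = B (fderiv ℝ f y X) (g y) + B (f y) (fderiv ℝ g y X) := by
  have h := (B.hasFDerivAt.comp y hf.hasFDerivAt).clm_apply hg.hasFDerivAt
  have h' : HasFDerivAt (fun y => B (f y) (g y)) _ y := h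
  rw [h'.fderiv]
  simp [add_comm]

theorem bilinear_fderiv_eq_zero (B : Λ →L[ℝ] Λ →L[ℝ] ℝ) {f g : V → Λ} {y : V} {O : Set V}
    (hO : O ∈ 𝓝 y) (hf : DifferentiableAt ℝ f y) (hg : DifferentiableAt ℝ g y) {c : ℝ}
    (h : ∀ z ∈ O, B (f z) (g z) = c) (X : V) :
    B (fderiv ℝ f y X) (g y) + B (f y) (fderiv ℝ g y X) = 0 := by
  rw [← fderiv_bilinear B hf hg]
  have : (fun y => B (f y) (g y)) =ᶠ[𝓝 y] fun _ => c := by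
    filter_upwards [hO] with z hz using h z hz
  rw [this.fderiv_eq]
  simp

end Calculus

namespace LegendreFrame

variable {V Λ : Type*} [NormedAddCommGroup V] [NormedSpace ℝ V] [FiniteDimensional ℝ V]
  [NormedAddCommGroup Λ] [NormedSpace ℝ Λ] [FiniteDimensional ℝ Λ]
  {B : Λ →L[ℝ] Λ →L[ℝ] ℝ} {O : Set V} {Y Z : V → Λ} {n₁ n₂ : Λ →L[ℝ] ℝ}

/-- The derivative of `Z + σ Y` for constant `σ`. -/
noncomputable abbrev pencil (Y Z : V → Λ) (σ : ℝ) (y : V) : V →L[ℝ] Λ := fderiv ℝ Z y + σ • fderiv ℝ Y y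

/-- Principal spaces. -/
noncomputable abbrev principal (Y Z : V → Λ) (σ : ℝ) (y : V) : Submodule ℝ V := LinearMap.ker (pencil Y Z σ y).toLinearMap

/-- Normalized curvature spheres. -/
def spec (Y Z : V → Λ) (y : V) : Set ℝ := {σ | principal Y Z σ y ≠ ⊥}

variable (F : LegendreFrame B O Y Z n₁ n₂) (hB : IsLieForm B)
include F hB

omit hB in
theorem diffY {y} (hy : y ∈ O) : DifferentiableAt ℝ Y y :=
  (F.smoothY y hy).differentiableAt (by simp)

omit hB in
theorem diffZ {y} (hy : y ∈ O) : DifferentiableAt ℝ Z y :=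
  (F.smoothZ y hy).differentiableAt (by simp)

omit hB in
theorem mem_nhds {y} (hy : y ∈ O) : O ∈ 𝓝 y := F.isOpen.mem_nhds hy

theorem dY_Y {y} (hy : y ∈ O) (X : V) : B (fderiv ℝ Y y X) (Y y) = 0 := by
  have := bilinear_fderiv_eq_zero B (F.mem_nhds hy) (F.diffY hy) (F.diffY hy) F.YY X
  rw [hB.symm (Y y)] at this; linarith

theorem dZ_Z {y} (hy : y ∈ O) (X : V) : B (fderiv ℝ Z y X) (Z y) = 0 := by
  have := bilinear_fderiv_eq_zero B (F.mem_nhds hy) (F.diffZ hy) (F.diffZ hy) F.ZZ X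
  rw [hB.symm (Z y)] at this; linarith

theorem dZ_Y {y} (hy : y ∈ O) (X : V) : B (fderiv ℝ Z y X) (Y y) = 0 := by
  have := bilinear_fderiv_eq_zero B (F.mem_nhds hy) (F.diffY hy) (F.diffZ hy) F.YZ X
  rw [F.contact y hy, hB.symm (Y y)] at this; linarith

omit hB in
theorem fderiv_const_functional {y} (hy : y ∈ O) (n : Λ →L[ℝ] ℝ) (f : V → Λ) (c : ℝ)
    (hf : DifferentiableAt ℝ f y) (h : ∀ y ∈ O, n (f y) = c) (X : V) :
    n (fderiv ℝ f y X) = 0 := by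
  have h1 := n.hasFDerivAt.comp y hf.hasFDerivAt
  have h2 : (n ∘ f) =ᶠ[𝓝 y] fun _ => c := by
    filter_upwards [F.mem_nhds hy] with z hz using h z hz
  have h3 := h1.fderiv
  rw [h2.fderiv_eq] at h3
  have := congrArg (fun g : V →L[ℝ] ℝ => g X) h3
  simpa using this.symm

omit hB in
theorem n₁_dY {y} (hy : y ∈ O) (X : V) : n₁ (fderiv ℝ Y y X) = 0 :=
  F.fderiv_const_functional hy n₁ Y 1 (F.diffY hy) F.n₁Y X
omit hB in
theorem n₂_dY {y} (hy : y ∈ O) (X : V) : n₂ (fderiv ℝ Y y X) = 0 :=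
  F.fderiv_const_functional hy n₂ Y 0 (F.diffY hy) F.n₂Y X
omit hB in
theorem n₁_dZ {y} (hy : y ∈ O) (X : V) : n₁ (fderiv ℝ Z y X) = 0 :=
  F.fderiv_const_functional hy n₁ Z 0 (F.diffZ hy) F.n₁Z X
omit hB in
theorem n₂_dZ {y} (hy : y ∈ O) (X : V) : n₂ (fderiv ℝ Z y X) = 0 :=
  F.fderiv_const_functional hy n₂ Z 1 (F.diffZ hy) F.n₂Z X

omit hB in
theorem smooth_dY {y} (hy : y ∈ O) : ContDiffAt ℝ ∞ (fderiv ℝ Y) y :=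
  (F.smoothY y hy).fderiv_right (m := ∞) (by simp)
omit hB in
theorem smooth_dZ {y} (hy : y ∈ O) : ContDiffAt ℝ ∞ (fderiv ℝ Z) y :=
  (F.smoothZ y hy).fderiv_right (m := ∞) (by simp)

/-- Differentiating the contact condition `B (dY X) Z = 0` once more expresses the second
fundamental form through the second derivative of `Y`, which is symmetric. -/
theorem dZ_dY_symm {y} (hy : y ∈ O) (X X' : V) :
    B (fderiv ℝ Z y X) (fderiv ℝ Y y X') = B (fderiv ℝ Z y X') (fderiv ℝ Y y X) := by
  have key : ∀ X X', B (fderiv ℝ (fderiv ℝ Y) y X' X) (Z y)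
      + B (fderiv ℝ Y y X) (fderiv ℝ Z y X') = 0 := by
    intro X X'
    have hd : DifferentiableAt ℝ (fun z => fderiv ℝ Y z X) y :=
      ((F.smooth_dY hy).differentiableAt (by simp)).clm_apply (differentiableAt_const _)
    have := bilinear_fderiv_eq_zero B (F.mem_nhds hy) hd (F.diffZ hy)
      (fun z hz => F.contact z hz X) X'
    have h2 : fderiv ℝ (fun z => fderiv ℝ Y z X) y X' = fderiv ℝ (fderiv ℝ Y) y X' X := by
      rw [fderiv_clm_apply ((F.smooth_dY hy).differentiableAt (by simp))
        (differentiableAt_const _)]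
      simp
    rwa [h2] at this
  have hs : fderiv ℝ (fderiv ℝ Y) y X' X = fderiv ℝ (fderiv ℝ Y) y X X' := by
    have := (F.smoothY y hy).isSymmSndFDerivAt (n := ∞) (by
      simp only [minSmoothness_of_isRCLikeNormedField]; exact WithTop.coe_le_coe.2 le_top)
    exact this.eq X' X
  have h1 := key X X'
  have h2 := key X' X
  rw [hs] at h1
  rw [hB.symm (fderiv ℝ Z y X), hB.symm (fderiv ℝ Z y X')]
  linarith

omit hB in
theorem linearIndependent {y} (hy : y ∈ O) : LinearIndependent ℝ ![Y y, Z y] := by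
  rw [LinearIndependent.pair_iff]
  intro s t h
  have h1 := congrArg n₁ h
  have h2 := congrArg n₂ h
  simp [F.n₁Y y hy, F.n₁Z y hy, F.n₂Y y hy, F.n₂Z y hy] at h1 h2
  exact ⟨h1, h2⟩

theorem form_nonneg {y} (hy : y ∈ O) (v : Λ) (h1 : B v (Y y) = 0) (h2 : B v (Z y) = 0) :
    0 ≤ B v v :=
  (hB.pos _ _ (F.linearIndependent hy) (F.YY y hy) (F.YZ y hy) (F.ZZ y hy) v h1 h2).1

theorem eq_zero_of_form {y} (hy : y ∈ O) (v : Λ) (h1 : B v (Y y) = 0) (h2 : B v (Z y) = 0)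
    (h3 : n₁ v = 0) (h4 : n₂ v = 0) (h : B v v = 0) : v = 0 := by
  have := (hB.pos _ _ (F.linearIndependent hy) (F.YY y hy) (F.YZ y hy) (F.ZZ y hy) v h1 h2).2 h
  obtain ⟨a, b, rfl⟩ := Submodule.mem_span_pair.1 this
  simp [F.n₁Y y hy, F.n₁Z y hy, F.n₂Y y hy, F.n₂Z y hy] at h3 h4
  simp [h3, h4]

/-- A dimension count. The four functionals are independent: evaluation on `Y` and `Z` removes the
coefficients of `n₁` and `n₂`, and nondegeneracy removes the other two. Their common kernel thus has
the dimension of `V`, and `dY` maps `V` injectively into it. -/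
theorem exists_dY (hdim : Module.finrank ℝ Λ = Module.finrank ℝ V + 4) {y} (hy : y ∈ O) (v : Λ)
    (h1 : B v (Y y) = 0) (h2 : B v (Z y) = 0) (h3 : n₁ v = 0) (h4 : n₂ v = 0) :
    ∃ X, fderiv ℝ Y y X = v := by
  set φ : Λ →ₗ[ℝ] (Fin 4 → ℝ) := LinearMap.pi ![(B (Y y)).toLinearMap, (B (Z y)).toLinearMap,
    n₁.toLinearMap, n₂.toLinearMap] with hφ
  have hmem : ∀ v, v ∈ LinearMap.ker φ ↔ B (Y y) v = 0 ∧ B (Z y) v = 0 ∧ n₁ v = 0 ∧ n₂ v = 0 := by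
    intro v
    rw [LinearMap.mem_ker, funext_iff, Fin.forall_fin_succ, Fin.forall_fin_succ,
      Fin.forall_fin_succ, Fin.forall_fin_succ]
    simp [hφ]
  have hsurj : Function.Surjective φ := by
    have hli : LinearIndependent ℝ ![(B (Y y)).toLinearMap, (B (Z y)).toLinearMap,
        n₁.toLinearMap, n₂.toLinearMap] := by
      rw [Fintype.linearIndependent_iff]
      intro g hg
      rw [Fin.sum_univ_four] at hg
      have hv : ∀ v, g 0 * B (Y y) v + g 1 * B (Z y) v + g 2 * n₁ v + g 3 * n₂ v = 0 := by
        intro v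
        have := LinearMap.congr_fun hg v
        simpa using this
      have e2 : g 2 = 0 := by
        have := hv (Y y)
        simpa [F.n₁Y y hy, F.n₂Y y hy, F.YY y hy, hB.symm (Z y) (Y y), F.YZ y hy] using this
      have e3 : g 3 = 0 := by
        have := hv (Z y)
        simpa [F.n₁Z y hy, F.n₂Z y hy, F.YZ y hy, F.ZZ y hy] using this
      have e01 : g 0 • Y y + g 1 • Z y = 0 := by
        apply hB.nondeg
        intro v
        have := hv v
        rw [e2, e3] at this
        simpa using this
      have := LinearIndependent.pair_iff.1 (F.linearIndependent hy) _ _ e01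
      intro i
      fin_cases i <;> simp [this.1, this.2, e2, e3]
    rw [← LinearMap.range_eq_top]
    by_contra hne
    obtain ⟨f, hf0, hf⟩ := Submodule.exists_le_ker_of_lt_top _ (lt_top_iff_ne_top.2 hne)
    apply hf0
    have hz := Fintype.linearIndependent_iff.1 hli (fun i => f (Pi.single i 1)) (by
      ext v
      have h0 : f (φ v) = 0 := hf ⟨v, rfl⟩
      rw [LinearMap.pi_apply_eq_sum_univ f (φ v)] at h0
      simp only [LinearMap.coe_sum, Finset.sum_apply, LinearMap.smul_apply, smul_eq_mul,
        LinearMap.zero_apply]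
      rw [← h0]
      refine Finset.sum_congr rfl fun i _ => ?_
      rw [smul_eq_mul, mul_comm]
      congr 1
      congr 1
      ext j
      simp [Pi.single_apply, eq_comm])
    refine LinearMap.pi_ext' fun i => LinearMap.ext_ring ?_
    simpa using hz i
  have hfk : Module.finrank ℝ (LinearMap.ker φ) = Module.finrank ℝ V := by
    have := LinearMap.finrank_range_add_finrank_ker φ
    rw [LinearMap.range_eq_top.2 hsurj, finrank_top] at this
    simp at this
    omega
  have hinj : Function.Injective (fderiv ℝ Y y).toLinearMap := by
    rw [← LinearMap.ker_eq_bot, LinearMap.ker_eq_bot']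
    exact F.inj y hy
  have hle : LinearMap.range (fderiv ℝ Y y).toLinearMap ≤ LinearMap.ker φ := by
    rintro _ ⟨X, rfl⟩
    rw [hmem]
    refine ⟨?_, ?_, F.n₁_dY hy X, F.n₂_dY hy X⟩
    · rw [hB.symm]; exact F.dY_Y hB hy X
    · rw [hB.symm]; exact F.contact y hy X
  have heq := Submodule.eq_of_le_of_finrank_le hle (by
    rw [hfk, LinearMap.finrank_range_of_inj hinj])
  have hv : v ∈ LinearMap.ker φ := by
    rw [hmem, hB.symm, hB.symm (Z y)]
    exact ⟨h1, h2, h3, h4⟩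
  rw [← heq] at hv
  exact hv

/-- This makes the pencil an endomorphism of the tangent space, namely the shape operator with
respect to `Y`, up to sign and shift. -/
theorem exists_dY_eq_pencil (hdim : Module.finrank ℝ Λ = Module.finrank ℝ V + 4) {y} (hy : y ∈ O)
    (σ : ℝ) (X : V) : ∃ X', fderiv ℝ Y y X' = pencil Y Z σ y X := by
  apply F.exists_dY hB hdim hy
  · simp [F.dY_Y hB hy, F.dZ_Y hB hy]
  · simp [F.contact y hy, F.dZ_Z hB hy]
  · simp [F.n₁_dY hy, F.n₁_dZ hy]
  · simp [F.n₂_dY hy, F.n₂_dZ hy]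

theorem pencil_dY_symm {y} (hy : y ∈ O) (σ : ℝ) (X X' : V) :
    B (pencil Y Z σ y X) (fderiv ℝ Y y X') = B (pencil Y Z σ y X') (fderiv ℝ Y y X) := by
  simp [F.dZ_dY_symm hB hy X X', hB.symm (fderiv ℝ Y y X)]

/-- The metric `B (dY ·) (dY ·)` is definite. -/
theorem dY_dY_pos {y} (hy : y ∈ O) {X : V} (hX : X ≠ 0) :
    0 < B (fderiv ℝ Y y X) (fderiv ℝ Y y X) := by
  refine lt_of_le_of_ne (F.form_nonneg hB hy _ (F.dY_Y hB hy X) (F.contact y hy X)) ?_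
  intro h
  exact hX (F.inj y hy X (F.eq_zero_of_form hB hy _ (F.dY_Y hB hy X) (F.contact y hy X)
    (F.n₁_dY hy X) (F.n₂_dY hy X) h.symm))

/-- A tangent vector whose image under `dY` is orthogonal to the image of `pencil σ` is principal. -/
theorem pencil_eq_zero_of_orthogonal (hdim : Module.finrank ℝ Λ = Module.finrank ℝ V + 4)
    {y} (hy : y ∈ O) (σ : ℝ) (X : V)
    (h : ∀ X', B (fderiv ℝ Y y X) (pencil Y Z σ y X') = 0) : pencil Y Z σ y X = 0 := by
  obtain ⟨X₁, hX₁⟩ := F.exists_dY_eq_pencil hB hdim hy σ X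
  have h1 := h X₁
  rw [hB.symm, F.pencil_dY_symm hB hy, ← hX₁] at h1
  by_cases h0 : X₁ = 0
  · rw [← hX₁, h0, map_zero]
  · exact absurd h1 (F.dY_dY_pos hB hy h0).ne'

/-- Principal bases. -/
theorem exists_principal_basis (hdim : Module.finrank ℝ Λ = Module.finrank ℝ V + 4)
    {y} (hy : y ∈ O) :
    ∃ (b : Module.Basis (Fin (Module.finrank ℝ V)) ℝ V) (s : Fin (Module.finrank ℝ V) → ℝ),
      (∀ i, pencil Y Z (s i) y (b i) = 0) ∧
      ∀ i j, B (fderiv ℝ Y y (b i)) (fderiv ℝ Y y (b j)) = if i = j then 1 else 0 := by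
  -- The first and second fundamental forms. The sign of `μ` changes because `Z + σ Y` vanishes to
  -- first order where `dZ = -σ dY`.
  let g : V →ₗ[ℝ] V →ₗ[ℝ] ℝ := LinearMap.mk₂ ℝ
    (fun X X' => B (fderiv ℝ Y y X) (fderiv ℝ Y y X')) (by simp) (by simp) (by simp) (by simp)
  let h : V →ₗ[ℝ] V →ₗ[ℝ] ℝ := LinearMap.mk₂ ℝ
    (fun X X' => B (fderiv ℝ Z y X) (fderiv ℝ Y y X')) (by simp) (by simp) (by simp) (by simp)
  obtain ⟨b, μ, hb, hbb⟩ := exists_simultaneous_diagonalization g h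
    (fun x y => hB.symm _ _) (F.dZ_dY_symm hB hy)
    (fun X => F.form_nonneg hB hy _ (F.dY_Y hB hy X) (F.contact y hy X)) (fun X hX => by
      by_contra h0
      exact (F.dY_dY_pos hB hy h0).ne' hX)
  refine ⟨b, fun i => -μ i, fun i => ?_, hbb⟩
  obtain ⟨X₁, hX₁⟩ := F.exists_dY_eq_pencil hB hdim hy (-μ i) (b i)
  have h2 : B (pencil Y Z (-μ i) y (b i)) (fderiv ℝ Y y X₁) = 0 := by
    have := hb i X₁
    have h3 : B (fderiv ℝ Z y (b i)) (fderiv ℝ Y y X₁)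
      = μ i * B (fderiv ℝ Y y (b i)) (fderiv ℝ Y y X₁) := this
    simp [h3]
  rw [← hX₁] at h2 ⊢
  by_cases h0 : X₁ = 0
  · rw [h0, map_zero]
  · exact absurd h2 (F.dY_dY_pos hB hy h0).ne'

end LegendreFrame

/-! ### Smooth branches of curvature spheres with constant multiplicity. -/

namespace LegendreFrame

variable {V Λ : Type*} [NormedAddCommGroup V] [NormedSpace ℝ V] [FiniteDimensional ℝ V]
  [NormedAddCommGroup Λ] [NormedSpace ℝ Λ] [FiniteDimensional ℝ Λ]
  {B : Λ →L[ℝ] Λ →L[ℝ] ℝ} {O : Set V} {Y Z : V → Λ} {n₁ n₂ : Λ →L[ℝ] ℝ}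

theorem mem_spec {y : V} {σ : ℝ} : σ ∈ spec Y Z y ↔ ∃ X, X ≠ 0 ∧ pencil Y Z σ y X = 0 := by
  rw [spec, mem_setOf_eq, Submodule.ne_bot_iff]
  exact ⟨fun ⟨X, h1, h2⟩ => ⟨X, h2, h1⟩, fun ⟨X, h1, h2⟩ => ⟨X, h2, h1⟩⟩

theorem pencil_sub (σ τ : ℝ) (y : V) (X : V) :
    pencil Y Z σ y X = pencil Y Z τ y X + (σ - τ) • fderiv ℝ Y y X := by
  simp [sub_smul]

variable (F : LegendreFrame B O Y Z n₁ n₂) (hB : IsLieForm B)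
  (hdim : Module.finrank ℝ Λ = Module.finrank ℝ V + 4)
include F hB hdim

omit hB hdim in
theorem eq_of_pencil {y} (hy : y ∈ O) {σ τ : ℝ} {X : V} (hX : X ≠ 0)
    (h1 : pencil Y Z σ y X = 0) (h2 : pencil Y Z τ y X = 0) : σ = τ := by
  rw [pencil_sub σ τ, h2, zero_add] at h1
  rcases smul_eq_zero.1 h1 with h | h
  · linarith
  · exact absurd (F.inj y hy X h) hX

/-- In a principal basis the pencil multiplies the `i`-th coordinate by `σ - s i`, followed by the
injective map `dY`; its kernel is spanned by the basis vectors with `s i = σ`. -/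
theorem finrank_principal {y} (hy : y ∈ O)
    (b : Module.Basis (Fin (Module.finrank ℝ V)) ℝ V) (s : Fin (Module.finrank ℝ V) → ℝ)
    (hb : ∀ i, pencil Y Z (s i) y (b i) = 0) (σ : ℝ) :
    Module.finrank ℝ (principal Y Z σ y) = (Finset.univ.filter fun i => s i = σ).card := by
  classical
  have hspan : principal Y Z σ y = Submodule.span ℝ (b '' {i | s i = σ}) := by
    apply le_antisymm
    · intro X hX
      have hX' : pencil Y Z σ y X = 0 := hX
      have h1 : fderiv ℝ Y y (∑ i, ((σ - s i) * b.repr X i) • b i) = 0 := by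
        rw [← hX']
        conv_rhs => rw [← b.sum_repr X]
        rw [map_sum, map_sum]
        refine Finset.sum_congr rfl fun i _ => ?_
        rw [map_smul, map_smul, pencil_sub σ (s i), hb, zero_add, smul_smul, mul_comm]
      have h2 := F.inj y hy _ h1
      have h3 := Fintype.linearIndependent_iff.1 b.linearIndependent _ h2
      rw [b.mem_span_image]
      intro i hi
      have h4 : b.repr X i ≠ 0 := Finsupp.mem_support_iff.1 hi
      have := (mul_eq_zero.1 (h3 i)).resolve_right h4
      simp only [mem_setOf_eq]; linarith
    · rw [Submodule.span_le]
      rintro _ ⟨i, hi, rfl⟩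
      have hi' : s i = σ := hi
      have := hb i
      rw [hi'] at this
      exact this
  have hli : LinearIndependent ℝ (fun i : {i // s i = σ} => b i) :=
    b.linearIndependent.comp _ Subtype.val_injective
  have := finrank_span_eq_card hli
  rw [hspan, ← Fintype.card_subtype, ← this]
  rw [image_eq_range]
  rfl

theorem spec_eq_range {y} (hy : y ∈ O)
    (b : Module.Basis (Fin (Module.finrank ℝ V)) ℝ V) (s : Fin (Module.finrank ℝ V) → ℝ)
    (hb : ∀ i, pencil Y Z (s i) y (b i) = 0) : spec Y Z y = range s := by
  ext σ
  rw [spec, mem_setOf_eq, ← Submodule.one_le_finrank_iff, F.finrank_principal hB hdim hy b s hb,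
    Nat.one_le_iff_ne_zero, Finset.card_ne_zero]
  simp [Finset.filter_nonempty_iff]

theorem sum_finrank_principal {y} (hy : y ∈ O) {g : ℕ} (σ : Fin g → ℝ)
    (hinj : Function.Injective σ) (hσ : spec Y Z y = range σ) :
    ∑ j, Module.finrank ℝ (principal Y Z (σ j) y) = Module.finrank ℝ V := by
  classical
  obtain ⟨b, s, hb, -⟩ := F.exists_principal_basis hB hdim hy
  have hr := F.spec_eq_range hB hdim hy b s hb
  rw [hσ] at hr
  have hmap : ∀ i, ∃ j, σ j = s i := fun i => by
    have : s i ∈ range σ := hr ▸ mem_range_self i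
    exact this
  choose f hf using hmap
  have : ∀ j, Module.finrank ℝ (principal Y Z (σ j) y)
      = (Finset.univ.filter fun i => f i = j).card := by
    intro j
    rw [F.finrank_principal hB hdim hy b s hb]
    congr 1
    ext i
    simp only [Finset.mem_filter, Finset.mem_univ, true_and]
    rw [← hf i]
    exact hinj.eq_iff
  simp_rw [this]
  rw [← Finset.card_eq_sum_card_fiberwise (f := f) (s := Finset.univ) (t := Finset.univ)
    (fun _ _ => Finset.mem_univ _)]
  simp

/-- If all curvature spheres at `y` are `ε`-far from `σ`, the pencil is bounded below. -/
theorem pencil_bound {y} (hy : y ∈ O) {ε σ : ℝ} (hε : 0 ≤ ε)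
    (h : ∀ τ ∈ spec Y Z y, ε ≤ |τ - σ|) (X : V) :
    ε ^ 2 * B (fderiv ℝ Y y X) (fderiv ℝ Y y X)
      ≤ B (pencil Y Z σ y X) (pencil Y Z σ y X) := by
  obtain ⟨b, s, hb, hbb⟩ := F.exists_principal_basis hB hdim hy
  have hr := F.spec_eq_range hB hdim hy b s hb
  have hform : ∀ c : Fin (Module.finrank ℝ V) → ℝ,
      B (fderiv ℝ Y y (∑ i, c i • b i)) (fderiv ℝ Y y (∑ i, c i • b i)) = ∑ i, c i ^ 2 := by
    intro c
    simp only [map_sum, map_smul, ContinuousLinearMap.sum_apply, ContinuousLinearMap.smul_apply,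
      hbb, smul_eq_mul]
    simp [sq]
  have h1 : pencil Y Z σ y X = fderiv ℝ Y y (∑ i, ((σ - s i) * b.repr X i) • b i) := by
    conv_lhs => rw [← b.sum_repr X]
    rw [map_sum, map_sum]
    refine Finset.sum_congr rfl fun i _ => ?_
    rw [map_smul, map_smul, pencil_sub σ (s i), hb, zero_add, smul_smul, mul_comm]
  rw [h1, hform]
  conv_lhs => rw [← b.sum_repr X]
  rw [hform, Finset.mul_sum]
  refine Finset.sum_le_sum fun i _ => ?_
  have h2 := h (s i) (hr ▸ mem_range_self i)
  have h3 : ε ^ 2 ≤ (σ - s i) ^ 2 := by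
    rw [← sq_abs (σ - s i), abs_sub_comm]
    exact pow_le_pow_left₀ hε h2 2
  rw [mul_pow]
  exact mul_le_mul_of_nonneg_right h3 (sq_nonneg _)

/-- Curvature spheres persist. -/
theorem eventually_exists_spec {y} (hy : y ∈ O) {σ ε : ℝ} (hε : 0 < ε) (hσ : σ ∈ spec Y Z y) :
    ∀ᶠ z in 𝓝 y, ∃ τ ∈ spec Y Z z, |τ - σ| < ε := by
  obtain ⟨X, hX, hX0⟩ := mem_spec.1 hσ
  have hc1 : ContinuousAt (fun z => B (pencil Y Z σ z X) (pencil Y Z σ z X)) y := by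
    have h1 : ContinuousAt (fun z => pencil Y Z σ z X) y :=
      ((F.smooth_dZ hy).continuousAt.add
        ((F.smooth_dY hy).continuousAt.const_smul σ)).clm_apply continuousAt_const
    exact (B.continuous.continuousAt.comp h1).clm_apply h1
  have hc2 : ContinuousAt (fun z => ε ^ 2 * B (fderiv ℝ Y z X) (fderiv ℝ Y z X)) y := by
    have h1 : ContinuousAt (fun z => fderiv ℝ Y z X) y :=
      (F.smooth_dY hy).continuousAt.clm_apply continuousAt_const
    exact continuousAt_const.mul ((B.continuous.continuousAt.comp h1).clm_apply h1)
  -- The principal vector `X` violates the lower bound of `pencil_bound` strictly. It still does so,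
  -- with `X` kept fixed, at nearby points.
  have hlt : B (pencil Y Z σ y X) (pencil Y Z σ y X)
      < ε ^ 2 * B (fderiv ℝ Y y X) (fderiv ℝ Y y X) := by
    rw [hX0]
    simpa using mul_pos (pow_pos hε 2) (F.dY_dY_pos hB hy hX)
  filter_upwards [hc1.eventually_lt hc2 hlt, F.mem_nhds hy] with z hz hzO
  by_contra hcon
  push Not at hcon
  exact absurd (F.pencil_bound hB hdim hzO hε.le hcon X) (not_le.2 hz)

/-- Local branches of the curvature spheres: continuity at the center and constant
multiplicities. -/
theorem exists_branches_aux {g : ℕ} (hg : ∀ y ∈ O, (spec Y Z y).encard = g) {y₀} (hy₀ : y₀ ∈ O) :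
    ∃ (μ : Fin g → ℝ) (ε : ℝ), 0 < ε ∧ Function.Injective μ ∧ spec Y Z y₀ = range μ ∧
      (∀ i j, i ≠ j → 2 * ε ≤ |μ i - μ j|) ∧
      ∃ σ : Fin g → V → ℝ, (∀ j, ContinuousAt (σ j) y₀) ∧ (∀ j, σ j y₀ = μ j) ∧
      ∀ᶠ y in 𝓝 y₀, y ∈ O ∧ (∀ j, |σ j y - μ j| < ε) ∧ spec Y Z y = range (fun j => σ j y) ∧
        ∀ j, Module.finrank ℝ (principal Y Z (σ j y) y)
          = Module.finrank ℝ (principal Y Z (μ j) y₀) := by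
  classical
  -- enumeration of the spectrum at the center
  have hfin : (spec Y Z y₀).Finite := Set.finite_of_encard_eq_coe (hg y₀ hy₀)
  have hcard : hfin.toFinset.card = g := by
    have := hg y₀ hy₀
    rw [hfin.encard_eq_coe_toFinset_card] at this
    exact_mod_cast this
  let en := hfin.toFinset.equivFinOfCardEq hcard
  set μ : Fin g → ℝ := fun j => (en.symm j : ℝ) with hμ
  have hμinj : Function.Injective μ := Subtype.val_injective.comp en.symm.injective
  have hμr : spec Y Z y₀ = range μ := by
    ext τ
    constructor
    · intro hτ
      exact ⟨en ⟨τ, by simpa using hτ⟩, by simp [hμ]⟩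
    · rintro ⟨j, rfl⟩
      exact hfin.mem_toFinset.1 (en.symm j).2
  obtain ⟨ε, hε, hsep⟩ : ∃ ε > 0, ∀ i j, i ≠ j → 2 * ε ≤ |μ i - μ j| := by
    have : ∀ p : Fin g × Fin g, ∃ ε > 0, p.1 ≠ p.2 → 2 * ε ≤ |μ p.1 - μ p.2| := by
      rintro ⟨i, j⟩
      by_cases hij : i = j
      · exact ⟨1, one_pos, fun h => absurd hij h⟩
      · refine ⟨|μ i - μ j| / 2, ?_, fun _ => by simp; linarith⟩
        have := abs_pos.2 (sub_ne_zero.2 (hμinj.ne hij))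
        positivity
    choose e he1 he2 using this
    by_cases hne : (Finset.univ : Finset (Fin g × Fin g)).Nonempty
    · refine ⟨Finset.univ.inf' hne e, (Finset.lt_inf'_iff hne).2 fun p _ => he1 p, fun i j hij => ?_⟩
      have := Finset.inf'_le e (Finset.mem_univ (i, j))
      linarith [he2 (i, j) hij]
    · refine ⟨1, one_pos, fun i j _ => ?_⟩
      exact absurd ⟨(i, j), Finset.mem_univ _⟩ hne
  -- Near `y₀` each interval of radius `ε` around a `μ j` contains a curvature sphere, so the
  -- default value is irrelevant there. The intervals are disjoint, and the total number `g` leaves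
  -- exactly one curvature sphere in each.
  set σ : Fin g → V → ℝ := fun j y =>
    if h : ∃ τ ∈ spec Y Z y, |τ - μ j| < ε then h.choose else 0 with hσ
  have hσ1 : ∀ j y, (∃ τ ∈ spec Y Z y, |τ - μ j| < ε) →
      σ j y ∈ spec Y Z y ∧ |σ j y - μ j| < ε := by
    intro j y h
    simp only [hσ, dif_pos h]
    exact h.choose_spec
  have hdisj : ∀ i j (t : ℝ), |t - μ i| < ε → |t - μ j| < ε → i = j := by
    intro i j t h1 h2
    by_contra hij
    have h3 := hsep i j hij
    have h4 : |μ i - μ j| ≤ |t - μ i| + |t - μ j| := by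
      rw [abs_sub_comm t (μ i)]; exact abs_sub_le _ _ _
    linarith
  have hspec : ∀ y ∈ O, (∀ j, ∃ τ ∈ spec Y Z y, |τ - μ j| < ε) →
      spec Y Z y = range (fun j => σ j y) := by
    intro y hy h
    have hinj : Function.Injective (fun j => σ j y) := by
      intro i j hij
      have hij' : σ i y = σ j y := hij
      exact hdisj i j (σ i y) (hσ1 i y (h i)).2 (by rw [hij']; exact (hσ1 j y (h j)).2)
    have hsub : range (fun j => σ j y) ⊆ spec Y Z y := by
      rintro _ ⟨j, rfl⟩; exact (hσ1 j y (h j)).1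
    refine (Set.Finite.eq_of_subset_of_encard_le (finite_range _) hsub ?_).symm
    rw [hg y hy, ← image_univ, hinj.encard_image]
    simp
  have hμmem : ∀ j, μ j ∈ spec Y Z y₀ := fun j => hμr ▸ mem_range_self j
  have hpers : ∀ᶠ y in 𝓝 y₀, ∀ j, ∃ τ ∈ spec Y Z y, |τ - μ j| < ε := by
    rw [eventually_all]
    exact fun j => F.eventually_exists_spec hB hdim hy₀ hε (hμmem j)
  have hσ0 : ∀ j, σ j y₀ = μ j := by
    intro j
    have h1 := hσ1 j y₀ ⟨μ j, hμmem j, by simpa using hε⟩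
    rw [hμr] at h1
    obtain ⟨⟨i, hi⟩, h2⟩ := h1
    rw [← hi] at h2 ⊢
    rw [hdisj i j (μ i) (by simpa using hε) h2]
  have hcont : ∀ j, ContinuousAt (σ j) y₀ := by
    intro j
    rw [Metric.continuousAt_iff']
    intro δ hδ
    filter_upwards [F.eventually_exists_spec hB hdim hy₀ (lt_min hδ hε) (hμmem j), hpers,
      F.mem_nhds hy₀] with y hy hp hyO
    obtain ⟨τ, hτ, hτd⟩ := hy
    rw [hspec y hyO hp] at hτ
    obtain ⟨i, rfl⟩ := hτ
    have h1 : i = j := hdisj i j (σ i y) (hσ1 i y (hp i)).2 (hτd.trans_le (min_le_right _ _))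
    subst h1
    rw [hσ0, Real.dist_eq]
    exact hτd.trans_le (min_le_left _ _)
  have hupper : ∀ᶠ y in 𝓝 y₀, ∀ j, Module.finrank ℝ (principal Y Z (σ j y) y)
      ≤ Module.finrank ℝ (principal Y Z (μ j) y₀) := by
    rw [eventually_all]
    intro j
    have hA : ContinuousAt (fun y => pencil Y Z (σ j y) y) y₀ :=
      (F.smooth_dZ hy₀).continuousAt.add ((hcont j).smul (F.smooth_dY hy₀).continuousAt)
    obtain ⟨q, -, -, h, -⟩ := exists_kernel_section _ y₀ hA
    rw [hσ0] at h
    exact h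
  refine ⟨μ, ε, hε, hμinj, hμr, hsep, σ, hcont, hσ0, ?_⟩
  filter_upwards [hpers, hupper, F.mem_nhds hy₀] with y hp hu hyO
  refine ⟨hyO, fun j => (hσ1 j y (hp j)).2, hspec y hyO hp, ?_⟩
  have hinj : Function.Injective (fun j => σ j y) := by
    intro i j hij
    have hij' : σ i y = σ j y := hij
    exact hdisj i j (σ i y) (hσ1 i y (hp i)).2 (by rw [hij']; exact (hσ1 j y (hp j)).2)
  -- No multiplicity can increase nearby, yet the multiplicities add up to the dimension of `V` at
  -- both points; hence none of them changes.
  have hs1 := F.sum_finrank_principal hB hdim hyO _ hinj (hspec y hyO hp)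
  have hs2 := F.sum_finrank_principal hB hdim hy₀ _ hμinj hμr
  have := (Finset.sum_eq_sum_iff_of_le (fun j _ => hu j)).1 (hs1.trans hs2.symm)
  exact fun j => this j (Finset.mem_univ _)

/-- Local smooth branches of the curvature spheres, of constant multiplicity. -/
theorem exists_branches {g : ℕ} (hg : ∀ y ∈ O, (spec Y Z y).encard = g) {y₀} (hy₀ : y₀ ∈ O) :
    ∃ (U : Set V) (σ : Fin g → V → ℝ), IsOpen U ∧ y₀ ∈ U ∧ U ⊆ O ∧ ∀ y ∈ U,
      Function.Injective (fun j => σ j y) ∧ spec Y Z y = range (fun j => σ j y) ∧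
      ∀ j, ContDiffAt ℝ ∞ (σ j) y ∧ Module.finrank ℝ (principal Y Z (σ j y) y)
          = Module.finrank ℝ (principal Y Z (σ j y₀) y₀) := by
  obtain ⟨μ, ε, hε, hμinj, hμr, hsep, σ, hcont, hσ0, hev⟩ := F.exists_branches_aux hB hdim hg hy₀
  obtain ⟨U, hU, hUo, hyU⟩ := mem_nhds_iff.1 hev
  have hdisj : ∀ i j (t : ℝ), |t - μ i| < ε → |t - μ j| < ε → i = j := by
    intro i j t h1 h2
    by_contra hij
    have h3 := hsep i j hij
    have h4 : |μ i - μ j| ≤ |t - μ i| + |t - μ j| := by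
      rw [abs_sub_comm t (μ i)]; exact abs_sub_le _ _ _
    linarith
  refine ⟨U, σ, hUo, hyU, fun y hy => (hU hy).1, fun y₁ hy₁ => ?_⟩
  obtain ⟨hy₁O, hnear, hspec, hrank⟩ := hU hy₁
  refine ⟨?_, hspec, fun j => ⟨?_, by rw [hrank, hσ0]⟩⟩
  · intro i j hij
    have hij' : σ i y₁ = σ j y₁ := hij
    exact hdisj i j (σ i y₁) (hnear i) (by rw [hij']; exact hnear j)
  -- compare with the branches centered at `y₁`
  obtain ⟨μ', ε', hε', -, hμ'r, -, σ', hcont', hσ'0, hev'⟩ := F.exists_branches_aux hB hdim hg hy₁O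
  have hl : ∃ l, μ' l = σ j y₁ := by
    have : σ j y₁ ∈ range μ' := by rw [← hμ'r, hspec]; exact mem_range_self j
    exact this
  obtain ⟨l, hl⟩ := hl
  have heq : σ j =ᶠ[𝓝 y₁] σ' l := by
    have h1 : ∀ᶠ y in 𝓝 y₁, |σ' l y - μ j| < ε := by
      have : ContinuousAt (fun y => |σ' l y - μ j|) y₁ :=
        ((hcont' l).sub continuousAt_const).abs
      refine this.eventually (gt_mem_nhds ?_)
      change |σ' l y₁ - μ j| < ε
      rw [hσ'0, hl]
      exact hnear j
    filter_upwards [h1, hev', hUo.mem_nhds hy₁] with y h1 h2 h3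
    have h4 : σ' l y ∈ range (fun j => σ j y) := by
      rw [← (hU h3).2.2.1, h2.2.2.1]; exact mem_range_self l
    obtain ⟨i, hi⟩ := h4
    have hi' : σ i y = σ' l y := hi
    have : i = j := hdisj i j (σ i y) ((hU h3).2.1 i) (by rw [hi']; exact h1)
    rw [← this, hi']
  have hcj : ContinuousAt (σ j) y₁ := (hcont' l).congr heq.symm
  -- regularity of the eigenvalue
  have hmem : σ j y₁ ∈ spec Y Z y₁ := hspec ▸ mem_range_self j
  obtain ⟨v₀, hv₀, hv₀0⟩ := mem_spec.1 hmem
  -- By symmetry the functional `B (dY v₀)` annihilates the image of the pencil when `v₀` is in its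
  -- kernel, and it is positive on `dY v₀`.
  refine contDiffAt_eigenvalue (by simp) (fderiv ℝ Z) (fderiv ℝ Y) (σ j) y₁ (F.smooth_dZ hy₁O)
    (F.smooth_dY hy₁O) hcj (B (fderiv ℝ Y y₁ v₀)) (fun X => ?_) ?_ v₀ hv₀0
    (F.dY_dY_pos hB hy₁O hv₀).ne'
  · have h := F.pencil_dY_symm hB hy₁O (σ j y₁) X v₀
    rw [hv₀0, hB.symm] at h
    rw [h]
    simp
  · filter_upwards [hUo.mem_nhds hy₁] with y hy
    have h1 := (hU hy).2.2.2 j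
    rw [← hrank j] at h1
    exact h1.ge

end LegendreFrame

/-! ### The Dupin condition in infinitesimal form. -/

/-- Smooth integral curves of a nonvanishing vector field. -/
theorem exists_smooth_integral_curve {V : Type*} [NormedAddCommGroup V] [NormedSpace ℝ V]
    [FiniteDimensional ℝ V] (ξ : V → V) (y₀ : V) (U : Set V) (hU : IsOpen U) (hy₀ : y₀ ∈ U)
    (hξ : ∀ y ∈ U, ContDiffAt ℝ ∞ ξ y) (hne : ξ y₀ ≠ 0) :
    ∃ (γ : ℝ → V) (ε : ℝ), 0 < ε ∧ γ 0 = y₀ ∧ InjOn γ (Ioo (-ε) ε) ∧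
      ∀ t ∈ Ioo (-ε) ε, γ t ∈ U ∧ HasDerivAt γ (ξ (γ t)) t ∧ ContDiffAt ℝ ∞ γ t := by
  obtain ⟨r, hr, ε₁, hε₁, h⟩ :=
    ((hξ y₀ hy₀).of_le (m := 1)
      (by exact_mod_cast le_top)).exists_forall_mem_closedBall_exists_eq_forall_mem_Ioo_hasDerivAt 0
  obtain ⟨γ, hγ0, hγ⟩ := h y₀ (Metric.mem_closedBall_self hr.le)
  rw [zero_sub, zero_add] at hγ
  have h0 : (0 : ℝ) ∈ Ioo (-ε₁) ε₁ := ⟨by linarith, hε₁⟩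
  have hc0 : ContinuousAt γ 0 := (hγ 0 h0).continuousAt
  obtain ⟨φ, hφ⟩ := SeparatingDual.exists_eq_one (R := ℝ) hne
  have hφc : ContinuousAt (fun t => φ (ξ (γ t))) 0 := by
    have h1 : ContinuousAt ξ (γ 0) := by rw [hγ0]; exact (hξ y₀ hy₀).continuousAt
    exact φ.continuous.continuousAt.comp (ContinuousAt.comp (f := γ) h1 hc0)
  have hev : ∀ᶠ t in 𝓝 (0 : ℝ), γ t ∈ U ∧ 0 < φ (ξ (γ t)) := by
    refine (hc0.eventually (hU.mem_nhds (by rwa [hγ0]))).and (hφc.eventually (lt_mem_nhds ?_))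
    change 0 < φ (ξ (γ 0))
    rw [hγ0, hφ]; exact one_pos
  obtain ⟨ε₂, hε₂, hball⟩ := Metric.eventually_nhds_iff_ball.1 hev
  set ε := min ε₁ ε₂ with hε
  have hsub1 : ∀ t ∈ Ioo (-ε) ε, t ∈ Ioo (-ε₁) ε₁ := fun t ht =>
    ⟨by linarith [ht.1, min_le_left ε₁ ε₂], by linarith [ht.2, min_le_left ε₁ ε₂]⟩
  have hsub2 : ∀ t ∈ Ioo (-ε) ε, γ t ∈ U ∧ 0 < φ (ξ (γ t)) := fun t ht => by
    apply hball
    rw [Metric.mem_ball, dist_zero_right, Real.norm_eq_abs, abs_lt]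
    exact ⟨by linarith [ht.1, min_le_right ε₁ ε₂], by linarith [ht.2, min_le_right ε₁ ε₂]⟩
  -- Bootstrapping: the derivative of `γ` is `ξ ∘ γ`, which is as regular as `γ`.
  have hsmooth : ∀ n : ℕ, ContDiffOn ℝ n γ (Ioo (-ε) ε) := by
    intro n
    induction n with
    | zero =>
      exact contDiffOn_zero.2 fun t ht => (hγ t (hsub1 t ht)).continuousAt.continuousWithinAt
    | succ n ih =>
      push_cast
      rw [contDiffOn_succ_iff_deriv_of_isOpen isOpen_Ioo]
      refine ⟨fun t ht => (hγ t (hsub1 t ht)).differentiableAt.differentiableWithinAt,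
        fun h => absurd h (by simp), ?_⟩
      have h1 : ContDiffOn ℝ n (fun t => ξ (γ t)) (Ioo (-ε) ε) := by
        intro t ht
        exact (((hξ _ (hsub2 t ht).1).of_le (m := n) (by exact_mod_cast le_top)).comp t
          ((ih t ht).contDiffAt (isOpen_Ioo.mem_nhds ht))).contDiffWithinAt
      exact h1.congr fun t ht => (hγ t (hsub1 t ht)).deriv
  refine ⟨γ, ε, lt_min hε₁ hε₂, hγ0, ?_, fun t ht => ⟨(hsub2 t ht).1, hγ t (hsub1 t ht), ?_⟩⟩
  -- A functional that is positive on the velocity increases strictly along the curve, which gives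
  -- injectivity.
  · have hmono : StrictMonoOn (fun t => φ (γ t)) (Ioo (-ε) ε) := by
      refine strictMonoOn_of_deriv_pos (convex_Ioo _ _) (fun t ht => ?_) (fun t ht => ?_)
      · exact (φ.continuous.continuousAt.comp
          (hγ t (hsub1 t ht)).continuousAt).continuousWithinAt
      · rw [interior_Ioo] at ht
        have := φ.hasFDerivAt.comp_hasDerivAt t (hγ t (hsub1 t ht))
        have h2 : deriv (fun t => φ (γ t)) t = φ (ξ (γ t)) := this.deriv
        rw [h2]
        exact (hsub2 t ht).2
    intro s hs t ht hst
    exact hmono.injOn hs ht (by simp [hst])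
  · rw [contDiffAt_infty]
    exact fun n => (hsmooth n t ht).contDiffAt (isOpen_Ioo.mem_nhds ht)

namespace LegendreFrame

variable {V Λ : Type*} [NormedAddCommGroup V] [NormedSpace ℝ V] [FiniteDimensional ℝ V]
  [NormedAddCommGroup Λ] [NormedSpace ℝ Λ] [FiniteDimensional ℝ Λ]
  {B : Λ →L[ℝ] Λ →L[ℝ] ℝ} {O : Set V} {Y Z : V → Λ} {n₁ n₂ : Λ →L[ℝ] ℝ}

/-- Curvature spheres are constant along curvature curves. -/
def DupinCurves (O : Set V) (Y Z : V → Λ) : Prop :=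
  ∀ (γ : ℝ → V) (τ : ℝ → ℝ) (ε : ℝ), 0 < ε → InjOn γ (Ioo (-ε) ε) →
    (∀ t ∈ Ioo (-ε) ε, γ t ∈ O ∧ ContDiffAt ℝ ∞ γ t ∧ deriv γ t ≠ 0 ∧
      principal Y Z (τ t) (γ t) = Submodule.span ℝ {deriv γ t}) →
    ∀ t ∈ Ioo (-ε) ε, τ t = τ 0

/-- A smooth family of curvature spheres with constant multiplicity, on an open set `U`. -/
structure Branch (O : Set V) (Y Z : V → Λ) (U : Set V) (σ : V → ℝ) (m : ℕ) : Prop where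
  isOpen : IsOpen U
  subset : U ⊆ O
  smooth : ∀ y ∈ U, ContDiffAt ℝ ∞ σ y
  rank : ∀ y ∈ U, Module.finrank ℝ (principal Y Z (σ y) y) = m
  pos : 0 < m

/-- The curvature sphere map of a branch. -/
def sphere (Y Z : V → Λ) (σ : V → ℝ) (y : V) : Λ := Z y + σ y • Y y

variable (F : LegendreFrame B O Y Z n₁ n₂) (hB : IsLieForm B)
  (hdim : Module.finrank ℝ Λ = Module.finrank ℝ V + 4)

include F in
theorem Branch.smooth_pencil {U : Set V} {σ : V → ℝ} {m : ℕ} (b : Branch O Y Z U σ m) {y}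
    (hy : y ∈ U) : ContDiffAt ℝ ∞ (fun y => pencil Y Z (σ y) y) y :=
  (F.smooth_dZ (b.subset hy)).add ((b.smooth y hy).smul (F.smooth_dY (b.subset hy)))

include F hB in
/-- The Dupin property in infinitesimal form. -/
theorem Branch.fderiv_eq_zero {U : Set V} {σ : V → ℝ} {m : ℕ} (b : Branch O Y Z U σ m)
    (hD : DupinCurves O Y Z) {y} (hy : y ∈ U) {X : V} (hX : pencil Y Z (σ y) y X = 0) :
    fderiv ℝ σ y X = 0 := by
  by_cases hX0 : X = 0
  · rw [hX0, map_zero]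
  have hyO := b.subset hy
  have hA := b.smooth_pencil F hy
  obtain ⟨q, -, -, -, hsec⟩ := exists_kernel_section _ y hA.continuousAt
  -- sections of the principal distribution
  have hsec' : ∀ X, pencil Y Z (σ y) y X = 0 → ∃ (ξ : V → V) (W : Set V), IsOpen W ∧ y ∈ W ∧
      W ⊆ U ∧ ξ y = X ∧ ∀ z ∈ W, ContDiffAt ℝ ∞ ξ z ∧ pencil Y Z (σ z) z (ξ z) = 0 := by
    intro X hX
    obtain ⟨ξ, hξ0, -, hξ⟩ := hsec X hX
    obtain ⟨W, hW, hWo, hyW⟩ := mem_nhds_iff.1 (hξ.and (b.isOpen.mem_nhds hy))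
    refine ⟨ξ, W, hWo, hyW, fun z hz => (hW hz).2, hξ0, fun z hz => ?_⟩
    obtain ⟨⟨-, h1, h2⟩, hzU⟩ := hW hz
    exact ⟨h2 ∞ (b.smooth_pencil F hzU), h1 (by rw [b.rank y hy, b.rank z hzU])⟩
  -- A curvature sphere of multiplicity at least two is constant along its principal directions
  -- without any hypothesis, by a Codazzi type argument. Only simple curvature spheres use the Dupin
  -- condition, on an integral curve of the principal line field.
  rcases Nat.lt_or_ge 1 m with hm | hm
  · -- multiplicity at least two
    have hex : ∃ X₂, pencil Y Z (σ y) y X₂ = 0 ∧ LinearIndependent ℝ ![X, X₂] := by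
      have hr := b.rank y hy
      by_contra hcon
      push Not at hcon
      have hle : principal Y Z (σ y) y ≤ Submodule.span ℝ {X} := by
        intro X₂ hX₂
        have h1 := hcon X₂ hX₂
        rw [LinearIndependent.pair_iff' hX0] at h1
        push Not at h1
        obtain ⟨a, ha⟩ := h1
        exact Submodule.mem_span_singleton.2 ⟨a, ha⟩
      have := Submodule.finrank_mono hle
      rw [hr, finrank_span_singleton hX0] at this
      omega
    obtain ⟨X₂, hX₂, hli⟩ := hex
    -- derivative of the pencil along principal vectors
    have hder : ∀ X X', pencil Y Z (σ y) y X = 0 → pencil Y Z (σ y) y X' = 0 →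
        B (fderiv ℝ (fderiv ℝ Z) y X' X + (fderiv ℝ σ y X' • fderiv ℝ Y y X
          + σ y • fderiv ℝ (fderiv ℝ Y) y X' X))
        (fderiv ℝ Y y (fderiv ℝ σ y X' • X - (fderiv ℝ σ y X) • X')) = 0 := by
      intro X X' hX hX'
      obtain ⟨ξ, W, hWo, hyW, hWU, hξ0, hξ⟩ := hsec' X hX
      have hd1 : HasFDerivAt (fun z => pencil Y Z (σ z) z)
          (fderiv ℝ (fderiv ℝ Z) y + (σ y • fderiv ℝ (fderiv ℝ Y) y
            + (fderiv ℝ σ y).smulRight (fderiv ℝ Y y))) y :=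
        ((F.smooth_dZ hyO).differentiableAt (by simp)).hasFDerivAt.add
          (((b.smooth y hy).differentiableAt (by simp)).hasFDerivAt.smul
            ((F.smooth_dY hyO).differentiableAt (by simp)).hasFDerivAt)
      have hd2 := hd1.clm_apply (((hξ y hyW).1.differentiableAt (by simp)).hasFDerivAt)
      have hd3 : (fun z => pencil Y Z (σ z) z (ξ z)) =ᶠ[𝓝 y] fun _ => 0 := by
        filter_upwards [hWo.mem_nhds hyW] with z hz using (hξ z hz).2
      have hd4 := (hd2.congr_of_eventuallyEq hd3.symm).unique (hasFDerivAt_const 0 y)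
      have hd5 := congrArg (fun f : V →L[ℝ] Λ => f X') hd4
      simp only [ContinuousLinearMap.add_apply, ContinuousLinearMap.comp_apply,
        ContinuousLinearMap.flip_apply, ContinuousLinearMap.smul_apply,
        ContinuousLinearMap.smulRight_apply, ContinuousLinearMap.zero_apply, hξ0] at hd5
      set η := fderiv ℝ ξ y X' with hη
      have hd6 : fderiv ℝ (fderiv ℝ Z) y X' X + (fderiv ℝ σ y X' • fderiv ℝ Y y X
          + σ y • fderiv ℝ (fderiv ℝ Y) y X' X) = - pencil Y Z (σ y) y η := by
        rw [eq_neg_iff_add_eq_zero, ← hd5]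
        simp only [ContinuousLinearMap.add_apply, ContinuousLinearMap.smul_apply]
        abel
      -- The unknown derivative `η` of the section enters only through the pencil, whose image is
      -- orthogonal to `dY` of principal vectors.
      rw [hd6, map_neg, ContinuousLinearMap.neg_apply, F.pencil_dY_symm hB hyO]
      rw [map_sub, map_smul, map_smul, hX, hX']
      simp
    have hsymm : ∀ (f : V → Λ), ContDiffAt ℝ ∞ f y → ∀ X X',
        fderiv ℝ (fderiv ℝ f) y X X' = fderiv ℝ (fderiv ℝ f) y X' X := by
      intro f hf X X'
      have := hf.isSymmSndFDerivAt (n := ∞) (by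
        simp only [minSmoothness_of_isRCLikeNormedField]; exact WithTop.coe_le_coe.2 le_top)
      exact this.eq X X'
    -- The second derivatives are symmetric, so the difference of the two identities leaves `B (dY
    -- W) (dY W) = 0` for `W = dσ(X₂) X - dσ(X) X₂`. Hence `W = 0`, and the independence of `X` and
    -- `X₂` gives `dσ(X) = 0`.
    have h1 := hder X X₂ hX hX₂
    have h2 := hder X₂ X hX₂ hX
    rw [hsymm Z (F.smoothZ y hyO) X X₂, hsymm Y (F.smoothY y hyO) X X₂] at h2
    set P := fderiv ℝ (fderiv ℝ Z) y X₂ X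
    set Q := fderiv ℝ (fderiv ℝ Y) y X₂ X
    set W := fderiv ℝ σ y X₂ • X - (fderiv ℝ σ y X) • X₂ with hW
    have hW' : fderiv ℝ σ y X • X₂ - (fderiv ℝ σ y X₂) • X = -W := by rw [hW]; abel
    rw [hW', map_neg, map_neg, neg_eq_zero] at h2
    have h3 : B (fderiv ℝ Y y W) (fderiv ℝ Y y W) = 0 := by
      have : fderiv ℝ Y y W = (P + (fderiv ℝ σ y X₂ • fderiv ℝ Y y X + σ y • Q))
          - (P + (fderiv ℝ σ y X • fderiv ℝ Y y X₂ + σ y • Q)) := by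
        rw [hW, map_sub, map_smul, map_smul]; abel
      rw [hB.symm] at h1 h2
      conv_lhs => arg 2; rw [this]
      rw [map_sub, h1, h2, sub_zero]
    have h4 : W = 0 := by
      by_contra h0
      exact (F.dY_dY_pos hB hyO h0).ne' h3
    have h5 := LinearIndependent.pair_iff.1 hli (fderiv ℝ σ y X₂) (-(fderiv ℝ σ y X)) (by
      rw [neg_smul, ← sub_eq_add_neg]; exact h4)
    linarith [h5.2]
  · -- multiplicity one
    have hm1 : m = 1 := le_antisymm hm b.pos
    obtain ⟨ξ, W, hWo, hyW, hWU, hξ0, hξ⟩ := hsec' X hX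
    have hne : ξ y ≠ 0 := by rwa [hξ0]
    have hW' : IsOpen (W ∩ ξ ⁻¹' {0}ᶜ) :=
      ContinuousOn.isOpen_inter_preimage
        (fun z hz => (hξ z hz).1.continuousAt.continuousWithinAt) hWo isOpen_compl_singleton
    obtain ⟨γ, ε, hε, hγ0, hinj, hγ⟩ := exists_smooth_integral_curve ξ y (W ∩ ξ ⁻¹' {0}ᶜ) hW'
      ⟨hyW, hne⟩ (fun z hz => (hξ z hz.1).1) hne
    have h0 : (0 : ℝ) ∈ Ioo (-ε) ε := ⟨by linarith, hε⟩
    have hconst := hD γ (fun t => σ (γ t)) ε hε hinj (fun t ht => by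
      obtain ⟨h1, h2, h3⟩ := hγ t ht
      refine ⟨b.subset (hWU h1.1), h3, ?_, ?_⟩
      · rw [h2.deriv]; exact h1.2
      · rw [h2.deriv]
        symm
        refine Submodule.eq_of_le_of_finrank_le ?_ ?_
        · rw [Submodule.span_singleton_le_iff_mem]
          exact (hξ _ h1.1).2
        · rw [b.rank _ (hWU h1.1), finrank_span_singleton h1.2, hm1])
    have hd : HasDerivAt (fun t => σ (γ t)) (fderiv ℝ σ y X) 0 := by
      have h1 : HasFDerivAt σ (fderiv ℝ σ y) (γ 0) := by
        rw [hγ0]; exact ((b.smooth y hy).differentiableAt (by simp)).hasFDerivAt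
      have h2 := (hγ 0 h0).2.1
      rw [hγ0, hξ0] at h2
      exact h1.comp_hasDerivAt 0 h2
    have hd' : HasDerivAt (fun t => σ (γ t)) 0 0 := by
      refine (hasDerivAt_const (0 : ℝ) (σ (γ 0))).congr_of_eventuallyEq ?_
      filter_upwards [isOpen_Ioo.mem_nhds h0] with t ht using hconst t ht
    exact hd.unique hd'

end LegendreFrame

/-! ### Curvature sphere maps and coordinates adapted to their leaves. -/

namespace LegendreFrame

variable {V Λ : Type*} [NormedAddCommGroup V] [NormedSpace ℝ V] [FiniteDimensional ℝ V]
  [NormedAddCommGroup Λ] [NormedSpace ℝ Λ] [FiniteDimensional ℝ Λ]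
  {B : Λ →L[ℝ] Λ →L[ℝ] ℝ} {O : Set V} {Y Z : V → Λ} {n₁ n₂ : Λ →L[ℝ] ℝ}

section
variable (F : LegendreFrame B O Y Z n₁ n₂)
include F

theorem smooth_sphere {σ : V → ℝ} {y : V} (hy : y ∈ O) (hσ : ContDiffAt ℝ ∞ σ y) :
    ContDiffAt ℝ ∞ (sphere Y Z σ) y :=
  (F.smoothZ y hy).add (hσ.smul (F.smoothY y hy))

theorem fderiv_sphere {σ : V → ℝ} {y : V} (hy : y ∈ O) (hσ : ContDiffAt ℝ ∞ σ y) (X : V) :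
    fderiv ℝ (sphere Y Z σ) y X = pencil Y Z (σ y) y X + fderiv ℝ σ y X • Y y := by
  have h : HasFDerivAt (sphere Y Z σ) _ y :=
    (F.diffZ hy).hasFDerivAt.add ((hσ.differentiableAt (by simp)).hasFDerivAt.smul
      (F.diffY hy).hasFDerivAt)
  rw [h.fderiv]
  simp [add_assoc]

theorem n₂_sphere {σ : V → ℝ} {y : V} (hy : y ∈ O) : n₂ (sphere Y Z σ y) = 1 := by
  simp [sphere, F.n₂Z y hy, F.n₂Y y hy]

theorem sphere_ne_zero {σ : V → ℝ} {y : V} (hy : y ∈ O) : sphere Y Z σ y ≠ 0 := by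
  intro h
  have := F.n₂_sphere (σ := σ) hy
  rw [h, map_zero] at this
  exact zero_ne_one this

theorem pencil_eq_zero_of_fderiv_sphere {σ : V → ℝ} {y : V} (hy : y ∈ O)
    (hσ : ContDiffAt ℝ ∞ σ y) {X : V} (h : fderiv ℝ (sphere Y Z σ) y X = 0) :
    pencil Y Z (σ y) y X = 0 := by
  rw [F.fderiv_sphere hy hσ] at h
  have h1 := congrArg n₁ h
  have h2 : fderiv ℝ σ y X = 0 := by
    simpa [F.n₁_dZ hy, F.n₁_dY hy, F.n₁Y y hy] using h1
  rwa [h2, zero_smul, add_zero] at h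

end

/-- A branch of curvature spheres which are constant along their principal directions. -/
structure DupinBranch (O : Set V) (Y Z : V → Λ) (U : Set V) (σ : V → ℝ) (m : ℕ) : Prop
    extends Branch O Y Z U σ m where
  dupin : ∀ y ∈ U, ∀ X, pencil Y Z (σ y) y X = 0 → fderiv ℝ σ y X = 0

variable (F : LegendreFrame B O Y Z n₁ n₂) (hB : IsLieForm B)
  (hdim : Module.finrank ℝ Λ = Module.finrank ℝ V + 4)

-- The derivative of `Z + σ Y` is the pencil plus `dσ · Y`; `n₁` separates the two parts, and on
-- principal vectors the Dupin condition removes the second. This is what gives the curvature sphere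
-- map constant rank.
include F in
theorem DupinBranch.fderiv_sphere_eq_zero_iff {U : Set V} {σ : V → ℝ} {m : ℕ}
    (b : DupinBranch O Y Z U σ m) {y : V} (hy : y ∈ U) (X : V) :
    fderiv ℝ (sphere Y Z σ) y X = 0 ↔ pencil Y Z (σ y) y X = 0 := by
  refine ⟨F.pencil_eq_zero_of_fderiv_sphere (b.subset hy) (b.smooth y hy), fun h => ?_⟩
  rw [F.fderiv_sphere (b.subset hy) (b.smooth y hy), h, b.dupin y hy X h]
  simp

include F in
theorem DupinBranch.ker_fderiv_sphere {U : Set V} {σ : V → ℝ} {m : ℕ}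
    (b : DupinBranch O Y Z U σ m) {y : V} (hy : y ∈ U) :
    LinearMap.ker (fderiv ℝ (sphere Y Z σ) y).toLinearMap = principal Y Z (σ y) y := by
  ext X
  exact b.fderiv_sphere_eq_zero_iff F hy X

/-- Coordinates adapted to the curvature surfaces of a branch. -/
structure LeafCoordinates (Y Z : V → Λ) (σ : V → ℝ) (y₀ : V) (U : Set V) {R D : Submodule ℝ Λ}
    (π : Λ →L[ℝ] R) (π' : Λ →L[ℝ] D) (e : OpenPartialHomeomorph V (R × D)) (r : ℝ) : Prop where
  mem : y₀ ∈ e.source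
  subset : e.source ⊆ U
  coe : ∀ y ∈ e.source, e y = (π (sphere Y Z σ y), π' (Y y))
  smooth_symm : ∀ p ∈ e.target, ContDiffAt ℝ ∞ e.symm p
  pos : 0 < r
  box : Metric.ball (π (sphere Y Z σ y₀)) r ×ˢ Metric.ball (π' (Y y₀)) r ⊆ e.target
  const : ∀ v ∈ Metric.ball (π (sphere Y Z σ y₀)) r, ∀ t ∈ Metric.ball (π' (Y y₀)) r,
    ∀ t' ∈ Metric.ball (π' (Y y₀)) r,
      sphere Y Z σ (e.symm (v, t)) = sphere Y Z σ (e.symm (v, t'))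
  ker : ∀ y ∈ e.source, ∀ X, π (fderiv ℝ (sphere Y Z σ) y X) = 0 →
    fderiv ℝ (sphere Y Z σ) y X = 0
  inj : ∀ y ∈ e.source, ∀ X, π (fderiv ℝ (sphere Y Z σ) y X) = 0 → π' (fderiv ℝ Y y X) = 0 → X = 0
  surj : ∀ y ∈ e.source, ∀ x : R, ∃ X, π (fderiv ℝ (sphere Y Z σ) y X) = x

-- The constant rank theorem for the curvature sphere map. `R` is the range of its derivative at
-- `y₀` and `D` is the image of the principal space under `dY`, so the first coordinate labels the
-- leaf and the second is a parameter on it that is linear in `Y`.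
include F in
theorem DupinBranch.exists_leafCoordinates {U : Set V} {σ : V → ℝ} {m : ℕ}
    (b : DupinBranch O Y Z U σ m) {y₀ : V} (hy₀ : y₀ ∈ U) (W : Set V) (hW : W ∈ 𝓝 y₀) :
    ∃ (R D : Submodule ℝ Λ) (π : Λ →L[ℝ] R) (π' : Λ →L[ℝ] D)
      (e : OpenPartialHomeomorph V (R × D)) (r : ℝ),
      LeafCoordinates Y Z σ y₀ (U ∩ W) π π' e r := by
  set K := sphere Y Z σ with hK
  have hKs : ∀ y ∈ U, ContDiffAt ℝ ∞ K y := fun y hy => F.smooth_sphere (b.subset hy) (b.smooth y hy)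
  set R : Submodule ℝ Λ := LinearMap.range (fderiv ℝ K y₀).toLinearMap with hR
  set D : Submodule ℝ Λ := (principal Y Z (σ y₀) y₀).map (fderiv ℝ Y y₀).toLinearMap with hDdef
  obtain ⟨p, hp⟩ := R.subtype.exists_leftInverse_of_injective R.ker_subtype
  obtain ⟨p', hp'⟩ := D.subtype.exists_leftInverse_of_injective D.ker_subtype
  set π : Λ →L[ℝ] R := p.toContinuousLinearMap
  set π' : Λ →L[ℝ] D := p'.toContinuousLinearMap
  have hπ : ∀ x (hx : x ∈ R), π x = ⟨x, hx⟩ := fun x hx => LinearMap.congr_fun hp ⟨x, hx⟩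
  have hπ' : ∀ x (hx : x ∈ D), π' x = ⟨x, hx⟩ := fun x hx => LinearMap.congr_fun hp' ⟨x, hx⟩
  have hker0 : ∀ X, π (fderiv ℝ K y₀ X) = 0 → fderiv ℝ K y₀ X = 0 := by
    intro X hX
    rw [hπ (fderiv ℝ K y₀ X) ⟨X, rfl⟩] at hX
    exact congrArg Subtype.val hX
  have hinj0 : ∀ X, π (fderiv ℝ K y₀ X) = 0 → π' (fderiv ℝ Y y₀ X) = 0 → X = 0 := by
    intro X h1 h2
    have h3 := (b.fderiv_sphere_eq_zero_iff F hy₀ X).1 (hker0 X h1)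
    rw [hπ' (fderiv ℝ Y y₀ X) ⟨X, h3, rfl⟩] at h2
    exact F.inj y₀ (b.subset hy₀) X (congrArg Subtype.val h2)
  have hDm : Module.finrank ℝ D = m := by
    rw [hDdef, ← b.rank y₀ hy₀]
    refine (Submodule.equivMapOfInjective (fderiv ℝ Y y₀).toLinearMap ?_ _).finrank_eq.symm
    rw [← LinearMap.ker_eq_bot, LinearMap.ker_eq_bot']
    exact F.inj y₀ (b.subset hy₀)
  have hRm : Module.finrank ℝ R + m = Module.finrank ℝ V := by
    rw [← b.rank y₀ hy₀, ← b.ker_fderiv_sphere F hy₀]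
    exact LinearMap.finrank_range_add_finrank_ker _
  have hAm : ∀ y ∈ U, LinearMap.ker (fderiv ℝ K y).toLinearMap
      ≤ LinearMap.ker (π ∘L fderiv ℝ K y).toLinearMap := by
    intro y _ X hX
    have hX' : fderiv ℝ K y X = 0 := hX
    change π (fderiv ℝ K y X) = 0
    rw [hX', map_zero]
  have hA0 : LinearMap.ker (π ∘L fderiv ℝ K y₀).toLinearMap
      = LinearMap.ker (fderiv ℝ K y₀).toLinearMap := le_antisymm (fun X hX => hker0 X hX) (hAm y₀ hy₀)
  -- The nullity of `π ∘ dK` is at least `m` everywhere on `U` and, by semicontinuity, at most `m`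
  -- near `y₀`; so `π` loses nothing of `dK` there.
  have hev : ∀ᶠ y in 𝓝 y₀, y ∈ U ∧ y ∈ W ∧ ∀ X, π (fderiv ℝ K y X) = 0 → fderiv ℝ K y X = 0 := by
    have hc : ContinuousAt (fun y => π ∘L fderiv ℝ K y) y₀ :=
      (ContinuousLinearMap.compL ℝ V Λ R π).continuous.continuousAt.comp
        (((hKs y₀ hy₀).fderiv_right (m := 0) (by simp)).continuousAt)
    obtain ⟨-, -, -, hle, -⟩ := exists_kernel_section _ y₀ hc
    filter_upwards [hle, b.isOpen.mem_nhds hy₀, hW] with y hy hyU hyW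
    refine ⟨hyU, hyW, fun X hX => ?_⟩
    rw [hA0, b.ker_fderiv_sphere F hy₀, b.rank y₀ hy₀] at hy
    have heq := Submodule.eq_of_le_of_finrank_le (hAm y hyU) (by
      rw [b.ker_fderiv_sphere F hyU, b.rank y hyU]; exact hy)
    have hX' : X ∈ LinearMap.ker (π ∘L fderiv ℝ K y).toLinearMap := hX
    rw [← heq] at hX'
    exact hX'
  have hπY : ∀ y ∈ U, HasFDerivAt (fun y => π' (Y y)) (π' ∘L fderiv ℝ Y y) y := fun y hy =>
    π'.hasFDerivAt.comp y (F.diffY (b.subset hy)).hasFDerivAt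
  obtain ⟨e, hmem, hsub, hcoe, hsymm, r, hr, hbox, hconst⟩ :=
    exists_constant_rank_coordinates K (fun y => π' (Y y)) π y₀ _ hev
      (fun y hy => hKs y hy.1)
      (fun y hy => π'.contDiff.contDiffAt.comp y (F.smoothY y (b.subset hy.1)))
      (fun X h1 h2 => hinj0 X h1 (by rwa [(hπY y₀ hy₀).fderiv] at h2))
      (by rw [hDm, hRm]) (fun y hy => hy.2.2)
  refine ⟨R, D, π, π', e, r, hmem, fun y hy => ⟨(hsub hy).1, (hsub hy).2.1⟩, hcoe, hsymm, hr, hbox,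
    hconst, fun y hy => (hsub hy).2.2, ?_, ?_⟩
  · intro y hy X h1 h2
    have hyU := (hsub hy).1
    have he : HasFDerivAt e ((π ∘L fderiv ℝ K y).prod (π' ∘L fderiv ℝ Y y)) y := by
      refine HasFDerivAt.congr_of_eventuallyEq (f := fun y => (π (K y), π' (Y y))) ?_ ?_
      · exact (π.hasFDerivAt.comp y ((hKs y hyU).differentiableAt (by simp)).hasFDerivAt).prodMk
          (hπY y hyU)
      · filter_upwards [e.open_source.mem_nhds hy] with z hz using hcoe z hz
    have hs := ((hsymm _ (e.map_source hy)).differentiableAt (by simp)).hasFDerivAt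
    have hcomp := hs.comp y he
    have hid : HasFDerivAt (e.symm ∘ e) (ContinuousLinearMap.id ℝ V) y := by
      refine (hasFDerivAt_id y).congr_of_eventuallyEq ?_
      filter_upwards [e.open_source.mem_nhds hy] with z hz using e.left_inv hz
    have := congrArg (fun f : V →L[ℝ] V => f X) (hcomp.unique hid)
    simp only [ContinuousLinearMap.comp_apply, ContinuousLinearMap.prod_apply, h1, h2,
      ContinuousLinearMap.id_apply] at this
    rw [← this]
    rw [show π (fderiv ℝ K y X) = 0 from h1]
    exact (fderiv ℝ e.symm (e y)).map_zero
  · intro y hy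
    have hyU := (hsub hy).1
    have hk : LinearMap.ker (π ∘L fderiv ℝ K y).toLinearMap
        = LinearMap.ker (fderiv ℝ K y).toLinearMap :=
      le_antisymm (fun X hX => (hsub hy).2.2 X hX) (hAm y hyU)
    have h1 := LinearMap.finrank_range_add_finrank_ker (π ∘L fderiv ℝ K y).toLinearMap
    rw [hk, b.ker_fderiv_sphere F hyU, b.rank y hyU, ← hRm] at h1
    have h2 : LinearMap.range (π ∘L fderiv ℝ K y).toLinearMap = ⊤ :=
      Submodule.eq_top_of_finrank_eq (by omega)
    exact LinearMap.range_eq_top.1 h2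

end LegendreFrame

/-! ### Real analyticity along the leaves. -/

theorem hasFDerivAt_prod_quadratic {Λ G : Type*} [NormedAddCommGroup Λ] [NormedSpace ℝ Λ]
    [NormedAddCommGroup G] [NormedSpace ℝ G] (ℓ : Λ →L[ℝ] G) (B : Λ →L[ℝ] Λ →L[ℝ] ℝ) (w : Λ) :
    HasFDerivAt (fun w => (ℓ w, B w w)) (ℓ.prod (B w + B.flip w)) w := by
  have h1 : HasFDerivAt (fun w => B w w) (B w + B.flip w) w := by
    have h2 := (B.hasFDerivAt (x := w)).clm_apply (hasFDerivAt_id w)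
    have h3 : B w + B.flip w = (B w) ∘L (ContinuousLinearMap.id ℝ Λ) + B.flip (id w) := by
      ext x; simp
    rw [h3]
    exact h2
  exact ℓ.hasFDerivAt.prodMk h1

theorem contDiff_prod_quadratic {Λ G : Type*} [NormedAddCommGroup Λ] [NormedSpace ℝ Λ]
    [NormedAddCommGroup G] [NormedSpace ℝ G] (ℓ : Λ →L[ℝ] G) (B : Λ →L[ℝ] Λ →L[ℝ] ℝ)
    (n : WithTop ℕ∞) : ContDiff ℝ n (fun w => (ℓ w, B w w)) :=
  ℓ.contDiff.prodMk (B.contDiff.clm_apply contDiff_id)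

namespace LegendreFrame

variable {V Λ : Type*} [NormedAddCommGroup V] [NormedSpace ℝ V] [FiniteDimensional ℝ V]
  [NormedAddCommGroup Λ] [NormedSpace ℝ Λ] [FiniteDimensional ℝ Λ]
  {B : Λ →L[ℝ] Λ →L[ℝ] ℝ} {O : Set V} {Y Z : V → Λ} {n₁ n₂ : Λ →L[ℝ] ℝ}
  {U : Set V} {σ : V → ℝ} {m : ℕ}
  {R D : Submodule ℝ Λ} {π : Λ →L[ℝ] R} {π' : Λ →L[ℝ] D} {e : OpenPartialHomeomorph V (R × D)}
  {r : ℝ} {y₀ : V}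

variable (F : LegendreFrame B O Y Z n₁ n₂) (hB : IsLieForm B)
  (hdim : Module.finrank ℝ Λ = Module.finrank ℝ V + 4)

/-- The curvature sphere map as a function on the leaf space. -/
def leafSphere (Y Z : V → Λ) (σ : V → ℝ) (y₀ : V) (e : OpenPartialHomeomorph V (R × D))
    (π' : Λ →L[ℝ] D) (v : R) : Λ := sphere Y Z σ (e.symm (v, π' (Y y₀)))

section
variable (L : LeafCoordinates Y Z σ y₀ U π π' e r)
include L

theorem LeafCoordinates.mem_target {v : R} {t : D}
    (hv : v ∈ Metric.ball (π (sphere Y Z σ y₀)) r) (ht : t ∈ Metric.ball (π' (Y y₀)) r) :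
    (v, t) ∈ e.target := L.box ⟨hv, ht⟩

theorem LeafCoordinates.center_mem : π' (Y y₀) ∈ Metric.ball (π' (Y y₀)) r :=
  Metric.mem_ball_self L.pos

theorem LeafCoordinates.sphere_symm {v : R} {t : D}
    (hv : v ∈ Metric.ball (π (sphere Y Z σ y₀)) r) (ht : t ∈ Metric.ball (π' (Y y₀)) r) :
    sphere Y Z σ (e.symm (v, t)) = leafSphere Y Z σ y₀ e π' v :=
  L.const v hv t ht _ L.center_mem

theorem LeafCoordinates.coe_symm {v : R} {t : D} (h : (v, t) ∈ e.target) :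
    π (sphere Y Z σ (e.symm (v, t))) = v ∧ π' (Y (e.symm (v, t))) = t := by
  have h1 := L.coe _ (e.map_target h)
  rw [e.right_inv h] at h1
  exact ⟨(congrArg Prod.fst h1).symm, (congrArg Prod.snd h1).symm⟩

include F in
theorem LeafCoordinates.smooth_leafSphere (b : DupinBranch O Y Z U σ m) {v : R}
    (hv : v ∈ Metric.ball (π (sphere Y Z σ y₀)) r) :
    ContDiffAt ℝ ∞ (leafSphere Y Z σ y₀ e π') v := by
  have hp := L.mem_target hv L.center_mem
  have hU := L.subset (e.map_target hp)
  have h1 := F.smooth_sphere (b.subset hU) (b.smooth _ hU)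
  have h2 : ContDiffAt ℝ ∞ (fun v : R => e.symm (v, π' (Y y₀))) v :=
    ContDiffAt.comp (g := e.symm) (f := fun v : R => (v, π' (Y y₀))) v (L.smooth_symm _ hp)
      (contDiffAt_id.prodMk contDiffAt_const)
  exact ContDiffAt.comp (g := sphere Y Z σ) v h1 h2

/-- The derivative of the curvature sphere map factors through the leaf space. -/
theorem LeafCoordinates.sphere_eventuallyEq {v : R} {t : D}
    (hv : v ∈ Metric.ball (π (sphere Y Z σ y₀)) r) (ht : t ∈ Metric.ball (π' (Y y₀)) r) :
    sphere Y Z σ =ᶠ[𝓝 (e.symm (v, t))]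
      fun y => leafSphere Y Z σ y₀ e π' (π (sphere Y Z σ y)) := by
  have hp := L.mem_target hv ht
  have hs := e.map_target hp
  have hc : Tendsto e (𝓝 (e.symm (v, t))) (𝓝 (v, t)) := by
    have := e.continuousAt hs
    rwa [ContinuousAt, e.right_inv hp] at this
  have hbox : Metric.ball (π (sphere Y Z σ y₀)) r ×ˢ Metric.ball (π' (Y y₀)) r ∈ 𝓝 (v, t) :=
    prod_mem_nhds (Metric.isOpen_ball.mem_nhds hv) (Metric.isOpen_ball.mem_nhds ht)
  filter_upwards [hc hbox, e.open_source.mem_nhds hs] with y hy hys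
  have h1 := L.coe y hys
  have h2 := L.sphere_symm (v := (e y).1) (t := (e y).2) hy.1 hy.2
  rw [Prod.mk.eta, e.left_inv hys, h1] at h2
  exact h2

include F in
theorem LeafCoordinates.fderiv_sphere_eq (b : DupinBranch O Y Z U σ m) {v : R} {t : D}
    (hv : v ∈ Metric.ball (π (sphere Y Z σ y₀)) r) (ht : t ∈ Metric.ball (π' (Y y₀)) r) (X : V) :
    fderiv ℝ (sphere Y Z σ) (e.symm (v, t)) X = fderiv ℝ (leafSphere Y Z σ y₀ e π') v
      (π (fderiv ℝ (sphere Y Z σ) (e.symm (v, t)) X)) := by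
  have hp := L.mem_target hv ht
  have hU := L.subset (e.map_target hp)
  have hd := ((F.smooth_sphere (b.subset hU) (b.smooth _ hU)).differentiableAt
    (by simp)).hasFDerivAt
  have h1 : HasFDerivAt (leafSphere Y Z σ y₀ e π') (fderiv ℝ (leafSphere Y Z σ y₀ e π') v)
      (π (sphere Y Z σ (e.symm (v, t)))) := by
    rw [(L.coe_symm hp).1]
    exact ((L.smooth_leafSphere F b hv).differentiableAt (by simp)).hasFDerivAt
  have h2 := HasFDerivAt.comp (e.symm (v, t)) h1 (π.hasFDerivAt.comp (e.symm (v, t)) hd)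
  have h3 := hd.unique (h2.congr_of_eventuallyEq (L.sphere_eventuallyEq hv ht))
  exact congrArg (fun f : V →L[ℝ] Λ => f X) h3

end

section
variable (L : LeafCoordinates Y Z σ y₀ U π π' e r) (b : DupinBranch O Y Z U σ m)
include F hB L b

omit L in
theorem Y_fderiv_sphere {y : V} (hy : y ∈ U) (X : V) :
    B (Y y) (fderiv ℝ (sphere Y Z σ) y X) = 0 := by
  rw [F.fderiv_sphere (b.subset hy) (b.smooth y hy), hB.symm]
  simp [F.dZ_Y hB (b.subset hy), F.dY_Y hB (b.subset hy), F.YY y (b.subset hy)]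

omit L b in
theorem Y_sphere {y : V} (hy : y ∈ O) : B (Y y) (sphere Y Z σ y) = 0 := by
  simp [sphere, F.YZ y hy, F.YY y hy]

/-- Along a leaf the Legendre map is real analytic. -/
theorem LeafCoordinates.analytic_Y (hdim : Module.finrank ℝ Λ = Module.finrank ℝ V + 4) {v : R}
    (hv : v ∈ Metric.ball (π (sphere Y Z σ y₀)) r) {t : D} (ht : t ∈ Metric.ball (π' (Y y₀)) r) :
    ContDiffAt ℝ ω (fun t => Y (e.symm (v, t))) t := by
  set K' := leafSphere Y Z σ y₀ e π' with hK'
  set dK := fderiv ℝ K' v with hdK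
  -- On a fixed leaf `K` and `dK` do not move, and `Y` satisfies linear equations (orthogonality to
  -- both, the normalizations, the leaf parameter) and one quadratic equation. The right hand side
  -- is affine in the parameter, so `Y` is as regular as these equations, namely analytic, once the
  -- linearization is injective.
  set ℓ : Λ →L[ℝ] ℝ × (R →L[ℝ] ℝ) × ℝ × ℝ × D :=
    (B (K' v)).prod ((((ContinuousLinearMap.compL ℝ R Λ ℝ).flip dK) ∘L B).prod
      (n₁.prod (n₂.prod π'))) with hℓ
  set g : Λ → (ℝ × (R →L[ℝ] ℝ) × ℝ × ℝ × D) × ℝ := fun w => (ℓ w, B w w) with hg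
  have hp := L.mem_target hv ht
  have hU := L.subset (e.map_target hp)
  have hO := b.subset hU
  have hgd : ∀ w, HasFDerivAt g (ℓ.prod (B w + B.flip w)) w :=
    hasFDerivAt_prod_quadratic (G := ℝ × (R →L[ℝ] ℝ) × ℝ × ℝ × D) ℓ B
  have hgs : ContDiff ℝ ω g :=
    contDiff_prod_quadratic (G := ℝ × (R →L[ℝ] ℝ) × ℝ × ℝ × D) ℓ B ω
  refine contDiffAt_of_comp_of_injective (by simp) (g := g) hgs.contDiffAt ?_ ?_ ?_
  · intro w hw
    rw [(hgd _).fderiv] at hw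
    set y := e.symm (v, t) with hy
    have e1 : B (K' v) w = 0 := congrArg (fun p => p.1.1) hw
    have e2 : ∀ x : R, B w (dK x) = 0 := fun x =>
      congrArg (fun p : (ℝ × (R →L[ℝ] ℝ) × ℝ × ℝ × D) × ℝ => p.1.2.1 x) hw
    have e3 : n₁ w = 0 := congrArg (fun p => p.1.2.2.1) hw
    have e4 : n₂ w = 0 := congrArg (fun p => p.1.2.2.2.1) hw
    have e5 : π' w = 0 := congrArg (fun p => p.1.2.2.2.2) hw
    have e6 : B (Y y) w + B w (Y y) = 0 := congrArg (fun p => p.2) hw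
    have e7 : B w (Y y) = 0 := by rw [hB.symm (Y y)] at e6; linarith
    rw [hK', ← L.sphere_symm hv ht, ← hy, hB.symm, sphere, map_add, map_smul, e7, smul_zero,
      add_zero] at e1
    -- A vector in the kernel of the linearization is some `dY X`. Its orthogonality to `dK` makes
    -- `X` principal, hence tangent to the leaf, and the leaf parameter then excludes `X ≠ 0`.
    obtain ⟨X, rfl⟩ := F.exists_dY hB hdim hO w e7 e1 e3 e4
    have h1 : pencil Y Z (σ y) y X = 0 := by
      refine F.pencil_eq_zero_of_orthogonal hB hdim hO _ X fun X' => ?_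
      have h2 := e2 (π (fderiv ℝ (sphere Y Z σ) y X'))
      rw [hdK, hK', ← L.fderiv_sphere_eq F b hv ht, ← hy,
        F.fderiv_sphere hO (b.smooth y hU), map_add, map_smul, F.dY_Y hB hO, smul_zero,
        add_zero] at h2
      exact h2
    have h3 : fderiv ℝ (sphere Y Z σ) y X = 0 := (b.fderiv_sphere_eq_zero_iff F hU X).2 h1
    have h4 := L.inj y (e.map_target hp) X (by rw [h3, map_zero]) e5
    rw [h4, map_zero]
  · have h1 : ContinuousAt (fun t : D => e.symm (v, t)) t :=
      ContinuousAt.comp (f := fun t : D => (v, t)) (e.continuousAt_symm hp)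
        (continuousAt_const.prodMk continuousAt_id)
    exact ContinuousAt.comp (f := fun t : D => e.symm (v, t)) (F.diffY hO).continuousAt h1
  · have h1 : (fun t => g (Y (e.symm (v, t)))) =ᶠ[𝓝 t] fun t => ((0, 0, 1, 0, t), 0) := by
      filter_upwards [Metric.isOpen_ball.mem_nhds ht] with s hs
      have hps := L.mem_target hv hs
      have hUs := L.subset (e.map_target hps)
      have hOs := b.subset hUs
      simp only [hg, Prod.mk.injEq]
      refine ⟨Prod.ext ?_ (Prod.ext ?_ (Prod.ext (F.n₁Y _ hOs) (Prod.ext (F.n₂Y _ hOs)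
        (L.coe_symm hps).2))), F.YY _ hOs⟩
      · change B (K' v) _ = 0
        rw [hK', ← L.sphere_symm hv hs, hB.symm]
        exact F.Y_sphere hB hOs
      · ext x
        obtain ⟨X, rfl⟩ := L.surj _ (e.map_target hps) x
        change B _ (dK _) = 0
        rw [hdK, hK', ← L.fderiv_sphere_eq F b hv hs]
        exact F.Y_fderiv_sphere hB b hUs X
    refine ContDiffAt.congr_of_eventuallyEq ?_ h1
    exact (contDiffAt_const.prodMk (contDiffAt_const.prodMk (contDiffAt_const.prodMk
      (contDiffAt_const.prodMk contDiffAt_id)))).prodMk contDiffAt_const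

end

end LegendreFrame

section Calculus

variable {V R Λ : Type*} [NormedAddCommGroup V] [NormedSpace ℝ V] [NormedAddCommGroup R]
  [NormedSpace ℝ R] [NormedAddCommGroup Λ] [NormedSpace ℝ Λ]

/-- Contraction of a vector valued bilinear map with a bilinear form. -/
theorem exists_contraction (B : Λ →L[ℝ] Λ →L[ℝ] ℝ) (S : R →L[ℝ] R →L[ℝ] Λ) :
    ∃ H : Λ →L[ℝ] R →L[ℝ] R →L[ℝ] ℝ, (∀ w x x', H w x x' = - B w (S x x')) ∧
      ∀ (f : V → Λ) (y : V), ContDiffAt ℝ ω f y → ContDiffAt ℝ ω (fun z => H (f z)) y := by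
  let H : Λ →L[ℝ] R →L[ℝ] R →L[ℝ] ℝ :=
    (ContinuousLinearMap.compL ℝ R (R →L[ℝ] Λ) (R →L[ℝ] ℝ)).flip S ∘L
      (ContinuousLinearMap.compL ℝ R Λ ℝ) ∘L (-B)
  refine ⟨H, fun _ _ _ => rfl, fun f y hf => ?_⟩
  have h1 : ContDiff ℝ ω (H : Λ → R →L[ℝ] R →L[ℝ] ℝ) := by fun_prop
  exact h1.contDiffAt.comp y hf

theorem hasFDerivAt_fderiv_comp {K : R → Λ} {f : V → R} {f' : V →L[ℝ] R} {y : V}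
    (hK : ContDiffAt ℝ ∞ K (f y)) (hf : HasFDerivAt f f' y) (x : R) :
    HasFDerivAt (fun z => fderiv ℝ K (f z) x) ((fderiv ℝ (fderiv ℝ K) (f y)).flip x ∘L f') y := by
  have h1 : HasFDerivAt (fderiv ℝ K) (fderiv ℝ (fderiv ℝ K) (f y)) (f y) :=
    ((hK.fderiv_right (m := ∞) (by simp)).differentiableAt (by simp)).hasFDerivAt
  have h2 := (HasFDerivAt.comp y h1 hf).clm_apply (hasFDerivAt_const x y)
  have h3 : HasFDerivAt (fun z => fderiv ℝ K (f z) x) _ y := h2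
  convert h3 using 1
  ext X
  simp

end Calculus

namespace LegendreFrame

variable {V Λ : Type*} [NormedAddCommGroup V] [NormedSpace ℝ V] [FiniteDimensional ℝ V]
  [NormedAddCommGroup Λ] [NormedSpace ℝ Λ] [FiniteDimensional ℝ Λ]
  {B : Λ →L[ℝ] Λ →L[ℝ] ℝ} {O : Set V} {Y Z : V → Λ} {n₁ n₂ : Λ →L[ℝ] ℝ}
  {U : Set V} {σ : V → ℝ} {m : ℕ}
  {R D : Submodule ℝ Λ} {π : Λ →L[ℝ] R} {π' : Λ →L[ℝ] D} {e : OpenPartialHomeomorph V (R × D)}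
  {r : ℝ} {y₀ : V}

variable (F : LegendreFrame B O Y Z n₁ n₂) (hB : IsLieForm B)
  (L : LeafCoordinates Y Z σ y₀ U π π' e r) (b : DupinBranch O Y Z U σ m)
include F hB L b

/-- The second derivative of the curvature sphere map on the leaf space. -/
theorem LeafCoordinates.second_derivative {v : R}
    (hv : v ∈ Metric.ball (π (sphere Y Z σ y₀)) r) {t : D} (ht : t ∈ Metric.ball (π' (Y y₀)) r)
    (X : V) (x' : R) :
    B (Y (e.symm (v, t))) (fderiv ℝ (fderiv ℝ (leafSphere Y Z σ y₀ e π')) v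
        (π (fderiv ℝ (sphere Y Z σ) (e.symm (v, t)) X)) x')
      = - B (fderiv ℝ Y (e.symm (v, t)) X) (fderiv ℝ (leafSphere Y Z σ y₀ e π') v x') := by
  set K' := leafSphere Y Z σ y₀ e π' with hK'
  have hp := L.mem_target hv ht
  have hU := L.subset (e.map_target hp)
  have hO := b.subset hU
  have hv' := (L.coe_symm hp).1
  set y := e.symm (v, t) with hy
  have hd := ((F.smooth_sphere hO (b.smooth _ hU)).differentiableAt (by simp)).hasFDerivAt
  have h1 : ContDiffAt ℝ ∞ K' (π (sphere Y Z σ y)) := by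
    rw [hv']
    exact L.smooth_leafSphere F b hv
  have hπ : HasFDerivAt (fun z => π (sphere Y Z σ z)) (π ∘L fderiv ℝ (sphere Y Z σ) y) y :=
    π.hasFDerivAt.comp y hd
  have h3 := hasFDerivAt_fderiv_comp (f := fun z => π (sphere Y Z σ z)) h1 hπ x'
  -- The identity to be differentiated in the direction `X`: near `y` the vector `Y` is orthogonal
  -- to the derivative of the leaf sphere.
  have h4 : ∀ᶠ z in 𝓝 y, B (Y z) (fderiv ℝ K' (π (sphere Y Z σ z)) x') = 0 := by
    have hbox : Metric.ball (π (sphere Y Z σ y₀)) r ×ˢ Metric.ball (π' (Y y₀)) r ∈ 𝓝 (v, t) :=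
      prod_mem_nhds (Metric.isOpen_ball.mem_nhds hv) (Metric.isOpen_ball.mem_nhds ht)
    have hc : Tendsto e (𝓝 y) (𝓝 (v, t)) := by
      have := e.continuousAt (e.map_target hp)
      rwa [ContinuousAt, e.right_inv hp] at this
    filter_upwards [hc hbox, e.open_source.mem_nhds (e.map_target hp)] with z hz hzs
    obtain ⟨X', hX'⟩ := L.surj z hzs x'
    have h5 := L.fderiv_sphere_eq F b (v := (e z).1) (t := (e z).2) hz.1 hz.2 X'
    rw [Prod.mk.eta, e.left_inv hzs, L.coe z hzs, hX'] at h5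
    rw [← h5]
    exact F.Y_fderiv_sphere hB b (L.subset hzs) X'
  obtain ⟨W, hW, hWz⟩ := h4.exists_mem
  have h5 := bilinear_fderiv_eq_zero B hW (F.diffY hO) h3.differentiableAt hWz X
  rw [h3.fderiv, hv'] at h5
  simp only [ContinuousLinearMap.add_apply, ContinuousLinearMap.comp_apply,
    ContinuousLinearMap.flip_apply, ContinuousLinearMap.zero_apply, map_zero, zero_add] at h5
  linarith

/-- Along a leaf of one family of curvature spheres, every other curvature sphere is real
analytic. -/
theorem LeafCoordinates.analytic_branch (hdim : Module.finrank ℝ Λ = Module.finrank ℝ V + 4)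
    {τ : V → ℝ} {k : ℕ} (b' : Branch O Y Z U τ k) (hne : ∀ y ∈ U, τ y ≠ σ y) {v : R}
    (hv : v ∈ Metric.ball (π (sphere Y Z σ y₀)) r) {t : D} (ht : t ∈ Metric.ball (π' (Y y₀)) r) :
    ContDiffAt ℝ ω (fun t => τ (e.symm (v, t)) - σ (e.symm (v, t))) t := by
  set K' := leafSphere Y Z σ y₀ e π' with hK'
  set dK := fderiv ℝ K' v with hdK
  set d2K := fderiv ℝ (fderiv ℝ K') v with hd2K
  -- On the leaf space, `G = B (dK ·) (dK ·)` and `-B Y (d²K · ·)` are the fundamental forms seen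
  -- from the sphere `K`. Only the second varies along the leaf, and only through `Y`, so it is
  -- analytic. The difference `ρ = τ - σ` is an eigenvalue of constant multiplicity of this pencil.
  set G : R →L[ℝ] R →L[ℝ] ℝ := ((ContinuousLinearMap.compL ℝ R Λ ℝ).flip dK) ∘L B ∘L dK with hG
  obtain ⟨HL, hHx, hHω⟩ := exists_contraction (V := D) B d2K
  have hGx : ∀ x x', G x x' = B (dK x) (dK x') := fun _ _ => rfl
  set ρ : D → ℝ := fun t => τ (e.symm (v, t)) - σ (e.symm (v, t)) with hρ
  -- the pencil on the leaf space
  have hA : ∀ s ∈ Metric.ball (π' (Y y₀)) r, ∀ X x', (G + ρ s • HL (Y (e.symm (v, s))))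
      (π (fderiv ℝ (sphere Y Z σ) (e.symm (v, s)) X)) x'
        = B (pencil Y Z (τ (e.symm (v, s))) (e.symm (v, s)) X) (dK x') := by
    intro s hs X x'
    have hp := L.mem_target hv hs
    have hU := L.subset (e.map_target hp)
    have hO := b.subset hU
    have h1 := L.second_derivative F hB b hv hs X x'
    have h2 := L.fderiv_sphere_eq F b hv hs X
    obtain ⟨X', hX'⟩ := L.surj _ (e.map_target hp) x'
    have h3 := L.fderiv_sphere_eq F b hv hs X'
    have h4 := F.Y_fderiv_sphere hB b hU X'
    set y := e.symm (v, s) with hy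
    rw [hX'] at h3
    rw [h3] at h4
    simp only [ContinuousLinearMap.add_apply, ContinuousLinearMap.smul_apply, hGx, hHx]
    rw [h1, ← h2, F.fderiv_sphere hO (b.smooth y hU)]
    simp only [map_add, map_smul, ContinuousLinearMap.add_apply, ContinuousLinearMap.smul_apply,
      smul_eq_mul]
    rw [h4]
    simp only [hρ, ← hy]
    ring
  have hsymm : ∀ s ∈ Metric.ball (π' (Y y₀)) r, ∀ x x',
      (G + ρ s • HL (Y (e.symm (v, s)))) x x' = (G + ρ s • HL (Y (e.symm (v, s)))) x' x := by
    intro s hs x x'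
    have h1 : d2K x x' = d2K x' x := by
      have := (L.smooth_leafSphere F b hv).isSymmSndFDerivAt (n := ∞) (by
        simp only [minSmoothness_of_isRCLikeNormedField]; exact WithTop.coe_le_coe.2 le_top)
      exact this.eq x x'
    simp only [ContinuousLinearMap.add_apply, ContinuousLinearMap.smul_apply, hGx, hHx, h1,
      hB.symm (dK x)]
  have hker : ∀ s ∈ Metric.ball (π' (Y y₀)) r, ∀ X,
      pencil Y Z (τ (e.symm (v, s))) (e.symm (v, s)) X = 0 →
      (G + ρ s • HL (Y (e.symm (v, s))))
        (π (fderiv ℝ (sphere Y Z σ) (e.symm (v, s)) X)) = 0 := by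
    intro s hs X hX
    ext x'
    rw [hA s hs, hX]
    simp
  have hker' : ∀ s ∈ Metric.ball (π' (Y y₀)) r, ∀ x,
      (G + ρ s • HL (Y (e.symm (v, s)))) x = 0 →
      ∃ X, pencil Y Z (τ (e.symm (v, s))) (e.symm (v, s)) X = 0 ∧
        π (fderiv ℝ (sphere Y Z σ) (e.symm (v, s)) X) = x := by
    intro s hs x hx
    have hp := L.mem_target hv hs
    have hU := L.subset (e.map_target hp)
    have hO := b.subset hU
    obtain ⟨X, rfl⟩ := L.surj _ (e.map_target hp) x
    have h1 : ∀ X', B (pencil Y Z (τ (e.symm (v, s))) (e.symm (v, s)) X)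
        (pencil Y Z (σ (e.symm (v, s))) (e.symm (v, s)) X') = 0 := by
      intro X'
      have h2 := hA s hs X (π (fderiv ℝ (sphere Y Z σ) (e.symm (v, s)) X'))
      rw [hx, ContinuousLinearMap.zero_apply, hdK, hK', ← L.fderiv_sphere_eq F b hv hs, F.fderiv_sphere hO (b.smooth _ hU)] at h2
      rw [map_add, map_smul] at h2
      have h3 : B (pencil Y Z (τ (e.symm (v, s))) (e.symm (v, s)) X) (Y (e.symm (v, s))) = 0 := by
        simp [F.dZ_Y hB hO, F.dY_Y hB hO]
      rw [h3, smul_zero, add_zero] at h2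
      exact h2.symm
    -- A representative `X` of a kernel vector may differ from a principal vector of `τ` by a vector
    -- `X₁` tangent to the leaf. Subtracting `(τ - σ)⁻¹ X₁` corrects this without changing the image
    -- in the leaf space.
    obtain ⟨X₁, hX₁⟩ := F.exists_dY_eq_pencil hB hdim hO (τ (e.symm (v, s))) X
    rw [← hX₁] at h1
    have h2 := F.pencil_eq_zero_of_orthogonal hB hdim hO _ X₁ h1
    have h0 : τ (e.symm (v, s)) - σ (e.symm (v, s)) ≠ 0 := sub_ne_zero.2 (hne _ hU)
    refine ⟨X - (τ (e.symm (v, s)) - σ (e.symm (v, s)))⁻¹ • X₁, ?_, ?_⟩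
    · rw [map_sub, map_smul, pencil_sub (τ (e.symm (v, s))) (σ (e.symm (v, s))) _ X₁, h2, zero_add,
        smul_smul, inv_mul_cancel₀ h0, one_smul, hX₁, sub_self]
    · rw [map_sub, map_sub, map_smul, (b.fderiv_sphere_eq_zero_iff F hU X₁).2 h2]
      simp
  have hrank : ∀ s ∈ Metric.ball (π' (Y y₀)) r,
      Module.finrank ℝ (LinearMap.ker (G + ρ s • HL (Y (e.symm (v, s)))).toLinearMap) = k := by
    intro s hs
    have hp := L.mem_target hv hs
    have hU := L.subset (e.map_target hp)
    have hO := b.subset hU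
    rw [← b'.rank _ hU]
    set y := e.symm (v, s) with hy
    let φ : principal Y Z (τ y) y →ₗ[ℝ] R :=
      (π ∘L fderiv ℝ (sphere Y Z σ) y).toLinearMap ∘ₗ (principal Y Z (τ y) y).subtype
    have hφ : LinearMap.range φ = LinearMap.ker (G + ρ s • HL (Y y)).toLinearMap := by
      ext x
      constructor
      · rintro ⟨X, rfl⟩
        exact hker s hs X X.2
      · intro hx
        obtain ⟨X, hX, rfl⟩ := hker' s hs x hx
        exact ⟨⟨X, hX⟩, rfl⟩
    rw [← hφ, LinearMap.finrank_range_of_inj]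
    rw [← LinearMap.ker_eq_bot, LinearMap.ker_eq_bot']
    rintro ⟨X, hX⟩ h0
    have h1 : fderiv ℝ (sphere Y Z σ) y X = 0 := L.ker y (e.map_target hp) X h0
    have h2 := (b.fderiv_sphere_eq_zero_iff F hU X).1 h1
    apply Subtype.ext
    by_contra hX0
    exact hne y hU (F.eq_of_pencil hO hX0 hX h2)
  have hp := L.mem_target hv ht
  have hU := L.subset (e.map_target hp)
  have hO := b.subset hU
  have hYω := L.analytic_Y F hB b hdim hv ht
  have hmem : τ (e.symm (v, t)) ∈ spec Y Z (e.symm (v, t)) := by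
    rw [spec, mem_setOf_eq, ← Submodule.one_le_finrank_iff, b'.rank _ hU]
    exact b'.pos
  obtain ⟨X₀, hX₀, hX₀0⟩ := mem_spec.1 hmem
  have hcont : ContinuousAt ρ t := by
    have h1 : ContinuousAt (fun t : D => e.symm (v, t)) t :=
      ContinuousAt.comp (f := fun t : D => (v, t)) (e.continuousAt_symm hp)
        (continuousAt_const.prodMk continuousAt_id)
    exact (ContinuousAt.comp (f := fun t : D => e.symm (v, t)) (b'.smooth _ hU).continuousAt
      h1).sub (ContinuousAt.comp (f := fun t : D => e.symm (v, t)) (b.smooth _ hU).continuousAt h1)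
  set v₀ := π (fderiv ℝ (sphere Y Z σ) (e.symm (v, t)) X₀) with hv₀
  have hA0 : (G + ρ t • HL (Y (e.symm (v, t)))) v₀ = 0 := hker t ht X₀ hX₀0
  refine contDiffAt_eigenvalue (by simp) (fun _ => G) (fun s => HL (Y (e.symm (v, s)))) ρ t
    contDiffAt_const (hHω _ t hYω) hcont
    (ContinuousLinearMap.apply ℝ ℝ v₀) (fun x => ?_) ?_ v₀ hA0 ?_
  · change (G + ρ t • HL (Y (e.symm (v, t)))) x v₀ = 0
    rw [hsymm t ht, hA0]
    rfl
  · filter_upwards [Metric.isOpen_ball.mem_nhds ht] with s hs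
    rw [hrank t ht, hrank s hs]
  -- Otherwise `G v₀ v₀ = 0`, so the pencil of `σ` would vanish on `X₀`, which is already principal
  -- for `τ ≠ σ`.
  · change HL (Y (e.symm (v, t))) v₀ v₀ ≠ 0
    intro h0
    have h1 := congrArg (fun f : R →L[ℝ] ℝ => f v₀) hA0
    simp only [ContinuousLinearMap.add_apply, ContinuousLinearMap.smul_apply, h0, hGx,
      ContinuousLinearMap.zero_apply, smul_zero, add_zero] at h1
    rw [hv₀, hdK, hK', ← L.fderiv_sphere_eq F b hv ht, F.fderiv_sphere hO (b.smooth _ hU)] at h1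
    obtain ⟨X₁, hX₁⟩ := F.exists_dY_eq_pencil hB hdim hO (σ (e.symm (v, t))) X₀
    rw [← hX₁] at h1
    simp only [map_add, map_smul, ContinuousLinearMap.add_apply, ContinuousLinearMap.smul_apply,
      F.dY_Y hB hO, F.YY _ hO, hB.symm (Y (e.symm (v, t))) (fderiv ℝ Y _ _), smul_zero,
      add_zero] at h1
    by_cases hX₁0 : X₁ = 0
    · rw [hX₁0, map_zero] at hX₁
      exact hne _ hU (F.eq_of_pencil hO hX₀ hX₀0 hX₁.symm)
    · exact (F.dY_dY_pos hB hO hX₁0).ne' h1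

/-- Vanishing of a linear functional on a curvature sphere map propagates along the leaves of every
family of curvature surfaces. -/
theorem LeafCoordinates.exists_propagation_curve
    (hdim : Module.finrank ℝ Λ = Module.finrank ℝ V + 4)
    {τ : V → ℝ} {k : ℕ} (b' : Branch O Y Z U τ k)
    (hne : (∀ y ∈ U, τ y ≠ σ y) ∨ ∀ y ∈ U, τ y = σ y) {X₀ : V}
    (hX₀ : pencil Y Z (σ y₀) y₀ X₀ = 0) :
    ∃ γ : ℝ → V, γ 0 = y₀ ∧ HasDerivAt γ X₀ 0 ∧ ∀ᶠ s in 𝓝 0, ∀ u : Λ →L[ℝ] ℝ,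
      (∀ᶠ y in 𝓝 (γ s), u (sphere Y Z τ y) = 0) → ∀ᶠ y in 𝓝 y₀, u (sphere Y Z τ y) = 0 := by
  set v₀ := π (sphere Y Z σ y₀) with hv₀
  set t₀ := π' (Y y₀) with ht₀
  have hvc : v₀ ∈ Metric.ball v₀ r := Metric.mem_ball_self L.pos
  have htc : t₀ ∈ Metric.ball t₀ r := Metric.mem_ball_self L.pos
  have hpc : (v₀, t₀) ∈ e.target := L.mem_target hvc htc
  have hU := L.subset L.mem
  have hec : e y₀ = (v₀, t₀) := L.coe y₀ L.mem
  have hesc : e.symm (v₀, t₀) = y₀ := by rw [← hec, e.left_inv L.mem]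
  -- On a leaf of `σ` the sphere of `τ` is a constant plus `(τ - σ) Y`, a combination of analytic
  -- functions.
  have han : ∀ v ∈ Metric.ball v₀ r, ∀ u : Λ →L[ℝ] ℝ,
      AnalyticOnNhd ℝ (fun t => u (sphere Y Z τ (e.symm (v, t)))) (Metric.ball t₀ r) := by
    intro v hv u t ht
    have heq : (fun t => u (sphere Y Z τ (e.symm (v, t)))) =ᶠ[𝓝 t] fun t =>
        u (leafSphere Y Z σ y₀ e π' v)
          + (τ (e.symm (v, t)) - σ (e.symm (v, t))) * u (Y (e.symm (v, t))) := by
      filter_upwards [Metric.isOpen_ball.mem_nhds ht] with s hs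
      rw [← L.sphere_symm hv hs]
      simp only [sphere, map_add, map_smul, smul_eq_mul]
      ring
    refine ContDiffAt.analyticAt (ContDiffAt.congr_of_eventuallyEq ?_ heq)
    refine contDiffAt_const.add (ContDiffAt.mul ?_
      (u.contDiff.contDiffAt.comp t (L.analytic_Y F hB b hdim hv ht)))
    rcases hne with hne | heq'
    · exact L.analytic_branch F hB b hdim b' hne hv ht
    · refine (contDiffAt_const (c := 0)).congr_of_eventuallyEq ?_
      filter_upwards [Metric.isOpen_ball.mem_nhds ht] with s hs
      rw [heq' _ (L.subset (e.map_target (L.mem_target hv hs))), sub_self]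
  -- The curve stays on the leaf of `y₀` and moves at constant speed in the leaf parameter.
  set w : R × D := (0, π' (fderiv ℝ Y y₀ X₀)) with hw
  have hK0 := (b.fderiv_sphere_eq_zero_iff F hU X₀).2 hX₀
  refine ⟨fun s => e.symm ((v₀, t₀) + s • w), by simp [hesc], ?_, ?_⟩
  · have hs := ((L.smooth_symm _ hpc).differentiableAt (by simp)).hasFDerivAt
    have hline : HasDerivAt (fun s : ℝ => (v₀, t₀) + s • w) w 0 := by
      simpa using ((hasDerivAt_id (0 : ℝ)).smul_const w).const_add (v₀, t₀)
    have h1 : HasDerivAt (fun s : ℝ => e.symm ((v₀, t₀) + s • w))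
        (fderiv ℝ e.symm (v₀, t₀) w) 0 := by
      refine HasFDerivAt.comp_hasDerivAt (0 : ℝ) ?_ hline
      simpa using hs
    have he : HasFDerivAt e ((π ∘L fderiv ℝ (sphere Y Z σ) y₀).prod (π' ∘L fderiv ℝ Y y₀)) y₀ := by
      refine HasFDerivAt.congr_of_eventuallyEq (f := fun y => (π (sphere Y Z σ y), π' (Y y))) ?_ ?_
      · exact (π.hasFDerivAt.comp y₀ ((F.smooth_sphere (b.subset hU)
          (b.smooth _ hU)).differentiableAt (by simp)).hasFDerivAt).prodMk
          (π'.hasFDerivAt.comp y₀ (F.diffY (b.subset hU)).hasFDerivAt)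
      · filter_upwards [e.open_source.mem_nhds L.mem] with z hz using L.coe z hz
    rw [← hec] at hs
    have hcomp := hs.comp y₀ he
    have hid : HasFDerivAt (e.symm ∘ e) (ContinuousLinearMap.id ℝ V) y₀ := by
      refine (hasFDerivAt_id y₀).congr_of_eventuallyEq ?_
      filter_upwards [e.open_source.mem_nhds L.mem] with z hz using e.left_inv hz
    have h2 := congrArg (fun f : V →L[ℝ] V => f X₀) (hcomp.unique hid)
    simp only [ContinuousLinearMap.comp_apply, ContinuousLinearMap.prod_apply, hK0, map_zero,
      ContinuousLinearMap.id_apply] at h2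
    rw [hec] at h2
    rw [← h2]
    exact h1
  · have hcl : Tendsto (fun s : ℝ => t₀ + s • π' (fderiv ℝ Y y₀ X₀)) (𝓝 0) (𝓝 t₀) := by
      have : Continuous (fun s : ℝ => t₀ + s • π' (fderiv ℝ Y y₀ X₀)) := by fun_prop
      simpa using this.tendsto 0
    filter_upwards [hcl (Metric.isOpen_ball.mem_nhds htc)] with s hs u hu
    set t₁ := t₀ + s • π' (fderiv ℝ Y y₀ X₀) with ht₁
    have ht₁b : t₁ ∈ Metric.ball t₀ r := hs
    have hpt : (v₀, t₀) + s • w = (v₀, t₁) := by simp [hw, ht₁]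
    rw [hpt] at hu
    have hp₁ := L.mem_target hvc ht₁b
    have h1 : ∀ᶠ p in 𝓝 (v₀, t₁), u (sphere Y Z τ (e.symm p)) = 0 :=
      (e.continuousAt_symm hp₁).eventually hu
    rw [nhds_prod_eq] at h1
    have h2 := h1.curry
    -- Vanishing near one point of the leaf means vanishing on a small piece of every neighbouring
    -- leaf. The identity theorem spreads it over each of these leaves, and together they cover a
    -- neighbourhood of `y₀`.
    have h3 : ∀ᶠ v in 𝓝 v₀, ∀ t ∈ Metric.ball t₀ r, u (sphere Y Z τ (e.symm (v, t))) = 0 := by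
      filter_upwards [h2, Metric.isOpen_ball.mem_nhds hvc] with v hv hvb t ht
      exact (han v hvb u).eqOn_zero_of_preconnected_of_eventuallyEq_zero
        (convex_ball t₀ r).isPreconnected ht₁b hv ht
    have h4 : ∀ᶠ p in 𝓝 (v₀, t₀), u (sphere Y Z τ (e.symm p)) = 0 := by
      rw [nhds_prod_eq]
      filter_upwards [h3.prod_mk (Metric.isOpen_ball.mem_nhds htc)] with p hp
      exact hp.1 p.2 hp.2
    have h5 : Tendsto e (𝓝 y₀) (𝓝 (v₀, t₀)) := by
      rw [← hec]; exact e.continuousAt L.mem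
    filter_upwards [h5.eventually h4, e.open_source.mem_nhds L.mem] with y hy hys
    rwa [e.left_inv hys] at hy

end LegendreFrame

/-! ### Branch systems and unique continuation. -/

namespace LegendreFrame

section
variable {V Λ : Type*} [NormedAddCommGroup V] [NormedSpace ℝ V] [FiniteDimensional ℝ V]
  [NormedAddCommGroup Λ] [NormedSpace ℝ Λ] [FiniteDimensional ℝ Λ]
  {B : Λ →L[ℝ] Λ →L[ℝ] ℝ} {O : Set V} {Y Z : V → Λ} {n₁ n₂ : Λ →L[ℝ] ℝ}

/-- The smooth families of curvature spheres of a proper Dupin submanifold on an open set. -/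
structure BranchSystem (O : Set V) (Y Z : V → Λ) (U : Set V) {g : ℕ} (σ : Fin g → V → ℝ) :
    Prop where
  isOpen : IsOpen U
  subset : U ⊆ O
  inj : ∀ y ∈ U, Function.Injective (fun j => σ j y)
  spec : ∀ y ∈ U, spec Y Z y = range (fun j => σ j y)
  dupin : ∀ j, ∃ m, DupinBranch O Y Z U (σ j) m

theorem DupinBranch.mono {U U' : Set V} {σ : V → ℝ} {m : ℕ} (b : DupinBranch O Y Z U σ m)
    (hU' : IsOpen U') (h : U' ⊆ U) : DupinBranch O Y Z U' σ m where
  isOpen := hU'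
  subset := h.trans b.subset
  smooth y hy := b.smooth y (h hy)
  rank y hy := b.rank y (h hy)
  pos := b.pos
  dupin y hy := b.dupin y (h hy)

theorem BranchSystem.mono {U U' : Set V} {g : ℕ} {σ : Fin g → V → ℝ} (S : BranchSystem O Y Z U σ)
    (hU' : IsOpen U') (h : U' ⊆ U) : BranchSystem O Y Z U' σ where
  isOpen := hU'
  subset := h.trans S.subset
  inj y hy := S.inj y (h hy)
  spec y hy := S.spec y (h hy)
  dupin j := let ⟨m, b⟩ := S.dupin j; ⟨m, b.mono hU' h⟩

variable (F : LegendreFrame B O Y Z n₁ n₂) (hB : IsLieForm B)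
  (hdim : Module.finrank ℝ Λ = Module.finrank ℝ V + 4)
include F hB hdim

theorem exists_branchSystem {g : ℕ} (hg : ∀ y ∈ O, (spec Y Z y).encard = g)
    (hD : DupinCurves O Y Z) {y₀ : V} (hy₀ : y₀ ∈ O) :
    ∃ ε > 0, ∃ σ : Fin g → V → ℝ, BranchSystem O Y Z (Metric.ball y₀ ε) σ := by
  obtain ⟨U, σ, hUo, hyU, hUO, h⟩ := F.exists_branches hB hdim hg hy₀
  obtain ⟨ε, hε, hεU⟩ := Metric.isOpen_iff.1 hUo y₀ hyU
  refine ⟨ε, hε, σ, BranchSystem.mono (U := U) ?_ Metric.isOpen_ball hεU⟩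
  refine ⟨hUo, hUO, fun y hy => (h y hy).1, fun y hy => (h y hy).2.1, fun j => ?_⟩
  have b : Branch O Y Z U (σ j) (Module.finrank ℝ (principal Y Z (σ j y₀) y₀)) := by
    refine ⟨hUo, hUO, fun y hy => ((h y hy).2.2 j).1, fun y hy => ((h y hy).2.2 j).2, ?_⟩
    have : σ j y₀ ∈ LegendreFrame.spec Y Z y₀ := by
      rw [(h y₀ hyU).2.1]; exact ⟨j, rfl⟩
    exact Submodule.one_le_finrank_iff.2 this
  exact ⟨_, b, fun y hy X hX => b.fderiv_eq_zero F hB hD hy hX⟩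

/-- The Legendre lines do not all lie in a subspace of codimension two. -/
theorem not_le_of_isOpen (hV : 0 < Module.finrank ℝ V) {U : Set V} (hU : IsOpen U) (hUO : U ⊆ O)
    (hne : U.Nonempty) (P : Submodule ℝ Λ)
    (hP : Module.finrank ℝ P + 2 = Module.finrank ℝ Λ) :
    ¬ ∀ y ∈ U, Y y ∈ P ∧ Z y ∈ P := by
  intro h
  have hclosed : IsClosed (P : Set Λ) := P.closed_of_finiteDimensional
  have hdY : ∀ y ∈ U, ∀ X, fderiv ℝ Y y X ∈ P := by
    intro y hy X
    have h1 : HasDerivAt (fun t : ℝ => Y (y + t • X)) (fderiv ℝ Y y X) 0 := by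
      have h2 := (F.diffY (hUO hy)).hasFDerivAt
      have h3 : HasDerivAt (fun t : ℝ => y + t • X) X 0 := by
        simpa using ((hasDerivAt_id (0 : ℝ)).smul_const X).const_add y
      refine HasFDerivAt.comp_hasDerivAt (0 : ℝ) ?_ h3
      simpa using h2
    have h4 : Tendsto (fun t : ℝ => y + t • X) (𝓝 0) (𝓝 y) := by
      have : Continuous (fun t : ℝ => y + t • X) := by fun_prop
      simpa using this.tendsto 0
    have h5 := hasDerivAt_iff_tendsto_slope.1 h1
    refine hclosed.mem_of_tendsto h5 ?_
    filter_upwards [nhdsWithin_le_nhds (h4 (hU.mem_nhds hy))] with t ht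
    simp only [slope, vsub_eq_sub, zero_smul, add_zero, sub_zero]
    exact P.smul_mem _ (P.sub_mem (h _ ht).1 (h y hy).1)
  -- `P` is the orthogonal complement of each line
  have hperp : ∀ y ∈ U, ∀ v ∈ P, B v (Y y) = 0 := by
    intro y hy
    have hO := hUO hy
    let Q : Submodule ℝ Λ := LinearMap.ker (((B (Y y)).toLinearMap).prod (B (Z y)).toLinearMap)
    have hQ : ∀ v, v ∈ Q ↔ B v (Y y) = 0 ∧ B v (Z y) = 0 := by
      intro v
      simp [Q, hB.symm v]
    -- The complement of a line is spanned by the line and the image of `dY`, all of which lie in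
    -- `P`; both spaces have codimension two.
    have hQP : Q ≤ P := by
      intro v hv
      obtain ⟨h1, h2⟩ := (hQ v).1 hv
      obtain ⟨X, hX⟩ := F.exists_dY hB hdim hO (v - n₁ v • Y y - n₂ v • Z y)
        (by simp [h1, F.YY y hO, hB.symm (Z y), F.YZ y hO])
        (by simp [h2, F.ZZ y hO, F.YZ y hO])
        (by simp [F.n₁Y y hO, F.n₁Z y hO]) (by simp [F.n₂Y y hO, F.n₂Z y hO])
      have h3 : v = fderiv ℝ Y y X + n₁ v • Y y + n₂ v • Z y := by rw [hX]; abel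
      rw [h3]
      exact P.add_mem (P.add_mem (hdY y hy X) (P.smul_mem _ (h y hy).1)) (P.smul_mem _ (h y hy).2)
    have hfin : Module.finrank ℝ P ≤ Module.finrank ℝ Q := by
      have h1 := LinearMap.finrank_range_add_finrank_ker
        (((B (Y y)).toLinearMap).prod (B (Z y)).toLinearMap)
      have h2 : Module.finrank ℝ (LinearMap.range
          (((B (Y y)).toLinearMap).prod (B (Z y)).toLinearMap)) ≤ 2 := by
        have := Submodule.finrank_le (LinearMap.range
          (((B (Y y)).toLinearMap).prod (B (Z y)).toLinearMap))
        simpa using this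
      change Module.finrank ℝ P ≤ Module.finrank ℝ (LinearMap.ker _)
      omega
    have hPQ : Q = P := Submodule.eq_of_le_of_finrank_le hQP hfin
    intro v hv
    rw [← hPQ] at hv
    exact ((hQ v).1 hv).1
  obtain ⟨y, hy⟩ := hne
  obtain ⟨X, hX⟩ := Module.finrank_pos_iff_exists_ne_zero.1 hV
  -- The fixed vector `dY X` at `y` belongs to `P`, so it is orthogonal to `Y z` for every `z`.
  -- Differentiating in the direction `X` shows that it is null, contrary to the definiteness of the
  -- metric.
  have h1 := bilinear_fderiv_eq_zero B (hU.mem_nhds hy) (f := fun _ => fderiv ℝ Y y X) (c := 0)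
    (differentiableAt_const _) (F.diffY (hUO hy)) (fun z hz => hperp z hz _ (hdY y hy X)) X
  simp only [fderiv_fun_const, Pi.zero_apply, ContinuousLinearMap.zero_apply, map_zero,
    zero_add] at h1
  exact (F.dY_dY_pos hB (hUO hy) hX).ne' h1

end

section
variable {d : ℕ} {Λ : Type*} [NormedAddCommGroup Λ] [NormedSpace ℝ Λ] [FiniteDimensional ℝ Λ]
  {B : Λ →L[ℝ] Λ →L[ℝ] ℝ} {O : Set (EuclideanSpace ℝ (Fin d))}
  {Y Z : EuclideanSpace ℝ (Fin d) → Λ} {n₁ n₂ : Λ →L[ℝ] ℝ}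

/-- Unique continuation: if a subspace contains a family of curvature spheres on some open set,
then it contains the whole family. -/
theorem BranchSystem.unique_continuation (F : LegendreFrame B O Y Z n₁ n₂) (hB : IsLieForm B)
    (hdim : Module.finrank ℝ Λ = d + 4) {c : EuclideanSpace ℝ (Fin d)} {R : ℝ} {g : ℕ}
    {σ : Fin g → EuclideanSpace ℝ (Fin d) → ℝ} (S : BranchSystem O Y Z (Metric.ball c R) σ)
    (j : Fin g) (P : Submodule ℝ Λ) {y₁ : EuclideanSpace ℝ (Fin d)} (hy₁ : y₁ ∈ Metric.ball c R)
    (h₁ : ∀ᶠ y in 𝓝 y₁, sphere Y Z (σ j) y ∈ P) :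
    ∀ y ∈ Metric.ball c R, sphere Y Z (σ j) y ∈ P := by
  have hdim' : Module.finrank ℝ Λ = Module.finrank ℝ (EuclideanSpace ℝ (Fin d)) + 4 := by
    simpa using hdim
  let A : Set (EuclideanSpace ℝ (Fin d)) := {y | ∀ᶠ z in 𝓝 y, sphere Y Z (σ j) z ∈ P}
  have hA : IsOpen A := isOpen_setOf_eventually_nhds
  obtain ⟨k, bj⟩ := S.dupin j
  have key : Metric.ball c R ⊆ A := by
    -- Some vector of a principal basis is not orthogonal to `w`; up to sign it points into the
    -- required half space, and the vanishing propagates along the leaf in its direction.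
    refine eq_ball_of_touching c R A hA ⟨y₁, h₁, hy₁⟩ fun y hy w hw => ?_
    obtain ⟨bas, s, hs, -⟩ := F.exists_principal_basis hB hdim' (S.subset hy)
    have hex : ∃ i, inner ℝ (bas i) w ≠ 0 := by
      by_contra hcon
      push Not at hcon
      apply hw
      have h0 : ∀ x, inner ℝ x w = 0 := by
        intro x
        rw [← bas.sum_repr x, sum_inner]
        exact Finset.sum_eq_zero fun i _ => by rw [inner_smul_left, hcon i, mul_zero]
      exact inner_self_eq_zero.1 (h0 w)
    obtain ⟨i, hi⟩ := hex
    have hspec : s i ∈ LegendreFrame.spec Y Z y := mem_spec.2 ⟨bas i, bas.ne_zero i, hs i⟩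
    rw [S.spec y hy] at hspec
    obtain ⟨l, hl⟩ := hspec
    obtain ⟨m, bl⟩ := S.dupin l
    obtain ⟨X, hXw, hX⟩ : ∃ X, 0 < inner ℝ X w ∧ pencil Y Z (σ l y) y X = 0 := by
      have hl' : σ l y = s i := hl
      rcases lt_or_gt_of_ne hi with h | h
      · exact ⟨-bas i, by rw [inner_neg_left]; linarith, by rw [map_neg, hl', hs i, neg_zero]⟩
      · exact ⟨bas i, h, by rw [hl', hs i]⟩
    obtain ⟨R', D, π, π', e, r, L⟩ := bl.exists_leafCoordinates F hy univ univ_mem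
    rw [inter_univ] at L
    have hne : (∀ z ∈ Metric.ball c R, σ j z ≠ σ l z) ∨ ∀ z ∈ Metric.ball c R, σ j z = σ l z := by
      by_cases hjl : j = l
      · exact Or.inr fun z _ => by rw [hjl]
      · exact Or.inl fun z hz h => hjl (S.inj z hz h)
    obtain ⟨γ, h0, hγ, hev⟩ := L.exists_propagation_curve F hB bl hdim' bj.toBranch hne hX
    refine ⟨X, γ, hXw, h0, hγ, ?_⟩
    filter_upwards [hev] with t ht hA'
    have hA'' : ∀ᶠ z in 𝓝 (γ t), sphere Y Z (σ j) z ∈ P := hA'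
    change ∀ᶠ z in 𝓝 y, sphere Y Z (σ j) z ∈ P
    -- Propagation concerns one functional at a time, so `P` is written as the common zero set of
    -- finitely many functionals.
    let qb := Module.finBasis ℝ (Λ ⧸ P)
    let u : Fin (Module.finrank ℝ (Λ ⧸ P)) → Λ →L[ℝ] ℝ :=
      fun i => ((qb.coord i) ∘ₗ P.mkQ).toContinuousLinearMap
    have hu : ∀ v, v ∈ P ↔ ∀ i, u i v = 0 := by
      intro v
      rw [← Submodule.Quotient.mk_eq_zero P, ← qb.forall_coord_eq_zero_iff]
      rfl
    have h2 : ∀ᶠ z in 𝓝 y, ∀ i, u i (sphere Y Z (σ j) z) = 0 :=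
      eventually_all.2 fun i => ht (u i) (by
        filter_upwards [hA''] with z hz using (hu _).1 hz i)
    filter_upwards [h2] with z hz using (hu _).2 hz
  exact fun y hy => (key hy).self_of_nhds

end

end LegendreFrame

/-! ### The Lie form and its isotropic planes. -/

namespace LieSphere

section Form
variable {n : ℕ}

/-- The Lie scalar product as a continuous bilinear form. -/
noncomputable def lieBilin (n : ℕ) : LieSpace n →L[ℝ] LieSpace n →L[ℝ] ℝ :=
  LinearMap.toContinuousLinearMap
    ((LinearMap.toContinuousLinearMap (𝕜 := ℝ) (E := LieSpace n) (F' := ℝ)).toLinearMap ∘ₗ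
      LinearMap.mk₂ ℝ (lieForm (n := n))
        (fun x y z => by simp only [lieForm, Prod.fst_add, Prod.snd_add, inner_add_left]; ring)
        (fun c x y => by
          simp only [lieForm, Prod.smul_fst, Prod.smul_snd, smul_eq_mul, inner_smul_left]
          simp only [conj_trivial]; ring)
        (fun x y z => by simp only [lieForm, Prod.fst_add, Prod.snd_add, inner_add_right]; ring)
        (fun c x y => by
          simp only [lieForm, Prod.smul_fst, Prod.smul_snd, smul_eq_mul, inner_smul_right]; ring))

theorem lieBilin_apply (x y : LieSpace n) : lieBilin n x y = lieForm x y := rfl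

theorem lieForm_comm (x y : LieSpace n) : lieForm x y = lieForm y x := by
  simp only [lieForm, real_inner_comm]; ring

theorem finrank_lieSpace (n : ℕ) : Module.finrank ℝ (LieSpace n) = n + 3 := by
  simp [LieSpace]; ring

/-- Two of the coordinates are injective on each isotropic plane. -/
theorem eq_zero_of_isotropic {v : LieSpace n} (h : lieForm v v = 0) (h1 : v.1 = 0)
    (h4 : v.2.2.2 = 0) : v = 0 := by
  simp only [lieForm, h1, h4] at h
  have hp : 0 ≤ inner ℝ v.2.2.1 v.2.2.1 := real_inner_self_nonneg
  have h2 : v.2.1 = 0 := by nlinarith [mul_self_nonneg v.2.1]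
  have h3 : inner ℝ v.2.2.1 v.2.2.1 = 0 := by rw [h2] at h; linarith
  exact Prod.ext h1 (Prod.ext h2 (Prod.ext (inner_self_eq_zero.1 h3) h4))

/-- The first and last coordinates carry the negative part of the form, so a null vector on which
both vanish is zero. They are therefore linear coordinates on every isotropic plane. -/
theorem det_ne_zero {a b : LieSpace n} (hab : LinearIndependent ℝ ![a, b]) (haa : lieForm a a = 0)
    (hbb : lieForm b b = 0) (h : lieForm a b = 0) : a.1 * b.2.2.2 - a.2.2.2 * b.1 ≠ 0 := by
  intro h0
  have hiso : ∀ s t : ℝ, lieForm (s • a + t • b) (s • a + t • b) = 0 := by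
    intro s t
    simp only [← lieBilin_apply, map_add, map_smul, ContinuousLinearMap.add_apply,
      ContinuousLinearMap.smul_apply, smul_eq_mul]
    simp only [lieBilin_apply, haa, hbb, h, lieForm_comm b a]
    ring
  have key : ∀ s t : ℝ, s * a.1 + t * b.1 = 0 → s * a.2.2.2 + t * b.2.2.2 = 0 → s = 0 ∧ t = 0 :=
    fun s t h1 h4 => LinearIndependent.pair_iff.1 hab s t (eq_zero_of_isotropic (hiso s t) h1 h4)
  obtain ⟨-, e1⟩ := key b.1 (-a.1) (by ring) (by linarith)
  obtain ⟨-, e2⟩ := key b.2.2.2 (-a.2.2.2) (by linarith) (by ring)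
  have := (key 1 0 (by simp [neg_eq_zero.1 e1]) (by simp [neg_eq_zero.1 e2])).1
  exact one_ne_zero this

/-- For `pos`, subtract from `v` the combination of `a` and `b` that has the same first and last
coordinates. This does not change `B v v`, and on the remainder the form is a sum of squares. -/
theorem isLieForm_lieBilin (n : ℕ) : IsLieForm (lieBilin n) where
  symm := lieForm_comm
  nondeg x hx := by
    have e1 := hx (1, 0, 0, 0)
    have e2 := hx (0, 1, 0, 0)
    have e3 := hx (0, 0, x.2.2.1, 0)
    have e4 := hx (0, 0, 0, 1)
    simp [lieBilin_apply, lieForm] at e1 e2 e3 e4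
    exact Prod.ext e1 (Prod.ext e2 (Prod.ext e3 e4))
  pos a b hab haa hab0 hbb v hva hvb := by
    simp only [lieBilin_apply] at *
    have hdet := det_ne_zero hab haa hbb hab0
    set D := a.1 * b.2.2.2 - a.2.2.2 * b.1 with hD
    set s := (v.1 * b.2.2.2 - v.2.2.2 * b.1) / D with hs
    set t := (a.1 * v.2.2.2 - a.2.2.2 * v.1) / D with ht
    set w := v - s • a - t • b with hw
    have h1 : w.1 = 0 := by
      simp only [hw, hs, ht, Prod.fst_sub, Prod.smul_fst, smul_eq_mul]
      field_simp
      rw [hD]; ring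
    have h4 : w.2.2.2 = 0 := by
      simp only [hw, hs, ht, Prod.snd_sub, Prod.smul_snd, smul_eq_mul]
      field_simp
      rw [hD]; ring
    have hww : lieForm v v = lieForm w w := by
      simp only [hw, ← lieBilin_apply, map_sub, map_smul, ContinuousLinearMap.sub_apply,
        ContinuousLinearMap.smul_apply, smul_eq_mul]
      simp only [lieBilin_apply, haa, hbb, hab0, lieForm_comm b a, lieForm_comm a v,
        lieForm_comm b v, hva, hvb]
      ring
    have hnn : lieForm w w = w.2.1 * w.2.1 + inner ℝ w.2.2.1 w.2.2.1 := by
      simp only [lieForm, h1, h4]; ring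
    refine ⟨?_, fun h0 => ?_⟩
    · rw [hww, hnn]
      exact add_nonneg (mul_self_nonneg _) real_inner_self_nonneg
    · rw [hww] at h0
      have hw0 := eq_zero_of_isotropic h0 h1 h4
      rw [Submodule.mem_span_pair]
      refine ⟨s, t, ?_⟩
      rw [hw, sub_sub, sub_eq_zero] at hw0
      exact hw0.symm

end Form

section Charts
variable {d : ℕ} {W : Type*} [TopologicalSpace W] [ChartedSpace (E d) W] [IsManifold (𝓡 d) ∞ W]

theorem contDiffAt_comp_chart_symm {Λ : Type*} [NormedAddCommGroup Λ] [NormedSpace ℝ Λ] {f : W → Λ}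
    (hf : ContMDiff (𝓡 d) 𝓘(ℝ, Λ) ∞ f) (x₀ : W) {y : E d} (hy : y ∈ (chartAt (E d) x₀).target) :
    ContDiffAt ℝ ∞ (fun z => f ((chartAt (E d) x₀).symm z)) y := by
  have h1 : ContMDiffOn (𝓡 d) (𝓡 d) ∞ (chartAt (E d) x₀).symm (chartAt (E d) x₀).target :=
    contMDiffOn_chart_symm
  have h2 := hf.comp_contMDiffOn h1
  exact (contMDiffOn_iff_contDiffOn.1 h2).contDiffAt
    ((chartAt (E d) x₀).open_target.mem_nhds hy)

theorem exists_tangent_equiv (x₀ : W) {y : E d} (hy : y ∈ (chartAt (E d) x₀).target) :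
    ∃ A : E d ≃L[ℝ] TangentSpace (𝓡 d) ((chartAt (E d) x₀).symm y),
      HasMFDerivAt (𝓡 d) (𝓡 d) (chartAt (E d) x₀).symm y A.toContinuousLinearMap := by
  have h := (mdifferentiable_chart (I := 𝓡 d) x₀).symm
  refine ⟨h.mfderiv hy, ?_⟩
  exact (h.mdifferentiableAt hy).hasMFDerivAt

end Charts

end LieSphere

/-! ### From the manifold to normalized frames in charts. -/

namespace LieSphere

open LegendreFrame

section
variable {d : ℕ} {W : Type*} [TopologicalSpace W] [ChartedSpace (E d) W]
  (L : LegendreSubmanifold d W)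

theorem LegendreSubmanifold.mem_principalSpace {x : W} {r s : ℝ} {X : TangentSpace (𝓡 d) x} :
    X ∈ L.principalSpace x r s ↔
      r • differential L.Z₁ x X + s • differential L.Z₂ x X ∈ L.line x := Iff.rfl

theorem LegendreSubmanifold.principalSpace_smul (x : W) (r s : ℝ) {q : ℝ} (hq : q ≠ 0) :
    L.principalSpace x (q * r) (q * s) = L.principalSpace x r s := by
  ext X
  rw [L.mem_principalSpace, L.mem_principalSpace, mul_smul, mul_smul, ← smul_add]
  exact Submodule.smul_mem_iff _ hq

/-- A normalized frame of a Legendre submanifold in a chart. -/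
structure LegendreSubmanifold.LocalFrame (L : LegendreSubmanifold d W) (x₀ : W) (g : ℕ)
    (O : Set (E d)) (Y Z : E d → LieSpace (d + 1)) (n₁ n₂ : LieSpace (d + 1) →L[ℝ] ℝ) : Prop where
  frame : LegendreFrame (lieBilin (d + 1)) O Y Z n₁ n₂
  subset : O ⊆ (chartAt (E d) x₀).target
  mem : chartAt (E d) x₀ x₀ ∈ O
  line : ∀ y ∈ O, L.line ((chartAt (E d) x₀).symm y) = Submodule.span ℝ {Y y, Z y}
  principal : ∀ y ∈ O, ∀ σ, ∃ (r s : ℝ) (A : E d ≃L[ℝ] TangentSpace (𝓡 d)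
      ((chartAt (E d) x₀).symm y)), Z y + σ • Y y = r • L.Z₁ ((chartAt (E d) x₀).symm y) +
        s • L.Z₂ ((chartAt (E d) x₀).symm y) ∧
      HasMFDerivAt (𝓡 d) (𝓡 d) (chartAt (E d) x₀).symm y A.toContinuousLinearMap ∧
      ∀ X, pencil Y Z σ y X = 0 ↔ A X ∈ L.principalSpace ((chartAt (E d) x₀).symm y) r s
  sphere : ∀ y ∈ O, ∀ K, K ∈ L.curvatureSpheres ((chartAt (E d) x₀).symm y) ↔
    ∃ σ ∈ spec Y Z y, ∃ h : Z y + σ • Y y ≠ 0, K = Projectivization.mk ℝ (Z y + σ • Y y) h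
  encard : ∀ y ∈ O, (spec Y Z y).encard = g

variable [IsManifold (𝓡 d) ∞ W]

/-- Principal spaces in terms of a moving point on the Legendre line. -/
theorem LegendreSubmanifold.fderiv_combination (x₀ : W) {y : E d}
    (hy : y ∈ (chartAt (E d) x₀).target) {A : E d ≃L[ℝ] TangentSpace (𝓡 d)
      ((chartAt (E d) x₀).symm y)}
    (hA : HasMFDerivAt (𝓡 d) (𝓡 d) (chartAt (E d) x₀).symm y A.toContinuousLinearMap)
    {ρ θ : E d → ℝ} (hρ : DifferentiableAt ℝ ρ y) (hθ : DifferentiableAt ℝ θ y) (X : E d) :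
    fderiv ℝ (fun z => ρ z • L.Z₁ ((chartAt (E d) x₀).symm z)
        + θ z • L.Z₂ ((chartAt (E d) x₀).symm z)) y X
      = (ρ y • differential L.Z₁ ((chartAt (E d) x₀).symm y) (A X)
        + θ y • differential L.Z₂ ((chartAt (E d) x₀).symm y) (A X))
        + (fderiv ℝ ρ y X • L.Z₁ ((chartAt (E d) x₀).symm y)
          + fderiv ℝ θ y X • L.Z₂ ((chartAt (E d) x₀).symm y)) := by
  have hd : ∀ f : W → LieSpace (d + 1), ContMDiff (𝓡 d) 𝓘(ℝ, LieSpace (d + 1)) ∞ f →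
      HasFDerivAt (fun z => f ((chartAt (E d) x₀).symm z))
        (show E d →L[ℝ] LieSpace (d + 1) from
          (differential f ((chartAt (E d) x₀).symm y)).comp A.toContinuousLinearMap) y := by
    intro f hf
    have h1 := ((hf.mdifferentiable (by simp)) ((chartAt (E d) x₀).symm y)).hasMFDerivAt
    exact (h1.comp y hA).hasFDerivAt
  have h := (hρ.hasFDerivAt.smul (hd _ L.smooth₁)).add (hθ.hasFDerivAt.smul (hd _ L.smooth₂))
  have h' : HasFDerivAt (fun z => ρ z • L.Z₁ ((chartAt (E d) x₀).symm z)
        + θ z • L.Z₂ ((chartAt (E d) x₀).symm z)) _ y := h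
  rw [h'.fderiv]
  change (ρ y • differential L.Z₁ ((chartAt (E d) x₀).symm y) (A X)
      + fderiv ℝ ρ y X • L.Z₁ ((chartAt (E d) x₀).symm y))
    + (θ y • differential L.Z₂ ((chartAt (E d) x₀).symm y) (A X)
      + fderiv ℝ θ y X • L.Z₂ ((chartAt (E d) x₀).symm y)) = _
  abel

/-- `Y` and `Z` are the vectors of the line with first and last coordinates `(1, u)` and `(0, 1)`,
obtained from the given frame by Cramer's rule. As there are only finitely many curvature spheres at
`x₀`, some `u` keeps `Y` from being one there; injectivity of `dY` is an open condition. -/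
theorem LegendreSubmanifold.exists_localFrame {g : ℕ}
    (hg : ∀ x, (L.curvatureSpheres x).encard = g) (x₀ : W) :
    ∃ O Y Z n₁ n₂, L.LocalFrame x₀ g O Y Z n₁ n₂ := by
  set φ := chartAt (E d) x₀ with hφ
  set a : E d → LieSpace (d + 1) := fun y => L.Z₁ (φ.symm y) with ha
  set b : E d → LieSpace (d + 1) := fun y => L.Z₂ (φ.symm y) with hb
  set D : E d → ℝ := fun y => (a y).1 * (b y).2.2.2 - (a y).2.2.2 * (b y).1 with hD
  have hD0 : ∀ y, D y ≠ 0 := fun y => det_ne_zero (L.linearIndependent _) (L.isotropic₁₁ _)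
    (L.isotropic₂₂ _) (L.isotropic₁₂ _)
  -- the gauge
  let α : ℝ → E d → ℝ := fun u y => ((b y).2.2.2 - u * (b y).1) / D y
  let β : ℝ → E d → ℝ := fun u y => (-(a y).2.2.2 + u * (a y).1) / D y
  let α' : E d → ℝ := fun y => -(b y).1 / D y
  let β' : E d → ℝ := fun y => (a y).1 / D y
  have hx₀ : φ x₀ ∈ φ.target := mem_chart_target _ x₀
  have hφx₀ : φ.symm (φ x₀) = x₀ := φ.left_inv (mem_chart_source _ x₀)
  let Yu : ℝ → E d → LieSpace (d + 1) := fun u y => α u y • a y + β u y • b y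
  let Z : E d → LieSpace (d + 1) := fun y => α' y • a y + β' y • b y
  have hYu1 : ∀ u y, (Yu u y).1 = 1 := by
    intro u y
    have := hD0 y
    simp only [Yu, α, β, Prod.fst_add, Prod.smul_fst, smul_eq_mul]
    field_simp
    simp only [hD]; ring
  have hYu4 : ∀ u y, (Yu u y).2.2.2 = u := by
    intro u y
    have := hD0 y
    simp only [Yu, α, β, Prod.snd_add, Prod.smul_snd, smul_eq_mul]
    field_simp
    simp only [hD]; ring
  have hZ1 : ∀ y, (Z y).1 = 0 := by
    intro y
    have := hD0 y
    simp only [Z, α', β', Prod.fst_add, Prod.smul_fst, smul_eq_mul]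
    field_simp
    ring
  have hZ4 : ∀ y, (Z y).2.2.2 = 1 := by
    intro y
    have := hD0 y
    simp only [Z, α', β', Prod.snd_add, Prod.smul_snd, smul_eq_mul]
    field_simp
    simp only [hD]; ring
  have hYu0 : ∀ u y, Yu u y ≠ 0 := fun u y h => by
    have := hYu1 u y; rw [h] at this; simp at this
  -- choice of a point on the line which is not a curvature sphere
  obtain ⟨u, hu⟩ : ∃ u, Projectivization.mk ℝ (Yu u (φ x₀)) (hYu0 u _)
      ∉ L.curvatureSpheres (φ.symm (φ x₀)) := by
    have hinj : Function.Injective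
        fun u => Projectivization.mk ℝ (Yu u (φ x₀)) (hYu0 u (φ x₀)) := by
      intro u v huv
      obtain ⟨c, hc⟩ := (Projectivization.mk_eq_mk_iff' ℝ _ _ _ _).1 huv
      have h1 := congrArg Prod.fst hc
      have h4 := congrArg (fun v : LieSpace (d + 1) => v.2.2.2) hc
      simp only [Prod.smul_fst, Prod.smul_snd, hYu1, hYu4, smul_eq_mul] at h1 h4
      rw [mul_one] at h1
      rw [h1, one_mul] at h4
      exact h4.symm
    obtain ⟨K, ⟨u, rfl⟩, hK⟩ := (infinite_range_of_injective hinj).exists_notMem_finite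
      (Set.finite_of_encard_eq_coe (hg (φ.symm (φ x₀))))
    exact ⟨u, hK⟩
  set Y := Yu u with hY
  let p₁ : LieSpace (d + 1) →L[ℝ] ℝ := ContinuousLinearMap.fst ℝ _ _
  let p₄ : LieSpace (d + 1) →L[ℝ] ℝ := ContinuousLinearMap.snd ℝ _ _ ∘L
    ContinuousLinearMap.snd ℝ _ _ ∘L ContinuousLinearMap.snd ℝ _ _
  let n₁ := p₁
  let n₂ := p₄ - u • p₁
  have hsa : ∀ y ∈ φ.target, ContDiffAt ℝ ∞ a y := fun y hy =>
    contDiffAt_comp_chart_symm L.smooth₁ x₀ hy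
  have hsb : ∀ y ∈ φ.target, ContDiffAt ℝ ∞ b y := fun y hy =>
    contDiffAt_comp_chart_symm L.smooth₂ x₀ hy
  have hs1 : ∀ {f : E d → LieSpace (d + 1)} {y}, ContDiffAt ℝ ∞ f y →
      ContDiffAt ℝ ∞ (fun z => (f z).1) y := fun h => p₁.contDiff.contDiffAt.comp _ h
  have hs4 : ∀ {f : E d → LieSpace (d + 1)} {y}, ContDiffAt ℝ ∞ f y →
      ContDiffAt ℝ ∞ (fun z => (f z).2.2.2) y := fun h => p₄.contDiff.contDiffAt.comp _ h
  have hsD : ∀ y ∈ φ.target, ContDiffAt ℝ ∞ D y := fun y hy =>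
    ((hs1 (hsa y hy)).mul (hs4 (hsb y hy))).sub ((hs4 (hsa y hy)).mul (hs1 (hsb y hy)))
  have hsα : ∀ y ∈ φ.target, ContDiffAt ℝ ∞ (α u) y := fun y hy =>
    ((hs4 (hsb y hy)).sub (contDiffAt_const.mul (hs1 (hsb y hy)))).div (hsD y hy) (hD0 y)
  have hsβ : ∀ y ∈ φ.target, ContDiffAt ℝ ∞ (β u) y := fun y hy =>
    ((hs4 (hsa y hy)).neg.add (contDiffAt_const.mul (hs1 (hsa y hy)))).div (hsD y hy) (hD0 y)
  have hsα' : ∀ y ∈ φ.target, ContDiffAt ℝ ∞ α' y := fun y hy =>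
    ((hs1 (hsb y hy)).neg).div (hsD y hy) (hD0 y)
  have hsβ' : ∀ y ∈ φ.target, ContDiffAt ℝ ∞ β' y := fun y hy =>
    (hs1 (hsa y hy)).div (hsD y hy) (hD0 y)
  have hsY : ∀ y ∈ φ.target, ContDiffAt ℝ ∞ Y y := fun y hy =>
    ((hsα y hy).smul (hsa y hy)).add ((hsβ y hy).smul (hsb y hy))
  have hsZ : ∀ y ∈ φ.target, ContDiffAt ℝ ∞ Z y := fun y hy =>
    ((hsα' y hy).smul (hsa y hy)).add ((hsβ' y hy).smul (hsb y hy))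
  have hdf : ∀ {f : E d → ℝ} {y}, ContDiffAt ℝ ∞ f y → DifferentiableAt ℝ f y :=
    fun h => h.differentiableAt (by simp)
  have hYline : ∀ y, Y y ∈ L.line (φ.symm y) := fun y =>
    Submodule.mem_span_pair.2 ⟨_, _, rfl⟩
  have hZline : ∀ y, Z y ∈ L.line (φ.symm y) := fun y =>
    Submodule.mem_span_pair.2 ⟨_, _, rfl⟩
  have hab : ∀ y, a y = (a y).1 • Y y + ((a y).2.2.2 - u * (a y).1) • Z y ∧
      b y = (b y).1 • Y y + ((b y).2.2.2 - u * (b y).1) • Z y := by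
    intro y
    have := hD0 y
    constructor
    · simp only [hY, Yu, Z, α, β, α', β', smul_add, smul_smul]
      rw [add_add_add_comm, ← add_smul, ← add_smul]
      rw [show (a y).1 * (((b y).2.2.2 - u * (b y).1) / D y) + ((a y).2.2.2 - u * (a y).1)
        * (-(b y).1 / D y) = 1 by field_simp; simp only [hD]; ring,
        show (a y).1 * ((-(a y).2.2.2 + u * (a y).1) / D y) + ((a y).2.2.2 - u * (a y).1)
        * ((a y).1 / D y) = 0 by field_simp; ring]
      simp
    · simp only [hY, Yu, Z, α, β, α', β', smul_add, smul_smul]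
      rw [add_add_add_comm, ← add_smul, ← add_smul]
      rw [show (b y).1 * (((b y).2.2.2 - u * (b y).1) / D y) + ((b y).2.2.2 - u * (b y).1)
        * (-(b y).1 / D y) = 0 by field_simp; ring,
        show (b y).1 * ((-(a y).2.2.2 + u * (a y).1) / D y) + ((b y).2.2.2 - u * (b y).1)
        * ((a y).1 / D y) = 1 by field_simp; simp only [hD]; ring]
      simp
  have hline : ∀ y, L.line (φ.symm y) = Submodule.span ℝ {Y y, Z y} := by
    intro y
    apply le_antisymm
    · rw [LegendreSubmanifold.line, Submodule.span_le]
      rintro _ (rfl | rfl)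
      · exact Submodule.mem_span_pair.2 ⟨_, _, (hab y).1.symm⟩
      · exact Submodule.mem_span_pair.2 ⟨_, _, (hab y).2.symm⟩
    · rw [Submodule.span_le]
      rintro _ (rfl | rfl)
      · exact hYline y
      · exact hZline y
  -- vectors on the line with vanishing coordinates
  have hline0 : ∀ y, ∀ v ∈ L.line (φ.symm y), n₁ v = 0 → n₂ v = 0 → v = 0 := by
    intro y v hv h1 h2
    rw [hline, Submodule.mem_span_pair] at hv
    obtain ⟨p, q, rfl⟩ := hv
    have e1 : (p • Y y + q • Z y).1 = 0 := h1
    have e2 : (p • Y y + q • Z y).2.2.2 - u * (p • Y y + q • Z y).1 = 0 := h2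
    rw [e1] at e2
    simp only [Prod.fst_add, Prod.snd_add, Prod.smul_fst, Prod.smul_snd, hYu1, hYu4, hZ1, hZ4, hY,
      smul_eq_mul, mul_zero, mul_one, add_zero, sub_zero] at e1 e2
    rw [e1, zero_mul, zero_add] at e2
    rw [e1, e2, zero_smul, zero_smul, add_zero]
  have hconst : ∀ {f : E d → LieSpace (d + 1)} {y}, ContDiffAt ℝ ∞ f y → ∀ (n : LieSpace (d + 1) →L[ℝ] ℝ)
      (c : ℝ), (∀ z, n (f z) = c) → ∀ X, n (fderiv ℝ f y X) = 0 := by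
    intro f y hf n c h X
    have h1 := n.hasFDerivAt.comp y (hf.differentiableAt (by simp)).hasFDerivAt
    have h2 : n ∘ f = fun _ => c := funext h
    rw [h2] at h1
    have h3 := h1.unique (hasFDerivAt_const c y)
    exact congrArg (fun f : E d →L[ℝ] ℝ => f X) h3
  -- principal spaces
  have hprin : ∀ y ∈ φ.target, ∀ A : E d ≃L[ℝ] TangentSpace (𝓡 d) (φ.symm y),
      HasMFDerivAt (𝓡 d) (𝓡 d) φ.symm y A.toContinuousLinearMap → ∀ (ρ θ : E d → ℝ),
      ContDiffAt ℝ ∞ ρ y → ContDiffAt ℝ ∞ θ y →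
      (∃ c₁, ∀ z, n₁ (ρ z • a z + θ z • b z) = c₁) →
      (∃ c₂, ∀ z, n₂ (ρ z • a z + θ z • b z) = c₂) → ∀ X,
      fderiv ℝ (fun z => ρ z • a z + θ z • b z) y X = 0 ↔
        A X ∈ L.principalSpace (φ.symm y) (ρ y) (θ y) := by
    rintro y hy A hA ρ θ hρ hθ ⟨c₁, h1⟩ ⟨c₂, h2⟩ X
    have hs : ContDiffAt ℝ ∞ (fun z => ρ z • a z + θ z • b z) y :=
      (hρ.smul (hsa y hy)).add (hθ.smul (hsb y hy))
    have hkey := L.fderiv_combination x₀ hy hA (hdf hρ) (hdf hθ) X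
    have hmem : fderiv ℝ ρ y X • a y + fderiv ℝ θ y X • b y ∈ L.line (φ.symm y) :=
      Submodule.mem_span_pair.2 ⟨_, _, rfl⟩
    rw [L.mem_principalSpace, ← Submodule.add_mem_iff_left _ hmem]
    change _ ↔ (ρ y • differential L.Z₁ (φ.symm y) (A X) + θ y • differential L.Z₂ (φ.symm y) (A X))
      + (fderiv ℝ ρ y X • L.Z₁ (φ.symm y) + fderiv ℝ θ y X • L.Z₂ (φ.symm y)) ∈ _
    rw [← hkey]
    constructor
    · intro h
      change fderiv ℝ (fun z => ρ z • a z + θ z • b z) y X ∈ _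
      rw [h]
      exact Submodule.zero_mem _
    · intro h
      exact hline0 y _ h (hconst hs n₁ c₁ h1 X) (hconst hs n₂ c₂ h2 X)
  have hnY1 : ∀ y, n₁ (Y y) = 1 := hYu1 u
  have hnY2 : ∀ y, n₂ (Y y) = 0 := fun y => by
    change (Y y).2.2.2 - u * (Y y).1 = 0
    rw [hY, hYu1, hYu4]; ring
  have hnZ1 : ∀ y, n₁ (Z y) = 0 := hZ1
  have hnZ2 : ∀ y, n₂ (Z y) = 1 := fun y => by
    change (Z y).2.2.2 - u * (Z y).1 = 1
    rw [hZ1, hZ4]; ring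
  -- the open set
  have hinj0 : ∀ X, fderiv ℝ Y (φ x₀) X = 0 → X = 0 := by
    intro X hX
    by_contra hX0
    obtain ⟨A, hA⟩ := exists_tangent_equiv x₀ hx₀
    have h1 := (hprin _ hx₀ A hA (α u) (β u) (hsα _ hx₀) (hsβ _ hx₀) ⟨1, hnY1⟩ ⟨0, hnY2⟩ X).1 hX
    refine hu ⟨_, α u (φ x₀), β u (φ x₀), hYu0 u _, rfl, rfl, ?_⟩
    intro hbot
    have h2 : A X ∈ L.principalSpace (φ.symm (φ x₀)) (α u (φ x₀)) (β u (φ x₀)) := h1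
    rw [hbot, Submodule.mem_bot] at h2
    exact hX0 (A.map_eq_zero_iff.1 h2)
  have hev : ∀ᶠ y in 𝓝 (φ x₀), y ∈ φ.target ∧ ∀ X, fderiv ℝ Y y X = 0 → X = 0 := by
    have hc : ContinuousAt (fderiv ℝ Y) (φ x₀) :=
      ((hsY _ hx₀).fderiv_right (m := 0) (by simp)).continuousAt
    obtain ⟨q, -, -, hsc, -⟩ := exists_kernel_section (fderiv ℝ Y) (φ x₀) hc
    filter_upwards [hsc, φ.open_target.mem_nhds hx₀] with y hy hyt
    refine ⟨hyt, ?_⟩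
    have h0 : LinearMap.ker (fderiv ℝ Y (φ x₀)).toLinearMap = ⊥ :=
      LinearMap.ker_eq_bot'.2 hinj0
    rw [h0, finrank_bot, Nat.le_zero, Submodule.finrank_eq_zero] at hy
    exact LinearMap.ker_eq_bot'.1 hy
  obtain ⟨O, hO, hOo, hxO⟩ := mem_nhds_iff.1 hev
  have hform : ∀ (y : E d) (v w : LieSpace (d + 1)), v ∈ L.line (φ.symm y) →
      w ∈ L.line (φ.symm y) → lieForm v w = 0 := by
    intro y v w hv hw
    obtain ⟨p, q, rfl⟩ := Submodule.mem_span_pair.1 hv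
    obtain ⟨p', q', rfl⟩ := Submodule.mem_span_pair.1 hw
    simp only [← lieBilin_apply, map_add, map_smul, ContinuousLinearMap.add_apply,
      ContinuousLinearMap.smul_apply, smul_eq_mul]
    simp only [lieBilin_apply, L.isotropic₁₁, L.isotropic₂₂, L.isotropic₁₂,
      lieForm_comm (L.Z₂ (φ.symm y)) (L.Z₁ (φ.symm y))]
    ring
  have hpencil : ∀ y ∈ O, ∀ σ : ℝ, pencil Y Z σ y
      = fderiv ℝ (fun z => (α' z + σ * α u z) • a z + (β' z + σ * β u z) • b z) y := by
    intro y hy σ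
    have h1 : HasFDerivAt (fun z => Z z + σ • Y z) (pencil Y Z σ y) y :=
      ((hsZ y (hO hy).1).differentiableAt (by simp)).hasFDerivAt.add
        (((hsY y (hO hy).1).differentiableAt (by simp)).hasFDerivAt.const_smul σ)
    rw [← h1.fderiv]
    congr 1
    funext z
    simp only [hY, Yu, Z, smul_add, add_smul, mul_smul]
    abel
  have hcomb : ∀ (σ : ℝ) z, (α' z + σ * α u z) • a z + (β' z + σ * β u z) • b z
      = Z z + σ • Y z := by
    intro σ z
    simp only [hY, Yu, Z, smul_add, add_smul, mul_smul]
    abel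
  have hprin' : ∀ y ∈ O, ∀ A : E d ≃L[ℝ] TangentSpace (𝓡 d) (φ.symm y),
      HasMFDerivAt (𝓡 d) (𝓡 d) φ.symm y A.toContinuousLinearMap → ∀ (σ : ℝ) X,
      pencil Y Z σ y X = 0 ↔
        A X ∈ L.principalSpace (φ.symm y) (α' y + σ * α u y) (β' y + σ * β u y) := by
    intro y hy A hA σ X
    have ht := (hO hy).1
    rw [hpencil y hy]
    refine hprin y ht A hA _ _ ((hsα' y ht).add (contDiffAt_const.mul (hsα y ht)))
      ((hsβ' y ht).add (contDiffAt_const.mul (hsβ y ht))) ⟨σ, fun z => ?_⟩ ⟨1, fun z => ?_⟩ X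
    · rw [hcomb, map_add, map_smul, hnZ1, hnY1]; simp
    · rw [hcomb, map_add, map_smul, hnZ2, hnY2]; simp
  have hne : ∀ y (σ : ℝ), Z y + σ • Y y ≠ 0 := by
    intro y σ h
    have := congrArg n₂ h
    rw [map_add, map_smul, hnZ2, hnY2] at this
    simp at this
  have hsphere : ∀ y ∈ O, ∀ K, K ∈ L.curvatureSpheres (φ.symm y) ↔
    ∃ σ ∈ spec Y Z y, ∃ h : Z y + σ • Y y ≠ 0, K = Projectivization.mk ℝ (Z y + σ • Y y) h := by
    intro y hy K
    obtain ⟨A, hA⟩ := exists_tangent_equiv x₀ (hO hy).1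
    constructor
    · rintro ⟨T, r, s, h, rfl, rfl, hT⟩
      have hmem : r • a y + s • b y ∈ L.line (φ.symm y) := Submodule.mem_span_pair.2 ⟨_, _, rfl⟩
      rw [hline, Submodule.mem_span_pair] at hmem
      obtain ⟨p, q, hpq⟩ := hmem
      have hpq' : r • a y + s • b y = (p * α u y + q * α' y) • a y
          + (p * β u y + q * β' y) • b y := by
        rw [← hpq]
        simp only [hY, Yu, Z, smul_add, add_smul, mul_smul]
        abel
      have hli := LinearIndependent.pair_iff.1 (L.linearIndependent (φ.symm y))
      obtain ⟨hr, hs⟩ := hli (r - (p * α u y + q * α' y)) (s - (p * β u y + q * β' y)) (by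
        rw [sub_smul, sub_smul, sub_add_sub_comm, sub_eq_zero]; exact hpq')
      rw [sub_eq_zero] at hr hs
      obtain ⟨X', hX', hX'0⟩ := Submodule.exists_mem_ne_zero_of_ne_bot hT
      by_cases hq : q = 0
      · exfalso
        have hp : p ≠ 0 := by
          rintro rfl
          apply h
          change r • a y + s • b y = 0
          rw [← hpq, hq]; simp
        rw [hq, zero_mul, add_zero] at hr hs
        rw [hr, hs, L.principalSpace_smul _ _ _ hp] at hX'
        have h1 := (hprin _ (hO hy).1 A hA (α u) (β u) (hsα _ (hO hy).1) (hsβ _ (hO hy).1)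
          ⟨1, hnY1⟩ ⟨0, hnY2⟩ (A.symm X')).2 (by rwa [A.apply_symm_apply])
        have h2 := (hO hy).2 _ h1
        exact hX'0 (by rw [← A.apply_symm_apply X', h2, map_zero])
      · have e1 : r = q * (α' y + p / q * α u y) := by rw [hr]; field_simp; ring
        have e2 : s = q * (β' y + p / q * β u y) := by rw [hs]; field_simp; ring
        refine ⟨p / q, mem_spec.2 ⟨A.symm X', ?_, ?_⟩, hne y _, ?_⟩
        · intro h0
          exact hX'0 (by rw [← A.apply_symm_apply X', h0, map_zero])
        · rw [hprin' y hy A hA, A.apply_symm_apply]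
          rwa [e1, e2, L.principalSpace_smul _ _ _ hq] at hX'
        · rw [Projectivization.mk_eq_mk_iff']
          refine ⟨q, ?_⟩
          change q • (Z y + (p / q) • Y y) = r • a y + s • b y
          rw [← hpq, smul_add, smul_smul, mul_div_cancel₀ _ hq]
          exact add_comm _ _
    · rintro ⟨σ, hσ, h, rfl⟩
      obtain ⟨X, hX0, hX⟩ := mem_spec.1 hσ
      refine ⟨_, α' y + σ * α u y, β' y + σ * β u y, ?_, ?_, rfl, ?_⟩
      · rw [show L.Z₁ (φ.symm y) = a y from rfl, show L.Z₂ (φ.symm y) = b y from rfl, hcomb]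
        exact h
      · congr 1
        exact (hcomb σ y).symm
      · intro hbot
        have h2 := (hprin' y hy A hA σ X).1 hX
        rw [hbot, Submodule.mem_bot] at h2
        exact hX0 (A.map_eq_zero_iff.1 h2)
  refine ⟨O, Y, Z, n₁, n₂, ⟨hOo, fun y hy => hsY y (hO hy).1, fun y hy => hsZ y (hO hy).1,
    fun y _ => hform y _ _ (hYline y) (hYline y), fun y _ => hform y _ _ (hYline y) (hZline y),
    fun y _ => hform y _ _ (hZline y) (hZline y), fun y _ => hnY1 y, fun y _ => hnY2 y,
    fun y _ => hnZ1 y, fun y _ => hnZ2 y, ?_, fun y hy => (hO hy).2⟩, fun y hy => (hO hy).1, hxO,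
    fun y _ => hline y, ?_, hsphere, ?_⟩
  · intro y hy X
    have ht := (hO hy).1
    obtain ⟨A, hA⟩ := exists_tangent_equiv x₀ ht
    have hda : fderiv ℝ a y X = differential L.Z₁ (φ.symm y) (A X) := by
      simpa using L.fderiv_combination x₀ ht hA (ρ := fun _ => 1) (θ := fun _ => 0)
        (differentiableAt_const _) (differentiableAt_const _) X
    have hdsa := (hsa y ht).differentiableAt (by simp)
    have hdsb := (hsb y ht).differentiableAt (by simp)
    have e1 : lieForm (fderiv ℝ a y X) (b y) = 0 := by
      rw [hda]; exact L.contact _ _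
    have e2 := bilinear_fderiv_eq_zero (lieBilin (d + 1)) univ_mem hdsa hdsa
      (fun z _ => L.isotropic₁₁ (φ.symm z)) X
    have e3 := bilinear_fderiv_eq_zero (lieBilin (d + 1)) univ_mem hdsb hdsb
      (fun z _ => L.isotropic₂₂ (φ.symm z)) X
    have e4 := bilinear_fderiv_eq_zero (lieBilin (d + 1)) univ_mem hdsa hdsb
      (fun z _ => L.isotropic₁₂ (φ.symm z)) X
    simp only [lieBilin_apply] at e2 e3 e4
    rw [lieForm_comm (a y)] at e2 e4
    rw [lieForm_comm (b y)] at e3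
    have e2' : lieForm (fderiv ℝ a y X) (a y) = 0 := by linarith
    have e3' : lieForm (fderiv ℝ b y X) (b y) = 0 := by linarith
    have e4' : lieForm (fderiv ℝ b y X) (a y) = 0 := by linarith
    have hfd := ((hdf (hsα y ht)).hasFDerivAt.smul hdsa.hasFDerivAt).add
      ((hdf (hsβ y ht)).hasFDerivAt.smul hdsb.hasFDerivAt)
    have hfd' : HasFDerivAt Y _ y := hfd
    have haa := hform y (a y) (Z y) (Submodule.subset_span (Or.inl rfl)) (hZline y)
    have hbb := hform y (b y) (Z y) (Submodule.subset_span (Or.inr rfl)) (hZline y)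
    rw [hfd'.fderiv]
    simp only [ContinuousLinearMap.add_apply, ContinuousLinearMap.smul_apply,
      ContinuousLinearMap.smulRight_apply, map_add, map_smul, smul_eq_mul, lieBilin_apply, haa, hbb,
      mul_zero, add_zero]
    simp only [Z]
    simp only [← lieBilin_apply, map_add, map_smul, smul_eq_mul]
    simp only [lieBilin_apply, e1, e2', e3', e4']
    simp
  · intro y hy σ
    obtain ⟨A, hA⟩ := exists_tangent_equiv x₀ (hO hy).1
    exact ⟨_, _, A, (hcomb σ y).symm, hA, hprin' y hy A hA σ⟩
  · intro y hy
    rw [← hg (φ.symm y)]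
    have himg : L.curvatureSpheres (φ.symm y)
        = (fun σ => Projectivization.mk ℝ (Z y + σ • Y y) (hne y σ)) '' spec Y Z y := by
      ext K
      rw [hsphere y hy]
      constructor
      · rintro ⟨σ, hσ, h, rfl⟩
        exact ⟨σ, hσ, rfl⟩
      · rintro ⟨σ, hσ, rfl⟩
        exact ⟨σ, hσ, _, rfl⟩
    rw [himg, Function.Injective.encard_image]
    intro σ τ h
    obtain ⟨c, hc⟩ := (Projectivization.mk_eq_mk_iff' ℝ _ _ _ _).1 h
    have h1 := congrArg n₁ hc
    have h2 := congrArg n₂ hc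
    simp only [map_smul, map_add, hnY1, hnY2, hnZ1, hnZ2, smul_eq_mul] at h1 h2
    have : c = 1 := by linarith
    rw [this] at h1
    linarith

end

end LieSphere

namespace LieSphere

open LegendreFrame

section
variable {d : ℕ} {W : Type*} [TopologicalSpace W] [ChartedSpace (E d) W] [IsManifold (𝓡 d) ∞ W]
  {L : LegendreSubmanifold d W}

/-- In a chart, the Dupin condition holds along curvature curves. -/
theorem LegendreSubmanifold.LocalFrame.dupinCurves {x₀ : W} {g : ℕ} {O : Set (E d)}
    {Y Z : E d → LieSpace (d + 1)} {n₁ n₂ : LieSpace (d + 1) →L[ℝ] ℝ}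
    (H : L.LocalFrame x₀ g O Y Z n₁ n₂) (hL : L.IsDupin) : DupinCurves O Y Z := by
  intro γ τ ε hε hinj hγ
  set φ := chartAt (E d) x₀ with hφ
  -- parametrization by the line
  let h : ℝ → ℝ := fun u => 2 * ε / Real.pi * Real.arctan u
  have hπ := Real.pi_pos
  have hmem : ∀ u, h u ∈ Ioo (-ε) ε := by
    intro u
    have h1 := Real.neg_pi_div_two_lt_arctan u
    have h2 := Real.arctan_lt_pi_div_two u
    have h3 : 0 < 2 * ε / Real.pi := by positivity
    have h4 : 2 * ε / Real.pi * (Real.pi / 2) = ε := by field_simp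
    constructor
    · have := mul_lt_mul_of_pos_left h1 h3
      simp only [h]; linarith
    · have := mul_lt_mul_of_pos_left h2 h3
      simp only [h]; linarith
  have hhinj : Function.Injective h := by
    intro u v huv
    exact Real.arctan_injective (mul_left_cancel₀ (by positivity) huv)
  have hder : ∀ u, HasDerivAt h (2 * ε / Real.pi * (1 / (1 + u ^ 2))) u := fun u =>
    (Real.hasDerivAt_arctan u).const_mul _
  have hsurj : ∀ t ∈ Ioo (-ε) ε, ∃ u, h u = t := by
    intro t ht
    refine ⟨Real.tan (t * Real.pi / (2 * ε)), ?_⟩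
    simp only [h]
    rw [Real.arctan_tan]
    · field_simp
    · rw [lt_div_iff₀ (by positivity)]
      nlinarith [ht.1]
    · rw [div_lt_iff₀ (by positivity)]
      nlinarith [ht.2]
  have hhs : ContDiff ℝ ∞ h := contDiff_const.mul Real.contDiff_arctan
  -- A curvature surface needs a manifold modelled on some `E m` as its source. A rescaled
  -- arctangent identifies `E 1` with the interval, so no structure on the interval is needed.
  let c : E 1 → ℝ := fun s => h (s 0)
  have hp0 : ContDiff ℝ ∞ (fun s : E 1 => s 0) := (EuclideanSpace.proj (𝕜 := ℝ) (0 : Fin 1)).contDiff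
  have hcs : ContDiff ℝ ∞ c := hhs.comp hp0
  have hcder : ∀ s, HasFDerivAt c ((2 * ε / Real.pi * (1 / (1 + (s 0) ^ 2))) •
      (EuclideanSpace.proj (𝕜 := ℝ) (0 : Fin 1) : E 1 →L[ℝ] ℝ)) s := fun s =>
    HasDerivAt.comp_hasFDerivAt (h₂ := h) (f := fun s : E 1 => s 0) s (hder (s 0))
      (EuclideanSpace.proj (𝕜 := ℝ) (0 : Fin 1) : E 1 →L[ℝ] ℝ).hasFDerivAt
  let δ : E 1 → E d := fun s => γ (c s)
  have hδs : ContDiff ℝ ∞ δ := contDiff_iff_contDiffAt.2 fun s =>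
    ContDiffAt.comp (g := γ) s (hγ _ (hmem _)).2.1 hcs.contDiffAt
  have hδO : ∀ s, δ s ∈ O := fun s => (hγ _ (hmem _)).1
  have hδt : ∀ s, δ s ∈ φ.target := fun s => H.subset (hδO s)
  have hδd : ∀ s, HasFDerivAt δ (((2 * ε / Real.pi * (1 / (1 + (s 0) ^ 2))) •
      (EuclideanSpace.proj (𝕜 := ℝ) (0 : Fin 1) : E 1 →L[ℝ] ℝ)).smulRight (deriv γ (c s))) s :=
    fun s => by
    have h1 : HasDerivAt γ (deriv γ (c s)) (c s) :=
      ((hγ _ (hmem (s 0))).2.1.differentiableAt (by simp)).hasDerivAt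
    have h2 := HasFDerivAt.comp (g := γ) (f := c) s h1.hasFDerivAt (hcder s)
    have h3 : ((2 * ε / Real.pi * (1 / (1 + (s 0) ^ 2))) •
      (EuclideanSpace.proj (𝕜 := ℝ) (0 : Fin 1) : E 1 →L[ℝ] ℝ)).smulRight (deriv γ (c s)) =
        (ContinuousLinearMap.toSpanSingleton ℝ (deriv γ (c s))).comp
          ((2 * ε / Real.pi * (1 / (1 + (s 0) ^ 2))) •
            (EuclideanSpace.proj (𝕜 := ℝ) (0 : Fin 1) : E 1 →L[ℝ] ℝ)) := by
      ext v
      simp [mul_smul]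
    rw [h3]
    exact h2
  let i : E 1 → W := fun s => φ.symm (δ s)
  have hne : ∀ s, Z (δ s) + τ (c s) • Y (δ s) ≠ 0 := fun s =>
    H.frame.sphere_ne_zero (σ := fun _ => τ (c s)) (hδO s)
  let K : E 1 → ℙ ℝ (LieSpace (d + 1)) := fun s => Projectivization.mk ℝ _ (hne s)
  have hprin : ∀ s, pencil Y Z (τ (c s)) (δ s) (deriv γ (c s)) = 0 := by
    intro s
    have h1 : deriv γ (c s) ∈ LegendreFrame.principal Y Z (τ (c s)) (γ (c s)) := by
      rw [(hγ _ (hmem (s 0))).2.2.2]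
      exact Submodule.mem_span_singleton_self _
    exact h1
  have hmf : ∀ s, ∀ A : E d ≃L[ℝ] TangentSpace (𝓡 d) (φ.symm (δ s)),
      HasMFDerivAt (𝓡 d) (𝓡 d) φ.symm (δ s) A.toContinuousLinearMap → ∀ v : E 1,
      mfderiv (𝓡 1) (𝓡 d) i s v
        = A (((2 * ε / Real.pi * (1 / (1 + (s 0) ^ 2))) * v 0) • deriv γ (c s)) := by
    intro s A hA v
    have h1 : HasMFDerivAt (𝓡 1) (𝓡 d) δ s _ := (hδd s).hasMFDerivAt
    have h2 := (hA.comp s h1).mfderiv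
    have h3 : mfderiv (𝓡 1) (𝓡 d) i s = _ := h2
    rw [h3]
    rfl
  have hcurv : L.IsCurvatureSurface (m := 1) i K := by
    refine ⟨?_, ?_, ?_, ?_⟩
    · exact (contMDiffOn_chart_symm (I := 𝓡 d) (n := ∞) (x := x₀)).comp_contMDiff
        hδs.contMDiff hδt
    · intro s t hst
      have h1 : δ s = δ t := φ.symm.injOn (hδt s) (hδt t) hst
      have h2 := hhinj (hinj (hmem (s 0)) (hmem (t 0)) h1)
      ext j
      rw [Subsingleton.elim j 0]
      exact h2
    · intro s
      obtain ⟨r, q, A, -, hA, -⟩ := H.principal _ (hδO s) 0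
      rw [injective_iff_map_eq_zero]
      intro v hv
      replace hv := (hmf s A hA v).symm.trans hv
      rw [A.map_eq_zero_iff] at hv
      rcases smul_eq_zero.1 hv with h0 | h0
      · have h1 : 0 < 2 * ε / Real.pi * (1 / (1 + (s 0) ^ 2)) := by positivity
        have h2 := (mul_eq_zero.1 h0).resolve_left h1.ne'
        have h3 : ∀ w : E 1, w 0 = 0 → w = 0 := fun w hw => by
          ext j
          rw [Subsingleton.elim j 0]
          exact hw
        exact h3 v h2
      · exact absurd h0 (hγ _ (hmem (s 0))).2.2.1
    · intro s
      obtain ⟨r, q, A, hrq, hA, hX⟩ := H.principal _ (hδO s) (τ (c s))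
      have hrange : LinearMap.range (mfderiv (𝓡 1) (𝓡 d) i s).toLinearMap
          = L.principalSpace (φ.symm (δ s)) r q := by
        ext T
        constructor
        · rintro ⟨v, rfl⟩
          have := hmf s A hA v
          change mfderiv (𝓡 1) (𝓡 d) i s v ∈ _
          rw [this]
          refine (hX _).1 ?_
          rw [map_smul, hprin s, smul_zero]
        · intro hT
          have h1 := (hX (A.symm T)).2 (by rwa [A.apply_symm_apply])
          have h2 : A.symm T ∈ LegendreFrame.principal Y Z (τ (c s)) (γ (c s)) := h1
          rw [(hγ _ (hmem (s 0))).2.2.2, Submodule.mem_span_singleton] at h2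
          obtain ⟨a, ha⟩ := h2
          have h3 : 0 < 2 * ε / Real.pi * (1 / (1 + (s 0) ^ 2)) := by positivity
          refine ⟨EuclideanSpace.single 0 ((2 * ε / Real.pi * (1 / (1 + (s 0) ^ 2)))⁻¹ * a), ?_⟩
          refine (hmf s A hA _).trans ?_
          have h4 : (EuclideanSpace.single (0 : Fin 1)
              ((2 * ε / Real.pi * (1 / (1 + (s 0) ^ 2)))⁻¹ * a) : E 1) 0
              = (2 * ε / Real.pi * (1 / (1 + (s 0) ^ 2)))⁻¹ * a := by simp
          rw [h4, mul_inv_cancel_left₀ h3.ne', ha, A.apply_symm_apply]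
      have hne' : r • L.Z₁ (φ.symm (δ s)) + q • L.Z₂ (φ.symm (δ s)) ≠ 0 := by
        rw [← hrq]; exact hne s
      refine ⟨r, q, hne', ?_, hrange, ?_⟩
      · simp only [K, hrq]
        rfl
      · rw [Ne, Submodule.eq_bot_iff]
        intro hall
        have h1 := hall (A (deriv γ (c s))) (by
          have := (hX (deriv γ (c s))).1 (hprin s)
          rw [hrange]; exact this)
        exact (hγ _ (hmem (s 0))).2.2.1 (A.map_eq_zero_iff.1 h1)
  have hconst := hL 1 (E 1) i K hcurv
  intro t ht
  obtain ⟨u, hu⟩ := hsurj t ht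
  have h0 : h 0 = 0 := by simp [h]
  have hK := hconst (EuclideanSpace.single 0 u) (EuclideanSpace.single 0 0)
  obtain ⟨q, hq⟩ := (Projectivization.mk_eq_mk_iff' ℝ _ _ _ _).1 hK
  have c1 : c (EuclideanSpace.single 0 u) = t := by simp [c, hu]
  have c0 : c (EuclideanSpace.single 0 0) = 0 := by simp [c, h0]
  have e1 := congrArg n₂ hq
  have e2 := congrArg n₁ hq
  simp only [map_smul, map_add, H.frame.n₂Z _ (hδO _), H.frame.n₂Y _ (hδO _),
    H.frame.n₁Z _ (hδO _), H.frame.n₁Y _ (hδO _), c1, c0, smul_eq_mul] at e1 e2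
  have : q = 1 := by linarith
  rw [this] at e2
  linarith

end

end LieSphere

/-! ### Necessity, locally: the sphere common to the contact elements is a curvature sphere. -/

/-- A cone over the image of a manifold of dimension less than `d` does not contain an immersed
projective `d`-manifold. -/
theorem exists_fderiv_eq_smul_of_cone {d c : ℕ} (hcd : c < d) {Λ : Type*} [NormedAddCommGroup Λ]
    [NormedSpace ℝ Λ] [FiniteDimensional ℝ Λ] {M : Type*} [TopologicalSpace M]
    [ChartedSpace (EuclideanSpace ℝ (Fin c)) M] [IsManifold (𝓡 c) ∞ M] [SecondCountableTopology M]
    {s : M → Λ} (hs : ContMDiff (𝓡 c) 𝓘(ℝ, Λ) ∞ s) {U : Set (EuclideanSpace ℝ (Fin d))}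
    (hU : IsOpen U) {k : EuclideanSpace ℝ (Fin d) → Λ} (hk : ∀ y ∈ U, ContDiffAt ℝ ∞ k y)
    (hk0 : ∀ y ∈ U, k y ≠ 0) (hks : ∀ y ∈ U, ∃ (x : M) (t : ℝ), k y = t • s x)
    {y : EuclideanSpace ℝ (Fin d)} (hy : y ∈ U) :
    ∃ X, X ≠ 0 ∧ ∃ a : ℝ, fderiv ℝ k y X = a • k y := by
  by_contra hcon
  push Not at hcon
  obtain ⟨n, hn⟩ : ∃ n : Λ →L[ℝ] ℝ, n (k y) ≠ 0 :=
    SeparatingDual.exists_ne_zero (hk0 y hy)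
  have hev : ∀ᶠ z in 𝓝 y, z ∈ U ∧ n (k z) ≠ 0 :=
    (hU.eventually_mem hy).and ((n.continuous.continuousAt.comp (hk y hy).continuousAt).eventually_ne hn)
  -- Dividing by a functional removes the scale, so `kh` depends on the projective point only; under
  -- `hcon` it is an immersion at `y`.
  let kh : EuclideanSpace ℝ (Fin d) → Λ := fun z => (n (k z))⁻¹ • k z
  have hkh : ContDiffAt ℝ ∞ kh y :=
    ((n.contDiff.contDiffAt.comp y (hk y hy)).inv hn).smul (hk y hy)
  have hinj : ∀ X, fderiv ℝ kh y X = 0 → X = 0 := by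
    intro X hX
    by_contra hX0
    have h1 : DifferentiableAt ℝ k y := (hk y hy).differentiableAt (by simp)
    have h2 : DifferentiableAt ℝ (fun z => (n (k z))⁻¹) y :=
      ((n.contDiff.contDiffAt.comp y (hk y hy)).inv hn).differentiableAt (by simp)
    have h3 : HasFDerivAt kh _ y := h2.hasFDerivAt.smul h1.hasFDerivAt
    rw [h3.fderiv] at hX
    simp only [ContinuousLinearMap.add_apply, ContinuousLinearMap.smul_apply,
      ContinuousLinearMap.smulRight_apply] at hX
    refine hcon X hX0 (-(n (k y) * fderiv ℝ (fun z => (n (k z))⁻¹) y X)) ?_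
    have h4 := congrArg (fun v => n (k y) • v) hX
    simp only [smul_add, smul_smul, mul_inv_cancel₀ hn, one_smul, smul_zero] at h4
    rw [neg_smul]
    exact eq_neg_of_add_eq_zero_left h4
  obtain ⟨l, hl⟩ := (fderiv ℝ kh y).toLinearMap.exists_leftInverse_of_injective
    (LinearMap.ker_eq_bot'.2 hinj)
  set A : Λ →L[ℝ] EuclideanSpace ℝ (Fin d) := l.toContinuousLinearMap
  have hAl : ∀ X, A (fderiv ℝ kh y X) = X := fun X => LinearMap.congr_fun hl X
  have hstrict : HasStrictFDerivAt (fun z => A (kh z))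
      ((ContinuousLinearEquiv.refl ℝ (EuclideanSpace ℝ (Fin d)) :
        EuclideanSpace ℝ (Fin d) ≃L[ℝ] EuclideanSpace ℝ (Fin d)) :
        EuclideanSpace ℝ (Fin d) →L[ℝ] EuclideanSpace ℝ (Fin d)) y := by
    have h1 := A.hasStrictFDerivAt.comp y (hkh.hasStrictFDerivAt (by simp))
    have h2 : A ∘L fderiv ℝ kh y = ((ContinuousLinearEquiv.refl ℝ (EuclideanSpace ℝ (Fin d)) :
        EuclideanSpace ℝ (Fin d) ≃L[ℝ] EuclideanSpace ℝ (Fin d)) :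
        EuclideanSpace ℝ (Fin d) →L[ℝ] EuclideanSpace ℝ (Fin d)) :=
      ContinuousLinearMap.ext hAl
    rw [← h2]
    exact h1
  have hmap := hstrict.map_nhds_eq_of_equiv
  -- `T` contains an open set of dimension `d`. It is also a countable union of locally Lipschitz
  -- images of subsets of the `c`-dimensional model space, so its Hausdorff dimension is at most
  -- `c`.
  set T : Set (EuclideanSpace ℝ (Fin d)) :=
    (fun x => A ((n (s x))⁻¹ • s x)) '' {x | n (s x) ≠ 0} with hT
  have hTn : T ∈ 𝓝 (A (kh y)) := by
    rw [← hmap]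
    refine mem_map.2 ?_
    filter_upwards [hev] with z hz
    obtain ⟨x, t, hx⟩ := hks z hz.1
    have h1 := hz.2
    rw [hx, map_smul, smul_eq_mul] at h1
    have ht := left_ne_zero_of_mul h1
    have hnx := right_ne_zero_of_mul h1
    refine ⟨x, hnx, ?_⟩
    simp only [kh, hx, map_smul, smul_eq_mul, smul_smul]
    congr 1
    field_simp
  have hdim : dimH T = d := by
    have := Real.dimH_of_nonempty_interior (E := EuclideanSpace ℝ (Fin d)) (s := T)
      ⟨_, mem_interior_iff_mem_nhds.2 hTn⟩
    simpa using this
  obtain ⟨C, hC, hCu⟩ := TopologicalSpace.countable_cover_nhds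
    (fun x : M => (chartAt (EuclideanSpace ℝ (Fin c)) x).open_source.mem_nhds (mem_chart_source _ x))
  have hle : dimH T ≤ c := by
    let D : M → Set (EuclideanSpace ℝ (Fin c)) := fun x =>
      {z | z ∈ (chartAt (EuclideanSpace ℝ (Fin c)) x).target ∧
        n (s ((chartAt (EuclideanSpace ℝ (Fin c)) x).symm z)) ≠ 0}
    let f : M → EuclideanSpace ℝ (Fin c) → EuclideanSpace ℝ (Fin d) := fun x z =>
      A ((n (s ((chartAt (EuclideanSpace ℝ (Fin c)) x).symm z)))⁻¹ •
        s ((chartAt (EuclideanSpace ℝ (Fin c)) x).symm z))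
    have hsub : T ⊆ ⋃ x ∈ C, f x '' D x := by
      rintro _ ⟨x, hx, rfl⟩
      have : x ∈ ⋃ x ∈ C, (chartAt (EuclideanSpace ℝ (Fin c)) x).source := by rw [hCu]; trivial
      simp only [mem_iUnion] at this ⊢
      obtain ⟨x', hx', hxs⟩ := this
      refine ⟨x', hx', chartAt (EuclideanSpace ℝ (Fin c)) x' x,
        ⟨(chartAt (EuclideanSpace ℝ (Fin c)) x').map_source hxs, ?_⟩, ?_⟩
      · rw [(chartAt (EuclideanSpace ℝ (Fin c)) x').left_inv hxs]; exact hx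
      · simp only [f]
        rw [(chartAt (EuclideanSpace ℝ (Fin c)) x').left_inv hxs]
    refine (dimH_mono hsub).trans ?_
    rw [dimH_bUnion hC]
    refine iSup₂_le fun x _ => ?_
    have h1 : dimH (f x '' D x) ≤ dimH (D x) := by
      refine dimH_image_le_of_locally_lipschitzOn fun z hz => ?_
      have h2 : ContDiffAt ℝ ∞ (fun z => s ((chartAt (EuclideanSpace ℝ (Fin c)) x).symm z)) z := by
        have h1 : ContMDiffOn (𝓡 c) (𝓡 c) ∞ (chartAt (EuclideanSpace ℝ (Fin c)) x).symm
          (chartAt (EuclideanSpace ℝ (Fin c)) x).target := contMDiffOn_chart_symm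
        exact (contMDiffOn_iff_contDiffOn.1 (hs.comp_contMDiffOn h1)).contDiffAt
          ((chartAt (EuclideanSpace ℝ (Fin c)) x).open_target.mem_nhds hz.1)
      have h3 : ContDiffAt ℝ ∞ (f x) z := A.contDiff.contDiffAt.comp z
        (((n.contDiff.contDiffAt.comp z h2).inv hz.2).smul h2)
      obtain ⟨K, t, ht, hK⟩ := (h3.of_le (by simp) : ContDiffAt ℝ 1 (f x) z).exists_lipschitzOnWith
      exact ⟨K, t, nhdsWithin_le_nhds ht, hK⟩
    refine h1.trans ((dimH_mono (subset_univ _)).trans ?_)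
    rw [Real.dimH_univ_eq_finrank]
    simp
  rw [hdim] at hle
  exact absurd hcd (not_lt.2 (by exact_mod_cast hle))

namespace LieSphere

theorem finrank_ker_prod_add_two {Λ : Type*} [AddCommGroup Λ] [Module ℝ Λ] [FiniteDimensional ℝ Λ]
    (α β : Λ →ₗ[ℝ] ℝ) {p q : Λ} (h1 : α p ≠ 0) (h2 : β p = 0) (h3 : α q = 0) (h4 : β q ≠ 0) :
    Module.finrank ℝ (LinearMap.ker (α.prod β)) + 2 = Module.finrank ℝ Λ := by
  rw [← LinearMap.finrank_range_add_finrank_ker (α.prod β)]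
  have : LinearMap.range (α.prod β) = ⊤ := by
    rw [LinearMap.range_eq_top]
    rintro ⟨s, t⟩
    refine ⟨(s / α p) • p + (t / β q) • q, Prod.ext ?_ ?_⟩
    · simp [h3, h1]
    · simp [h2, h4]
  rw [this]
  simp [add_comm]

theorem mem_ker_prod {Λ : Type*} [AddCommGroup Λ] [Module ℝ Λ] {α β : Λ →ₗ[ℝ] ℝ} {v : Λ} :
    v ∈ LinearMap.ker (α.prod β) ↔ α v = 0 ∧ β v = 0 := by
  rw [LinearMap.mem_ker, LinearMap.prod_apply, Prod.ext_iff]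
  rfl

section Maps
variable {k n : ℕ}

/-- Linear inclusion of Lie sphere spaces induced by an isometric inclusion of Euclidean spaces. -/
noncomputable def lieInclusion (ι : E k →ₗᵢ[ℝ] E n) : LieSpace k →ₗ[ℝ] LieSpace n where
  toFun v := (v.1, v.2.1, ι v.2.2.1, v.2.2.2)
  map_add' v w := by simp
  map_smul' c v := by simp

theorem lieInclusion_pointSphere (ι : E k →ₗᵢ[ℝ] E n) (p : E k) :
    lieInclusion ι (pointSphere p) = pointSphere (ι p) := by
  simp [lieInclusion, pointSphere]

theorem lieInclusion_orientedPlane (ι : E k →ₗᵢ[ℝ] E n) (p ν : E k) :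
    lieInclusion ι (orientedPlane p ν) = orientedPlane (ι p) (ι ν) := by
  simp [lieInclusion, orientedPlane]

/-- The sum of the first two coordinates. -/
noncomputable def improperForm (n : ℕ) : LieSpace n →ₗ[ℝ] ℝ where
  toFun v := v.1 + v.2.1
  map_add' v w := by simp only [Prod.fst_add, Prod.snd_add]; ring
  map_smul' c v := by simp [mul_add]

/-- Inner product of the center with a vector. -/
noncomputable def centerForm (a : E n) : LieSpace n →ₗ[ℝ] ℝ where
  toFun v := inner ℝ a v.2.2.1
  map_add' v w := by simp [inner_add_right]
  map_smul' c v := by simp [inner_smul_right]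

/-- The last coordinate. -/
noncomputable def radiusForm (n : ℕ) : LieSpace n →ₗ[ℝ] ℝ where
  toFun v := v.2.2.2
  map_add' v w := by simp
  map_smul' c v := by simp

@[simp] theorem improperForm_apply (v : LieSpace n) : improperForm n v = v.1 + v.2.1 := rfl
@[simp] theorem centerForm_apply (a : E n) (v : LieSpace n) :
    centerForm a v = inner ℝ a v.2.2.1 := rfl
@[simp] theorem radiusForm_apply (v : LieSpace n) : radiusForm n v = v.2.2.2 := rfl

/-- The parallel transformation: it increases the signed radii by `-ε`. -/
noncomputable def parallelMap (n : ℕ) (ε : ℝ) : LieSpace n →ₗ[ℝ] LieSpace n where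
  toFun v := (v.1 - ε ^ 2 / 2 * (v.1 + v.2.1) + ε * v.2.2.2,
    v.2.1 + ε ^ 2 / 2 * (v.1 + v.2.1) - ε * v.2.2.2, v.2.2.1, v.2.2.2 - ε * (v.1 + v.2.1))
  map_add' v w := by
    refine Prod.ext ?_ (Prod.ext ?_ (Prod.ext ?_ ?_)) <;>
      simp only [Prod.fst_add, Prod.snd_add] <;> ring
  map_smul' c v := by
    refine Prod.ext ?_ (Prod.ext ?_ (Prod.ext ?_ ?_)) <;>
      simp only [Prod.smul_fst, Prod.smul_snd, smul_eq_mul, RingHom.id_apply] <;> ring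

theorem parallelMap_orientedPlane (ε : ℝ) {p ν : E n} (hν : inner ℝ ν ν = 1) :
    parallelMap n ε (orientedPlane p ν) = orientedPlane (p + ε • ν) ν := by
  simp only [parallelMap, orientedPlane, LinearMap.coe_mk, AddHom.coe_mk, inner_add_left,
    inner_smul_left, hν, conj_trivial]
  refine Prod.ext ?_ (Prod.ext ?_ (Prod.ext rfl ?_)) <;> simp only <;> ring

theorem parallelMap_pointSphere (ε : ℝ) {p ν : E n} (hν : inner ℝ ν ν = 1) :
    parallelMap n ε (pointSphere p)
      = pointSphere (p + ε • ν) - ε • orientedPlane (p + ε • ν) ν := by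
  simp only [parallelMap, pointSphere, orientedPlane, LinearMap.coe_mk, AddHom.coe_mk,
    inner_add_left, inner_smul_left, inner_add_right, inner_smul_right, hν, conj_trivial,
    real_inner_comm ν p]
  refine Prod.ext ?_ (Prod.ext ?_ (Prod.ext ?_ ?_)) <;>
    simp only [Prod.fst_sub, Prod.snd_sub, Prod.smul_fst, Prod.smul_snd, smul_eq_mul]
  · ring
  · ring
  · simp
  · ring

theorem lieForm_parallelMap (ε : ℝ) (v w : LieSpace n) :
    lieForm (parallelMap n ε v) (parallelMap n ε w) = lieForm v w := by
  simp only [parallelMap, lieForm, LinearMap.coe_mk, AddHom.coe_mk]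
  ring

theorem exists_unit_orthogonal (ι : E k →ₗᵢ[ℝ] E n) (hkn : k < n) :
    ∃ e : E n, ‖e‖ = 1 ∧ ∀ u, inner ℝ (ι u) e = 0 := by
  have h1 : LinearMap.range ι.toLinearMap ≠ ⊤ := by
    intro h
    have h2 := LinearMap.finrank_range_of_inj (f := ι.toLinearMap) ι.injective
    rw [h] at h2
    simp at h2
    omega
  have h2 : (LinearMap.range ι.toLinearMap)ᗮ ≠ ⊥ := fun h =>
    h1 (Submodule.orthogonal_eq_bot_iff.1 h)
  obtain ⟨e, he, he0⟩ := Submodule.exists_mem_ne_zero_of_ne_bot h2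
  have hn : ‖e‖ ≠ 0 := norm_ne_zero_iff.2 he0
  refine ⟨‖e‖⁻¹ • e, by rw [norm_smul, norm_inv, norm_norm, inv_mul_cancel₀ hn], fun u => ?_⟩
  rw [inner_smul_right, (Submodule.mem_orthogonal _ _).1 he (ι u) ⟨u, rfl⟩, mul_zero]

end Maps

section Focal
variable {c d : ℕ} {M : Type} [TopologicalSpace M] [ChartedSpace (E c) M]

/-- In each of the standard constructions, the contact elements contain a sphere which depends on
the given Legendre submanifold only and lies in a subspace of codimension two. -/
theorem IsStandardConstruction.exists_focal (hcd : c < d) {L₀ : LegendreSubmanifold c M}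
    {F η : M → E (c + 1)} (hL₀ : L₀.HasEuclideanProjection F η)
    {C : Set (Submodule ℝ (LieSpace (d + 1)))} (hC : IsStandardConstruction F η C) :
    ∃ (P Q : Submodule ℝ (LieSpace (d + 1))) (f : LieSpace (c + 1) →ₗ[ℝ] ℝ)
      (J : LieSpace (c + 1) →ₗ[ℝ] LieSpace (d + 1)),
      Module.finrank ℝ P + 2 = Module.finrank ℝ (LieSpace (d + 1)) ∧ Q ≤ P ∧
      ∀ ℓ ∈ C, ¬ ℓ ≤ Q → ∃ x, ∃ v ∈ L₀.line x, f v = 0 ∧ J v ≠ 0 ∧ J v ∈ ℓ ∧ J v ∈ Q ∧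
        ∃ w ∈ L₀.line x, f w ≠ 0 := by
  obtain ⟨ι, hC⟩ := hC
  obtain ⟨e₀, he₀, hιe⟩ := exists_unit_orthogonal ι (by omega : c + 1 < d + 1)
  have hee : inner ℝ e₀ e₀ = 1 := by rw [real_inner_self_eq_norm_sq, he₀]; norm_num
  have he0 : e₀ ≠ 0 := by rintro rfl; simp at he₀
  have hpt : ∀ x, pointSphere (F x) ∈ L₀.line x := fun x => by
    rw [(hL₀ x).2]; exact Submodule.subset_span (Or.inl rfl)
  have hpl : ∀ x, orientedPlane (F x) (η x) ∈ L₀.line x := fun x => by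
    rw [(hL₀ x).2]; exact Submodule.subset_span (Or.inr rfl)
  have hη : ∀ x, inner ℝ (η x) (η x) = 1 := fun x => by
    rw [real_inner_self_eq_norm_sq, (hL₀ x).1]; norm_num
  rcases hC with ⟨ε, hε, rfl⟩ | rfl | ⟨a, ha, rfl⟩
  -- Tube: `radiusForm` singles out the point sphere of `F x`, and the parallel transformation makes
  -- it the sphere of signed radius `-ε` around `F x`, which touches all elements over `x`. The
  -- equations fix the radius and put the centre into the hyperplane orthogonal to `e₀`.
  · refine ⟨_, _, radiusForm _, parallelMap _ ε ∘ₗ lieInclusion ι, finrank_ker_prod_add_two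
      (radiusForm _ + ε • improperForm _) (centerForm e₀) (p := (0, 0, 0, 1)) (q := (0, 0, e₀, 0))
      (by simp) (by simp) (by simp) (by simp [he0]), le_rfl, ?_⟩
    rintro ℓ ⟨x, θ, e, ν, he, hιe', hν, rfl⟩ -
    have hee' : inner ℝ e e = 1 := by rw [real_inner_self_eq_norm_sq, he]; norm_num
    have hνν : inner ℝ ν ν = 1 := by
      rw [hν]
      simp only [inner_add_left, inner_add_right, inner_smul_left, inner_smul_right, conj_trivial,
        hιe', real_inner_comm (ι (η x)) e, LinearIsometry.inner_map_map, hη, hee']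
      nlinarith [Real.cos_sq_add_sin_sq θ]
    have hJ : (parallelMap (d + 1) ε ∘ₗ lieInclusion ι) (pointSphere (F x))
        = parallelMap (d + 1) ε (pointSphere (ι (F x))) := by
      rw [LinearMap.comp_apply, lieInclusion_pointSphere]
    refine ⟨x, _, hpt x, by simp [pointSphere], ?_, ?_, ?_, _, hpl x, by simp [orientedPlane]⟩
    · rw [hJ]
      intro h
      have h4 := congrArg (fun v : LieSpace (d + 1) => v.2.2.2) h
      simp only [parallelMap, pointSphere, LinearMap.coe_mk, AddHom.coe_mk] at h4
      have : -ε = 0 := by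
        refine Eq.trans ?_ h4
        ring
      linarith
    · rw [hJ, parallelMap_pointSphere ε hνν]
      exact Submodule.sub_mem _ (Submodule.subset_span (Or.inl rfl))
        (Submodule.smul_mem _ _ (Submodule.subset_span (Or.inr rfl)))
    · rw [hJ, mem_ker_prod]
      refine ⟨?_, ?_⟩
      · simp only [LinearMap.add_apply, LinearMap.smul_apply, radiusForm_apply,
          improperForm_apply, parallelMap, pointSphere, LinearMap.coe_mk, AddHom.coe_mk,
          smul_eq_mul]
        ring
      · simp only [centerForm_apply, parallelMap, pointSphere, LinearMap.coe_mk,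
          AddHom.coe_mk]
        rw [real_inner_comm, hιe]
  -- Cylinder: the tangent hyperplane, singled out by `improperForm`, is not affected by
  -- translations `t` orthogonal to its normal.
  · refine ⟨_, _, improperForm _, lieInclusion ι, finrank_ker_prod_add_two
      (improperForm _) (centerForm e₀) (p := (1, 0, 0, 0)) (q := (0, 0, e₀, 0))
      (by simp) (by simp) (by simp) (by simp [he0]), le_rfl, ?_⟩
    rintro ℓ ⟨x, t, ht, rfl⟩ -
    have hJ : lieInclusion ι (orientedPlane (F x) (η x))
        = orientedPlane (ι (F x) + t) (ι (η x)) := by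
      rw [lieInclusion_orientedPlane]
      simp only [orientedPlane, inner_add_left, real_inner_comm (ι (η x)) t, ht, add_zero]
    refine ⟨x, _, hpl x, by simp [orientedPlane], ?_, ?_, ?_, _, hpt x, ?_⟩
    · rw [hJ]
      intro h
      have h4 := congrArg (fun v : LieSpace (d + 1) => v.2.2.2) h
      simp [orientedPlane] at h4
    · rw [hJ]
      exact Submodule.subset_span (Or.inr rfl)
    · rw [lieInclusion_orientedPlane, mem_ker_prod]
      refine ⟨?_, ?_⟩
      · simp [orientedPlane]
      · simp only [centerForm_apply, orientedPlane]
        rw [real_inner_comm, hιe]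
    · simp only [improperForm_apply, pointSphere]
      intro h
      linarith
  · have ha0 : a ≠ 0 := by rintro rfl; simp at ha
    -- Surface of revolution: the spheres whose centre lies on the axis. `Q` may be smaller than
    -- `P`; it is the space that decides whether a line singles out a sphere.
    let Q : Submodule ℝ (LieSpace (d + 1)) :=
      ((LinearMap.ker (innerₛₗ ℝ a)).map ι.toLinearMap).comap
        (LinearMap.fst ℝ _ _ ∘ₗ LinearMap.snd ℝ _ _ ∘ₗ LinearMap.snd ℝ _ _)
    have hQ : ∀ v : LieSpace (d + 1), v ∈ Q ↔ ∃ u, inner ℝ a u = 0 ∧ ι u = v.2.2.1 := fun v => by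
      simp only [Q, Submodule.mem_comap, Submodule.mem_map, LinearMap.mem_ker]
      rfl
    refine ⟨_, Q, centerForm a, lieInclusion ι, finrank_ker_prod_add_two
      (centerForm (ι a)) (centerForm e₀) (p := (0, 0, ι a, 0)) (q := (0, 0, e₀, 0))
      (by simp [ha0]) (by rw [centerForm_apply, real_inner_comm]; exact hιe a) (by simp [hιe]) (by simp [he0]), ?_, ?_⟩
    · intro v hv
      obtain ⟨u, hu, huv⟩ := (hQ v).1 hv
      rw [mem_ker_prod]
      refine ⟨?_, ?_⟩
      · simp [← huv, hu]
      · simp only [centerForm_apply, ← huv]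
        rw [real_inner_comm, hιe]
    · rintro ℓ ⟨x, R, hR, rfl⟩ hℓ
      -- The combination of point sphere and plane with coefficients `s` and `-t` is centred on the
      -- axis, hence not moved by `R`. If `s = t = 0`, all spheres of the line are centred on the
      -- axis and none is distinguished; such lines lie in `Q` and are excluded.
      set s := inner ℝ a (η x) with hs
      set t := inner ℝ a (F x) with ht
      have hst : ¬ (s = 0 ∧ t = 0) := by
        rintro ⟨hs0, ht0⟩
        apply hℓ
        rw [contactLine, Submodule.span_le]
        rintro _ (rfl | rfl)
        · refine (hQ _).2 ⟨F x, ht0, ?_⟩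
          simp only [pointSphere]
          rw [hR _ (by rw [real_inner_comm]; exact ht0)]
        · refine (hQ _).2 ⟨η x, hs0, ?_⟩
          simp only [orientedPlane]
          rw [hR _ (by rw [real_inner_comm]; exact hs0)]
      have hu : inner ℝ a (s • F x - t • η x) = 0 := by
        rw [inner_sub_right, inner_smul_right, inner_smul_right, ← hs, ← ht]; ring
      have hJ : lieInclusion ι (s • pointSphere (F x) - t • orientedPlane (F x) (η x))
          = s • pointSphere (R (ι (F x))) - t • orientedPlane (R (ι (F x))) (R (ι (η x))) := by
        rw [map_sub, map_smul, map_smul, lieInclusion_pointSphere, lieInclusion_orientedPlane]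
        simp only [pointSphere, orientedPlane, LinearIsometryEquiv.inner_map_map]
        refine Prod.ext rfl (Prod.ext rfl (Prod.ext ?_ rfl))
        simp only [Prod.snd_sub, Prod.fst_sub, Prod.smul_snd, Prod.smul_fst]
        have h := hR _ (by rw [real_inner_comm]; exact hu)
        simp only [map_sub, map_smul] at h ⊢
        exact h.symm
      refine ⟨x, _, Submodule.sub_mem _ (Submodule.smul_mem _ s (hpt x))
        (Submodule.smul_mem _ t (hpl x)), ?_, ?_, ?_, ?_, ?_⟩
      · exact hu
      · intro h
        have h4 := congrArg (fun v : LieSpace (d + 1) => v.2.2.2) h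
        have h1 := congrArg (fun v : LieSpace (d + 1) => v.1 + v.2.1) h
        simp only [lieInclusion, pointSphere, orientedPlane, LinearMap.coe_mk, AddHom.coe_mk,
          Prod.fst_sub, Prod.snd_sub, Prod.smul_fst, Prod.smul_snd, smul_eq_mul, Prod.fst_zero,
          Prod.snd_zero] at h4 h1
        exact hst ⟨by linarith, by linarith⟩
      · rw [hJ]
        exact Submodule.sub_mem _ (Submodule.smul_mem _ _ (Submodule.subset_span (Or.inl rfl)))
          (Submodule.smul_mem _ _ (Submodule.subset_span (Or.inr rfl)))
      · exact (hQ _).2 ⟨_, hu, rfl⟩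
      · by_cases hs0 : s = 0
        · exact ⟨_, hpt x, fun h => hst ⟨hs0, h⟩⟩
        · exact ⟨_, hpl x, hs0⟩

end Focal

end LieSphere

namespace LieSphere

open LegendreFrame

theorem exists_smul_of_mem_span_pair {Λ : Type*} [AddCommGroup Λ] [Module ℝ Λ] {f : Λ →ₗ[ℝ] ℝ}
    {a b v : Λ} (hv : v ∈ Submodule.span ℝ {a, b}) (hfv : f v = 0) (hne : f a ≠ 0 ∨ f b ≠ 0) :
    ∃ t : ℝ, v = t • (f a • b - f b • a) := by
  obtain ⟨p, q, rfl⟩ := Submodule.mem_span_pair.1 hv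
  simp only [map_add, map_smul, smul_eq_mul] at hfv
  rcases hne with h | h
  · refine ⟨q / f a, ?_⟩
    have hp : p = -(q / f a * f b) := by field_simp; linarith
    rw [smul_sub, smul_smul, smul_smul, div_mul_cancel₀ _ h, hp, neg_smul]
    abel
  · refine ⟨-(p / f b), ?_⟩
    have hq : q = -(p / f b * f a) := by field_simp; linarith
    rw [smul_sub, smul_smul, smul_smul, neg_mul, neg_mul, div_mul_cancel₀ _ h, hq, neg_smul,
      neg_smul]
    abel

section
variable {d : ℕ} {W : Type*} [TopologicalSpace W] [ChartedSpace (E d) W] [IsManifold (𝓡 d) ∞ W]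
  {L : LegendreSubmanifold d W}

/-- The sphere supplied by `exists_focal` is a multiple of a map that is defined on a manifold of
dimension `c < d`. Some tangent vector therefore changes it only by a multiple of itself, and such a
vector is principal. -/
theorem LegendreSubmanifold.IsReducible.exists_eventually (hd : 1 ≤ d) {g : ℕ}
    (hg : ∀ x, (L.curvatureSpheres x).encard = g) (hred : L.IsReducible) (x : W) :
    ∃ P : Submodule ℝ (LieSpace (d + 1)),
      Module.finrank ℝ P + 2 = Module.finrank ℝ (LieSpace (d + 1)) ∧
      ∃ x₁ : W, ∀ᶠ y in 𝓝 x₁, ∃ K ∈ L.curvatureSpheres y, K.submodule ≤ P := by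
  obtain ⟨U, hU, hxU, β, -, c, M, _, _, _, _, _, L₀, F, η, C, hcd, -, hFη, hC, hUC⟩ := hred x
  obtain ⟨O, Y, Z, n₁, n₂, H⟩ := L.exists_localFrame hg x
  have Fr := H.frame
  have hB := isLieForm_lieBilin (d + 1)
  have hdim : Module.finrank ℝ (LieSpace (d + 1)) = Module.finrank ℝ (E d) + 4 := by
    rw [finrank_lieSpace]; simp
  set φ := chartAt (E d) x with hφ
  obtain ⟨P, Q, f, J, hP, hQP, hfoc⟩ := hC.exists_focal hcd hFη
  set P' := P.comap β.toLinearMap with hP'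
  set Q' := Q.comap β.toLinearMap with hQ'
  have hQP' : Q' ≤ P' := Submodule.comap_mono hQP
  have hP'dim : Module.finrank ℝ P' + 2 = Module.finrank ℝ (LieSpace (d + 1)) := by
    rw [← hP, hP']
    congr 1
    have h1 : P.comap β.toLinearMap = P.map β.symm.toLinearMap :=
      Submodule.comap_equiv_eq_map_symm β P
    rw [h1]
    exact LinearEquiv.finrank_map_eq β.symm P
  set O' := O ∩ (φ.target ∩ φ.symm ⁻¹' U) with hO'
  have hO'o : IsOpen O' := Fr.isOpen.inter (φ.isOpen_inter_preimage_symm hU)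
  have hO'ne : O'.Nonempty := ⟨φ x, H.mem, H.subset H.mem, by
    rw [mem_preimage, φ.left_inv (mem_chart_source _ x)]; exact hxU⟩
  -- At `x` itself the line could lie in `Q'`, where no sphere is distinguished. A nearby point
  -- whose line is not contained in `P'` avoids this, and a neighbourhood of that point is enough
  -- here.
  have hnot := Fr.not_le_of_isOpen hB hdim (by simp; omega) hO'o inter_subset_left hO'ne P' hP'dim
  push Not at hnot
  obtain ⟨y₁, hy₁, hnot⟩ := hnot
  obtain ⟨u, huQ, hu⟩ : ∃ u : LieSpace (d + 1) →L[ℝ] ℝ, (∀ v ∈ Q', u v = 0) ∧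
      (u (Y y₁) ≠ 0 ∨ u (Z y₁) ≠ 0) := by
    by_cases hY : Y y₁ ∈ P'
    · obtain ⟨f, hf, hfP⟩ := Q'.exists_le_ker_of_notMem fun h => hnot hY (hQP' h)
      exact ⟨f.toContinuousLinearMap, fun v hv => hfP hv, Or.inr hf⟩
    · obtain ⟨f, hf, hfP⟩ := Q'.exists_le_ker_of_notMem fun h => hY (hQP' h)
      exact ⟨f.toContinuousLinearMap, fun v hv => hfP hv, Or.inl hf⟩
  have hev : ∀ᶠ y in 𝓝 y₁, y ∈ O' ∧ (u (Y y) ≠ 0 ∨ u (Z y) ≠ 0) := by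
    refine (hO'o.eventually_mem hy₁).and ?_
    rcases hu with h | h
    · exact ((u.continuous.continuousAt.comp (Fr.diffY hy₁.1).continuousAt).eventually_ne h).mono
        fun _ h => Or.inl h
    · exact ((u.continuous.continuousAt.comp (Fr.diffZ hy₁.1).continuousAt).eventually_ne h).mono
        fun _ h => Or.inr h
  obtain ⟨O₁, hO₁, hO₁o, hyO₁⟩ := mem_nhds_iff.1 hev
  -- The intersection of the line with the kernel of `u`. Since `u` vanishes on `Q'`, this is the
  -- distinguished sphere, now depending smoothly on `y`.
  let k : E d → LieSpace (d + 1) := fun y => u (Y y) • Z y - u (Z y) • Y y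
  have hks : ∀ y ∈ O₁, ContDiffAt ℝ ∞ k y := fun y hy =>
    have hyO := (hO₁ hy).1.1
    ((u.contDiff.contDiffAt.comp y (Fr.smoothY y hyO)).smul (Fr.smoothZ y hyO)).sub
      ((u.contDiff.contDiffAt.comp y (Fr.smoothZ y hyO)).smul (Fr.smoothY y hyO))
  have hk0 : ∀ y ∈ O₁, k y ≠ 0 := by
    intro y hy h0
    have h2 := congrArg n₂ h0
    have h1 := congrArg n₁ h0
    have hyO := (hO₁ hy).1.1
    simp only [k, map_sub, map_smul, Fr.n₁Y _ hyO, Fr.n₁Z _ hyO, Fr.n₂Y _ hyO, Fr.n₂Z _ hyO,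
      smul_eq_mul, map_zero] at h1 h2
    rcases (hO₁ hy).2 with h | h
    · exact h (by linarith)
    · exact h (by linarith)
  let s₀ : M → LieSpace (c + 1) := fun x => f (L₀.Z₁ x) • L₀.Z₂ x - f (L₀.Z₂ x) • L₀.Z₁ x
  let J' : LieSpace (c + 1) →L[ℝ] LieSpace (d + 1) :=
    (β.symm.toLinearMap ∘ₗ J).toContinuousLinearMap
  have hs₀ : ContMDiff (𝓡 c) 𝓘(ℝ, LieSpace (c + 1)) ∞ s₀ :=
    ((f.toContinuousLinearMap.contMDiff.comp L₀.smooth₁).smul L₀.smooth₂).sub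
      ((f.toContinuousLinearMap.contMDiff.comp L₀.smooth₂).smul L₀.smooth₁)
  have hcone : ∀ y ∈ O₁, k y ∈ Q' ∧ ∃ (x : M) (t : ℝ), k y = t • J' (s₀ x) := by
    intro y hy
    have hyO := (hO₁ hy).1.1
    have hline := H.line y hyO
    have hnle : ¬ (L.line (φ.symm y)).map β.toLinearMap ≤ Q := by
      intro h
      rw [Submodule.map_le_iff_le_comap, hline, Submodule.span_le] at h
      rcases (hO₁ hy).2 with h' | h'
      · exact h' (huQ _ (h (Or.inl rfl)))
      · exact h' (huQ _ (h (Or.inr rfl)))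
    obtain ⟨x', v, hv, hfv, hJ0, hJℓ, hJQ, w, hw, hfw⟩ := hfoc _ (hUC _ (hO₁ hy).1.2.2) hnle
    obtain ⟨p, hp, hpJ⟩ := hJℓ
    have hpQ : p ∈ Q' := by
      change β.toLinearMap p ∈ Q
      rw [hpJ]; exact hJQ
    have hp0 : p ≠ 0 := by rintro rfl; exact hJ0 (by rw [← hpJ, map_zero])
    rw [SetLike.mem_coe, hline] at hp
    obtain ⟨t, ht⟩ := exists_smul_of_mem_span_pair (f := u.toLinearMap) hp (huQ p hpQ) (hO₁ hy).2
    have ht0 : t ≠ 0 := by rintro rfl; exact hp0 (by rw [ht, zero_smul])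
    have hkp : k y = t⁻¹ • p := by
      rw [ht, smul_smul, inv_mul_cancel₀ ht0, one_smul]; rfl
    have hne : f (L₀.Z₁ x') ≠ 0 ∨ f (L₀.Z₂ x') ≠ 0 := by
      by_contra hcon
      push Not at hcon
      obtain ⟨a, b, rfl⟩ := Submodule.mem_span_pair.1 hw
      apply hfw
      rw [map_add, map_smul, map_smul, hcon.1, hcon.2, smul_zero, smul_zero, add_zero]
    obtain ⟨t', ht'⟩ := exists_smul_of_mem_span_pair hv hfv hne
    refine ⟨by rw [hkp]; exact Submodule.smul_mem _ _ hpQ, x', t⁻¹ * t', ?_⟩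
    have hp' : p = β.symm (J v) := by
      rw [← hpJ]; exact (β.symm_apply_apply p).symm
    rw [hkp, hp', ht', map_smul, map_smul, smul_smul]
    rfl
  refine ⟨P', hP'dim, φ.symm y₁, ?_⟩
  have hy₁t : y₁ ∈ φ.target := hy₁.2.1
  have hc : Tendsto φ (𝓝 (φ.symm y₁)) (𝓝 y₁) := by
    have := φ.continuousAt (φ.map_target hy₁t)
    rwa [ContinuousAt, φ.right_inv hy₁t] at this
  filter_upwards [hc (hO₁o.mem_nhds hyO₁), φ.open_source.mem_nhds (φ.map_target hy₁t)] with z hz hzs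
  have hz' : φ z ∈ O₁ := hz
  set y := φ z with hyz
  have hyO := (hO₁ hz').1.1
  have hzy : φ.symm y = z := φ.left_inv hzs
  rw [← hzy]
  obtain ⟨X, hX0, a, hX⟩ := exists_fderiv_eq_smul_of_cone hcd (J'.contMDiff.comp hs₀) hO₁o hks hk0
    (fun y hy => (hcone y hy).2) hz'
  have hkd : HasFDerivAt k _ y :=
    ((u.hasFDerivAt.comp y (Fr.diffY hyO).hasFDerivAt).smul (Fr.diffZ hyO).hasFDerivAt).sub
      ((u.hasFDerivAt.comp y (Fr.diffZ hyO).hasFDerivAt).smul (Fr.diffY hyO).hasFDerivAt)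
  rw [hkd.fderiv] at hX
  simp only [ContinuousLinearMap.sub_apply, ContinuousLinearMap.add_apply,
    ContinuousLinearMap.smul_apply, ContinuousLinearMap.smulRight_apply,
    ContinuousLinearMap.comp_apply, Function.comp_apply] at hX
  have e1 := congrArg n₁ hX
  have e2 := congrArg n₂ hX
  simp only [k, map_sub, map_add, map_smul, smul_eq_mul, Fr.n₁_dY hyO, Fr.n₁_dZ hyO, Fr.n₂_dY hyO,
    Fr.n₂_dZ hyO, Fr.n₁Y _ hyO, Fr.n₁Z _ hyO, Fr.n₂Y _ hyO, Fr.n₂Z _ hyO] at e1 e2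
  -- The derivatives of `Y` and `Z` have no components seen by `n₁` and `n₂`. Comparing these
  -- components in `dk X = a k` determines the derivatives of the coefficients, and the remaining
  -- part must vanish.
  have hX' : u (Y y) • fderiv ℝ Z y X - u (Z y) • fderiv ℝ Y y X = 0 := by
    have e1' : u (fderiv ℝ Z y X) = a * u (Z y) := by linarith
    have e2' : u (fderiv ℝ Y y X) = a * u (Y y) := by linarith
    rw [e1', e2'] at hX
    simp only [k, smul_sub, smul_smul] at hX
    have : u (Y y) • fderiv ℝ Z y X - u (Z y) • fderiv ℝ Y y X
      = u (Y y) • fderiv ℝ Z y X + (a * u (Y y)) • Z y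
        - (u (Z y) • fderiv ℝ Y y X + (a * u (Z y)) • Y y)
        - ((a * u (Y y)) • Z y - (a * u (Z y)) • Y y) := by abel
    rw [this, hX, sub_self]
  -- Otherwise the sphere would be `Y`, and `X` would be in the kernel of `dY`.
  have huY : u (Y y) ≠ 0 := by
    intro h0
    rw [h0, zero_smul, zero_sub, neg_eq_zero] at hX'
    rcases smul_eq_zero.1 hX' with h | h
    · exact (hO₁ hz').2.elim (fun h' => h' h0) fun h' => h' h
    · exact hX0 (Fr.inj y hyO X h)
  have hkK : Z y + (-(u (Z y) / u (Y y))) • Y y = (u (Y y))⁻¹ • k y := by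
    simp only [k, smul_sub, smul_smul, inv_mul_cancel₀ huY, one_smul, neg_smul]
    rw [sub_eq_add_neg, inv_mul_eq_div]
  have hKne : Z y + (-(u (Z y) / u (Y y))) • Y y ≠ 0 := by
    rw [hkK]; exact smul_ne_zero (inv_ne_zero huY) (hk0 y hz')
  refine ⟨Projectivization.mk ℝ _ hKne, (H.sphere y hyO _).2 ⟨_, mem_spec.2 ⟨X, hX0, ?_⟩, hKne, rfl⟩,
    ?_⟩
  · change fderiv ℝ Z y X + (-(u (Z y) / u (Y y))) • fderiv ℝ Y y X = 0
    have h1 := congrArg (fun v => (u (Y y))⁻¹ • v) hX'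
    simp only [smul_sub, smul_smul, inv_mul_cancel₀ huY, one_smul, smul_zero] at h1
    rw [neg_smul, ← sub_eq_add_neg, div_eq_inv_mul]
    exact h1
  · rw [Projectivization.submodule_mk, Submodule.span_singleton_le_iff_mem, hkK]
    exact Submodule.smul_mem _ _ (hQP' (hcone y hz').1)

end

end LieSphere

/-! ### Necessity, globally: spreading the curvature sphere over the connected manifold. -/

namespace LieSphere

open LegendreFrame

section
variable {d : ℕ} {W : Type*} [TopologicalSpace W] [ChartedSpace (E d) W] [IsManifold (𝓡 d) ∞ W]
  {L : LegendreSubmanifold d W}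

theorem finrank_lieSpace_succ (d : ℕ) : Module.finrank ℝ (LieSpace (d + 1)) = d + 4 := by
  rw [finrank_lieSpace]

theorem finrank_lieSpace_eq (d : ℕ) :
    Module.finrank ℝ (LieSpace (d + 1)) = Module.finrank ℝ (E d) + 4 := by
  rw [finrank_lieSpace]; simp

theorem LegendreSubmanifold.exists_localSystem (hL : L.IsDupin) {g : ℕ}
    (hg : ∀ x, (L.curvatureSpheres x).encard = g) (x : W) :
    ∃ O Y Z n₁ n₂, L.LocalFrame x g O Y Z n₁ n₂ ∧ ∃ ε > 0, ∃ σ : Fin g → E d → ℝ,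
      BranchSystem O Y Z (Metric.ball (chartAt (E d) x x) ε) σ := by
  obtain ⟨O, Y, Z, n₁, n₂, H⟩ := L.exists_localFrame hg x
  exact ⟨O, Y, Z, n₁, n₂, H, H.frame.exists_branchSystem (isLieForm_lieBilin _)
    (finrank_lieSpace_eq d) H.encard (H.dupinCurves hL) H.mem⟩

theorem LegendreSubmanifold.not_eventually_line_le (hd : 1 ≤ d) {g : ℕ}
    (hg : ∀ x, (L.curvatureSpheres x).encard = g) {P : Submodule ℝ (LieSpace (d + 1))}
    (hP : Module.finrank ℝ P + 2 = Module.finrank ℝ (LieSpace (d + 1))) (x : W) :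
    ¬ ∀ᶠ y in 𝓝 x, L.line y ≤ P := by
  intro h
  obtain ⟨O, Y, Z, n₁, n₂, H⟩ := L.exists_localFrame hg x
  set φ := chartAt (E d) x with hφ
  have hc : Tendsto φ.symm (𝓝 (φ x)) (𝓝 x) := by
    have := φ.continuousAt_symm (H.subset H.mem)
    rwa [ContinuousAt, φ.left_inv (mem_chart_source _ x)] at this
  have hev : ∀ᶠ y in 𝓝 (φ x), y ∈ O ∧ L.line (φ.symm y) ≤ P :=
    (H.frame.isOpen.eventually_mem H.mem).and (hc.eventually h)
  obtain ⟨U, hU, hUo, hxU⟩ := mem_nhds_iff.1 hev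
  refine H.frame.not_le_of_isOpen (isLieForm_lieBilin _) (finrank_lieSpace_eq d) (by simp; omega)
    hUo (fun y hy => (hU hy).1) ⟨_, hxU⟩ P hP fun y hy => ?_
  have h1 := (hU hy).2
  rw [H.line y (hU hy).1] at h1
  exact ⟨h1 (Submodule.subset_span (Or.inl rfl)), h1 (Submodule.subset_span (Or.inr rfl))⟩

theorem LegendreSubmanifold.lieForm_eq_zero (x : W) {v w : LieSpace (d + 1)} (hv : v ∈ L.line x)
    (hw : w ∈ L.line x) : lieForm v w = 0 := by
  obtain ⟨p, q, rfl⟩ := Submodule.mem_span_pair.1 hv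
  obtain ⟨p', q', rfl⟩ := Submodule.mem_span_pair.1 hw
  simp only [← lieBilin_apply, map_add, map_smul, ContinuousLinearMap.add_apply,
    ContinuousLinearMap.smul_apply, smul_eq_mul]
  simp only [lieBilin_apply, L.isotropic₁₁, L.isotropic₂₂, L.isotropic₁₂,
    lieForm_comm (L.Z₂ x) (L.Z₁ x)]
  ring

theorem finrank_span_pair {Λ : Type*} [AddCommGroup Λ] [Module ℝ Λ] {v w : Λ}
    (h : LinearIndependent ℝ ![v, w]) : Module.finrank ℝ (Submodule.span ℝ {v, w}) = 2 := by
  have h' := finrank_span_eq_card h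
  have h2 : range ![v, w] = {v, w} := by
    simp only [Matrix.range_cons, Matrix.range_empty, union_empty, singleton_union]
  rwa [h2, Fintype.card_fin] at h'

theorem LegendreSubmanifold.finrank_line (x : W) : Module.finrank ℝ (L.line x) = 2 := by
  exact finrank_span_pair (L.linearIndependent x)

theorem LegendreSubmanifold.line_eq_span (x : W) {v w : LieSpace (d + 1)} (hv : v ∈ L.line x)
    (hw : w ∈ L.line x) (h : LinearIndependent ℝ ![v, w]) :
    L.line x = Submodule.span ℝ {v, w} := by
  symm
  refine Submodule.eq_of_le_of_finrank_le ?_ ?_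
  · rw [Submodule.span_le]
    rintro _ (rfl | rfl) <;> assumption
  · rw [L.finrank_line x, finrank_span_pair h]

/-- Two continuous families of points on the lines, lying in a subspace of codimension two,
coincide. -/
theorem LegendreSubmanifold.mk_eq_mk_of_mem (hd : 1 ≤ d) {g : ℕ}
    (hg : ∀ x, (L.curvatureSpheres x).encard = g) {P : Submodule ℝ (LieSpace (d + 1))}
    (hP : Module.finrank ℝ P + 2 = Module.finrank ℝ (LieSpace (d + 1))) {x : W}
    {k₁ k₂ : W → LieSpace (d + 1)} (hk₁ : ContinuousAt k₁ x) (hk₂ : ContinuousAt k₂ x)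
    (h₁ : ∀ᶠ y in 𝓝 x, k₁ y ∈ L.line y ∧ k₁ y ∈ P) (h₂ : ∀ᶠ y in 𝓝 x, k₂ y ∈ L.line y ∧ k₂ y ∈ P)
    (h₁0 : k₁ x ≠ 0) (h₂0 : k₂ x ≠ 0) :
    Projectivization.mk ℝ (k₁ x) h₁0 = Projectivization.mk ℝ (k₂ x) h₂0 := by
  by_contra hne
  have hind : LinearIndependent ℝ ![k₁ x, k₂ x] := by
    rw [LinearIndependent.pair_iff]
    intro s t hst
    by_contra hcon
    apply hne
    rw [Projectivization.mk_eq_mk_iff']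
    have hs : s ≠ 0 := by
      rintro rfl
      rw [zero_smul, zero_add] at hst
      rcases smul_eq_zero.1 hst with h | h
      · exact hcon ⟨rfl, h⟩
      · exact h₂0 h
    refine ⟨-(s⁻¹ * t), ?_⟩
    rw [neg_smul, neg_eq_iff_add_eq_zero]
    have := congrArg (fun v => s⁻¹ • v) hst
    simpa [smul_add, smul_smul, inv_mul_cancel₀ hs, add_comm] using this
  have hx₁ := h₁.self_of_nhds.1
  have hx₂ := h₂.self_of_nhds.1
  -- If the two points differ at `x`, the determinant keeps them independent nearby. They then span
  -- the lines, which would lie in `P` on an open set.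
  have hdet := det_ne_zero hind (L.lieForm_eq_zero x hx₁ hx₁) (L.lieForm_eq_zero x hx₂ hx₂)
    (L.lieForm_eq_zero x hx₁ hx₂)
  have hcd : ContinuousAt (fun y => (k₁ y).1 * (k₂ y).2.2.2 - (k₁ y).2.2.2 * (k₂ y).1) x := by
    have a1 : ∀ {k : W → LieSpace (d + 1)}, ContinuousAt k x → ContinuousAt (fun y => (k y).1) x :=
      fun h => continuous_fst.continuousAt.comp h
    have a4 : ∀ {k : W → LieSpace (d + 1)}, ContinuousAt k x →
      ContinuousAt (fun y => (k y).2.2.2) x := fun h =>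
        (continuous_snd.comp (continuous_snd.comp continuous_snd)).continuousAt.comp h
    exact ((a1 hk₁).mul (a4 hk₂)).sub ((a4 hk₁).mul (a1 hk₂))
  refine L.not_eventually_line_le hd hg hP x ?_
  filter_upwards [h₁, h₂, hcd.eventually_ne hdet] with y hy₁ hy₂ hy
  have hind' : LinearIndependent ℝ ![k₁ y, k₂ y] := by
    rw [LinearIndependent.pair_iff]
    intro s t hst
    have e1 := congrArg (fun v : LieSpace (d + 1) => v.1) hst
    have e4 := congrArg (fun v : LieSpace (d + 1) => v.2.2.2) hst
    simp only [Prod.fst_add, Prod.snd_add, Prod.smul_fst, Prod.smul_snd, smul_eq_mul, Prod.fst_zero,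
      Prod.snd_zero] at e1 e4
    constructor
    · refine (mul_eq_zero.1 (?_ : s * _ = 0)).resolve_right hy
      linear_combination (k₂ y).2.2.2 * e1 - (k₂ y).1 * e4
    · refine (mul_eq_zero.1 (?_ : t * _ = 0)).resolve_right hy
      linear_combination (k₁ y).1 * e4 - (k₁ y).2.2.2 * e1
  rw [L.line_eq_span y hy₁.1 hy₂.1 hind', Submodule.span_le]
  rintro _ (rfl | rfl)
  · exact hy₁.2
  · exact hy₂.2

/-- A family of curvature spheres contained in a subspace on some open set extends to a
neighborhood of each point of the closure. -/
theorem LegendreSubmanifold.LocalFrame.exists_sphere_mem {x : W} {g : ℕ} {O : Set (E d)}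
    {Y Z : E d → LieSpace (d + 1)} {n₁ n₂ : LieSpace (d + 1) →L[ℝ] ℝ}
    (H : L.LocalFrame x g O Y Z n₁ n₂) {ε : ℝ} {σ : Fin g → E d → ℝ}
    (S : BranchSystem O Y Z (Metric.ball (chartAt (E d) x x) ε) σ) (hε : 0 < ε)
    (P : Submodule ℝ (LieSpace (d + 1)))
    (hx : x ∈ closure {z | ∀ᶠ y in 𝓝 z, ∃ K ∈ L.curvatureSpheres y, K.submodule ≤ P}) :
    ∃ j, ∀ y ∈ Metric.ball (chartAt (E d) x x) ε, LegendreFrame.sphere Y Z (σ j) y ∈ P := by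
  set φ := chartAt (E d) x with hφ
  set D := Metric.ball (φ x) ε with hD
  have hxs : x ∈ φ.source := mem_chart_source _ x
  have hN : φ.source ∩ φ ⁻¹' D ∈ 𝓝 x :=
    (φ.isOpen_inter_preimage Metric.isOpen_ball).mem_nhds ⟨hxs, Metric.mem_ball_self hε⟩
  obtain ⟨z, hzN, hz⟩ := mem_closure_iff_nhds.1 hx _ hN
  have hcz : Tendsto φ.symm (𝓝 (φ z)) (𝓝 z) := by
    have := φ.continuousAt_symm (φ.map_source hzN.1)
    rwa [ContinuousAt, φ.left_inv hzN.1] at this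
  have hmem : ∀ᶠ w in 𝓝 (φ z), w ∈ D ∧ ∃ j, LegendreFrame.sphere Y Z (σ j) w ∈ P := by
    filter_upwards [hcz.eventually hz, Metric.isOpen_ball.mem_nhds hzN.2] with w hw hwD
    refine ⟨hwD, ?_⟩
    obtain ⟨K, hK, hKP⟩ := hw
    obtain ⟨τ, hτ, hne, rfl⟩ := (H.sphere w (S.subset hwD) K).1 hK
    rw [S.spec w hwD] at hτ
    obtain ⟨j, rfl⟩ := hτ
    refine ⟨j, ?_⟩
    rwa [Projectivization.submodule_mk, Submodule.span_singleton_le_iff_mem] at hKP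
  obtain ⟨T, hT, hTo, hzT⟩ := mem_nhds_iff.1 hmem
  classical
  let J : E d → Finset (Fin g) := fun w => Finset.univ.filter fun j => LegendreFrame.sphere Y Z (σ j) w ∈ P
  -- Which branch lies in `P` may depend on the point. The set `J w` can only shrink near `w₀`
  -- because `P` is closed; where its size is minimal it is locally constant, so one branch lies in
  -- `P` on an open set and unique continuation applies.
  obtain ⟨w₀, hw₀, hmin⟩ := (measure fun w => (J w).card).wf.has_min T ⟨_, hzT⟩
  have hclosed : IsClosed (P : Set (LieSpace (d + 1))) := P.closed_of_finiteDimensional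
  have hsub : ∀ᶠ w in 𝓝 w₀, J w ⊆ J w₀ := by
    have : ∀ᶠ w in 𝓝 w₀, ∀ j, LegendreFrame.sphere Y Z (σ j) w₀ ∉ P → LegendreFrame.sphere Y Z (σ j) w ∉ P := by
      refine eventually_all.2 fun j => ?_
      by_cases hj : LegendreFrame.sphere Y Z (σ j) w₀ ∈ P
      · exact Eventually.of_forall fun _ h => absurd hj h
      · obtain ⟨m, b⟩ := S.dupin j
        have hc := (H.frame.smooth_sphere (S.subset (hT hw₀).1)
          (b.smooth w₀ (hT hw₀).1)).continuousAt
        exact (hc.eventually (hclosed.isOpen_compl.mem_nhds hj)).mono fun w hw _ => hw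
    filter_upwards [this] with w hw j hj
    simp only [J, Finset.mem_filter, Finset.mem_univ, true_and] at hj ⊢
    by_contra hcon
    exact hw j hcon hj
  obtain ⟨j, hj⟩ := (hT hw₀).2
  refine ⟨j, S.unique_continuation H.frame (isLieForm_lieBilin _) (finrank_lieSpace_succ d) j P
    (hT hw₀).1 ?_⟩
  filter_upwards [hsub, hTo.mem_nhds hw₀] with w hw hwT
  have heq : J w = J w₀ := Finset.eq_of_subset_of_card_le hw (not_lt.1 (hmin w hwT))
  have : j ∈ J w := by
    rw [heq]; simp only [J, Finset.mem_filter, Finset.mem_univ, true_and]; exact hj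
  simpa [J] using this

/-- Reducibility implies the existence of a curvature sphere map in a subspace of codimension
two. -/
theorem LegendreSubmanifold.IsReducible.exists_curvatureSphereMap [ConnectedSpace W] (hd : 1 ≤ d)
    (hL : L.IsProperDupin) (hred : L.IsReducible) :
    ∃ K : W → ℙ ℝ (LieSpace (d + 1)), L.IsCurvatureSphereMap K ∧
      ∃ P : Submodule ℝ (LieSpace (d + 1)),
        Module.finrank ℝ P + 2 = Module.finrank ℝ (LieSpace (d + 1)) ∧
        ∀ x, (K x).submodule ≤ P := by
  obtain ⟨hDup, g, hg⟩ := hL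
  obtain ⟨x₀⟩ := (inferInstance : Nonempty W)
  obtain ⟨P, hP, x₁, hx₁⟩ := hred.exists_eventually hd hg x₀
  set A : Set W := {z | ∀ᶠ y in 𝓝 z, ∃ K ∈ L.curvatureSpheres y, K.submodule ≤ P} with hA
  choose O Y Z n₁ n₂ H ε hε σ S using fun x : W => L.exists_localSystem hDup hg x
  have hsphere : ∀ x, ∀ y ∈ Metric.ball (chartAt (E d) x x) (ε x), ∀ j,
      sphere (Y x) (Z x) (σ x j) y ≠ 0 := fun x y hy j =>
    (H x).frame.sphere_ne_zero ((S x).subset hy)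
  have hcurv : ∀ x, ∀ y (hy : y ∈ Metric.ball (chartAt (E d) x x) (ε x)), ∀ j,
      Projectivization.mk ℝ _ (hsphere x y hy j) ∈
        L.curvatureSpheres ((chartAt (E d) x).symm y) := fun x y hy j => by
    refine ((H x).sphere y ((S x).subset hy) _).2 ⟨σ x j y, ?_, hsphere x y hy j, rfl⟩
    rw [(S x).spec y hy]
    exact ⟨j, rfl⟩
  have hnhds : ∀ x, (chartAt (E d) x).source ∩
      chartAt (E d) x ⁻¹' Metric.ball (chartAt (E d) x x) (ε x) ∈ 𝓝 x := fun x =>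
    ((chartAt (E d) x).isOpen_inter_preimage Metric.isOpen_ball).mem_nhds
      ⟨mem_chart_source _ x, Metric.mem_ball_self (hε x)⟩
  -- At a point of the closure, a whole branch around that point lies in `P`, so the point belongs
  -- to `A`.
  have hAcl : IsClopen A := by
    refine ⟨?_, isOpen_setOf_eventually_nhds⟩
    rw [← closure_subset_iff_isClosed]
    intro x hx
    obtain ⟨j, hj⟩ := (H x).exists_sphere_mem (S x) (hε x) P hx
    refine mem_of_superset (hnhds x) ?_
    rintro y ⟨hys, hyb⟩
    refine ⟨Projectivization.mk ℝ _ (hsphere x _ hyb j), ?_, ?_⟩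
    · have := hcurv x _ hyb j
      rwa [(chartAt (E d) x).left_inv hys] at this
    · rw [Projectivization.submodule_mk, Submodule.span_singleton_le_iff_mem]
      exact hj _ hyb
  have hAuniv : A = univ := hAcl.eq_univ ⟨x₁, hx₁⟩
  have hj : ∀ x, ∃ j, ∀ y ∈ Metric.ball (chartAt (E d) x x) (ε x),
      sphere (Y x) (Z x) (σ x j) y ∈ P := fun x =>
    (H x).exists_sphere_mem (S x) (hε x) P (by rw [← hA, hAuniv]; exact subset_closure trivial)
  choose j hj using hj
  let k : W → W → LieSpace (d + 1) := fun x y =>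
    sphere (Y x) (Z x) (σ x (j x)) (chartAt (E d) x y)
  have hk : ∀ x, ∀ y ∈ (chartAt (E d) x).source ∩
      chartAt (E d) x ⁻¹' Metric.ball (chartAt (E d) x x) (ε x),
      k x y ∈ L.line y ∧ k x y ∈ P ∧ k x y ≠ 0 := by
    rintro x y ⟨hys, hyb⟩
    refine ⟨?_, hj x _ hyb, hsphere x _ hyb _⟩
    have := (H x).line _ ((S x).subset hyb)
    rw [(chartAt (E d) x).left_inv hys] at this
    rw [this]
    exact Submodule.add_mem _ (Submodule.subset_span (Or.inr rfl))
      (Submodule.smul_mem _ _ (Submodule.subset_span (Or.inl rfl)))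
  have hks : ∀ x, ContMDiffOn (𝓡 d) 𝓘(ℝ, LieSpace (d + 1)) ∞ (k x)
      ((chartAt (E d) x).source ∩
        chartAt (E d) x ⁻¹' Metric.ball (chartAt (E d) x x) (ε x)) := by
    intro x
    obtain ⟨m, b⟩ := (S x).dupin (j x)
    have h1 : ContMDiffOn 𝓘(ℝ, E d) 𝓘(ℝ, LieSpace (d + 1)) ∞ (sphere (Y x) (Z x) (σ x (j x)))
        (Metric.ball (chartAt (E d) x x) (ε x)) :=
      contMDiffOn_iff_contDiffOn.2 fun y hy =>
        ((H x).frame.smooth_sphere ((S x).subset hy) (b.smooth y hy)).contDiffWithinAt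
    have h2 : ContMDiffOn (𝓡 d) (𝓡 d) ∞ (chartAt (E d) x) (chartAt (E d) x).source :=
      contMDiffOn_chart
    exact h1.comp (h2.mono inter_subset_left) inter_subset_right
  have hkc : ∀ x, ∀ y ∈ (chartAt (E d) x).source ∩
      chartAt (E d) x ⁻¹' Metric.ball (chartAt (E d) x x) (ε x), ContinuousAt (k x) y := fun x y hy =>
    (hks x).continuousOn.continuousAt
      (((chartAt (E d) x).isOpen_inter_preimage Metric.isOpen_ball).mem_nhds hy)
  have hself : ∀ x, x ∈ (chartAt (E d) x).source ∩
      chartAt (E d) x ⁻¹' Metric.ball (chartAt (E d) x x) (ε x) := fun x => mem_of_mem_nhds (hnhds x)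
  refine ⟨fun x => Projectivization.mk ℝ (k x x) (hk x x (hself x)).2.2, ⟨fun x => ?_, fun x => ?_⟩,
    P, hP, fun x => ?_⟩
  · have := hcurv x _ (hself x).2 (j x)
    rwa [(chartAt (E d) x).left_inv (hself x).1] at this
  · refine ⟨_, k x, (chartAt (E d) x).isOpen_inter_preimage Metric.isOpen_ball, hself x, hks x,
      fun y hy => ⟨(hk x y hy).2.2, ?_⟩⟩
    -- The branches chosen at different centres are unrelated, but their spheres lie in `P` and must
    -- coincide. Hence the map defined by taking each point as its own centre has the smooth local
    -- lifts `k x`.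
    refine L.mk_eq_mk_of_mem hd hg hP (hkc y y (hself y)) (hkc x y hy) ?_ ?_ _ _
    · filter_upwards [hnhds y] with z hz using ⟨(hk y z hz).1, (hk y z hz).2.1⟩
    · filter_upwards [((chartAt (E d) x).isOpen_inter_preimage Metric.isOpen_ball).mem_nhds hy]
        with z hz using ⟨(hk x z hz).1, (hk x z hz).2.1⟩
  · rw [Projectivization.submodule_mk, Submodule.span_singleton_le_iff_mem]
    exact (hk x x (hself x)).2.1

end

end LieSphere

/-! ### Local completeness of the leaves and slices by hyperplanes. -/

theorem continuousAt_clm_prod {T Λ P Q : Type*} [TopologicalSpace T] [NormedAddCommGroup Λ]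
    [NormedSpace ℝ Λ] [NormedAddCommGroup P] [NormedSpace ℝ P] [NormedAddCommGroup Q]
    [NormedSpace ℝ Q] {a : T → Λ →L[ℝ] P} {c : T → Λ →L[ℝ] Q} {t : T} (ha : ContinuousAt a t)
    (hc : ContinuousAt c t) : ContinuousAt (fun q => (a q).prod (c q)) t :=
  ((ContinuousLinearMap.prodₗᵢ ℝ).continuous.continuousAt).comp (ha.prodMk hc)

namespace LegendreFrame

section Completeness
variable {V Λ : Type*} [NormedAddCommGroup V] [NormedSpace ℝ V] [FiniteDimensional ℝ V]
  [NormedAddCommGroup Λ] [NormedSpace ℝ Λ] [FiniteDimensional ℝ Λ]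
  {B : Λ →L[ℝ] Λ →L[ℝ] ℝ} {O : Set V} {Y Z : V → Λ} {n₁ n₂ : Λ →L[ℝ] ℝ}
  {U : Set V} {σ : V → ℝ} {m : ℕ}
  (F : LegendreFrame B O Y Z n₁ n₂) (hB : IsLieForm B)
  (hdim : Module.finrank ℝ Λ = Module.finrank ℝ V + 4) (b : DupinBranch O Y Z U σ m)

include F hB in
theorem sphere_sphere {y : V} (hy : y ∈ O) : B (sphere Y Z σ y) (sphere Y Z σ y) = 0 := by
  simp [sphere, F.YY _ hy, F.YZ _ hy, F.ZZ _ hy, hB.symm (Z y) (Y y)]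

include F hB b in
theorem DupinBranch.fderiv_sphere_sphere {y : V} (hy : y ∈ U) (X : V) :
    B (fderiv ℝ (sphere Y Z σ) y X) (sphere Y Z σ y) = 0 := by
  have h1 : (fun z => B (sphere Y Z σ z) (sphere Y Z σ z)) =ᶠ[𝓝 y] fun _ => 0 := by
    filter_upwards [b.isOpen.mem_nhds hy] with z hz using F.sphere_sphere hB (b.subset hz)
  have hd := (F.smooth_sphere (b.subset hy) (b.smooth y hy)).differentiableAt (by simp)
  have h2 := fderiv_bilinear B hd hd X
  rw [h1.fderiv_eq, hB.symm (sphere Y Z σ y)] at h2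
  simp at h2
  linarith

include F hB hdim b

/-- Each isotropic line through a curvature sphere, in contact with the curvature surface and close
to a line of the Legendre submanifold, belongs to the Legendre submanifold. -/
theorem DupinBranch.exists_of_null {y₁ : V} (hy₁ : y₁ ∈ U) {A₀ : Set V} (hA₀ : A₀ ∈ 𝓝 y₁) :
    ∀ᶠ p : V × Λ in 𝓝 (y₁, Y y₁), n₁ p.2 = 1 → n₂ p.2 = 0 → B p.2 p.2 = 0 →
      B (sphere Y Z σ p.1) p.2 = 0 → (∀ X, B (fderiv ℝ (sphere Y Z σ) p.1 X) p.2 = 0) →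
      ∃ y' ∈ A₀, y' ∈ U ∧ sphere Y Z σ y' = sphere Y Z σ p.1 ∧ Y y' = p.2 := by
  obtain ⟨R, D, π, π', e, r, L'⟩ := b.exists_leafCoordinates F hy₁ A₀ hA₀
  have hA₀' : interior A₀ ⊆ A₀ := interior_subset
  have b' : DupinBranch O Y Z U σ m := b
  have hLU : ∀ y ∈ e.source, y ∈ U := fun y hy => (L'.subset hy).1
  have L : LeafCoordinates Y Z σ y₁ U π π' e r := ⟨L'.mem, fun y hy => hLU y hy, L'.coe,
    L'.smooth_symm, L'.pos, L'.box, L'.const, L'.ker, L'.inj, L'.surj⟩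
  set K := sphere Y Z σ with hK
  have hKc : ∀ y ∈ U, ContinuousAt K y := fun y hy =>
    (F.smooth_sphere (b.subset hy) (b.smooth y hy)).continuousAt
  have hO₁ := b.subset hy₁
  -- the linear system determining a null vector
  let G := ℝ × (V →L[ℝ] ℝ) × ℝ × ℝ × D × ℝ
  let ℓ : V × Λ → Λ →L[ℝ] G := fun p =>
    (B (K p.1)).prod ((((ContinuousLinearMap.compL ℝ V Λ ℝ).flip (fderiv ℝ K p.1)) ∘L B).prod
      (n₁.prod (n₂.prod (π'.prod (B p.2)))))
  -- Two normalized null vectors `w` and `Y y'` with the same data differ by a solution of the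
  -- linear system at `w + Y y'`, since `B (w + Y y') (w - Y y')` is the difference of their
  -- squares. Near `Y y₁` this sum is close to `2 • Y y₁`, where the system is shown to be
  -- injective.
  have hℓ : ContinuousAt ℓ (y₁, (2 : ℝ) • Y y₁) := by
    have h1 : ContinuousAt (fun p : V × Λ => K p.1) (y₁, (2 : ℝ) • Y y₁) :=
      Tendsto.comp (hKc y₁ hy₁) continuousAt_fst
    have h2 : ContinuousAt (fun p : V × Λ => fderiv ℝ K p.1) (y₁, (2 : ℝ) • Y y₁) :=
      Tendsto.comp ((((F.smooth_sphere (b.subset hy₁)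
        (b.smooth y₁ hy₁)).fderiv_right (m := 0) (by simp)).continuousAt)) continuousAt_fst
    have h3 : ContinuousAt (fun p : V × Λ => B (K p.1)) (y₁, (2 : ℝ) • Y y₁) :=
      Tendsto.comp B.continuous.continuousAt h1
    have h4 : ContinuousAt (fun p : V × Λ => B p.2) (y₁, (2 : ℝ) • Y y₁) := by fun_prop
    have h5 : ContinuousAt (fun p : V × Λ =>
        ((ContinuousLinearMap.compL ℝ V Λ ℝ).flip (fderiv ℝ K p.1)) ∘L B)
        (y₁, (2 : ℝ) • Y y₁) := by fun_prop
    exact continuousAt_clm_prod h3 (continuousAt_clm_prod h5 (continuousAt_clm_prod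
      continuousAt_const (continuousAt_clm_prod continuousAt_const
      (continuousAt_clm_prod continuousAt_const h4))))
  obtain ⟨q, -, -, hsc, -⟩ := exists_kernel_section ℓ (y₁, (2 : ℝ) • Y y₁) hℓ
  have hker0 : LinearMap.ker (ℓ (y₁, (2 : ℝ) • Y y₁)).toLinearMap = ⊥ := by
    rw [LinearMap.ker_eq_bot']
    intro δ hδ
    have e1 : B (K y₁) δ = 0 := congrArg (fun p : G => p.1) hδ
    have e2 : ∀ X : V, B δ (fderiv ℝ K y₁ X) = 0 := fun X =>
      congrArg (fun p : G => p.2.1 X) hδ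
    have e3 : n₁ δ = 0 := congrArg (fun p : G => p.2.2.1) hδ
    have e4 : n₂ δ = 0 := congrArg (fun p : G => p.2.2.2.1) hδ
    have e5 : π' δ = 0 := congrArg (fun p : G => p.2.2.2.2.1) hδ
    have e6 : B ((2 : ℝ) • Y y₁) δ = 0 := congrArg (fun p : G => p.2.2.2.2.2) hδ
    have e7 : B δ (Y y₁) = 0 := by
      rw [map_smul, ContinuousLinearMap.smul_apply, hB.symm (Y y₁)] at e6
      simpa using e6
    rw [hK, hB.symm, sphere, map_add, map_smul, e7, smul_zero, add_zero] at e1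
    obtain ⟨X, rfl⟩ := F.exists_dY hB hdim hO₁ δ e7 e1 e3 e4
    have h1 : pencil Y Z (σ y₁) y₁ X = 0 := by
      refine F.pencil_eq_zero_of_orthogonal hB hdim hO₁ _ X fun X' => ?_
      have h2 := e2 X'
      rw [hK, F.fderiv_sphere hO₁ (b.smooth y₁ hy₁), map_add, map_smul, F.dY_Y hB hO₁, smul_zero,
        add_zero] at h2
      exact h2
    have h3 : fderiv ℝ (sphere Y Z σ) y₁ X = 0 := (b.fderiv_sphere_eq_zero_iff F hy₁ X).2 h1
    have h4 := L.inj y₁ L.mem X (by rw [h3, map_zero]) e5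
    rw [h4, map_zero]
  have hev : ∀ᶠ p in 𝓝 (y₁, (2 : ℝ) • Y y₁), ∀ δ, ℓ p δ = 0 → δ = 0 := by
    filter_upwards [hsc] with p hp
    rw [hker0, finrank_bot, Nat.le_zero, Submodule.finrank_eq_zero] at hp
    exact LinearMap.ker_eq_bot'.1 hp
  -- the point with the given leaf coordinates
  have hes : e.symm (π (K y₁), π' (Y y₁)) = y₁ := by rw [← L.coe y₁ L.mem, e.left_inv L.mem]
  have hpt : (π (K y₁), π' (Y y₁)) ∈ e.target :=
    L.mem_target (Metric.mem_ball_self L.pos) (Metric.mem_ball_self L.pos)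
  let s : V × Λ → V := fun p => e.symm (π (K p.1), π' p.2)
  have hin : Tendsto (fun p : V × Λ => (π (K p.1), π' p.2)) (𝓝 (y₁, Y y₁))
      (𝓝 (π (K y₁), π' (Y y₁))) := by
    have h1 : ContinuousAt (fun p : V × Λ => K p.1) (y₁, Y y₁) :=
      Tendsto.comp (hKc y₁ hy₁) continuousAt_fst
    exact (ContinuousAt.prodMk (π.continuous.continuousAt.comp h1)
      (π'.continuous.continuousAt.comp continuousAt_snd))
  have hs : Tendsto s (𝓝 (y₁, Y y₁)) (𝓝 y₁) := by
    have h1 := (e.continuousAt_symm hpt).tendsto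
    rw [hes] at h1
    exact h1.comp hin
  have hYs : Tendsto (fun p => (s p, p.2 + Y (s p))) (𝓝 (y₁, Y y₁)) (𝓝 (y₁, (2 : ℝ) • Y y₁)) := by
    refine hs.prodMk_nhds ?_
    rw [two_smul]
    exact continuousAt_snd.tendsto.add ((F.diffY hO₁).continuousAt.tendsto.comp hs)
  have hball : ∀ᶠ p : V × Λ in 𝓝 (y₁, Y y₁), π (K p.1) ∈ Metric.ball (π (K y₁)) r ∧
      π' p.2 ∈ Metric.ball (π' (Y y₁)) r := by
    have h1 := hin.eventually (prod_mem_nhds (Metric.ball_mem_nhds (π (K y₁)) L.pos)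
      (Metric.ball_mem_nhds (π' (Y y₁)) L.pos))
    filter_upwards [h1] with p hp using hp
  have hsrc : ∀ᶠ p : V × Λ in 𝓝 (y₁, Y y₁), p.1 ∈ e.source ∧
      π' (Y p.1) ∈ Metric.ball (π' (Y y₁)) r := by
    have h2 : ContinuousAt (fun y => π' (Y y)) y₁ :=
      π'.continuous.continuousAt.comp (F.diffY hO₁).continuousAt
    have h1 : ∀ᶠ y in 𝓝 y₁, y ∈ e.source ∧ π' (Y y) ∈ Metric.ball (π' (Y y₁)) r :=
      (e.open_source.eventually_mem L.mem).and (h2.eventually (Metric.ball_mem_nhds _ L.pos))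
    exact h1.prod_inl_nhds _
  filter_upwards [hYs.eventually hev, hball, hsrc] with p hp hpb hps h1 h2 h3 h4 h5
  obtain ⟨y, w⟩ := p
  simp only at *
  set y' := e.symm (π (K y), π' w) with hy'
  have htar := L.mem_target hpb.1 hpb.2
  have hys := e.map_target htar
  have hKy' : K y' = K y := by
    have e1 := L.sphere_symm hpb.1 hpb.2
    have e2 := L.sphere_symm hpb.1 hps.2
    rw [← L.coe y hps.1, e.left_inv hps.1] at e2
    rw [hK, hy', e1, e2]
  have hUy' := hLU _ hys
  refine ⟨y', (L'.subset hys).2, hUy', hKy', ?_⟩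
  have hδ := hp (w - Y y') ?_
  · exact (sub_eq_zero.1 hδ).symm
  have hO' := b.subset hUy'
  -- `y` and `y'` lie on the same leaf, and the range of `dK` is the same along a leaf.
  have hdK : ∀ X, B (fderiv ℝ K y' X) w = 0 := by
    intro X
    have e1 := L.fderiv_sphere_eq F b hpb.1 hpb.2 X
    obtain ⟨X', hX'⟩ := L.surj y hps.1 (π (fderiv ℝ (sphere Y Z σ) y' X))
    have e2 := L.fderiv_sphere_eq F b hpb.1 hps.2 X'
    rw [← L.coe y hps.1, e.left_inv hps.1, hX'] at e2
    rw [hK, e1, ← e2]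
    exact h5 X'
  have hz : ℓ (y', w + Y y') (w - Y y') = (0, 0, 0, 0, 0, 0) := by
    refine Prod.ext ?_ (Prod.ext ?_ (Prod.ext ?_ (Prod.ext ?_ (Prod.ext ?_ ?_))))
    · change B (K y') (w - Y y') = 0
      rw [map_sub, hB.symm (K y') (Y y'), F.Y_sphere hB hO', sub_zero, hKy', h4]
    · ext X
      change B (w - Y y') (fderiv ℝ K y' X) = 0
      rw [map_sub, ContinuousLinearMap.sub_apply, F.Y_fderiv_sphere hB b hUy', sub_zero, hB.symm]
      exact hdK X
    · change n₁ (w - Y y') = 0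
      rw [map_sub, h1, F.n₁Y _ hO', sub_self]
    · change n₂ (w - Y y') = 0
      rw [map_sub, h2, F.n₂Y _ hO', sub_self]
    · change π' (w - Y y') = 0
      rw [map_sub, (L.coe_symm htar).2, sub_self]
    · change B (w + Y y') (w - Y y') = 0
      rw [map_add, ContinuousLinearMap.add_apply, map_sub, map_sub, h3, F.YY _ hO',
        hB.symm (Y y') w]
      ring
  exact hz

/-- A Legendre submanifold whose curvature sphere is orthogonal to `e` is sliced by the hyperplane
orthogonal to `e`. -/
theorem DupinBranch.exists_slice {c : ℕ} (hc : Module.finrank ℝ V = c + 1) {e : Λ}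
    (he : B e e ≠ 0) (hKe : ∀ y ∈ U, B (sphere Y Z σ y) e = 0) {y₁ : V} (hy₁ : y₁ ∈ U)
    (hYe : B (Y y₁) e = 0) {A₀ : Set V} (hA₀ : A₀ ∈ 𝓝 y₁) :
    ∃ s : EuclideanSpace ℝ (Fin c) → V, ContDiff ℝ ∞ s ∧ (∀ v X, fderiv ℝ s v X = 0 → X = 0) ∧
      (∀ v, s v ∈ U ∧ s v ∈ A₀ ∧ B (Y (s v)) e = 0) ∧
      ∃ δ > 0, ∀ᶠ y in 𝓝 y₁, ∀ ν, ‖ν‖ < δ → (∀ z ∈ U, B (sphere Y Z σ z) ν = 0) →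
        B (Y y + ν) e = 0 → B (Y y + ν) (Y y + ν) = 0 →
        ∃ v, ∃ q r : ℝ, r ≠ 0 ∧ sphere Y Z σ (s v) = sphere Y Z σ y ∧
          Y y + ν = q • sphere Y Z σ y + r • Y (s v) := by
  have hO₁ := b.subset hy₁
  set φ : V →L[ℝ] ℝ := (B.flip e) ∘L fderiv ℝ Y y₁ with hφ
  -- The component of `e` transversal to the line is a value `dY X`, and `B (dY X) e = B e e`. So `B
  -- (Y ·) e` is a submersion at `y₁` and its zero set is a hypersurface.
  have hφX : ∃ X, φ X ≠ 0 := by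
    have hZe : B (Z y₁) e = 0 := by
      have h := hKe y₁ hy₁
      rwa [sphere, map_add, map_smul, ContinuousLinearMap.add_apply,
        ContinuousLinearMap.smul_apply, hYe, smul_zero, add_zero] at h
    obtain ⟨X, hX⟩ := F.exists_dY hB hdim hO₁ (e - n₁ e • Y y₁ - n₂ e • Z y₁)
      (by simp [hB.symm e, hYe, F.YY _ hO₁, hB.symm (Z y₁) (Y y₁), F.YZ _ hO₁])
      (by simp [hB.symm e, hZe, F.ZZ _ hO₁, F.YZ _ hO₁])
      (by simp [F.n₁Y _ hO₁, F.n₁Z _ hO₁]) (by simp [F.n₂Y _ hO₁, F.n₂Z _ hO₁])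
    refine ⟨X, ?_⟩
    rw [hφ, ContinuousLinearMap.comp_apply, hX]
    simpa [hYe, hZe] using he
  obtain ⟨θ, hθ⟩ := LinearMap.exists_leftInverse_of_injective
    (LinearMap.ker φ.toLinearMap).subtype (Submodule.ker_subtype _)
  have hker : Module.finrank ℝ (LinearMap.ker φ.toLinearMap) = c := by
    have h1 := LinearMap.finrank_range_add_finrank_ker φ.toLinearMap
    have h2 : LinearMap.range φ.toLinearMap = ⊤ := by
      obtain ⟨X, hX⟩ := hφX
      exact LinearMap.range_eq_top.2 (LinearMap.surjective fun h => hX (by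
        exact congrArg (fun f : V →ₗ[ℝ] ℝ => f X) h))
    rw [h2, finrank_top, Module.finrank_self, hc] at h1
    omega
  let q₀ : LinearMap.ker φ.toLinearMap ≃ₗ[ℝ] EuclideanSpace ℝ (Fin c) :=
    LinearEquiv.ofFinrankEq _ _ (by simpa using hker)
  let Θ : V →L[ℝ] EuclideanSpace ℝ (Fin c) := LinearMap.toContinuousLinearMap (q₀.toLinearMap ∘ₗ θ)
  have hN : U ∩ A₀ ∈ 𝓝 y₁ := inter_mem (b.isOpen.mem_nhds hy₁) hA₀
  set h : V → ℝ := fun y => B (Y y) e with hh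
  have hdiff : ∀ y ∈ U, ContDiffAt ℝ ∞ h y := fun y hy =>
    ((B.flip e).contDiff.contDiffAt).comp y (F.smoothY y (b.subset hy))
  have hfd : fderiv ℝ h y₁ = φ :=
    ((B.flip e).hasFDerivAt.comp y₁ (F.diffY hO₁).hasFDerivAt).fderiv
  obtain ⟨E, hE₁, hEs, hEc, hEsm, r, hr, htar, -⟩ := exists_constant_rank_coordinates h Θ
    (ContinuousLinearMap.id ℝ ℝ) y₁ (U ∩ A₀) hN (fun y hy => hdiff y hy.1)
    (fun y _ => Θ.contDiff.contDiffAt) (by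
      intro X h1 h2
      rw [hfd, ContinuousLinearMap.id_apply] at h1
      rw [Θ.fderiv] at h2
      have h3 : θ X = 0 := by simpa [Θ] using h2
      have h4 := LinearMap.congr_fun hθ ⟨X, h1⟩
      rw [LinearMap.comp_apply, Submodule.subtype_apply, h3] at h4
      exact congrArg Subtype.val h4.symm) (by simp [hc, add_comm])
    (fun y _ X h => h)
  have hEc' : ∀ y ∈ E.source, E y = (h y, Θ y) := hEc
  have htar' : ∀ t ∈ Metric.ball (Θ y₁) r, ((0 : ℝ), t) ∈ E.target := by
    intro t ht
    refine htar ⟨?_, ht⟩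
    rw [ContinuousLinearMap.id_apply, hh]
    simp only [hYe]
    exact Metric.mem_ball_self hr
  -- A diffeomorphism of the ball with the whole space, so that the slice is parametrized by all of
  -- `EuclideanSpace ℝ (Fin c)`.
  let u := OpenPartialHomeomorph.univBall (Θ y₁) r
  have hut : u.target = Metric.ball (Θ y₁) r := OpenPartialHomeomorph.univBall_target _ hr
  have hus : u.source = univ := OpenPartialHomeomorph.univBall_source _ _
  have huv : ∀ v, u v ∈ Metric.ball (Θ y₁) r := fun v => hut ▸ u.map_source (by rw [hus]; trivial)
  let s : EuclideanSpace ℝ (Fin c) → V := fun v => E.symm (0, u v)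
  have hsE : ∀ v, s v ∈ E.source := fun v => E.map_target (htar' _ (huv v))
  have hEs' : ∀ v, h (s v) = 0 ∧ Θ (s v) = u v := by
    intro v
    have h1 := E.right_inv (htar' _ (huv v))
    rw [hEc' _ (hsE v)] at h1
    exact ⟨congrArg Prod.fst h1, congrArg Prod.snd h1⟩
  have hsm : ContDiff ℝ ∞ s := by
    rw [contDiff_iff_contDiffAt]
    intro v
    exact ContDiffAt.comp v (hEsm _ (htar' _ (huv v)))
      (contDiffAt_const.prodMk OpenPartialHomeomorph.contDiff_univBall.contDiffAt)
  refine ⟨s, hsm, ?_, fun v => ⟨(hEs (hsE v)).1, (hEs (hsE v)).2, (hEs' v).1⟩, ?_⟩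
  · intro v X hX
    have hd : DifferentiableAt ℝ u.symm (Θ (s v)) := by
      rw [(hEs' v).2]
      have h1 := (OpenPartialHomeomorph.contDiffOn_univBall_symm (n := 1) (c := Θ y₁) (r := r)
        |>.contDiffAt (Metric.isOpen_ball.mem_nhds (huv v)))
      exact h1.differentiableAt (by simp)
    have h1 : HasFDerivAt (fun v => u.symm (Θ (s v)))
        (fderiv ℝ u.symm (Θ (s v)) ∘L (Θ ∘L fderiv ℝ s v)) v :=
      hd.hasFDerivAt.comp v (Θ.hasFDerivAt.comp v
        ((hsm.differentiable (by simp)) v).hasFDerivAt)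
    have h2 : (fun v => u.symm (Θ (s v))) = id := by
      funext v
      rw [(hEs' v).2, u.left_inv (by rw [hus]; trivial), id]
    rw [h2] at h1
    have h3 := congrArg (fun f => f X) (h1.unique (hasFDerivAt_id v))
    simpa [hX] using h3.symm
  · have hA₁ : E.source ∩ Θ ⁻¹' Metric.ball (Θ y₁) r ∈ 𝓝 y₁ :=
      inter_mem (E.open_source.mem_nhds hE₁)
        (Θ.continuous.continuousAt.preimage_mem_nhds (Metric.ball_mem_nhds _ hr))
    have hLC := b.exists_of_null F hB hdim hy₁ hA₁
    -- `Y + ν` need not be normalized. Subtracting `n₂ ν` times the curvature sphere removes the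
    -- value under `n₂` and leaves `R` under `n₁`; dividing by `R` gives a normalized vector on the
    -- same line.
    let R : V × Λ → ℝ := fun p => 1 + n₁ p.2 - n₂ p.2 * σ p.1
    have hσc : ContinuousAt (fun p : V × Λ => σ p.1) (y₁, (0 : Λ)) :=
      Tendsto.comp (b.smooth y₁ hy₁).continuousAt continuousAt_fst
    have hYc : ContinuousAt (fun p : V × Λ => Y p.1) (y₁, (0 : Λ)) :=
      Tendsto.comp (F.diffY hO₁).continuousAt continuousAt_fst
    have hKc : ContinuousAt (fun p : V × Λ => sphere Y Z σ p.1) (y₁, (0 : Λ)) :=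
      Tendsto.comp (F.smooth_sphere hO₁ (b.smooth y₁ hy₁)).continuousAt continuousAt_fst
    have hRc : ContinuousAt R (y₁, (0 : Λ)) :=
      ContinuousAt.sub (by fun_prop) (ContinuousAt.mul (by fun_prop) hσc)
    have hR1 : R (y₁, (0 : Λ)) = 1 := by simp [R]
    have hw : Tendsto (fun p : V × Λ => (p.1, (R p)⁻¹ • (Y p.1 + p.2 - n₂ p.2 • sphere Y Z σ p.1)))
        (𝓝 (y₁, (0 : Λ))) (𝓝 (y₁, Y y₁)) := by
      have h1 : ContinuousAt (fun p : V × Λ => (p.1, (R p)⁻¹ • (Y p.1 + p.2 -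
          n₂ p.2 • sphere Y Z σ p.1))) (y₁, (0 : Λ)) := by
        refine continuousAt_fst.prodMk ((hRc.inv₀ (by rw [hR1]; simp)).smul ?_)
        exact (hYc.add continuousAt_snd).sub (ContinuousAt.smul (by fun_prop) hKc)
      have h2 := h1.tendsto
      simpa [hR1] using h2
    have hU' : ∀ᶠ p : V × Λ in 𝓝 (y₁, (0 : Λ)), p.1 ∈ U :=
      (b.isOpen.eventually_mem hy₁).prod_inl_nhds _
    have hall := ((hw.eventually hLC).and (hRc.eventually_ne (by rw [hR1]; exact one_ne_zero))).and hU'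
    rw [nhds_prod_eq, eventually_prod_iff] at hall
    obtain ⟨pa, hpa, pb, hpb, hab⟩ := hall
    obtain ⟨δ, hδ, hball⟩ := Metric.eventually_nhds_iff_ball.1 hpb
    refine ⟨δ, hδ, hpa.mono fun y hy ν hν hKν hYν hnull => ?_⟩
    obtain ⟨⟨h1, h2⟩, h3⟩ := hab hy (hball ν (by simpa using hν))
    simp only at h1 h2 h3
    have hO := b.subset h3
    have hKK := F.sphere_sphere (σ := σ) hB hO
    have hKY : B (sphere Y Z σ y) (Y y) = 0 := by rw [hB.symm]; exact F.Y_sphere hB hO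
    have hdKK := b.fderiv_sphere_sphere F hB h3
    -- The moved line still contains `K y` and is orthogonal to `dK`, because `ν` is orthogonal to
    -- every value of `K`. It therefore occurs in the submanifold, at a point where `B (Y ·) e`
    -- vanishes.
    obtain ⟨y', hy', hyU', hK', hY'⟩ := h1
      (by
        simp only [map_smul, map_sub, map_add, F.n₁Y _ hO, smul_eq_mul, sphere, F.n₁Z _ hO]
        rw [inv_mul_eq_one₀ h2]; simp [R])
      (by simp [F.n₂Y _ hO, F.n₂_sphere hO])
      (by
        have e1 := hKν y h3
        have e2 : B (Y y + ν - n₂ ν • sphere Y Z σ y) (Y y + ν - n₂ ν • sphere Y Z σ y) = 0 := by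
          have e3 : B (sphere Y Z σ y) (Y y + ν) = 0 := by rw [map_add, hKY, e1, add_zero]
          simp only [map_sub, map_smul, ContinuousLinearMap.sub_apply,
            ContinuousLinearMap.smul_apply, hB.symm (Y y + ν) (sphere Y Z σ y), hnull, e3, hKK,
            smul_zero, sub_zero]
        rw [map_smul, map_smul, ContinuousLinearMap.smul_apply, e2, smul_zero, smul_zero])
      (by simp [hKK, hKY, hKν y h3])
      (by
        intro X
        have e1 : B (fderiv ℝ (sphere Y Z σ) y X) ν = 0 := by
          have e2 : (fun z => B (sphere Y Z σ z) ν) =ᶠ[𝓝 y] fun _ => 0 := by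
            filter_upwards [b.isOpen.mem_nhds h3] with z hz using hKν z hz
          have e3 := ((B.flip ν).hasFDerivAt.comp y (((F.smooth_sphere hO
            (b.smooth y h3)).differentiableAt (by simp)).hasFDerivAt)).fderiv
          have e4 := e2.fderiv_eq (𝕜 := ℝ)
          rw [(hasFDerivAt_const (0 : ℝ) y).fderiv] at e4
          exact congrArg (fun f => f X) (e3.symm.trans e4)
        have e5 : B (fderiv ℝ (sphere Y Z σ) y X) (Y y) = 0 := by
          rw [hB.symm]; exact F.Y_fderiv_sphere hB b h3 X
        simp [e1, e5, hdKK])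
    have hy'0 : h y' = 0 := by
      rw [hh]
      simp only [hY']
      have e1 := hKe y h3
      rw [map_add, ContinuousLinearMap.add_apply] at hYν
      simp [e1, hYν]
    have hu' : Θ y' ∈ u.target := hut ▸ hy'.2
    have hsy : s (u.symm (Θ y')) = y' := by
      change E.symm (0, u (u.symm (Θ y'))) = y'
      rw [u.right_inv hu', ← hy'0, ← hEc' y' hy'.1, E.left_inv hy'.1]
    refine ⟨u.symm (Θ y'), n₂ ν, R (y, ν), h2, by rw [hsy, hK'], ?_⟩
    rw [hsy, hY', smul_inv_smul₀ h2]
    abel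

end Completeness

end LegendreFrame

/-! ### Countably many slices as one Dupin submanifold with a Euclidean projection. -/

namespace LieSphere

/-- Countably many copies of Euclidean space. -/
def Sheets (c : ℕ) : Type := ℕ × E c

namespace Sheets
variable {c : ℕ}

/-- The number of the copy. -/
def index (p : Sheets c) : ℕ := Prod.fst p

/-- The position in the copy. -/
def point (p : Sheets c) : E c := Prod.snd p

/-- A point of one of the copies. -/
def of (n : ℕ) (v : E c) : Sheets c := (n, v)

instance : TopologicalSpace (Sheets c) := inferInstanceAs (TopologicalSpace (ℕ × E c))
instance : T2Space (Sheets c) := inferInstanceAs (T2Space (ℕ × E c))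
instance : SecondCountableTopology (Sheets c) :=
  inferInstanceAs (SecondCountableTopology (ℕ × E c))

theorem continuous_point : Continuous (point (c := c)) :=
  continuous_snd (X := ℕ) (Y := E c)

theorem continuous_index : Continuous (index (c := c)) :=
  continuous_fst (X := ℕ) (Y := E c)

theorem isOpen_sheet (n : ℕ) : IsOpen {p : Sheets c | p.index = n} :=
  (isOpen_discrete {n}).preimage continuous_index

/-- The coordinates on one of the copies. -/
noncomputable def sheetChart (n : ℕ) : OpenPartialHomeomorph (Sheets c) (E c) where
  toFun := point
  invFun := of n
  source := {p | p.index = n}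
  target := univ
  map_source' _ _ := trivial
  map_target' _ _ := rfl
  left_inv' p hp := Prod.ext (Eq.symm hp) rfl
  right_inv' _ _ := rfl
  open_source := isOpen_sheet n
  open_target := isOpen_univ
  continuousOn_toFun := continuous_point.continuousOn
  continuousOn_invFun := (Continuous.prodMk_right (X := ℕ) (Y := E c) n).continuousOn

noncomputable instance : ChartedSpace (E c) (Sheets c) where
  atlas := range sheetChart
  chartAt p := sheetChart p.index
  mem_chart_source _ := rfl
  chart_mem_atlas p := ⟨p.index, rfl⟩

instance : IsManifold (𝓡 c) ∞ (Sheets c) := by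
  apply isManifold_of_contDiffOn
  rintro _ _ ⟨n, rfl⟩ ⟨n', rfl⟩
  exact contDiffOn_id

variable {T : Type*} [NormedAddCommGroup T] [NormedSpace ℝ T]

theorem contMDiff_iff {f : Sheets c → T} (hf : ∀ n, ContDiff ℝ ∞ (fun v => f (of n v))) :
    ContMDiff (𝓡 c) 𝓘(ℝ, T) ∞ f := by
  intro p
  have h1 : ContMDiffAt (𝓡 c) 𝓘(ℝ, E c) ∞ (point (c := c)) p :=
    contMDiffAt_extChartAt (I := 𝓡 c) (x := p)
  have h2 := (hf p.index).contMDiff.contMDiffAt.comp p h1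
  refine h2.congr_of_eventuallyEq ?_
  filter_upwards [(isOpen_sheet p.index).mem_nhds rfl] with q hq
  change f q = f (of p.index q.point)
  rw [← show q.index = p.index from hq]
  rfl

theorem hasMFDerivAt {f : Sheets c → T} (hf : ∀ n, ContDiff ℝ ∞ (fun v => f (of n v)))
    (p : Sheets c) :
    HasMFDerivAt (𝓡 c) 𝓘(ℝ, T) f p (fderiv ℝ (fun v => f (of p.index v)) p.point) := by
  refine ⟨(contMDiff_iff hf).continuous.continuousAt, ?_⟩
  have h := (((hf p.index).differentiable (by simp)) p.point).hasFDerivAt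
  exact h.hasFDerivWithinAt

end Sheets

end LieSphere

namespace LegendreFrame

/-- Along a map tangent to curvature surfaces, the curvature sphere is locally constant. -/
theorem BranchSystem.eventually_sphere_eq {V Λ X' : Type*} [NormedAddCommGroup V]
    [NormedSpace ℝ V] [FiniteDimensional ℝ V] [NormedAddCommGroup Λ] [NormedSpace ℝ Λ]
    [FiniteDimensional ℝ Λ] [NormedAddCommGroup X'] [NormedSpace ℝ X']
    {B : Λ →L[ℝ] Λ →L[ℝ] ℝ} {O : Set V} {Y Z : V → Λ} {n₁ n₂ : Λ →L[ℝ] ℝ} {U : Set V} {g : ℕ}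
    {σ : Fin g → V → ℝ} (S : BranchSystem O Y Z U σ) (F : LegendreFrame B O Y Z n₁ n₂)
    {G : Set X'} (hG : IsOpen G) {f : X' → V} (hf : ∀ u ∈ G, ContDiffAt ℝ ∞ f u)
    (hfU : ∀ u ∈ G, f u ∈ U)
    (hex : ∀ u ∈ G, ∃ j, ∀ X, pencil Y Z (σ j (f u)) (f u) (fderiv ℝ f u X) = 0)
    (hne : ∀ u ∈ G, ∃ X, fderiv ℝ f u X ≠ 0) {u₀ : X'} (hu₀ : u₀ ∈ G) {j₀ : Fin g}
    (hj₀ : ∀ X, pencil Y Z (σ j₀ (f u₀)) (f u₀) (fderiv ℝ f u₀ X) = 0) :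
    ∀ᶠ u in 𝓝 u₀, (∀ X, pencil Y Z (σ j₀ (f u)) (f u) (fderiv ℝ f u X) = 0) ∧
      sphere Y Z (σ j₀) (f u) = sphere Y Z (σ j₀) (f u₀) := by
  -- A nonzero tangent vector is principal for one branch only, and not being principal is an open
  -- condition. So the branch cannot switch near `u₀`, and the derivative of its sphere along `f`
  -- vanishes.
  have h1 : ∀ j, j ≠ j₀ → ∀ᶠ u in 𝓝 u₀,
      ¬ ∀ X, pencil Y Z (σ j (f u)) (f u) (fderiv ℝ f u X) = 0 := by
    intro j hj
    obtain ⟨X, hX⟩ := hne u₀ hu₀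
    obtain ⟨m, b⟩ := S.dupin j
    have hp : pencil Y Z (σ j (f u₀)) (f u₀) (fderiv ℝ f u₀ X) ≠ 0 := fun h =>
      hj (S.inj _ (hfU u₀ hu₀) (F.eq_of_pencil (S.subset (hfU u₀ hu₀)) hX h (hj₀ X)))
    have hc : ContinuousAt (fun u => pencil Y Z (σ j (f u)) (f u) (fderiv ℝ f u X)) u₀ := by
      have h2 : ContinuousAt (fun u => pencil Y Z (σ j (f u)) (f u)) u₀ :=
        Tendsto.comp (b.toBranch.smooth_pencil F (hfU u₀ hu₀)).continuousAt
          (hf u₀ hu₀).continuousAt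
      have h3 : ContinuousAt (fun u => fderiv ℝ f u) u₀ :=
        ((hf u₀ hu₀).fderiv_right (m := 0) (by simp)).continuousAt
      exact h2.clm_apply (h3.clm_apply continuousAt_const)
    exact (hc.eventually_ne hp).mono fun u hu h => hu (h X)
  have h2 : ∀ᶠ u in 𝓝 u₀, u ∈ G ∧ ∀ X, pencil Y Z (σ j₀ (f u)) (f u) (fderiv ℝ f u X) = 0 := by
    have h3 : ∀ᶠ u in 𝓝 u₀, ∀ j, j ≠ j₀ →
        ¬ ∀ X, pencil Y Z (σ j (f u)) (f u) (fderiv ℝ f u X) = 0 := by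
      rw [eventually_all]
      intro j
      by_cases hj : j = j₀
      · exact Eventually.of_forall fun _ h => absurd hj h
      · exact (h1 j hj).mono fun u hu _ => hu
    filter_upwards [h3, hG.mem_nhds hu₀] with u hu huG
    obtain ⟨j, hj⟩ := hex u huG
    by_cases hjj : j = j₀
    · exact ⟨huG, hjj ▸ hj⟩
    · exact absurd hj (hu j hjj)
  obtain ⟨r, hr, hball⟩ := Metric.eventually_nhds_iff_ball.1 h2
  obtain ⟨m, b⟩ := S.dupin j₀
  have hd : ∀ u ∈ Metric.ball u₀ r,
      HasFDerivAt (fun u => sphere Y Z (σ j₀) (f u)) (0 : X' →L[ℝ] Λ) u := by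
    intro u hu
    have hfu := hfU u (hball u hu).1
    have h3 := ((F.smooth_sphere (S.subset hfu) (b.smooth _ hfu)).differentiableAt
      (by simp)).hasFDerivAt.comp u ((hf u (hball u hu).1).differentiableAt (by simp)).hasFDerivAt
    have h4 : fderiv ℝ (sphere Y Z (σ j₀)) (f u) ∘L fderiv ℝ f u = 0 := by
      ext X
      exact (b.fderiv_sphere_eq_zero_iff F hfu _).2 ((hball u hu).2 X)
    rw [h4] at h3
    exact h3
  filter_upwards [Metric.ball_mem_nhds u₀ hr] with u hu
  refine ⟨(hball u hu).2, ?_⟩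
  refine (convex_ball u₀ r).is_const_of_fderivWithin_eq_zero (𝕜 := ℝ)
    (fun z hz => (hd z hz).differentiableAt.differentiableWithinAt) (fun z hz => ?_) hu
    (Metric.mem_ball_self hr)
  exact (hd z hz).hasFDerivWithinAt.fderivWithin (Metric.isOpen_ball.uniqueDiffWithinAt hz)

end LegendreFrame

namespace LieSphere
open LegendreFrame

/-- Slices of a Legendre submanifold by hyperplanes, together with linear maps that are isometric
on these hyperplanes. -/
structure SliceFamily {c d : ℕ} (Y Z : E d → LieSpace (d + 1)) (U : Set (E d))
    (s : ℕ → E c → E d) (e : ℕ → LieSpace (d + 1))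
    (Φ : ℕ → LieSpace (d + 1) →ₗ[ℝ] LieSpace (c + 1)) : Prop where
  smooth : ∀ n, ContDiff ℝ ∞ (s n)
  inj : ∀ n v X, fderiv ℝ (s n) v X = 0 → X = 0
  mem : ∀ n v, s n v ∈ U
  orthY : ∀ n v, lieForm (Y (s n v)) (e n) = 0
  orthZ : ∀ n v, lieForm (Z (s n v)) (e n) = 0
  isometric : ∀ n x y, lieForm x (e n) = 0 → lieForm y (e n) = 0 →
    lieForm (Φ n x) (Φ n y) = lieForm x y
  ker : ∀ n x, lieForm x (e n) = 0 → Φ n x = 0 → x = 0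

namespace SliceFamily
variable {c d : ℕ} {O : Set (E d)} {Y Z : E d → LieSpace (d + 1)}
  {n₁ n₂ : LieSpace (d + 1) →L[ℝ] ℝ} {U : Set (E d)} {g : ℕ} {σ : Fin g → E d → ℝ}
  {s : ℕ → E c → E d} {e : ℕ → LieSpace (d + 1)}
  {Φ : ℕ → LieSpace (d + 1) →ₗ[ℝ] LieSpace (c + 1)}
  (H : SliceFamily Y Z U s e Φ) (F : LegendreFrame (lieBilin (d + 1)) O Y Z n₁ n₂) (hU : U ⊆ O)

section Maps
include H hU

theorem smooth_comp {f : E d → LieSpace (d + 1)} (hf : ∀ y ∈ O, ContDiffAt ℝ ∞ f y) (n : ℕ) :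
    ContDiff ℝ ∞ (fun v => Φ n (f (s n v))) := by
  rw [contDiff_iff_contDiffAt]
  intro v
  have h1 := (hf _ (hU (H.mem n v))).comp v (H.smooth n).contDiffAt
  exact (Φ n).toContinuousLinearMap.contDiff.contDiffAt.comp v h1

theorem differential_comp {f : E d → LieSpace (d + 1)} (hf : ∀ y ∈ O, ContDiffAt ℝ ∞ f y)
    (p : Sheets c) (X : E c) :
    differential (fun p : Sheets c => Φ p.index (f (s p.index p.point))) p X
      = Φ p.index (fderiv ℝ f (s p.index p.point) (fderiv ℝ (s p.index) p.point X)) := by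
  rw [differential, (Sheets.hasMFDerivAt (fun n => H.smooth_comp hU hf n) p).mfderiv]
  have h1 := ((hf _ (hU (H.mem p.index p.point))).differentiableAt (by simp)).hasFDerivAt.comp p.point
    (((H.smooth p.index).differentiable (by simp)) p.point).hasFDerivAt
  have h2 := (Φ p.index).toContinuousLinearMap.hasFDerivAt.comp p.point h1
  exact congrArg (fun f => f X) h2.fderiv

theorem orth_fderiv {f : E d → LieSpace (d + 1)} (hf : ∀ y ∈ O, ContDiffAt ℝ ∞ f y) (n : ℕ)
    (ho : ∀ v, lieForm (f (s n v)) (e n) = 0) (v X : E c) :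
    lieForm (fderiv ℝ f (s n v) (fderiv ℝ (s n) v X)) (e n) = 0 := by
  have h1 := ((hf _ (hU (H.mem n v))).differentiableAt (by simp)).hasFDerivAt.comp v
    (((H.smooth n).differentiable (by simp)) v).hasFDerivAt
  have h2 := ((lieBilin (d + 1)).flip (e n)).hasFDerivAt.comp v h1
  have h3 : (((lieBilin (d + 1)).flip (e n)) ∘ f ∘ s n) = fun _ => 0 := funext ho
  rw [h3] at h2
  exact congrArg (fun f => f X) (h2.unique (hasFDerivAt_const (0 : ℝ) v))

end Maps

theorem map_mem_span {n : ℕ} (H : SliceFamily Y Z U s e Φ) {v : E c} {x : LieSpace (d + 1)}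
    (hx : lieForm x (e n) = 0)
    (h : Φ n x ∈ Submodule.span ℝ {Φ n (Y (s n v)), Φ n (Z (s n v))}) :
    x ∈ Submodule.span ℝ {Y (s n v), Z (s n v)} := by
  obtain ⟨p, q, hpq⟩ := Submodule.mem_span_pair.1 h
  refine Submodule.mem_span_pair.2 ⟨p, q, ?_⟩
  rw [← sub_eq_zero]
  refine H.ker n _ ?_ (by rw [map_sub, ← hpq]; simp)
  have h1 := H.orthY n v
  have h2 := H.orthZ n v
  rw [← lieBilin_apply] at *
  simp [h1, h2, hx]

include F in
theorem eq_zero_of_mem_span {y : E d} (hy : y ∈ O) {x : LieSpace (d + 1)} (h1 : n₁ x = 0)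
    (h2 : n₂ x = 0) (hx : x ∈ Submodule.span ℝ {Y y, Z y}) : x = 0 := by
  obtain ⟨p, q, rfl⟩ := Submodule.mem_span_pair.1 hx
  have e1 : p = 0 := by simpa [F.n₁Y _ hy, F.n₁Z _ hy] using h1
  have e2 : q = 0 := by simpa [F.n₂Y _ hy, F.n₂Z _ hy] using h2
  rw [e1, e2]; simp

/-- The Legendre submanifold formed by the slices. -/
noncomputable def legendre : LegendreSubmanifold c (Sheets c) where
  Z₁ p := Φ p.index (Y (s p.index p.point))
  Z₂ p := Φ p.index (Z (s p.index p.point))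
  smooth₁ := Sheets.contMDiff_iff fun n => H.smooth_comp hU F.smoothY n
  smooth₂ := Sheets.contMDiff_iff fun n => H.smooth_comp hU F.smoothZ n
  linearIndependent p := by
    have hO := hU (H.mem p.index p.point)
    rw [LinearIndependent.pair_iff]
    intro r t h
    rw [← map_smul, ← map_smul, ← map_add] at h
    have h0 := H.ker p.index _ (by
      have h1 := H.orthY p.index p.point
      have h2 := H.orthZ p.index p.point
      rw [← lieBilin_apply] at *
      simp [h1, h2]) h
    have e1 := congrArg n₁ h0
    have e2 := congrArg n₂ h0
    simp [F.n₁Y _ hO, F.n₁Z _ hO, F.n₂Y _ hO, F.n₂Z _ hO] at e1 e2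
    exact ⟨e1, e2⟩
  isotropic₁₁ p := by
    rw [H.isometric _ _ _ (H.orthY _ _) (H.orthY _ _)]
    exact F.YY _ (hU (H.mem p.index p.point))
  isotropic₂₂ p := by
    rw [H.isometric _ _ _ (H.orthZ _ _) (H.orthZ _ _)]
    exact F.ZZ _ (hU (H.mem p.index p.point))
  isotropic₁₂ p := by
    rw [H.isometric _ _ _ (H.orthY _ _) (H.orthZ _ _)]
    exact F.YZ _ (hU (H.mem p.index p.point))
  immersion p X h1 _ := by
    have hO := hU (H.mem p.index p.point)
    have e1 := H.differential_comp hU F.smoothY p X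
    have h1' : Φ p.index (fderiv ℝ Y (s p.index p.point) (fderiv ℝ (s p.index) p.point X)) ∈
      Submodule.span ℝ {Φ p.index (Y (s p.index p.point)), Φ p.index (Z (s p.index p.point))} :=
      e1 ▸ h1
    have h2 := H.map_mem_span (H.orth_fderiv hU F.smoothY p.index (H.orthY p.index) p.point X) h1'
    exact H.inj _ _ _ (F.inj _ hO _ (eq_zero_of_mem_span F hO (F.n₁_dY hO _) (F.n₂_dY hO _) h2))
  contact p X := by
    have hO := hU (H.mem p.index p.point)
    have e1 := H.differential_comp hU F.smoothY p X
    refine (congrArg (fun x => lieForm x (Φ p.index (Z (s p.index p.point)))) e1).trans ?_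
    rw [H.isometric _ _ _
      (H.orth_fderiv hU F.smoothY p.index (H.orthY p.index) p.point X) (H.orthZ _ _)]
    exact F.contact _ hO _

/-- `Φ` is injective on the hyperplane that contains the slice and its derivatives, and the
normalization by `n₁`, `n₂` turns membership in the line into vanishing. Principal vectors of a
slice are thus those principal vectors of the ambient frame that are tangent to it. -/
theorem mem_principalSpace (p : Sheets c) (r t : ℝ) (X : E c) :
    X ∈ (H.legendre F hU).principalSpace p r t ↔
      r • fderiv ℝ Y (s p.index p.point) (fderiv ℝ (s p.index) p.point X)
        + t • fderiv ℝ Z (s p.index p.point) (fderiv ℝ (s p.index) p.point X) = 0 := by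
  have hO := hU (H.mem p.index p.point)
  have h1 := H.differential_comp hU F.smoothY p X
  have h2 := H.differential_comp hU F.smoothZ p X
  refine (LegendreSubmanifold.mem_principalSpace (L := H.legendre F hU)).trans ?_
  change r • differential (fun p : Sheets c => Φ p.index (Y (s p.index p.point))) p X
    + t • differential (fun p : Sheets c => Φ p.index (Z (s p.index p.point))) p X ∈ Submodule.span ℝ
      {Φ p.index (Y (s p.index p.point)), Φ p.index (Z (s p.index p.point))} ↔ _
  rw [h1, h2, ← (Φ p.index).map_smul, ← (Φ p.index).map_smul, ← (Φ p.index).map_add]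
  constructor
  · intro h
    refine eq_zero_of_mem_span F hO ?_ ?_ (H.map_mem_span ?_ h)
    · simp [F.n₁_dY hO, F.n₁_dZ hO]
    · simp [F.n₂_dY hO, F.n₂_dZ hO]
    · have e1 := H.orth_fderiv hU F.smoothY p.index (H.orthY p.index) p.point X
      have e2 := H.orth_fderiv hU F.smoothZ p.index (H.orthZ p.index) p.point X
      rw [← lieBilin_apply] at *
      simp [e1, e2]
  · intro h
    rw [h, map_zero]
    exact zero_mem _

/-- The coefficient `t` of `Z` cannot vanish, because `Y` is nowhere a curvature sphere. Hence `r /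
t` is a curvature sphere of the ambient frame and belongs to one of its branches. -/
theorem exists_of_isCurvatureSphereAt (S : BranchSystem O Y Z U σ) {p : Sheets c}
    {K : ℙ ℝ (LieSpace (c + 1))} {T : Submodule ℝ (E c)}
    (h : (H.legendre F S.subset).IsCurvatureSphereAt p K T) :
    (∃ X ∈ T, X ≠ 0) ∧ ∃ j, ∃ h0 : Φ p.index (sphere Y Z (σ j) (s p.index p.point)) ≠ 0,
      K = Projectivization.mk ℝ (Φ p.index (sphere Y Z (σ j) (s p.index p.point))) h0 ∧
      ∀ X ∈ T, pencil Y Z (σ j (s p.index p.point)) (s p.index p.point) (fderiv ℝ (s p.index) p.point X) = 0 := by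
  obtain ⟨r, t, h0, rfl, hT, hne⟩ := h
  obtain ⟨X₀, hX₀T, hX₀⟩ := (Submodule.ne_bot_iff _).1 hne
  have hmU := H.mem p.index p.point
  have hO := S.subset hmU
  have hmem : ∀ X ∈ T, r • fderiv ℝ Y (s p.index p.point) (fderiv ℝ (s p.index) p.point X)
        + t • fderiv ℝ Z (s p.index p.point) (fderiv ℝ (s p.index) p.point X) = 0 := by
    intro X hX
    rw [hT] at hX
    exact (H.mem_principalSpace F S.subset p r t X).1 hX
  have hsX₀ : fderiv ℝ (s p.index) p.point X₀ ≠ 0 := fun h => hX₀ (H.inj _ _ _ h)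
  have ht : t ≠ 0 := by
    rintro rfl
    have hr : r ≠ 0 := by
      rintro rfl
      simp at h0
    have h1 := hmem X₀ hX₀T
    rw [zero_smul, add_zero] at h1
    exact hsX₀ (F.inj _ hO _ ((smul_eq_zero.1 h1).resolve_left hr))
  have hpen : ∀ X ∈ T, pencil Y Z (r / t) (s p.index p.point) (fderiv ℝ (s p.index) p.point X) = 0 := by
    intro X hX
    have h1 := congrArg (fun x => t⁻¹ • x) (hmem X hX)
    simp only [smul_add, smul_smul, inv_mul_cancel₀ ht, one_smul, smul_zero] at h1
    rw [← div_eq_inv_mul, add_comm (_ • _)] at h1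
    simpa using h1
  have hspec : r / t ∈ spec Y Z (s p.index p.point) := mem_spec.2 ⟨_, hsX₀, hpen X₀ hX₀T⟩
  rw [S.spec _ hmU] at hspec
  obtain ⟨j, hj⟩ := hspec
  have hj' : σ j (s p.index p.point) = r / t := hj
  have hsph : t • sphere Y Z (σ j) (s p.index p.point) = r • Y (s p.index p.point) + t • Z (s p.index p.point) := by
    rw [sphere, hj', smul_add, smul_smul, mul_div_cancel₀ _ ht, add_comm (_ • _)]
  have hΦ : t • Φ p.index (sphere Y Z (σ j) (s p.index p.point)) =
      r • (H.legendre F S.subset).Z₁ p + t • (H.legendre F S.subset).Z₂ p := by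
    rw [← map_smul, hsph, map_add, map_smul, map_smul]; rfl
  refine ⟨⟨X₀, hX₀T, hX₀⟩, j, ?_, ?_, ?_⟩
  · intro h
    rw [h, smul_zero] at hΦ
    exact h0 hΦ.symm
  · rw [Projectivization.mk_eq_mk_iff']
    exact ⟨t, hΦ⟩
  · rw [hj']
    exact hpen

/-- A curvature surface of the slices, viewed in the ambient chart, is tangent to principal spaces
of one branch, whose sphere is then locally constant by `eventually_sphere_eq`. The number of the
sheet, hence the map `Φ`, is locally constant too, and the surface is connected. -/
theorem isDupin (S : BranchSystem O Y Z U σ) : (H.legendre F S.subset).IsDupin := by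
  intro m M _ _ _ _ i K hi
  have hloc : IsLocallyConstant K := by
    rw [IsLocallyConstant.iff_eventually_eq]
    intro t₀
    set φ := chartAt (E m) t₀ with hφ
    let q : Sheets c → E d := fun p => s p.index p.point
    have hq : ContMDiff (𝓡 c) 𝓘(ℝ, E d) ∞ q := Sheets.contMDiff_iff H.smooth
    let f : E m → E d := fun u => q (i (φ.symm u))
    have hf : ∀ u ∈ φ.target, ContDiffAt ℝ ∞ f u := fun u hu =>
      contDiffAt_comp_chart_symm (hq.comp hi.smooth) t₀ hu
    have hfd : ∀ u ∈ φ.target, ∃ A : E m ≃L[ℝ] TangentSpace (𝓡 m) (φ.symm u), ∀ X : E m,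
        fderiv ℝ f u X = fderiv ℝ (s (i (φ.symm u)).index) (i (φ.symm u)).point
          (mfderiv (𝓡 m) (𝓡 c) i (φ.symm u) (A X)) := by
      intro u hu
      obtain ⟨A, hA⟩ := exists_tangent_equiv t₀ hu
      refine ⟨A, fun X => ?_⟩
      have h1 := ((hi.smooth.mdifferentiable (by simp)) (φ.symm u)).hasMFDerivAt.comp u hA
      have h2 := (Sheets.hasMFDerivAt (f := q) H.smooth (i (φ.symm u))).comp u h1
      have h3 : HasFDerivAt f (show E m →L[ℝ] E d from
          (fderiv ℝ (s (i (φ.symm u)).index) (i (φ.symm u)).point).comp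
            ((mfderiv (𝓡 m) (𝓡 c) i (φ.symm u)).comp A.toContinuousLinearMap)) u := h2.hasFDerivAt
      rw [h3.fderiv]
      rfl
    have hcurv := fun u : E m => H.exists_of_isCurvatureSphereAt F S (hi.tangent (φ.symm u))
    have hpen : ∀ u ∈ φ.target, ∃ j, (∃ h0 : Φ (i (φ.symm u)).index (sphere Y Z (σ j) (f u)) ≠ 0,
        K (φ.symm u) = Projectivization.mk ℝ _ h0) ∧
        ∀ X, pencil Y Z (σ j (f u)) (f u) (fderiv ℝ f u X) = 0 := by
      intro u hu
      obtain ⟨A, hA⟩ := hfd u hu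
      obtain ⟨-, j, h0, hK, hj⟩ := hcurv u
      refine ⟨j, ⟨h0, hK⟩, fun X => ?_⟩
      rw [hA X]
      exact hj _ ⟨A X, rfl⟩
    have hne : ∀ u ∈ φ.target, ∃ X, fderiv ℝ f u X ≠ 0 := by
      intro u hu
      obtain ⟨A, hA⟩ := hfd u hu
      obtain ⟨⟨-, ⟨X, rfl⟩, hX⟩, -⟩ := hcurv u
      refine ⟨A.symm X, fun h => hX ?_⟩
      rw [hA, A.apply_symm_apply] at h
      exact H.inj _ _ _ h
    have ht₀ := φ.map_source (mem_chart_source (E m) t₀)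
    obtain ⟨j₀, ⟨h₀, hK₀⟩, hj₀⟩ := hpen (φ t₀) ht₀
    have hev := S.eventually_sphere_eq F φ.open_target hf (fun u _ => H.mem _ _)
      (fun u hu => (hpen u hu).imp fun _ h => h.2) hne ht₀ hj₀
    have hev' := (φ.continuousAt (mem_chart_source (E m) t₀)).eventually hev
    have hidx : ∀ᶠ t in 𝓝 t₀, (i t).index = (i t₀).index :=
      (Sheets.continuous_index.continuousAt.comp hi.smooth.continuous.continuousAt).eventually
        ((isOpen_discrete {(i t₀).index}).eventually_mem rfl)
    filter_upwards [hev', hidx, φ.open_source.mem_nhds (mem_chart_source (E m) t₀)] with t h1 h2 h3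
    obtain ⟨j, ⟨h, hK⟩, hj⟩ := hpen (φ t) (φ.map_source h3)
    obtain ⟨X, hX⟩ := hne (φ t) (φ.map_source h3)
    have hm : f (φ t) ∈ U := H.mem _ _
    have hjj : j = j₀ := S.inj _ hm (F.eq_of_pencil (S.subset hm) hX (hj X) (h1.1 X))
    subst hjj
    have e1 : K t = K (φ.symm (φ t)) := by rw [φ.left_inv h3]
    have e2 : K t₀ = K (φ.symm (φ t₀)) := by rw [φ.left_inv (mem_chart_source (E m) t₀)]
    rw [e1, e2, hK, hK₀, Projectivization.mk_eq_mk_iff']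
    refine ⟨1, ?_⟩
    rw [one_smul, h1.2, φ.left_inv h3, φ.left_inv (mem_chart_source (E m) t₀), h2]
  exact fun t t' => hloc.apply_eq_of_preconnectedSpace t t'

end SliceFamily

theorem finrank_contactLine {k : ℕ} (p ν : E k) : Module.finrank ℝ (contactLine p ν) = 2 := by
  rw [contactLine, finrank_span_pair]
  rw [LinearIndependent.pair_iff]
  intro s t h0
  have e1 := congrArg (fun v : LieSpace k => v.2.2.2) h0
  have e2 := congrArg (improperForm k) h0
  simp [pointSphere, orientedPlane] at e1 e2
  subst e1
  refine ⟨?_, rfl⟩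
  linarith

/-- An isotropic line that contains no improper point sphere is a line of contact. -/
theorem exists_eq_contactLine {k : ℕ} {a b : LieSpace k} (hab : LinearIndependent ℝ ![a, b])
    (haa : lieForm a a = 0) (hbb : lieForm b b = 0) (h : lieForm a b = 0)
    (hne : ∃ z ∈ Submodule.span ℝ {a, b}, improperForm k z ≠ 0) :
    ∃ p ν : E k, ‖ν‖ = 1 ∧ Submodule.span ℝ {a, b} = contactLine p ν := by
  have hiso : ∀ v ∈ Submodule.span ℝ {a, b}, ∀ w ∈ Submodule.span ℝ {a, b}, lieForm v w = 0 := by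
    intro v hv w hw
    obtain ⟨p, q, rfl⟩ := Submodule.mem_span_pair.1 hv
    obtain ⟨p', q', rfl⟩ := Submodule.mem_span_pair.1 hw
    have h' : lieForm b a = 0 := by rw [lieForm_comm, h]
    rw [← lieBilin_apply] at *
    simp [haa, hbb, h, h']
  obtain ⟨z, hz, hz0⟩ := hne
  have hw : ∃ w ∈ Submodule.span ℝ {a, b}, w ≠ 0 ∧ improperForm k w = 0 := by
    refine ⟨improperForm k b • a - improperForm k a • b, ?_, fun h0 => hz0 ?_, ?_⟩
    · exact sub_mem (Submodule.smul_mem _ _ (Submodule.subset_span (by simp)))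
        (Submodule.smul_mem _ _ (Submodule.subset_span (by simp)))
    · rw [sub_eq_add_neg, ← neg_smul] at h0
      obtain ⟨h1, h2⟩ := LinearIndependent.pair_iff.1 hab _ _ h0
      obtain ⟨p, q, rfl⟩ := Submodule.mem_span_pair.1 hz
      rw [map_add, map_smul, map_smul, h1, neg_eq_zero.1 h2]; simp
    · rw [map_sub, map_smul, map_smul, smul_eq_mul, smul_eq_mul]; ring
  obtain ⟨⟨w₁, w₂, u, β⟩, hw, hw0, hwi⟩ := hw
  rw [improperForm_apply] at hz0 hwi
  simp only at hwi
  -- With last coordinate zero, `w` would be null with vanishing improper form, hence a multiple of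
  -- the improper point. Orthogonality to `z`, whose improper form does not vanish, then makes it
  -- zero.
  have hβ : β ≠ 0 := by
    rintro rfl
    have h1 := hiso _ hw _ hw
    have h2 := hiso _ hz _ hw
    simp only [lieForm] at h1 h2
    have h3 : inner ℝ u u = 0 := by
      have : w₁ = - w₂ := by linarith
      rw [this] at h1; linarith
    rw [inner_self_eq_zero] at h3
    subst h3
    have h4 : w₂ = 0 := by
      have h5 : w₂ * (z.1 + z.2.1) = 0 := by
        have : w₁ = - w₂ := by linarith
        rw [this, inner_zero_right] at h2; linarith
      exact (mul_eq_zero.1 h5).resolve_right hz0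
    subst h4
    refine hw0 (Prod.ext ?_ rfl)
    simpa using hwi
  obtain ⟨α, ν, hmem⟩ : ∃ (α : ℝ) (ν : E k),
      ((α, -α, ν, 1) : LieSpace k) ∈ Submodule.span ℝ {a, b} := by
    refine ⟨β⁻¹ * w₁, β⁻¹ • u, ?_⟩
    have h1 := Submodule.smul_mem _ β⁻¹ hw
    have h2 : w₂ = - w₁ := by linarith
    rw [h2] at h1
    simpa [hβ] using h1
  have hν : inner ℝ ν ν = 1 := by
    have h1 := hiso _ hmem _ hmem
    simp only [lieForm] at h1
    linarith
  obtain ⟨x, y, p, hps, hxy⟩ : ∃ (x y : ℝ) (p : E k),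
      ((x, y, p, 0) : LieSpace k) ∈ Submodule.span ℝ {a, b} ∧ x + y = 1 := by
    have h1 := Submodule.smul_mem _ (z.1 + z.2.1)⁻¹ (sub_mem hz (Submodule.smul_mem _ z.2.2.2 hmem))
    refine ⟨(z.1 + z.2.1)⁻¹ * (z.1 - z.2.2.2 * α), (z.1 + z.2.1)⁻¹ * (z.2.1 - z.2.2.2 * -α),
      (z.1 + z.2.1)⁻¹ • (z.2.2.1 - z.2.2.2 • ν), ?_, ?_⟩
    · have h2 : (z.1 + z.2.1)⁻¹ • (z - z.2.2.2 • ((α, -α, ν, 1) : LieSpace k)) =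
          ((z.1 + z.2.1)⁻¹ * (z.1 - z.2.2.2 * α), (z.1 + z.2.1)⁻¹ * (z.2.1 - z.2.2.2 * -α),
            (z.1 + z.2.1)⁻¹ • (z.2.2.1 - z.2.2.2 • ν), 0) := by
        refine Prod.ext rfl (Prod.ext rfl (Prod.ext rfl ?_))
        simp
      rw [h2] at h1
      exact h1
    · rw [← mul_add, inv_mul_eq_one₀ hz0]; ring
  have hpp : inner ℝ p p = x - y := by
    have h1 := hiso _ hps _ hps
    simp only [lieForm] at h1
    have h2 : inner ℝ p p = (x + y) * (x - y) := by linarith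
    rw [h2, hxy, one_mul]
  have hpν : inner ℝ p ν = α := by
    have h1 := hiso _ hps _ hmem
    simp only [lieForm] at h1
    have h2 : inner ℝ p ν = (x + y) * α := by linarith
    rw [h2, hxy, one_mul]
  have h1 : pointSphere p ∈ Submodule.span ℝ {a, b} := by
    convert hps using 1
    rw [pointSphere, hpp]
    refine Prod.ext ?_ (Prod.ext ?_ rfl) <;> simp only <;> linarith
  have h2 : orientedPlane p ν ∈ Submodule.span ℝ {a, b} := by
    rw [orientedPlane, hpν]
    exact hmem
  refine ⟨p, ν, by rw [← sq_eq_sq₀ (norm_nonneg _) zero_le_one, ← real_inner_self_eq_norm_sq, hν,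
    one_pow], ?_⟩
  symm
  refine Submodule.eq_of_le_of_finrank_eq ?_ ?_
  · rw [contactLine, Submodule.span_le]
    rintro v (rfl | rfl)
    · exact h1
    · exact h2
  · rw [finrank_span_pair hab, finrank_contactLine]

/-- The Euclidean picture of the Legendre submanifold formed by the slices. -/
theorem SliceFamily.exists_euclideanProjection {c d : ℕ} {O : Set (E d)}
    {Y Z : E d → LieSpace (d + 1)} {n₁ n₂ : LieSpace (d + 1) →L[ℝ] ℝ} {U : Set (E d)}
    {s : ℕ → E c → E d} {e : ℕ → LieSpace (d + 1)}
    {Φ : ℕ → LieSpace (d + 1) →ₗ[ℝ] LieSpace (c + 1)}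
    (H : SliceFamily Y Z U s e Φ) (F : LegendreFrame (lieBilin (d + 1)) O Y Z n₁ n₂) (hU : U ⊆ O)
    (hne : ∀ n v, ∃ z ∈ Submodule.span ℝ {Y (s n v), Z (s n v)},
      improperForm (c + 1) (Φ n z) ≠ 0) :
    ∃ P η : Sheets c → E (c + 1), (H.legendre F hU).HasEuclideanProjection P η := by
  have h : ∀ p : Sheets c, ∃ P ν : E (c + 1), ‖ν‖ = 1 ∧
      (H.legendre F hU).line p = contactLine P ν := by
    intro p
    refine exists_eq_contactLine ((H.legendre F hU).linearIndependent p)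
      ((H.legendre F hU).isotropic₁₁ p) ((H.legendre F hU).isotropic₂₂ p)
      ((H.legendre F hU).isotropic₁₂ p) ?_
    obtain ⟨z, hz, hz0⟩ := hne p.index p.point
    refine ⟨Φ p.index z, ?_, hz0⟩
    obtain ⟨x, y, rfl⟩ := Submodule.mem_span_pair.1 hz
    exact Submodule.mem_span_pair.2 ⟨x, y, by rw [map_add, map_smul, map_smul]; rfl⟩
  choose P η hη using h
  exact ⟨P, η, hη⟩

end LieSphere

/-! ### Isometries of the Lie form: reflections, Witt's theorem, the hyperplane model. -/

namespace LieSphere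

section Isometries
variable {n : ℕ}

/-- The linear automorphism `T` preserves the Lie scalar product. -/
def IsLieIsometry (T : LieSpace n ≃ₗ[ℝ] LieSpace n) : Prop :=
  ∀ x y, lieForm (T x) (T y) = lieForm x y

theorem IsLieIsometry.trans {S T : LieSpace n ≃ₗ[ℝ] LieSpace n} (hS : IsLieIsometry S)
    (hT : IsLieIsometry T) : IsLieIsometry (S.trans T) := fun x y => by
  rw [LinearEquiv.trans_apply, LinearEquiv.trans_apply, hT, hS]

theorem IsLieIsometry.isLieSphereTransformation {T : LieSpace n ≃ₗ[ℝ] LieSpace n}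
    (hT : IsLieIsometry T) : IsLieSphereTransformation T := fun v => by rw [hT]

theorem lieForm_add_left (x y z : LieSpace n) : lieForm (x + y) z = lieForm x z + lieForm y z := by
  simp [← lieBilin_apply]

theorem lieForm_add_right (x y z : LieSpace n) :
    lieForm x (y + z) = lieForm x y + lieForm x z := by
  simp [← lieBilin_apply]

theorem lieForm_sub_left (x y z : LieSpace n) : lieForm (x - y) z = lieForm x z - lieForm y z := by
  simp [← lieBilin_apply]

theorem lieForm_sub_right (x y z : LieSpace n) :
    lieForm x (y - z) = lieForm x y - lieForm x z := by
  simp [← lieBilin_apply]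

theorem lieForm_smul_left (r : ℝ) (x y : LieSpace n) : lieForm (r • x) y = r * lieForm x y := by
  simp [← lieBilin_apply]

theorem lieForm_smul_right (r : ℝ) (x y : LieSpace n) : lieForm x (r • y) = r * lieForm x y := by
  simp [← lieBilin_apply]

theorem lieForm_zero_left (x : LieSpace n) : lieForm 0 x = 0 := by
  simp [← lieBilin_apply]

theorem lieForm_zero_right (x : LieSpace n) : lieForm x 0 = 0 := by
  simp [← lieBilin_apply]

theorem exists_reflection {v : LieSpace n} (hv : lieForm v v ≠ 0) :
    ∃ T : LieSpace n ≃ₗ[ℝ] LieSpace n, IsLieIsometry T ∧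
      ∀ x, T x = x - (2 * lieForm v x / lieForm v v) • v := by
  have h2 : ((2 / lieForm v v) • (lieBilin n v).toLinearMap) v = 2 := by
    change (2 / lieForm v v) * lieForm v v = 2
    field_simp
  have happ : ∀ x, Module.reflection h2 x = x - (2 * lieForm v x / lieForm v v) • v := by
    intro x
    rw [Module.reflection_apply]
    congr 2
    change (2 / lieForm v v) * lieForm v x = _
    ring
  refine ⟨Module.reflection h2, fun x y => ?_, happ⟩
  rw [happ, happ]
  simp only [lieForm_sub_left, lieForm_sub_right, lieForm_smul_left, lieForm_smul_right,
    lieForm_comm x v]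
  field_simp
  ring

/-- A vector can be moved to each vector of the same nonzero length. -/
theorem exists_isometry_apply_eq {u v : LieSpace n} (huv : lieForm u u = lieForm v v)
    (hu : lieForm u u ≠ 0) :
    ∃ T : LieSpace n ≃ₗ[ℝ] LieSpace n, IsLieIsometry T ∧ T u = v ∧
      ∀ x, lieForm u x = 0 → lieForm v x = 0 → T x = x := by
  -- If `u - v` is not null, the reflection in it exchanges `u` and `v`. Otherwise `u + v` is not
  -- null; its reflection sends `u` to `-v`, and the reflection in `v` corrects the sign.
  by_cases h : lieForm (u - v) (u - v) = 0
  · have h' : lieForm (u + v) (u + v) ≠ 0 := by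
      intro h'
      simp only [lieForm_sub_left, lieForm_sub_right, lieForm_add_left, lieForm_add_right] at h h'
      apply hu; linarith
    obtain ⟨T, hT, hTx⟩ := exists_reflection h'
    obtain ⟨T', hT', hTx'⟩ := exists_reflection (huv ▸ hu)
    refine ⟨T.trans T', hT.trans hT', ?_, fun x h1 h2 => ?_⟩
    · have e1 : T u = -v := by
        rw [hTx]
        have : 2 * lieForm (u + v) u / lieForm (u + v) (u + v) = 1 := by
          rw [div_eq_one_iff_eq h']
          simp only [lieForm_add_left, lieForm_add_right, lieForm_comm v u]
          linarith
        rw [this]; module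
      rw [LinearEquiv.trans_apply, e1, map_neg, hTx']
      have : 2 * lieForm v v / lieForm v v = 2 := by
        have := huv ▸ hu
        field_simp
      rw [this]; module
    · rw [LinearEquiv.trans_apply, hTx, hTx', lieForm_add_left, h1, h2]
      simp [h2]
  · obtain ⟨T, hT, hTx⟩ := exists_reflection h
    refine ⟨T, hT, ?_, fun x h1 h2 => ?_⟩
    · rw [hTx]
      have : 2 * lieForm (u - v) u / lieForm (u - v) (u - v) = 1 := by
        rw [div_eq_one_iff_eq h]
        simp only [lieForm_sub_left, lieForm_sub_right, lieForm_comm v u]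
        linarith
      rw [this]; module
    · rw [hTx, lieForm_sub_left, h1, h2]
      simp

/-- Witt's theorem for orthogonal families. -/
theorem exists_isometry_family : ∀ {k : ℕ} (a b : Fin k → LieSpace n),
    (∀ i j, i ≠ j → lieForm (a i) (a j) = 0) → (∀ i j, i ≠ j → lieForm (b i) (b j) = 0) →
    (∀ i, lieForm (a i) (a i) = lieForm (b i) (b i)) → (∀ i, lieForm (a i) (a i) ≠ 0) →
    ∃ T : LieSpace n ≃ₗ[ℝ] LieSpace n, IsLieIsometry T ∧ ∀ i, T (a i) = b i
  | 0, _, _, _, _, _, _ => ⟨LinearEquiv.refl ℝ _, fun _ _ => rfl, fun i => i.elim0⟩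
  | k + 1, a, b, ha, hb, hab, h0 => by
    obtain ⟨T, hT, hTa⟩ := exists_isometry_family (fun i : Fin k => a i.castSucc)
      (fun i => b i.castSucc) (fun i j h => ha _ _ fun h' => h (Fin.castSucc_injective _ h'))
      (fun i j h => hb _ _ fun h' => h (Fin.castSucc_injective _ h')) (fun i => hab _)
      (fun i => h0 _)
    -- The correction for the last vector fixes everything orthogonal to it and to its target, in
    -- particular the vectors already placed.
    obtain ⟨T', hT', h1, h2⟩ := exists_isometry_apply_eq (u := T (a (Fin.last k)))
      (v := b (Fin.last k)) (by rw [hT, hab]) (by rw [hT]; exact h0 _)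
    refine ⟨T.trans T', hT.trans hT', fun i => ?_⟩
    rw [LinearEquiv.trans_apply]
    induction i using Fin.lastCases with
    | last => exact h1
    | cast i =>
      rw [hTa, h2]
      · rw [← hTa, hT]
        exact ha _ _ (Fin.castSucc_lt_last i).ne'
      · exact hb _ _ (Fin.castSucc_lt_last i).ne'

/-- A null vector orthogonal to an orthogonal family lies in a hyperbolic plane orthogonal to
the family. -/
theorem exists_hyperbolic_split {k : ℕ} (a : Fin k → LieSpace n)
    (ha : ∀ i j, i ≠ j → lieForm (a i) (a j) = 0) (h0 : ∀ i, lieForm (a i) (a i) ≠ 0)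
    {w : LieSpace n} (hw0 : w ≠ 0) (hw : lieForm w w = 0) (hwa : ∀ i, lieForm w (a i) = 0) :
    ∃ e f : LieSpace n, w = e + f ∧ lieForm e e = 1 ∧ lieForm f f = -1 ∧ lieForm e f = 0 ∧
      (∀ i, lieForm e (a i) = 0) ∧ ∀ i, lieForm f (a i) = 0 := by
  obtain ⟨x, hx⟩ : ∃ x, lieForm w x ≠ 0 := by
    by_contra! h
    exact hw0 ((isLieForm_lieBilin n).nondeg w h)
  let y := x - ∑ i, (lieForm x (a i) / lieForm (a i) (a i)) • a i
  have hsum : ∀ z, lieForm z (∑ i, (lieForm x (a i) / lieForm (a i) (a i)) • a i) =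
      ∑ i, (lieForm x (a i) / lieForm (a i) (a i)) * lieForm z (a i) := by
    intro z
    rw [← lieBilin_apply, map_sum]
    exact Finset.sum_congr rfl fun i _ => lieForm_smul_right _ _ _
  have hya : ∀ j, lieForm y (a j) = 0 := by
    intro j
    rw [lieForm_sub_left, lieForm_comm _ (a j), lieForm_comm _ (a j), hsum,
      Finset.sum_eq_single j]
    · rw [div_mul_cancel₀ _ (h0 j), lieForm_comm, sub_self]
    · intro i _ hij
      rw [ha j i hij.symm, mul_zero]
    · simp
  have hwy : lieForm w y = lieForm w x := by
    rw [lieForm_sub_right, hsum, Finset.sum_eq_zero, sub_zero]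
    intro i _
    rw [hwa, mul_zero]
  let z := (lieForm w x)⁻¹ • y
  have hwz : lieForm w z = 1 := by rw [lieForm_smul_right, hwy, inv_mul_cancel₀ hx]
  have hza : ∀ j, lieForm z (a j) = 0 := fun j => by rw [lieForm_smul_left, hya, mul_zero]
  -- A null vector with `⟨w, u⟩ = 1`, orthogonal to the family. Half of `w` plus or minus `u` then
  -- has square `1` or `-1`.
  let u := z - (lieForm z z / 2) • w
  have hzw : lieForm z w = 1 := by rw [lieForm_comm, hwz]
  refine ⟨(1 / 2 : ℝ) • w + u, (1 / 2 : ℝ) • w - u, by module, ?_, ?_, ?_, fun i => ?_, fun i => ?_⟩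
  all_goals
    simp only [u, lieForm_sub_left, lieForm_sub_right, lieForm_smul_left, lieForm_smul_right,
      lieForm_add_left, lieForm_add_right, hw, hwz, hzw, hza, hwa]
    ring

/-- Witt's theorem for an orthogonal family and a null vector. -/
theorem exists_isometry_family_null {k : ℕ} (a b : Fin k → LieSpace n)
    (ha : ∀ i j, i ≠ j → lieForm (a i) (a j) = 0) (hb : ∀ i j, i ≠ j → lieForm (b i) (b j) = 0)
    (hab : ∀ i, lieForm (a i) (a i) = lieForm (b i) (b i)) (h0 : ∀ i, lieForm (a i) (a i) ≠ 0)
    {w w' : LieSpace n} (hw0 : w ≠ 0) (hw : lieForm w w = 0) (hwa : ∀ i, lieForm w (a i) = 0)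
    (hw0' : w' ≠ 0) (hw' : lieForm w' w' = 0) (hwb : ∀ i, lieForm w' (b i) = 0) :
    ∃ T : LieSpace n ≃ₗ[ℝ] LieSpace n, IsLieIsometry T ∧ (∀ i, T (a i) = b i) ∧ T w = w' := by
  obtain ⟨e, f, rfl, hee, hff, hef, hea, hfa⟩ := exists_hyperbolic_split a ha h0 hw0 hw hwa
  obtain ⟨e', f', rfl, hee', hff', hef', hea', hfa'⟩ := exists_hyperbolic_split b hb
    (fun i => by rw [← hab]; exact h0 i) hw0' hw' hwb
  obtain ⟨T, hT, hTa⟩ := exists_isometry_family a b ha hb hab h0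
  obtain ⟨T₁, hT₁, h1, h2⟩ := exists_isometry_apply_eq (u := T e) (v := e')
    (by rw [hT, hee, hee']) (by rw [hT, hee]; exact one_ne_zero)
  obtain ⟨T₂, hT₂, h3, h4⟩ := exists_isometry_apply_eq (u := T₁ (T f)) (v := f')
    (by rw [hT₁, hT, hff, hff']) (by rw [hT₁, hT, hff]; norm_num)
  have e1 : ∀ i, T₁ (b i) = b i := fun i => h2 _ (by rw [← hTa, hT, hea]) (hea' i)
  have e2 : ∀ i, T₂ (b i) = b i := fun i => h4 _ (by rw [← e1, hT₁, ← hTa, hT, hfa]) (hfa' i)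
  refine ⟨(T.trans T₁).trans T₂, (hT.trans hT₁).trans hT₂, fun i => ?_, ?_⟩
  · simp only [LinearEquiv.trans_apply, hTa, e1, e2]
  · simp only [LinearEquiv.trans_apply, map_add, h1, h3]
    rw [h4 e' (by rw [← h1, hT₁, hT, lieForm_comm, hef]) (by rw [lieForm_comm, hef'])]

end Isometries

section Model

theorem lieForm_lieInclusion {k n : ℕ} (ι : E k →ₗᵢ[ℝ] E n) (x y : LieSpace k) :
    lieForm (lieInclusion ι x) (lieInclusion ι y) = lieForm x y := by
  simp [lieForm, lieInclusion]

theorem map_lieInclusion_contactLine {k n : ℕ} (ι : E k →ₗᵢ[ℝ] E n) (p ν : E k) :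
    (contactLine p ν).map (lieInclusion ι) = contactLine (ι p) (ι ν) := by
  rw [contactLine, Submodule.map_span, image_pair, lieInclusion_pointSphere,
    lieInclusion_orientedPlane, contactLine]

/-- `ℝᵏ` as a hyperplane of `ℝᵏ⁺¹`, with the orthogonal projection in Lie coordinates. -/
theorem exists_hyperplane_model (k : ℕ) :
    ∃ (ι : E k →ₗᵢ[ℝ] E (k + 1)) (e : E (k + 1)) (π : LieSpace (k + 1) →ₗ[ℝ] LieSpace k),
      ‖e‖ = 1 ∧ (∀ u, inner ℝ (ι u) e = 0) ∧
      (∀ x, lieInclusion ι (π x) = x - lieForm x (0, 0, e, 0) • ((0, 0, e, 0) : LieSpace (k + 1))) ∧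
      (∀ y, π (lieInclusion ι y) = y) := by
  obtain ⟨e, he⟩ := exists_norm_eq (E (k + 1)) (zero_le_one' ℝ)
  have he0 : e ≠ 0 := by rintro rfl; simp at he
  haveI : Fact (Module.finrank ℝ (E (k + 1)) = k + 1) := ⟨by simp⟩
  let r := (OrthonormalBasis.fromOrthogonalSpanSingleton (𝕜 := ℝ) k he0).repr
  let ι : E k →ₗᵢ[ℝ] E (k + 1) := (ℝ ∙ e)ᗮ.subtypeₗᵢ.comp r.symm.toLinearIsometry
  let q : E (k + 1) →ₗ[ℝ] E k := r.toLinearEquiv.toLinearMap ∘ₗ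
    ((ℝ ∙ e)ᗮ.orthogonalProjection).toLinearMap
  have hιq : ∀ x, ι (q x) = x - (inner ℝ e x : ℝ) • e := by
    intro x
    have h1 : ι (q x) = ((ℝ ∙ e)ᗮ.orthogonalProjection x : E (k + 1)) := by
      simp [ι, q]
    rw [h1, ← Submodule.starProjection_unit_singleton ℝ he]
    exact Submodule.starProjection_orthogonal_val (K := (ℝ ∙ e)) x
  have hqι : ∀ y, q (ι y) = y := by
    intro y
    simp [ι, q]
  let π : LieSpace (k + 1) →ₗ[ℝ] LieSpace k :=
    { toFun := fun x => (x.1, x.2.1, q x.2.2.1, x.2.2.2)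
      map_add' := fun x y => by simp
      map_smul' := fun r x => by simp }
  refine ⟨ι, e, π, he, fun u => ?_, fun x => ?_, fun y => ?_⟩
  · have h : ((r.symm u : (ℝ ∙ e)ᗮ) : E (k + 1)) ∈ (ℝ ∙ e)ᗮ := Subtype.mem _
    exact Submodule.mem_orthogonal_singleton_iff_inner_left.1 h
  · refine Prod.ext ?_ (Prod.ext ?_ (Prod.ext ?_ ?_))
    · simp [lieInclusion, π]
    · simp [lieInclusion, π]
    · simp [lieInclusion, π, hιq, lieForm, real_inner_comm]
    · simp [lieInclusion, π]
  · refine Prod.ext rfl (Prod.ext rfl (Prod.ext ?_ rfl))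
    simp [lieInclusion, π, hqι]

end Model

end LieSphere

/-! ### What the three constructions share. -/

namespace LieSphere
open LegendreFrame

/-- Reducibility near a point. -/
def LegendreSubmanifold.IsReducibleAt {d : ℕ} {W : Type*} [TopologicalSpace W]
    [ChartedSpace (E d) W] (L : LegendreSubmanifold d W) (x : W) : Prop :=
  ∃ U : Set W, IsOpen U ∧ x ∈ U ∧
    ∃ B : LieSpace (d + 1) ≃ₗ[ℝ] LieSpace (d + 1), IsLieSphereTransformation B ∧
    ∃ (c : ℕ) (M : Type) (_ : TopologicalSpace M) (_ : ChartedSpace (E c) M)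
      (_ : IsManifold (𝓡 c) ∞ M) (_ : T2Space M) (_ : SecondCountableTopology M)
      (L₀ : LegendreSubmanifold c M) (F η : M → E (c + 1))
      (C : Set (Submodule ℝ (LieSpace (d + 1)))),
      c < d ∧ L₀.IsDupin ∧ L₀.HasEuclideanProjection F η ∧ IsStandardConstruction F η C ∧
      ∀ y ∈ U, (L.line y).map B.toLinearMap ∈ C

section
variable {c d : ℕ} {W : Type*} [TopologicalSpace W] [ChartedSpace (E d) W]
  {L : LegendreSubmanifold d W} {x : W} {g : ℕ} {O : Set (E d)}
  {Y Z : E d → LieSpace (d + 1)} {n₁ n₂ : LieSpace (d + 1) →L[ℝ] ℝ}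
  {U : Set (E d)} {σ : Fin g → E d → ℝ} {τ : E d → ℝ}

/-- The slices provide the lower dimensional Dupin submanifold and `hne` its Euclidean picture. What
remains for each construction is `hC`: the lines near the point belong to it. -/
theorem LegendreSubmanifold.LocalFrame.isReducibleAt [IsManifold (𝓡 d) ∞ W]
    (H : L.LocalFrame x g O Y Z n₁ n₂) (S : BranchSystem O Y Z U σ) (hcd : c < d)
    {s : ℕ → E c → E d} {e : ℕ → LieSpace (d + 1)}
    {Φ : ℕ → LieSpace (d + 1) →ₗ[ℝ] LieSpace (c + 1)} (A : SliceFamily Y Z U s e Φ)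
    (hne : ∀ n v, ∃ z ∈ Submodule.span ℝ {Y (s n v), Z (s n v)},
      improperForm (c + 1) (Φ n z) ≠ 0)
    {T : LieSpace (d + 1) ≃ₗ[ℝ] LieSpace (d + 1)} (hT : IsLieSphereTransformation T)
    (hC : ∀ P η : Sheets c → E (c + 1), (∀ p, ‖η p‖ = 1) →
      (∀ n v, Submodule.span ℝ {Φ n (Y (s n v)), Φ n (Z (s n v))}
        = contactLine (P (Sheets.of n v)) (η (Sheets.of n v))) →
      ∃ C, IsStandardConstruction P η C ∧ ∀ᶠ y in 𝓝 (chartAt (E d) x x),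
        y ∈ O → (Submodule.span ℝ {Y y, Z y}).map T.toLinearMap ∈ C) :
    L.IsReducibleAt x := by
  obtain ⟨P, η, hE⟩ := A.exists_euclideanProjection H.frame S.subset hne
  obtain ⟨C, hCs, hev⟩ := hC P η (fun p => (hE p).1) (fun n v => (hE (Sheets.of n v)).2)
  set φ := chartAt (E d) x
  have hx := mem_chart_source (E d) x
  have h1 : ∀ᶠ z in 𝓝 x, z ∈ φ.source ∧ φ z ∈ O ∧
      (Submodule.span ℝ {Y (φ z), Z (φ z)}).map T.toLinearMap ∈ C := by
    have h2 := (φ.continuousAt hx).eventually (hev.and (H.frame.mem_nhds H.mem))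
    filter_upwards [φ.open_source.mem_nhds hx, h2] with z hz h
    exact ⟨hz, h.2, h.1 h.2⟩
  obtain ⟨U', hU', hU'o, hxU'⟩ := mem_nhds_iff.1 h1
  refine ⟨U', hU'o, hxU', T, hT, c, Sheets c, inferInstance, inferInstance, inferInstance,
    inferInstance, inferInstance, A.legendre H.frame S.subset, P, η, C, hcd,
    A.isDupin H.frame S, hE, hCs, fun z hz => ?_⟩
  obtain ⟨hz1, hz2, hz3⟩ := hU' hz
  have h3 := H.line (φ z) hz2
  rw [φ.left_inv hz1] at h3
  rwa [h3]

/-- The image of a line spanned by a curvature sphere is determined by two of its vectors. -/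
theorem map_span_eq_contactLine {n : ℕ} (F : LegendreFrame (lieBilin (d + 1)) O Y Z n₁ n₂)
    {T : LieSpace (d + 1) ≃ₗ[ℝ] LieSpace n} {y : E d} (hy : y ∈ O) {p ν : E n}
    (hK : T (LegendreFrame.sphere Y Z τ y) ∈ contactLine p ν) (hY : T (Y y) ∈ contactLine p ν) :
    (Submodule.span ℝ {Y y, Z y}).map T.toLinearMap = contactLine p ν := by
  have hZ : T (Z y) ∈ contactLine p ν := by
    have h1 : Z y = LegendreFrame.sphere Y Z τ y - τ y • Y y := by
      rw [LegendreFrame.sphere]; abel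
    rw [h1, map_sub, map_smul]
    exact sub_mem hK (Submodule.smul_mem _ _ hY)
  refine Submodule.eq_of_le_of_finrank_eq ?_ ?_
  · rw [Submodule.map_span_le]
    rintro v (rfl | rfl)
    · exact hY
    · exact hZ
  · rw [finrank_contactLine, LinearEquiv.finrank_map_eq, finrank_span_pair]
    rw [LinearIndependent.pair_iff]
    intro p q h
    have e1 := congrArg n₁ h
    have e2 := congrArg n₂ h
    simp [F.n₁Y _ hy, F.n₁Z _ hy, F.n₂Y _ hy, F.n₂Z _ hy] at e1 e2
    exact ⟨e1, e2⟩

theorem lieInclusion_mem_contactLine {n : ℕ} (ι : E (c + 1) →ₗᵢ[ℝ] E n)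
    {Φ : LieSpace (d + 1) →ₗ[ℝ] LieSpace (c + 1)} {y' : E d} {P η : E (c + 1)}
    (h : Submodule.span ℝ {Φ (Y y'), Φ (Z y')} = contactLine P η) {z : LieSpace (d + 1)}
    {q r : ℝ} (hz : z = q • LegendreFrame.sphere Y Z τ y' + r • Y y') :
    lieInclusion ι (Φ z) ∈ contactLine (ι P) (ι η) := by
  rw [← map_lieInclusion_contactLine, ← h]
  refine Submodule.mem_map_of_mem (Submodule.mem_span_pair.2 ⟨q * τ y' + r, q, ?_⟩)
  rw [hz, ← map_smul, ← map_smul, ← map_add, LegendreFrame.sphere]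
  congr 1
  module

section Model
variable {k : ℕ} {ι : E k →ₗᵢ[ℝ] E (k + 1)} {ê : E (k + 1)}
  {π : LieSpace (k + 1) →ₗ[ℝ] LieSpace k}
  (hπ : ∀ x, lieInclusion ι (π x) = x - lieForm x (0, 0, ê, 0) • ((0, 0, ê, 0) : LieSpace (k + 1)))
  {T : LieSpace (k + 1) ≃ₗ[ℝ] LieSpace (k + 1)} (hT : IsLieIsometry T) {e : LieSpace (k + 1)}
  (hTe : T e = (0, 0, ê, 0))
include hπ hT hTe

/-- `T e` is the unit normal of the model hyperplane, so the projection has nothing to remove from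
`T x`. -/
theorem lieInclusion_projection {x : LieSpace (k + 1)} (hx : lieForm x e = 0) :
    lieInclusion ι (π (T x)) = T x := by
  rw [hπ, ← hTe, hT, hx, zero_smul, sub_zero]

theorem lieForm_projection {x y : LieSpace (k + 1)} (hx : lieForm x e = 0) (hy : lieForm y e = 0) :
    lieForm (π (T x)) (π (T y)) = lieForm x y := by
  rw [← lieForm_lieInclusion ι, lieInclusion_projection hπ hT hTe hx,
    lieInclusion_projection hπ hT hTe hy, hT]

theorem eq_zero_of_projection {x : LieSpace (k + 1)} (hx : lieForm x e = 0) (h : π (T x) = 0) :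
    x = 0 := by
  have h1 := lieInclusion_projection hπ hT hTe hx
  rw [h, map_zero] at h1
  exact (LinearEquiv.map_eq_zero_iff T).1 h1.symm

theorem improperForm_projection {x : LieSpace (k + 1)} (hx : lieForm x e = 0) :
    improperForm k (π (T x)) = improperForm (k + 1) (T x) := by
  conv_rhs => rw [← lieInclusion_projection hπ hT hTe hx]
  rfl

end Model

end

end LieSphere

/-! ### Surfaces of revolution and cylinders. -/

namespace LieSphere
open LegendreFrame

section
variable {c : ℕ} {W : Type*} [TopologicalSpace W] [ChartedSpace (E (c + 1)) W]
  [IsManifold (𝓡 (c + 1)) ∞ W]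
  {L : LegendreSubmanifold (c + 1) W} {x : W} {g : ℕ} {O : Set (E (c + 1))}
  {Y Z : E (c + 1) → LieSpace (c + 1 + 1)} {n₁ n₂ : LieSpace (c + 1 + 1) →L[ℝ] ℝ}
  {U : Set (E (c + 1))} {σ : Fin g → E (c + 1) → ℝ}

/-- A single slice, projected to the hyperplane orthogonal to a spacelike vector. -/
theorem sliceFamily_projection {ι : E (c + 1) →ₗᵢ[ℝ] E (c + 1 + 1)} {ê : E (c + 1 + 1)}
    {π : LieSpace (c + 1 + 1) →ₗ[ℝ] LieSpace (c + 1)}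
    (hπ : ∀ x, lieInclusion ι (π x) = x - lieForm x (0, 0, ê, 0) • (0, 0, ê, 0))
    {T : LieSpace (c + 1 + 1) ≃ₗ[ℝ] LieSpace (c + 1 + 1)} (hT : IsLieIsometry T)
    {e : LieSpace (c + 1 + 1)} (hTe : T e = (0, 0, ê, 0)) {τ : E (c + 1) → ℝ}
    (hKe : ∀ y ∈ U, lieForm (LegendreFrame.sphere Y Z τ y) e = 0) {s : E c → E (c + 1)}
    (hs : ContDiff ℝ ∞ s) (hinj : ∀ v X, fderiv ℝ s v X = 0 → X = 0)
    (hmem : ∀ v, s v ∈ U) (hYe : ∀ v, lieForm (Y (s v)) e = 0) :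
    SliceFamily Y Z U (fun _ => s) (fun _ => e) (fun _ => π ∘ₗ T.toLinearMap) where
  smooth _ := hs
  inj _ := hinj
  mem _ := hmem
  orthY _ := hYe
  orthZ _ v := by
    have h1 : Z (s v) = LegendreFrame.sphere Y Z τ (s v) - τ (s v) • Y (s v) := by
      rw [LegendreFrame.sphere]; abel
    rw [h1, lieForm_sub_left, lieForm_smul_left, hKe _ (hmem v), hYe]; simp
  isometric _ _ _ hx hy := lieForm_projection hπ hT hTe hx hy
  ker _ _ hx h := eq_zero_of_projection hπ hT hTe hx h

theorem LegendreSubmanifold.LocalFrame.continuousAt_lieForm (H : L.LocalFrame x g O Y Z n₁ n₂)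
    (e : LieSpace (c + 1 + 1)) {y : E (c + 1)} (hy : y ∈ O) :
    ContinuousAt (fun y => lieForm (Y y) e) y :=
  Tendsto.comp ((lieBilin (c + 1 + 1)).flip e).continuous.continuousAt
    (H.frame.smoothY y hy).continuousAt

theorem sphere_mem_span {y : E (c + 1)} {τ : E (c + 1) → ℝ} :
    LegendreFrame.sphere Y Z τ y ∈ Submodule.span ℝ {Y y, Z y} :=
  Submodule.mem_span_pair.2 ⟨τ y, 1, by rw [LegendreFrame.sphere]; module⟩

/-- After an isometry, `e` is the normal of the hyperplane and `f` the direction `a` inside it, so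
all spheres of the branch have centres orthogonal to both. Such spheres are fixed by the orthogonal
maps of the plane of `e` and `f`, and one of these maps takes each line to a line of the slice. -/
theorem LegendreSubmanifold.LocalFrame.isReducibleAt_of_revolution
    (H : L.LocalFrame x g O Y Z n₁ n₂) (S : BranchSystem O Y Z U σ)
    (hx : chartAt (E (c + 1)) x x ∈ U) (j : Fin g) {e f : LieSpace (c + 1 + 1)}
    (hee : lieForm e e = 1) (hff : lieForm f f = 1) (hef : lieForm e f = 0)
    (hKe : ∀ y ∈ U, lieForm (LegendreFrame.sphere Y Z (σ j) y) e = 0)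
    (hKf : ∀ y ∈ U, lieForm (LegendreFrame.sphere Y Z (σ j) y) f = 0)
    (hYe : lieForm (Y (chartAt (E (c + 1)) x x)) e = 0) : L.IsReducibleAt x := by
  set y₀ := chartAt (E (c + 1)) x x with hy₀
  have F := H.frame
  have hB := isLieForm_lieBilin (c + 1 + 1)
  have hdim := finrank_lieSpace_eq (c + 1)
  obtain ⟨m, b⟩ := S.dupin j
  have hO₀ := S.subset hx
  set K := LegendreFrame.sphere Y Z (σ j) with hK
  obtain ⟨ι, ê, π, hê, hιê, hπ, -⟩ := exists_hyperplane_model (c + 1)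
  let a : E (c + 1) := EuclideanSpace.single 0 1
  have ha : ‖a‖ = 1 := by simp [a]
  have haa : inner ℝ (ι a) (ι a) = (1 : ℝ) := by
    rw [real_inner_self_eq_norm_sq, ι.norm_map, ha, one_pow]
  have hêê : inner ℝ ê ê = (1 : ℝ) := by rw [real_inner_self_eq_norm_sq, hê, one_pow]
  have hêι : ∀ u, inner ℝ ê (ι u) = (0 : ℝ) := fun u => by rw [real_inner_comm, hιê]
  -- `(1, 1, 0, 0)` represents the point sphere of the origin. Placing `K y₀` there keeps the
  -- improper form nonzero on `K` nearby, so every line of the slice contains a proper sphere.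
  obtain ⟨T, hT, hTef, hTK⟩ := exists_isometry_family_null ![e, f]
    ![((0, 0, ê, 0) : LieSpace (c + 1 + 1)), (0, 0, ι a, 0)]
    (by simp [Fin.forall_fin_two, hef, lieForm_comm f e])
    (by simp [Fin.forall_fin_two, lieForm, hιê, hêι])
    (Fin.forall_fin_two.2 ⟨hee.trans (by simp [lieForm, hê]), hff.trans (by simp [lieForm, ha])⟩)
    (by simp [Fin.forall_fin_two, hee, hff]) (w := K y₀) (w' := (1, 1, 0, 0))
    (F.sphere_ne_zero hO₀) (F.sphere_sphere hB hO₀)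
    (by simp [Fin.forall_fin_two, hKe y₀ hx, hKf y₀ hx]) (by simp) (by simp [lieForm])
    (by simp [Fin.forall_fin_two, lieForm])
  have hTe : T e = (0, 0, ê, 0) := hTef 0
  have hTf : T f = (0, 0, ι a, 0) := hTef 1
  have himp : ∀ᶠ y in 𝓝 y₀, improperForm _ (T (K y)) ≠ 0 := by
    have h1 : ContinuousAt (fun y => (improperForm _ ∘ₗ T.toLinearMap) (K y)) y₀ :=
      Tendsto.comp (LinearMap.continuous_of_finiteDimensional _).continuousAt
        (F.smooth_sphere hO₀ (b.smooth _ hx)).continuousAt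
    refine h1.eventually_ne ?_
    change improperForm _ (T (K y₀)) ≠ 0
    rw [hTK]; simp
  obtain ⟨s, hs, hsinj, hsU, δ, hδ, hslice⟩ := b.exists_slice F hB hdim (c := c) (by simp) (e := e)
    (by rw [lieBilin_apply, hee]; exact one_ne_zero) hKe hx hYe himp
  have A := sliceFamily_projection (τ := σ j) (Z := Z) hπ hT hTe hKe hs hsinj (fun v => (hsU v).1)
    (fun v => (hsU v).2.2)
  refine H.isReducibleAt S (Nat.lt_succ_self c) A (fun _ v => ⟨K (s v), sphere_mem_span, ?_⟩)
    hT.isLieSphereTransformation (fun P η _ hPη => ⟨surfaceOfRevolution ι P η a,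
      ⟨ι, Or.inr (Or.inr ⟨a, ha, rfl⟩)⟩, ?_⟩)
  · rw [LinearMap.comp_apply, LinearEquiv.coe_coe,
      improperForm_projection hπ hT hTe (hKe _ (hsU v).1)]
    exact (hsU v).2.1
  -- the rotation
  let α : E (c + 1) → ℝ := fun y => lieForm (Y y) e
  let β : E (c + 1) → ℝ := fun y => lieForm (Y y) f
  -- The component `(α, β)` of `Y` is rotated to `(0, β')` with `β'² = α² + β²`. The sign is chosen
  -- so that the move is trivial at `y₀`. Continuity of `ν` is all that is needed, so a zero of the
  -- square root does no harm.
  obtain ⟨ε, hε, hεβ⟩ : ∃ ε : ℝ, ε ^ 2 = 1 ∧ ε * |β y₀| = β y₀ := by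
    rcases le_total 0 (β y₀) with h | h
    · exact ⟨1, by norm_num, by rw [abs_of_nonneg h, one_mul]⟩
    · exact ⟨-1, by norm_num, by rw [abs_of_nonpos h]; ring⟩
  let β' : E (c + 1) → ℝ := fun y => ε * √(α y ^ 2 + β y ^ 2)
  let ν : E (c + 1) → LieSpace (c + 1 + 1) := fun y => (-α y) • e + (β' y - β y) • f
  have hβ' : ∀ y, β' y ^ 2 = α y ^ 2 + β y ^ 2 := fun y => by
    rw [mul_pow, hε, one_mul, Real.sq_sqrt (by positivity)]
  have hν : ∀ᶠ y in 𝓝 y₀, ‖ν y‖ < δ := by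
    have hα : ContinuousAt α y₀ := H.continuousAt_lieForm e hO₀
    have hβ : ContinuousAt β y₀ := H.continuousAt_lieForm f hO₀
    have hβ'c : ContinuousAt β' y₀ := by fun_prop
    have hνc : ContinuousAt ν y₀ := by fun_prop
    have h0 : ν y₀ = 0 := by
      have h1 : α y₀ = 0 := hYe
      have h2 : β' y₀ = β y₀ := by
        simp only [β', h1]
        rw [zero_pow two_ne_zero, zero_add, Real.sqrt_sq_eq_abs, hεβ]
      simp [ν, h1, h2]
    have h2 := hνc.norm.eventually_lt_const (u := δ) (by simpa [h0] using hδ)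
    exact h2
  filter_upwards [hslice, hν, S.isOpen.mem_nhds hx] with y hy hyν hyU hyO
  have hνK : ∀ z ∈ U, lieForm (K z) (ν y) = 0 := fun z hz => by
    rw [lieForm_add_right, lieForm_smul_right, lieForm_smul_right, hKe z hz, hKf z hz]; simp
  have hfe : lieForm f e = 0 := by rw [lieForm_comm, hef]
  have h1 : lieForm (Y y + ν y) e = 0 := by
    simp only [ν, lieForm_add_left, lieForm_smul_left, hee, hfe]
    change α y + _ = 0
    ring
  have h2 : lieForm (Y y + ν y) (Y y + ν y) = 0 := by
    have e1 : lieForm (Y y) (Y y) = 0 := F.YY y hyO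
    have e2 := hβ' y
    simp only [ν, lieForm_add_left, lieForm_smul_left, lieForm_add_right, lieForm_smul_right, hee,
      hfe, hef, hff, e1, lieForm_comm e (Y y), lieForm_comm f (Y y)]
    change 0 + (-α y * α y + (β' y - β y) * β y) + (-α y * (α y + _) + (β' y - β y) *
      (β y + _)) = 0
    linear_combination e2
  obtain ⟨v, q, r, hr, hKv, hYv⟩ := hy (ν y) hyν hνK h1 h2
  have hP := hPη 0 v
  set p := P (Sheets.of 0 v)
  set η' := η (Sheets.of 0 v)
  have hc1 : T (K y) ∈ contactLine (ι p) (ι η') := by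
    rw [← lieInclusion_projection hπ hT hTe (hKe y hyU)]
    exact lieInclusion_mem_contactLine (τ := σ j) ι hP (z := K y) (q := 1) (r := 0)
      (by rw [one_smul, zero_smul, add_zero]; exact hKv.symm)
  have hc2 : T (Y y + ν y) ∈ contactLine (ι p) (ι η') := by
    rw [← lieInclusion_projection hπ hT hTe h1]
    exact lieInclusion_mem_contactLine (τ := σ j) ι hP (q := q) (r := r) (by rw [hYv, hKv])
  -- `u` and `w` are the components of the moved and the original line in the plane of rotation.
  -- They have equal length, so a reflection maps `u` to `w`, and it fixes everything orthogonal to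
  -- this plane, in particular the axis.
  let u := β' y • ι a
  let w := α y • ê + β y • ι a
  have huw : ‖u‖ = ‖w‖ := by
    rw [← sq_eq_sq₀ (norm_nonneg _) (norm_nonneg _), ← real_inner_self_eq_norm_sq,
      ← real_inner_self_eq_norm_sq]
    simp only [u, w, inner_add_left, inner_add_right, inner_smul_left, inner_smul_right, haa, hêê,
      hιê, hêι, conj_trivial]
    linear_combination hβ' y
  let R := (ℝ ∙ (u - w))ᗮ.reflection
  have hRu : R u = w := Submodule.reflection_sub huw
  have hRfix : ∀ z, inner ℝ z (ι a) = (0 : ℝ) → inner ℝ z ê = (0 : ℝ) → R z = z := by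
    intro z hz1 hz2
    refine Submodule.reflection_mem_subspace_eq_self ?_
    rw [Submodule.mem_orthogonal_singleton_iff_inner_left]
    simp [u, w, inner_sub_right, inner_add_right, inner_smul_right, hz1, hz2]
  have hTx : ∀ z, lieForm z e = inner ℝ (T z).2.2.1 ê ∧ lieForm z f = inner ℝ (T z).2.2.1 (ι a) := by
    intro z
    rw [← hT z e, ← hT z f, hTe, hTf]
    simp [lieForm]
  have hR1 : lieInclusion R.toLinearIsometry (T (K y)) = T (K y) := by
    refine Prod.ext rfl (Prod.ext rfl (Prod.ext ?_ rfl))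
    refine hRfix _ ?_ ?_
    · rw [← (hTx _).2, hKf y hyU]
    · rw [← (hTx _).1, hKe y hyU]
  have hR2 : lieInclusion R.toLinearIsometry (T (Y y + ν y)) = T (Y y) := by
    have e1 : T (Y y + ν y) = T (Y y) + (0, 0, u - w, 0) := by
      rw [map_add, map_add, map_smul, map_smul, hTe, hTf]
      congr 1
      simp only [Prod.smul_mk, smul_zero, Prod.mk_add_mk, add_zero, u, w]
      congr 3
      module
    rw [e1]
    refine Prod.ext (by simp [lieInclusion]) (Prod.ext (by simp [lieInclusion])
      (Prod.ext ?_ (by simp [lieInclusion])))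
    change R ((T (Y y)).2.2.1 + (u - w)) = (T (Y y)).2.2.1
    have e2 : (T (Y y)).2.2.1 + (u - w) = ((T (Y y)).2.2.1 - w) + u := by abel
    rw [e2, map_add, hRu, hRfix, sub_add_cancel]
    · rw [inner_sub_left, ← (hTx _).2]
      simp only [w, inner_add_left, inner_smul_left, haa, hêι, conj_trivial]
      change β y - _ = 0
      ring
    · rw [inner_sub_left, ← (hTx _).1]
      simp only [w, inner_add_left, inner_smul_left, hêê, hιê, conj_trivial]
      change α y - _ = 0
      ring
  refine ⟨Sheets.of 0 v, R, fun u hu => hRfix _ ?_ (hιê u), ?_⟩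
  · rw [ι.inner_map_map, hu]
  · refine map_span_eq_contactLine (τ := σ j) F hyO ?_ ?_
    · have h := map_lieInclusion_contactLine R.toLinearIsometry (ι p) (ι η')
      refine h ▸ ?_
      exact ⟨_, hc1, hR1⟩
    · have h := map_lieInclusion_contactLine R.toLinearIsometry (ι p) (ι η')
      refine h ▸ ?_
      exact ⟨_, hc2, hR2⟩

/-- After an isometry `w` is the improper point, so the spheres of the branch are hyperplanes
parallel to `e`. Translations along `e` fix them. The move `ν` below is such a translation on `Y`:
its `e`-part makes the result orthogonal to `e`, and its `w`-part keeps the result null. The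
hypothesis on `Y` and `w` makes the slice lines proper and allows division by `γ`. -/
theorem LegendreSubmanifold.LocalFrame.isReducibleAt_of_cylinder
    (H : L.LocalFrame x g O Y Z n₁ n₂) (S : BranchSystem O Y Z U σ)
    (hx : chartAt (E (c + 1)) x x ∈ U) (j : Fin g) {e w : LieSpace (c + 1 + 1)}
    (hee : lieForm e e = 1) (hww : lieForm w w = 0) (hew : lieForm e w = 0)
    (hKe : ∀ y ∈ U, lieForm (LegendreFrame.sphere Y Z (σ j) y) e = 0)
    (hKw : ∀ y ∈ U, lieForm (LegendreFrame.sphere Y Z (σ j) y) w = 0)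
    (hYe : lieForm (Y (chartAt (E (c + 1)) x x)) e = 0)
    (hYw : lieForm (Y (chartAt (E (c + 1)) x x)) w ≠ 0) : L.IsReducibleAt x := by
  set y₀ := chartAt (E (c + 1)) x x with hy₀
  have F := H.frame
  have hB := isLieForm_lieBilin (c + 1 + 1)
  have hdim := finrank_lieSpace_eq (c + 1)
  obtain ⟨m, b⟩ := S.dupin j
  have hO₀ := S.subset hx
  set K := LegendreFrame.sphere Y Z (σ j) with hK
  obtain ⟨ι, ê, π, hê, hιê, hπ, -⟩ := exists_hyperplane_model (c + 1)
  have hêê : inner ℝ ê ê = (1 : ℝ) := by rw [real_inner_self_eq_norm_sq, hê, one_pow]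
  have hw0 : w ≠ 0 := by rintro rfl; exact hYw (lieForm_zero_right _)
  obtain ⟨T, hT, hTe', hTw⟩ := exists_isometry_family_null (fun _ : Fin 1 => e)
    (fun _ => ((0, 0, ê, 0) : LieSpace (c + 1 + 1)))
    (fun i j h => absurd (Subsingleton.elim i j) h) (fun i j h => absurd (Subsingleton.elim i j) h)
    (fun _ => hee.trans (by simp [lieForm, hê])) (fun _ => by rw [hee]; exact one_ne_zero)
    (w' := (1, -1, 0, 0)) hw0 hww (fun _ => by rw [lieForm_comm, hew]) (by simp) (by simp [lieForm])
    (fun _ => by simp [lieForm])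
  have hTe : T e = (0, 0, ê, 0) := hTe' 0
  let α : E (c + 1) → ℝ := fun y => lieForm (Y y) e
  let γ : E (c + 1) → ℝ := fun y => lieForm (Y y) w
  have himpγ : ∀ y, improperForm _ (T (Y y)) = - γ y := by
    intro y
    simp only [γ, ← hT (Y y) w, hTw]
    simp [lieForm]
    ring
  have hα : ContinuousAt α y₀ := H.continuousAt_lieForm e hO₀
  have hγ : ContinuousAt γ y₀ := H.continuousAt_lieForm w hO₀
  obtain ⟨s, hs, hsinj, hsU, δ, hδ, hslice⟩ := b.exists_slice F hB hdim (c := c) (by simp) (e := e)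
    (by rw [lieBilin_apply, hee]; exact one_ne_zero) hKe hx hYe (hγ.eventually_ne hYw)
  have A := sliceFamily_projection (τ := σ j) (Z := Z) hπ hT hTe hKe hs hsinj (fun v => (hsU v).1)
    (fun v => (hsU v).2.2)
  refine H.isReducibleAt S (Nat.lt_succ_self c) A
    (fun _ v => ⟨Y (s v), Submodule.subset_span (by simp), ?_⟩)
    hT.isLieSphereTransformation (fun P η _ hPη => ⟨cylinder ι P η, ⟨ι, Or.inr (Or.inl rfl)⟩, ?_⟩)
  · rw [LinearMap.comp_apply, LinearEquiv.coe_coe,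
      improperForm_projection hπ hT hTe (hsU v).2.2, himpγ]
    exact neg_ne_zero.2 (hsU v).2.1
  -- the translation
  let ν : E (c + 1) → LieSpace (c + 1 + 1) := fun y => (-α y) • e + (α y ^ 2 / (2 * γ y)) • w
  have hν : ∀ᶠ y in 𝓝 y₀, ‖ν y‖ < δ := by
    have hνc : ContinuousAt ν y₀ :=
      (hα.neg.smul continuousAt_const).add (((hα.pow 2).div (continuousAt_const.mul hγ)
        (mul_ne_zero two_ne_zero hYw)).smul continuousAt_const)
    have h0 : ν y₀ = 0 := by
      have h1 : α y₀ = 0 := hYe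
      simp [ν, h1]
    exact hνc.norm.eventually_lt_const (u := δ) (by simpa [h0] using hδ)
  filter_upwards [hslice, hν, S.isOpen.mem_nhds hx, hγ.eventually_ne hYw] with y hy hyν hyU hγy hyO
  have hνK : ∀ z ∈ U, lieForm (K z) (ν y) = 0 := fun z hz => by
    rw [lieForm_add_right, lieForm_smul_right, lieForm_smul_right, hKe z hz, hKw z hz]; simp
  have hwe : lieForm w e = 0 := by rw [lieForm_comm, hew]
  have h1 : lieForm (Y y + ν y) e = 0 := by
    simp only [ν, lieForm_add_left, lieForm_smul_left, hee, hwe]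
    change α y + _ = 0
    ring
  have h2 : lieForm (Y y + ν y) (Y y + ν y) = 0 := by
    have e1 : lieForm (Y y) (Y y) = 0 := F.YY y hyO
    simp only [ν, lieForm_add_left, lieForm_smul_left, lieForm_add_right, lieForm_smul_right, hee,
      hwe, hew, hww, e1, lieForm_comm e (Y y), lieForm_comm w (Y y)]
    change 0 + (-α y * α y + α y ^ 2 / (2 * γ y) * γ y) + (-α y * (α y + _) + α y ^ 2 / (2 * γ y) *
      (γ y + _)) = 0
    field_simp
    ring
  obtain ⟨v, q, r, hr, hKv, hYv⟩ := hy (ν y) hyν hνK h1 h2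
  have hP := hPη 0 v
  set p := P (Sheets.of 0 v)
  set η' := η (Sheets.of 0 v)
  have hc1 : T (K y) ∈ contactLine (ι p) (ι η') := by
    rw [← lieInclusion_projection hπ hT hTe (hKe y hyU)]
    exact lieInclusion_mem_contactLine (τ := σ j) ι hP (z := K y) (q := 1) (r := 0)
      (by rw [one_smul, zero_smul, add_zero]; exact hKv.symm)
  have hc2 : T (Y y + ν y) ∈ contactLine (ι p) (ι η') := by
    rw [← lieInclusion_projection hπ hT hTe h1]
    exact lieInclusion_mem_contactLine (τ := σ j) ι hP (q := q) (r := r) (by rw [hYv, hKv])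
  have himp : ∀ r t : ℝ, improperForm (c + 1 + 1) (r • pointSphere (ι p) +
      t • orientedPlane (ι p) (ι η')) = r := by
    intro r t
    rw [map_add, map_smul, map_smul]
    simp [pointSphere, orientedPlane]
    ring
  -- `Y` has improper form `-γ`, so its centre in affine normalization is obtained by division by
  -- `-γ`. The removed component `α` along the normal becomes this translation.
  let t : E (c + 1 + 1) := (-(α y / γ y)) • ê
  have hιt : ∀ u, inner ℝ (ι u) t = (0 : ℝ) := fun u => by
    simp [t, inner_smul_right, hιê]
  have htt : inner ℝ t t = (α y / γ y) ^ 2 := by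
    simp only [t, inner_smul_right, inner_smul_left, hêê, conj_trivial]; ring
  have hop : orientedPlane (ι p + t) (ι η') = orientedPlane (ι p) (ι η') := by
    rw [orientedPlane, orientedPlane, inner_add_left, real_inner_comm (ι η') t, hιt, add_zero]
  have hps : pointSphere (ι p + t) = pointSphere (ι p) + (0, 0, t, 0) +
      ((α y / γ y) ^ 2 / 2) • ((1, -1, 0, 0) : LieSpace (c + 1 + 1)) := by
    have e1 : inner ℝ (ι p + t) (ι p + t) = (inner ℝ (ι p) (ι p) : ℝ) + (α y / γ y) ^ 2 := by
      rw [inner_add_left, inner_add_right, inner_add_right, htt, real_inner_comm (ι p) t, hιt]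
      ring
    simp only [pointSphere, e1]
    refine Prod.ext ?_ (Prod.ext ?_ (Prod.ext ?_ ?_)) <;> simp <;> ring
  refine ⟨Sheets.of 0 v, t, hιt, map_span_eq_contactLine (τ := σ j) F hyO ?_ ?_⟩
  · obtain ⟨x₁, x₂, hx₁₂⟩ := Submodule.mem_span_pair.1 hc1
    have hx₁ : x₁ = 0 := by
      rw [← himp x₁ x₂, hx₁₂]
      have e1 := hT (K y) w
      rw [hTw, hKw y hyU] at e1
      simp [lieForm] at e1
      rw [improperForm_apply]
      linarith
    rw [← hx₁₂, hx₁, zero_smul, zero_add]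
    refine Submodule.smul_mem _ _ (Submodule.subset_span (Or.inr ?_))
    exact hop.symm
  · obtain ⟨x₁, x₂, hx₁₂⟩ := Submodule.mem_span_pair.1 hc2
    have hx₁ : x₁ = - γ y := by
      have e1 := himp x₁ x₂
      rw [hx₁₂, map_add, map_add, himpγ] at e1
      rw [← e1]
      simp [ν, hTe, hTw]
    have e2 : T (Y y) = x₁ • pointSphere (ι p + t) + x₂ • orientedPlane (ι p + t) (ι η') := by
      have e3 : T (Y y) = T (Y y + ν y) - T (ν y) := by rw [map_add, add_sub_cancel_right]
      have e4 : T (ν y) = γ y • ((0, 0, t, 0) : LieSpace (c + 1 + 1)) +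
          (γ y * ((α y / γ y) ^ 2 / 2)) • ((1, -1, 0, 0) : LieSpace (c + 1 + 1)) := by
        simp only [ν, map_add, map_smul, hTe, hTw, t]
        congr 1
        · simp only [Prod.smul_mk, smul_zero, smul_smul]
          congr 4
          field_simp
        · congr 1
          field_simp
      rw [e3, e4, ← hx₁₂, hop, hps, hx₁]
      module
    rw [e2]
    exact Submodule.mem_span_pair.2 ⟨_, _, rfl⟩

end

end LieSphere

/-! ### Tubes: poles, boosts and countably many slices. -/

namespace LegendreFrame

/-- Each leaf of a curvature sphere map contains three points with different lines. -/
theorem DupinBranch.exists_leaf_points {V Λ : Type*} [NormedAddCommGroup V]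
    [NormedSpace ℝ V] [FiniteDimensional ℝ V] [NormedAddCommGroup Λ] [NormedSpace ℝ Λ]
    [FiniteDimensional ℝ Λ]
    {B : Λ →L[ℝ] Λ →L[ℝ] ℝ} {O : Set V} {Y Z : V → Λ} {n₁ n₂ : Λ →L[ℝ] ℝ} {U : Set V}
    {σ : V → ℝ} {m : ℕ} (b : DupinBranch O Y Z U σ m) (F : LegendreFrame B O Y Z n₁ n₂)
    {y₀ : V} (hy₀ : y₀ ∈ U) :
    ∃ q : Fin 3 → V, (∀ i, q i ∈ U) ∧ (∀ i, sphere Y Z σ (q i) = sphere Y Z σ y₀) ∧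
      (∀ i j, Y (q i) = Y (q j) → i = j) ∧
      ∀ i, ∀ Q : V → Prop, (∀ᶠ y in 𝓝 (q i), Q y) →
        ∀ᶠ y in 𝓝 y₀, ∃ y', Q y' ∧ sphere Y Z σ y' = sphere Y Z σ y := by
  obtain ⟨R, D, π, π', e, r, L⟩ := b.exists_leafCoordinates F hy₀ univ univ_mem
  have hU : ∀ y ∈ e.source, y ∈ U := fun y hy => (L.subset hy).1
  set K := sphere Y Z σ with hK
  obtain ⟨u, hu0⟩ : ∃ u : D, u ≠ 0 := by
    have h1 : principal Y Z (σ y₀) y₀ ≠ ⊥ := by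
      intro h
      have h2 := b.rank y₀ hy₀
      rw [h, finrank_bot] at h2
      exact b.pos.ne h2
    obtain ⟨X, hX, hX0⟩ := (Submodule.ne_bot_iff _).1 h1
    refine ⟨π' (fderiv ℝ Y y₀ X), fun h => hX0 (L.inj y₀ L.mem X ?_ h)⟩
    rw [(b.fderiv_sphere_eq_zero_iff F hy₀ X).2 hX, map_zero]
  -- Leaf parameters at distances `0`, `r / 3` and `2 r / 3` from the centre, all inside the box.
  -- Three points are needed because a leaf can contain two poles.
  let t : Fin 3 → D := fun i => π' (Y y₀) + ((i : ℝ) * (r / 3 / ‖u‖)) • u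
  have hu : 0 < ‖u‖ := norm_pos_iff.2 hu0
  have hr := L.pos
  have ht : ∀ i, t i ∈ Metric.ball (π' (Y y₀)) r := by
    intro i
    have hi : ((i : ℕ) : ℝ) ≤ 2 := by exact_mod_cast Nat.le_of_lt_succ i.2
    rw [mem_ball_iff_norm, add_sub_cancel_left, norm_smul, Real.norm_of_nonneg (by positivity),
      mul_assoc, div_mul_cancel₀ _ hu.ne']
    nlinarith
  have hc := Metric.mem_ball_self (x := π (K y₀)) L.pos
  have htar : ∀ i, (π (K y₀), t i) ∈ e.target := fun i => L.mem_target hc (ht i)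
  have hKeq : ∀ i, ∀ y ∈ e.source, π (K y) ∈ Metric.ball (π (K y₀)) r →
      π' (Y y) ∈ Metric.ball (π' (Y y₀)) r → K (e.symm (π (K y), t i)) = K y := by
    intro i y hy h1 h2
    have e1 := L.sphere_symm h1 (ht i)
    have e2 := L.sphere_symm h1 h2
    rw [← L.coe y hy, e.left_inv hy] at e2
    rw [hK, e1, e2]
  refine ⟨fun i => e.symm (π (K y₀), t i), fun i => hU _ (e.map_target (htar i)),
    fun i => hKeq i y₀ L.mem hc (Metric.mem_ball_self L.pos), fun i j hij => ?_, fun i Q hQ => ?_⟩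
  · have e1 := (L.coe_symm (htar i)).2
    have e2 := (L.coe_symm (htar j)).2
    simp only at hij
    rw [hij, e2] at e1
    have e3 : (((j : ℕ) : ℝ) * (r / 3 / ‖u‖)) = ((i : ℕ) : ℝ) * (r / 3 / ‖u‖) :=
      smul_left_injective ℝ hu0 (add_left_cancel e1)
    have e4 : ((j : ℕ) : ℝ) = ((i : ℕ) : ℝ) :=
      mul_right_cancel₀ (by positivity : r / 3 / ‖u‖ ≠ 0) e3
    exact Fin.ext (by exact_mod_cast e4.symm)
  · have hKc : ContinuousAt (fun y => π (K y)) y₀ :=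
      π.continuous.continuousAt.comp (F.smooth_sphere (b.subset hy₀) (b.smooth _ hy₀)).continuousAt
    have hYc : ContinuousAt (fun y => π' (Y y)) y₀ :=
      π'.continuous.continuousAt.comp (F.diffY (b.subset hy₀)).continuousAt
    have hlim : Tendsto (fun y => e.symm (π (K y), t i)) (𝓝 y₀) (𝓝 (e.symm (π (K y₀), t i))) :=
      (e.continuousAt_symm (htar i)).tendsto.comp (hKc.prodMk continuousAt_const)
    filter_upwards [hlim.eventually hQ, e.open_source.mem_nhds L.mem,
      hKc.eventually (Metric.ball_mem_nhds _ L.pos), hYc.eventually (Metric.ball_mem_nhds _ L.pos)]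
      with y h1 h2 h3 h4
    exact ⟨_, h1, hKeq i y h2 h3 h4⟩

end LegendreFrame

namespace LieSphere
open LegendreFrame

/-- The parallel transformation as a linear automorphism. -/
theorem exists_parallelEquiv (n : ℕ) (ε : ℝ) :
    ∃ T : LieSpace n ≃ₗ[ℝ] LieSpace n, IsLieIsometry T ∧ ∀ v, T v = parallelMap n ε v := by
  have hinj : Function.Injective (parallelMap n ε) := by
    rw [← LinearMap.ker_eq_bot, LinearMap.ker_eq_bot']
    intro v hv
    refine (isLieForm_lieBilin n).nondeg v fun w => ?_
    rw [lieBilin_apply, ← lieForm_parallelMap ε, hv, lieForm_zero_left]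
  exact ⟨LinearEquiv.ofInjectiveEndo _ hinj, lieForm_parallelMap ε, fun _ => rfl⟩

theorem parallelMap_mem_contactLine {n : ℕ} (ε : ℝ) {p ν : E n} (hν : inner ℝ ν ν = (1 : ℝ))
    {z : LieSpace n} (hz : z ∈ contactLine p ν) :
    parallelMap n ε z ∈ contactLine (p + ε • ν) ν := by
  obtain ⟨r, t, rfl⟩ := Submodule.mem_span_pair.1 hz
  rw [map_add, map_smul, map_smul, parallelMap_pointSphere ε hν, parallelMap_orientedPlane ε hν]
  refine Submodule.mem_span_pair.2 ⟨r, t - r * ε, ?_⟩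
  module

theorem exists_angle {x y : ℝ} (h : x ^ 2 + y ^ 2 = 1) :
    ∃ θ : ℝ, Real.cos θ = x ∧ Real.sin θ = y := by
  have h1 : ‖(⟨x, y⟩ : ℂ)‖ = 1 := by
    rw [Complex.norm_def, Complex.normSq_mk, ← sq, ← sq, h, Real.sqrt_one]
  refine ⟨Complex.arg ⟨x, y⟩, ?_, ?_⟩
  · have := Complex.norm_mul_cos_arg ⟨x, y⟩
    rwa [h1, one_mul] at this
  · have := Complex.norm_mul_sin_arg ⟨x, y⟩
    rwa [h1, one_mul] at this

end LieSphere

namespace LieSphere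
open LegendreFrame

section Boost
variable {n : ℕ} {e f : LieSpace n} (hee : lieForm e e = 1) (hff : lieForm f f = -1)
  (hef : lieForm e f = 0)

/-- The linear map that carries the hyperplane orthogonal to `e' = a e - b f` isometrically onto
the hyperplane orthogonal to `e`, and fixes the vectors orthogonal to `e` and `f`. -/
noncomputable def boost (e f : LieSpace n) (a b : ℝ) : LieSpace n →ₗ[ℝ] LieSpace n :=
  LinearMap.id - ((lieBilin n).flip e).toLinearMap.smulRight e
    + ((lieBilin n).flip (f - (a • f - b • e))).toLinearMap.smulRight f

theorem boost_apply (a b : ℝ) (x : LieSpace n) : boost e f a b x =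
    x - lieForm x e • e + (lieForm x f - (a * lieForm x f - b * lieForm x e)) • f := by
  have h : lieForm x (f - (a • f - b • e)) =
      lieForm x f - (a * lieForm x f - b * lieForm x e) := by
    simp only [lieForm_sub_right, lieForm_smul_right]
  rw [← h]
  rfl

theorem boost_of_orthogonal (a b : ℝ) {x : LieSpace n} (h1 : lieForm x e = 0)
    (h2 : lieForm x f = 0) : boost e f a b x = x := by
  rw [boost_apply, h1, h2]; simp

include hee hef in
theorem lieForm_boost_left (a b : ℝ) (x : LieSpace n) : lieForm (boost e f a b x) e = 0 := by
  rw [boost_apply]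
  simp only [lieForm_sub_left, lieForm_add_left, lieForm_smul_left, hee, lieForm_comm f e, hef]
  ring

/-- In the hyperbolic plane the complement of `a e - b f` is spanned by the timelike unit vector `a
f - b e`, so both products of `x` are multiples of its product with that vector. The boost replaces
this vector by `f`. -/
theorem coordinates_of_orthogonal {a b : ℝ} (hab : a ^ 2 - b ^ 2 = 1) {x : LieSpace n}
    (hx : lieForm x (a • e - b • f) = 0) :
    lieForm x e = b * (a * lieForm x f - b * lieForm x e) ∧
      lieForm x f = a * (a * lieForm x f - b * lieForm x e) := by
  simp only [lieForm_sub_right, lieForm_smul_right] at hx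
  constructor
  · linear_combination a * hx - lieForm x e * hab
  · linear_combination b * hx - lieForm x f * hab

include hee hff hef in
theorem lieForm_boost {a b : ℝ} (hab : a ^ 2 - b ^ 2 = 1) {x y : LieSpace n}
    (hx : lieForm x (a • e - b • f) = 0) (hy : lieForm y (a • e - b • f) = 0) :
    lieForm (boost e f a b x) (boost e f a b y) = lieForm x y := by
  obtain ⟨x1, x2⟩ := coordinates_of_orthogonal hab hx
  obtain ⟨y1, y2⟩ := coordinates_of_orthogonal hab hy
  rw [boost_apply, boost_apply]
  set X := a * lieForm x f - b * lieForm x e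
  set Y := a * lieForm y f - b * lieForm y e
  simp only [lieForm_sub_left, lieForm_add_left, lieForm_smul_left, lieForm_sub_right,
    lieForm_add_right, lieForm_smul_right, hee, hff, hef, lieForm_comm f e, lieForm_comm e y,
    lieForm_comm f y]
  rw [x1, x2, y1, y2]
  linear_combination X * Y * hab

theorem eq_zero_of_boost (hee : lieForm e e = 1) (hff : lieForm f f = -1)
    (hef : lieForm e f = 0) {a b : ℝ} (hab : a ^ 2 - b ^ 2 = 1) {x : LieSpace n}
    (hx : lieForm x (a • e - b • f) = 0) (h : boost e f a b x = 0) : x = 0 := by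
  obtain ⟨x1, x2⟩ := coordinates_of_orthogonal hab hx
  have h1 : lieForm (boost e f a b x) f = 0 := by rw [h, lieForm_zero_left]
  rw [boost_apply] at h1
  simp only [lieForm_sub_left, lieForm_add_left, lieForm_smul_left, hff, hef] at h1
  have h2 : a * lieForm x f - b * lieForm x e = 0 := by linarith
  rw [h2, mul_zero] at x1 x2
  rwa [boost_of_orthogonal a b x1 x2] at h

end Boost

section
variable {c : ℕ} {W : Type*} [TopologicalSpace W] [ChartedSpace (E (c + 1)) W]
  [IsManifold (𝓡 (c + 1)) ∞ W]
  {L : LegendreSubmanifold (c + 1) W} {x : W} {g : ℕ} {O : Set (E (c + 1))}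
  {Y Z : E (c + 1) → LieSpace (c + 1 + 1)} {n₁ n₂ : LieSpace (c + 1 + 1) →L[ℝ] ℝ}
  {U : Set (E (c + 1))} {τ : E (c + 1) → ℝ} {m : ℕ}

/-- The projection of a Legendre submanifold to a hyperbolic plane that is orthogonal to its
curvature sphere is causal, and it is null only for the poles. -/
theorem causal_projection (F : LegendreFrame (lieBilin (c + 1 + 1)) O Y Z n₁ n₂)
    {e f : LieSpace (c + 1 + 1)} (hee : lieForm e e = 1) (hff : lieForm f f = -1)
    (hef : lieForm e f = 0) {y : E (c + 1)} (hy : y ∈ O)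
    (hKe : lieForm (LegendreFrame.sphere Y Z τ y) e = 0)
    (hKf : lieForm (LegendreFrame.sphere Y Z τ y) f = 0) :
    lieForm (Y y) e ^ 2 ≤ lieForm (Y y) f ^ 2 ∧ lieForm (Y y) f ≠ 0 ∧
      (lieForm (Y y) e ^ 2 = lieForm (Y y) f ^ 2 → ∃ p : ℝ,
        Y y - lieForm (Y y) e • e + lieForm (Y y) f • f = p • LegendreFrame.sphere Y Z τ y) := by
  have hB := isLieForm_lieBilin (c + 1 + 1)
  set K := LegendreFrame.sphere Y Z τ y with hK
  have hKK : lieForm K K = 0 := F.sphere_sphere hB hy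
  have hYK : lieForm (Y y) K = 0 := F.Y_sphere hB hy
  have hYY : lieForm (Y y) (Y y) = 0 := F.YY y hy
  have hK0 : K ≠ 0 := F.sphere_ne_zero hy
  have hfe : lieForm f e = 0 := by rw [lieForm_comm, hef]
  have heK : lieForm e K = 0 := by rw [lieForm_comm, hKe]
  have hfK : lieForm f K = 0 := by rw [lieForm_comm, hKf]
  set α := lieForm (Y y) e with hα
  set β := lieForm (Y y) f with hβ
  set v := Y y - α • e + β • f with hv
  have hvv : lieForm v v = β ^ 2 - α ^ 2 := by
    simp only [hv, lieForm_sub_left, lieForm_add_left, lieForm_smul_left, lieForm_sub_right,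
      lieForm_add_right, lieForm_smul_right, hee, hff, hef, hfe, hYY, lieForm_comm e (Y y),
      lieForm_comm f (Y y), ← hα, ← hβ]
    ring
  have hvK : lieForm v K = 0 := by
    simp only [hv, lieForm_sub_left, lieForm_add_left, lieForm_smul_left, hYK, heK, hfK]
    ring
  have hvf : lieForm v f = 0 := by
    simp only [hv, lieForm_sub_left, lieForm_add_left, lieForm_smul_left, hff, hef, ← hβ]
    ring
  have hve : lieForm v e = 0 := by
    simp only [hv, lieForm_sub_left, lieForm_add_left, lieForm_smul_left, hee, hfe, ← hα]
    ring
  -- `K` and `e + f` span an isotropic plane. The part `v` of `Y` orthogonal to `e` and `f` is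
  -- orthogonal to it, so `B v v = β² - α²` is nonnegative, and if it vanishes then `v` is a
  -- multiple of `K`.
  have hlin : LinearIndependent ℝ ![K, e + f] := by
    rw [LinearIndependent.pair_iff]
    intro p q h
    have h1 : lieForm (p • K + q • (e + f)) f = 0 := by rw [h, lieForm_zero_left]
    simp only [lieForm_add_left, lieForm_smul_left, hKf, hef, hff] at h1
    have hq : q = 0 := by linarith
    rw [hq, zero_smul, add_zero] at h
    exact ⟨(smul_eq_zero.1 h).resolve_right hK0, hq⟩
  have hpos := hB.pos K (e + f) hlin hKK
    (by rw [lieBilin_apply, lieForm_add_right, hKe, hKf, add_zero])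
    (by
      rw [lieBilin_apply]
      simp only [lieForm_add_left, lieForm_add_right, hee, hef, hfe, hff]
      ring) v hvK (by rw [lieBilin_apply, lieForm_add_right, hve, hvf, add_zero])
  rw [lieBilin_apply, hvv] at hpos
  have hnull : α ^ 2 = β ^ 2 → ∃ p : ℝ, v = p • K := by
    intro h
    obtain ⟨p, q, hpq⟩ := Submodule.mem_span_pair.1 (hpos.2 (by rw [h, sub_self]))
    have h1 : lieForm (p • K + q • (e + f)) f = 0 := by rw [hpq, hvf]
    simp only [lieForm_add_left, lieForm_smul_left, hKf, hef, hff] at h1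
    have hq : q = 0 := by linarith
    exact ⟨p, by rw [← hpq, hq, zero_smul, add_zero]⟩
  refine ⟨by linarith [hpos.1], fun hβ0 => ?_, hnull⟩
  have hα0 : α = 0 := by
    have := hpos.1
    rw [hβ0] at this
    nlinarith [sq_nonneg α]
  obtain ⟨p, hp⟩ := hnull (by rw [hα0, hβ0])
  rw [hv, hα0, hβ0, zero_smul, zero_smul, sub_zero, add_zero] at hp
  have e2 := congrArg n₂ hp
  rw [F.n₂Y _ hy, map_smul, F.n₂_sphere hy, smul_eq_mul, mul_one] at e2
  have e1 := congrArg n₁ hp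
  rw [← e2, zero_smul, F.n₁Y _ hy, map_zero] at e1
  exact one_ne_zero e1

/-- On each leaf some point is not a pole. -/
theorem exists_timelike (F : LegendreFrame (lieBilin (c + 1 + 1)) O Y Z n₁ n₂)
    (b : DupinBranch O Y Z U τ m)
    {e f : LieSpace (c + 1 + 1)} (hee : lieForm e e = 1) (hff : lieForm f f = -1)
    (hef : lieForm e f = 0)
    (hKe : ∀ y ∈ U, lieForm (LegendreFrame.sphere Y Z τ y) e = 0)
    (hKf : ∀ y ∈ U, lieForm (LegendreFrame.sphere Y Z τ y) f = 0) {y₀ : E (c + 1)} (hy₀ : y₀ ∈ U) :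
    ∃ y₁ ∈ U, lieForm (Y y₁) e ^ 2 < lieForm (Y y₁) f ^ 2 ∧
      ∀ Q : E (c + 1) → Prop, (∀ᶠ y in 𝓝 y₁, Q y) → ∀ᶠ y in 𝓝 y₀, ∃ y', Q y' ∧
        LegendreFrame.sphere Y Z τ y' = LegendreFrame.sphere Y Z τ y := by
  obtain ⟨q, hqU, hqK, hqinj, hq⟩ := b.exists_leaf_points F hy₀
  by_contra! hcon
  have hcaus := fun i => causal_projection F hee hff hef (b.subset (hqU i)) (hKe _ (hqU i))
    (hKf _ (hqU i))
  have heq : ∀ i, lieForm (Y (q i)) e ^ 2 = lieForm (Y (q i)) f ^ 2 := by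
    intro i
    by_contra h
    obtain ⟨Q, hQ, hQ'⟩ := hcon (q i) (hqU i) (lt_of_le_of_ne (hcaus i).1 h)
    exact hQ' ((hq i Q hQ).mono fun y ⟨y', h1, h2⟩ h3 => h3 y' h1 h2)
  -- At a pole `α = ±β`. Among three points of a leaf two have the same sign; there `Y` lies in the
  -- span of `K` and one null vector, and the normalizations make the two values equal.
  have hsign : ∀ i, ∃ s : Bool, lieForm (Y (q i)) e =
      (if s then 1 else -1) * lieForm (Y (q i)) f := by
    intro i
    rcases sq_eq_sq_iff_eq_or_eq_neg.1 (heq i) with h | h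
    · exact ⟨true, by simpa using h⟩
    · exact ⟨false, by simpa using h⟩
  choose s hs using hsign
  obtain ⟨i, j, hij, hsij⟩ := Fintype.exists_ne_map_eq_of_card_lt s (by simp)
  apply hij
  apply hqinj
  set K := LegendreFrame.sphere Y Z τ y₀
  let w : LieSpace (c + 1 + 1) := (if s i then (1 : ℝ) else -1) • e - f
  have hform : ∀ l, s l = s i → ∃ p : ℝ, Y (q l) = p • K + lieForm (Y (q l)) f • w := by
    intro l hl
    obtain ⟨p, hp⟩ := (hcaus l).2.2 (heq l)
    refine ⟨p, ?_⟩
    rw [hqK, hs l, hl] at hp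
    rw [← hp]
    simp only [w]
    module
  obtain ⟨p, hp⟩ := hform i rfl
  obtain ⟨p', hp'⟩ := hform j hsij.symm
  set β := lieForm (Y (q i)) f
  set β' := lieForm (Y (q j)) f
  have hK2 : n₂ K = 1 := F.n₂_sphere (b.subset hy₀)
  have hO := fun l => b.subset (hqU l)
  have e1 : β' * p = β * p' := by
    have h1 := congrArg n₂ hp
    have h2 := congrArg n₂ hp'
    rw [F.n₂Y _ (hO _), map_add, map_smul, map_smul, hK2, smul_eq_mul, smul_eq_mul] at h1 h2
    linear_combination β * h2 - β' * h1
  have e2 : β' • Y (q i) = β • Y (q j) := by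
    rw [hp, hp', smul_add, smul_add, smul_smul, smul_smul, smul_smul, smul_smul, e1, mul_comm β']
  have e3 : β' = β := by
    have h1 := congrArg n₁ e2
    simpa [F.n₁Y _ (hO _)] using h1
  rw [e3] at e2
  exact smul_right_injective _ (hcaus i).2.1 e2

end

end LieSphere

/-! ### The tube construction. -/

namespace LieSphere
open LegendreFrame

section
variable {c : ℕ} {W : Type*} [TopologicalSpace W] [ChartedSpace (E (c + 1)) W]
  [IsManifold (𝓡 (c + 1)) ∞ W]
  {L : LegendreSubmanifold (c + 1) W} {x : W} {g : ℕ} {O : Set (E (c + 1))}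
  {Y Z : E (c + 1) → LieSpace (c + 1 + 1)} {n₁ n₂ : LieSpace (c + 1 + 1) →L[ℝ] ℝ}
  {U : Set (E (c + 1))} {σ : Fin g → E (c + 1) → ℝ} {τ : E (c + 1) → ℝ} {m : ℕ}

/-- A slice orthogonal to a moving vector of a hyperbolic plane, through a point that is not a
pole. -/
theorem exists_boosted_slice (F : LegendreFrame (lieBilin (c + 1 + 1)) O Y Z n₁ n₂)
    (b : DupinBranch O Y Z U τ m)
    {e f : LieSpace (c + 1 + 1)} (hee : lieForm e e = 1) (hff : lieForm f f = -1)
    (hef : lieForm e f = 0)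
    (hKe : ∀ y ∈ U, lieForm (LegendreFrame.sphere Y Z τ y) e = 0)
    (hKf : ∀ y ∈ U, lieForm (LegendreFrame.sphere Y Z τ y) f = 0) {y₁ : E (c + 1)} (hy₁ : y₁ ∈ U)
    (hlt : lieForm (Y y₁) e ^ 2 < lieForm (Y y₁) f ^ 2) :
    ∃ (a t : ℝ) (s : E c → E (c + 1)), a ^ 2 - t ^ 2 = 1 ∧ ContDiff ℝ ∞ s ∧
      (∀ v X, fderiv ℝ s v X = 0 → X = 0) ∧
      (∀ v, s v ∈ U ∧ lieForm (Y (s v)) (a • e - t • f) = 0) ∧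
      ∀ᶠ y in 𝓝 y₁, ∃ v, LegendreFrame.sphere Y Z τ (s v) = LegendreFrame.sphere Y Z τ y ∧
        ∃ (ν : LieSpace (c + 1 + 1)) (q r : ℝ), Y y + ν = q • LegendreFrame.sphere Y Z τ (s v) + r • Y (s v) ∧
          lieForm (Y y + ν) (a • e - t • f) = 0 ∧ boost e f a t (Y y + ν) = Y y
            - lieForm (Y y) e • e
            + (lieForm (Y y) f - √(lieForm (Y y) f ^ 2 - lieForm (Y y) e ^ 2)) • f := by
  have hB := isLieForm_lieBilin (c + 1 + 1)
  have hdim := finrank_lieSpace_eq (c + 1)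
  have hfe : lieForm f e = 0 := by rw [lieForm_comm, hef]
  have hO₁ := b.subset hy₁
  let α : E (c + 1) → ℝ := fun y => lieForm (Y y) e
  let β : E (c + 1) → ℝ := fun y => lieForm (Y y) f
  let D : E (c + 1) → ℝ := fun y => √(β y ^ 2 - α y ^ 2)
  have hDpos : 0 < D y₁ := Real.sqrt_pos.2 (sub_pos.2 hlt)
  have hD2 : D y₁ ^ 2 = β y₁ ^ 2 - α y₁ ^ 2 := Real.sq_sqrt (sub_pos.2 hlt).le
  -- `a e - t f` is the spacelike unit vector of the hyperbolic plane that is orthogonal to `Y y₁`;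
  -- it exists because the projection of `Y y₁` to this plane is timelike.
  let a := β y₁ / D y₁
  let t := α y₁ / D y₁
  have hat : a ^ 2 - t ^ 2 = 1 := by
    simp only [a, t, div_pow]
    rw [← sub_div, ← hD2, div_self (pow_ne_zero 2 hDpos.ne')]
  have hYe₁ : lieForm (Y y₁) (a • e - t • f) = 0 := by
    rw [lieForm_sub_right, lieForm_smul_right, lieForm_smul_right]
    change β y₁ / D y₁ * α y₁ - α y₁ / D y₁ * β y₁ = 0
    ring
  have he₁ : lieForm (a • e - t • f) (a • e - t • f) = 1 := by
    simp only [lieForm_sub_left, lieForm_smul_left, lieForm_sub_right, lieForm_smul_right, hee,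
      hff, hef, hfe]
    linear_combination hat
  have hKe₁ : ∀ y ∈ U, lieForm (LegendreFrame.sphere Y Z τ y) (a • e - t • f) = 0 := fun y hy => by
    rw [lieForm_sub_right, lieForm_smul_right, lieForm_smul_right, hKe y hy, hKf y hy]; simp
  obtain ⟨s, hs, hsinj, hsU, δ, hδ, hslice⟩ := b.exists_slice F hB hdim (c := c) (by simp)
    (e := a • e - t • f) (by rw [lieBilin_apply, he₁]; exact one_ne_zero) hKe₁ hy₁ hYe₁ univ_mem
  refine ⟨a, t, s, hat, hs, hsinj, fun v => ⟨(hsU v).1, (hsU v).2.2⟩, ?_⟩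
  -- The component `α e - β f` of `Y` is replaced by `-D (a f - t e)`, which has the same length and
  -- is orthogonal to `a e - t f`. At `y₁` the two components agree.
  let ν : E (c + 1) → LieSpace (c + 1 + 1) := fun y =>
    (-D y) • (a • f - t • e) - α y • e + β y • f
  have hν : ∀ᶠ y in 𝓝 y₁, ‖ν y‖ < δ := by
    have hα : ContinuousAt α y₁ :=
      Tendsto.comp ((lieBilin (c + 1 + 1)).flip e).continuous.continuousAt
        (F.smoothY _ hO₁).continuousAt
    have hβ : ContinuousAt β y₁ :=
      Tendsto.comp ((lieBilin (c + 1 + 1)).flip f).continuous.continuousAt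
        (F.smoothY _ hO₁).continuousAt
    have hDc : ContinuousAt D y₁ := by fun_prop
    have hνc : ContinuousAt ν y₁ := by fun_prop
    have h0 : ν y₁ = 0 := by
      have h1 : D y₁ * a = β y₁ := mul_div_cancel₀ _ hDpos.ne'
      have h2 : D y₁ * t = α y₁ := mul_div_cancel₀ _ hDpos.ne'
      simp only [ν]
      rw [smul_sub, smul_smul, smul_smul, neg_mul, neg_mul, h1, h2]
      module
    exact hνc.norm.eventually_lt_const (u := δ) (by simpa [h0] using hδ)
  filter_upwards [hslice, hν, b.isOpen.mem_nhds hy₁] with y hy hyν hyU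
  have hO := b.subset hyU
  have hD2 : D y ^ 2 = β y ^ 2 - α y ^ 2 := Real.sq_sqrt (sub_nonneg.2
    (causal_projection F hee hff hef hO (hKe y hyU) (hKf y hyU)).1)
  have e1 : lieForm (Y y + ν y) e = t * D y := by
    simp only [ν, lieForm_add_left, lieForm_smul_left, lieForm_sub_left, hee, hfe]
    change α y + (-D y * (a * 0 - t * 1) - α y * 1 + β y * 0) = _
    ring
  have e2 : lieForm (Y y + ν y) f = a * D y := by
    simp only [ν, lieForm_add_left, lieForm_smul_left, lieForm_sub_left, hff, hef]
    change β y + (-D y * (a * -1 - t * 0) - α y * 0 + β y * -1) = _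
    ring
  have h1 : lieForm (Y y + ν y) (a • e - t • f) = 0 := by
    rw [lieForm_sub_right, lieForm_smul_right, lieForm_smul_right, e1, e2]; ring
  have h2 : lieForm (Y y + ν y) (Y y + ν y) = 0 := by
    have e0 : lieForm (Y y) (Y y) = 0 := F.YY y hO
    simp only [ν, lieForm_add_left, lieForm_smul_left, lieForm_sub_left, lieForm_add_right,
      lieForm_smul_right, lieForm_sub_right, hee, hff, hef, hfe, e0, lieForm_comm e (Y y),
      lieForm_comm f (Y y)]
    change 0 + (-D y * (a * β y - t * α y) - α y * α y + β y * β y)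
      + (-D y * (a * (β y + _) - t * (α y + _)) - α y * (α y + _) + β y * (β y + _)) = 0
    linear_combination (-D y ^ 2) * hat - hD2
  have h3 : ∀ z ∈ U, lieForm (LegendreFrame.sphere Y Z τ z) (ν y) = 0 := fun z hz => by
    simp only [ν, lieForm_add_right, lieForm_sub_right, lieForm_smul_right, hKe z hz, hKf z hz]
    ring
  obtain ⟨v, q, r, -, hKv, hYv⟩ := hy (ν y) hyν h3 h1 h2
  refine ⟨v, hKv, ν y, q, r, by rw [hYv, hKv], h1, ?_⟩
  rw [boost_apply, e1, e2]
  have e3 : a * (a * D y) - t * (t * D y) = D y := by linear_combination D y * hat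
  rw [e3]
  change Y y + ((-D y) • (a • f - t • e) - α y • e + β y • f) - (t * D y) • e +
    (a * D y - D y) • f = Y y - α y • e + (β y - D y) • f
  module

/-- After an isometry `f` is the radius direction and `e` the normal of a hyperplane, so the spheres
of the branch are points of the hyperplane. The contact elements are based at these points with
normals `cos θ η + sin θ e`: a tube of radius zero. A slice orthogonal to `a e - t f` has constant
`θ`, and the boost turns it into the slice `θ = 0`. A parallel transformation finally makes the
radius positive. -/
theorem LegendreSubmanifold.LocalFrame.isReducibleAt_of_tube
    (H : L.LocalFrame x g O Y Z n₁ n₂) (S₀ : BranchSystem O Y Z U σ)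
    (hx₀ : chartAt (E (c + 1)) x x ∈ U) (j : Fin g) {e f : LieSpace (c + 1 + 1)}
    (hee : lieForm e e = 1) (hff : lieForm f f = -1) (hef : lieForm e f = 0)
    (hKe₀ : ∀ y ∈ U, lieForm (LegendreFrame.sphere Y Z (σ j) y) e = 0)
    (hKf₀ : ∀ y ∈ U, lieForm (LegendreFrame.sphere Y Z (σ j) y) f = 0) : L.IsReducibleAt x := by
  set y₀ := chartAt (E (c + 1)) x x with hy₀
  have F := H.frame
  have hB := isLieForm_lieBilin (c + 1 + 1)
  obtain ⟨m₀, b₀⟩ := S₀.dupin j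
  have hO₀ := S₀.subset hx₀
  set K := LegendreFrame.sphere Y Z (σ j) with hK
  obtain ⟨ι, ê, π, hê, hιê, hπ, hπι⟩ := exists_hyperplane_model (c + 1)
  have hêê : inner ℝ ê ê = (1 : ℝ) := by rw [real_inner_self_eq_norm_sq, hê, one_pow]
  let e₄ : LieSpace (c + 1 + 1) := (0, 0, 0, 1)
  -- `K y₀` is sent to the point sphere of the origin, so that the spheres `K` stay proper points
  -- nearby.
  obtain ⟨T, hT, hTef, hTK⟩ := exists_isometry_family_null ![e, f]
    ![((0, 0, ê, 0) : LieSpace (c + 1 + 1)), e₄]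
    (by simp [Fin.forall_fin_two, hef, lieForm_comm f e])
    (by simp [Fin.forall_fin_two, lieForm, e₄])
    (Fin.forall_fin_two.2 ⟨hee.trans (by simp [lieForm, hê]),
      hff.trans (by simp [lieForm, e₄])⟩)
    (by simp [Fin.forall_fin_two, hee, hff]) (w := K y₀) (w' := (1, 1, 0, 0))
    (F.sphere_ne_zero hO₀) (F.sphere_sphere hB hO₀)
    (by simp [Fin.forall_fin_two, hKe₀ y₀ hx₀, hKf₀ y₀ hx₀]) (by simp) (by simp [lieForm])
    (by simp [Fin.forall_fin_two, lieForm, e₄])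
  have hTe : T e = (0, 0, ê, 0) := hTef 0
  have hTf : T f = e₄ := hTef 1
  have himp : ∀ᶠ y in 𝓝 y₀, y ∈ U ∧ improperForm _ (T (K y)) ≠ 0 := by
    have h1 : ContinuousAt (fun y => (improperForm _ ∘ₗ T.toLinearMap) (K y)) y₀ :=
      Tendsto.comp (LinearMap.continuous_of_finiteDimensional _).continuousAt
        (F.smooth_sphere hO₀ (b₀.smooth _ hx₀)).continuousAt
    refine (S₀.isOpen.eventually_mem hx₀).and (h1.eventually_ne ?_)
    change improperForm _ (T (K y₀)) ≠ 0
    rw [hTK]; simp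
  obtain ⟨U', hU', hU'o, hx⟩ := mem_nhds_iff.1 himp
  have S := S₀.mono hU'o fun y hy => (hU' hy).1
  have hKe : ∀ y ∈ U', lieForm (K y) e = 0 := fun y hy => hKe₀ y (hU' hy).1
  have hKf : ∀ y ∈ U', lieForm (K y) f = 0 := fun y hy => hKf₀ y (hU' hy).1
  obtain ⟨m, b⟩ := S.dupin j
  -- the slices
  let α : E (c + 1) → ℝ := fun y => lieForm (Y y) e
  let β : E (c + 1) → ℝ := fun y => lieForm (Y y) f
  let Valid : ℝ × ℝ × (E c → E (c + 1)) → Prop := fun D => D.1 ^ 2 - D.2.1 ^ 2 = 1 ∧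
    ContDiff ℝ ∞ D.2.2 ∧ (∀ v X, fderiv ℝ D.2.2 v X = 0 → X = 0) ∧
    ∀ v, D.2.2 v ∈ U' ∧ lieForm (Y (D.2.2 v)) (D.1 • e - D.2.1 • f) = 0
  let Good : ℝ × ℝ × (E c → E (c + 1)) → E (c + 1) → Prop := fun D y =>
    ∃ v, K (D.2.2 v) = K y ∧ (α y ^ 2 < β y ^ 2 → ∃ (ν : LieSpace (c + 1 + 1)) (q r : ℝ),
      Y y + ν = q • K (D.2.2 v) + r • Y (D.2.2 v) ∧
      lieForm (Y y + ν) (D.1 • e - D.2.1 • f) = 0 ∧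
      boost e f D.1 D.2.1 (Y y + ν) = Y y - α y • e + (β y - √(β y ^ 2 - α y ^ 2)) • f)
  -- Away from the poles a slice through `y` serves all nearby points. At a pole only a point of the
  -- slice with the same sphere `K` is required, and it comes from a slice through a timelike point
  -- of the leaf of `y`. That slice is only claimed to serve the poles near `y`.
  have hloc : ∀ y ∈ U', ∃ D, Valid D ∧ (α y ^ 2 < β y ^ 2 → ∀ᶠ z in 𝓝 y, Good D z) ∧
      (¬ α y ^ 2 < β y ^ 2 → ∀ᶠ z in 𝓝 y, ¬ α z ^ 2 < β z ^ 2 → Good D z) := by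
    intro y hy
    by_cases hlt : α y ^ 2 < β y ^ 2
    · obtain ⟨a, t, s, h1, h2, h3, h4, h5⟩ := exists_boosted_slice F b hee hff hef hKe hKf hy hlt
      refine ⟨(a, t, s), ⟨h1, h2, h3, h4⟩, fun _ => ?_, fun h => absurd hlt h⟩
      exact h5.mono fun z ⟨v, hv, hz⟩ => ⟨v, hv, fun _ => hz⟩
    · obtain ⟨y₁, hy₁, hlt₁, hev⟩ := exists_timelike F b hee hff hef hKe hKf hy
      obtain ⟨a, t, s, h1, h2, h3, h4, h5⟩ :=
        exists_boosted_slice F b hee hff hef hKe hKf hy₁ hlt₁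
      refine ⟨(a, t, s), ⟨h1, h2, h3, h4⟩, fun h => absurd h hlt, fun _ => ?_⟩
      refine (hev _ h5).mono ?_
      rintro z ⟨y', ⟨v, hv, -⟩, hz⟩ hnz
      exact ⟨v, hv.trans hz, fun h => absurd h hnz⟩
  choose! D hDvalid hDlt hDge using hloc
  -- The Lindelöf property is applied separately to the poles and to the other points, because a
  -- slice chosen at a pole is good only relative to the set of poles.
  obtain ⟨N, hNU, hNc, hcov⟩ : ∃ N ⊆ U', N.Countable ∧ ∀ y ∈ U', ∃ z ∈ N, Good (D z) y := by
    obtain ⟨N₁, h1, hc1, hN₁⟩ := TopologicalSpace.countable_cover_nhdsWithin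
      (f := fun y => {z | Good (D y) z}) (s := {y ∈ U' | α y ^ 2 < β y ^ 2})
      (fun y hy => mem_nhdsWithin_of_mem_nhds (hDlt y hy.1 hy.2))
    obtain ⟨N₂, h2, hc2, hN₂⟩ := TopologicalSpace.countable_cover_nhdsWithin
      (f := fun y => {z | Good (D y) z}) (s := {y ∈ U' | ¬ α y ^ 2 < β y ^ 2})
      (fun y hy => by
        filter_upwards [mem_nhdsWithin_of_mem_nhds (hDge y hy.1 hy.2), self_mem_nhdsWithin]
          with z hz1 hz2 using hz1 hz2.2)
    refine ⟨N₁ ∪ N₂, union_subset (fun y hy => (h1 hy).1) (fun y hy => (h2 hy).1), hc1.union hc2,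
      fun y hy => ?_⟩
    by_cases h : α y ^ 2 < β y ^ 2
    · obtain ⟨z, hz, hgood⟩ := mem_iUnion₂.1 (hN₁ ⟨hy, h⟩)
      exact ⟨z, Or.inl hz, hgood⟩
    · obtain ⟨z, hz, hgood⟩ := mem_iUnion₂.1 (hN₂ ⟨hy, h⟩)
      exact ⟨z, Or.inr hz, hgood⟩
  obtain ⟨z₀, hz₀, -⟩ := hcov y₀ hx
  obtain ⟨u, rfl⟩ := hNc.exists_eq_range ⟨z₀, hz₀⟩
  have hV : ∀ n, Valid (D (u n)) := fun n => hDvalid _ (hNU ⟨n, rfl⟩)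
  let s : ℕ → E c → E (c + 1) := fun n => (D (u n)).2.2
  let G : ℕ → LieSpace (c + 1 + 1) →ₗ[ℝ] LieSpace (c + 1 + 1) := fun n =>
    boost e f (D (u n)).1 (D (u n)).2.1
  have hKs : ∀ y ∈ U', ∀ n, lieForm (K y) ((D (u n)).1 • e - (D (u n)).2.1 • f) = 0 :=
    fun y hy n => by
      rw [lieForm_sub_right, lieForm_smul_right, lieForm_smul_right, hKe y hy, hKf y hy]; simp
  have A : SliceFamily Y Z U' s (fun n => (D (u n)).1 • e - (D (u n)).2.1 • f)
      (fun n => π ∘ₗ T.toLinearMap ∘ₗ G n) :=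
    { smooth := fun n => (hV n).2.1
      inj := fun n => (hV n).2.2.1
      mem := fun n v => ((hV n).2.2.2 v).1
      orthY := fun n v => ((hV n).2.2.2 v).2
      orthZ := fun n v => by
        have h1 : Z (s n v) = K (s n v) - σ j (s n v) • Y (s n v) := by
          rw [hK, LegendreFrame.sphere]; abel
        rw [h1, lieForm_sub_left, lieForm_smul_left, hKs _ ((hV n).2.2.2 v).1,
          ((hV n).2.2.2 v).2]
        simp
      isometric := fun n z z' hz hz' => by
        have h1 := lieForm_boost hee hff hef (hV n).1 hz hz'
        rw [← h1]
        exact lieForm_projection hπ hT hTe (lieForm_boost_left hee hef _ _ z)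
          (lieForm_boost_left hee hef _ _ z')
      ker := fun n z hz h => eq_zero_of_boost hee hff hef (hV n).1 hz
        (eq_zero_of_projection hπ hT hTe (lieForm_boost_left hee hef _ _ z) h) }
  have hGK : ∀ n, ∀ y ∈ U', G n (K y) = K y := fun n y hy =>
    boost_of_orthogonal _ _ (hKe y hy) (hKf y hy)
  have hincl : ∀ n z, lieInclusion ι ((π ∘ₗ T.toLinearMap ∘ₗ G n) z) = T (G n z) := fun n z =>
    lieInclusion_projection hπ hT hTe (lieForm_boost_left hee hef _ _ z)
  -- A tube must have positive radius; the parallel transformation turns radius zero into radius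
  -- `1`.
  obtain ⟨Tp, hTp, hTpv⟩ := exists_parallelEquiv (c + 1 + 1) 1
  refine H.isReducibleAt S (Nat.lt_succ_self c) A
    (fun n v => ⟨K (s n v), sphere_mem_span, ?_⟩) (hT.trans hTp).isLieSphereTransformation
    (fun P η hη hPη => ⟨tube ι P η 1, ⟨ι, Or.inl ⟨1, one_pos, rfl⟩⟩, ?_⟩)
  · have hs := ((hV n).2.2.2 v).1
    change improperForm (c + 1) (π (T (G n (K (s n v))))) ≠ 0
    rw [hGK n _ hs, improperForm_projection hπ hT hTe (hKe _ hs)]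
    exact (hU' hs).2
  filter_upwards [hU'o.mem_nhds hx] with y hyU hyO
  obtain ⟨-, ⟨n, rfl⟩, v, hKv, hYv⟩ := hcov y hyU
  have hP := hPη n v
  set p := P (Sheets.of n v)
  set η' := η (Sheets.of n v)
  have hη' : inner ℝ (ι η') (ι η') = (1 : ℝ) := by
    rw [ι.inner_map_map, real_inner_self_eq_norm_sq, hη, one_pow]
  have h4 : ∀ z, (T z).2.2.2 = - lieForm z f := fun z => by
    rw [← hT, hTf]; simp [lieForm, e₄]
  have hc1 : T (K y) ∈ contactLine (ι p) (ι η') := by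
    have h1 := lieInclusion_mem_contactLine (τ := σ j) ι hP (z := K y) (q := 1) (r := 0)
      (by rw [one_smul, zero_smul, add_zero]; exact hKv.symm)
    rwa [hincl, hGK n y hyU] at h1
  obtain ⟨x₁, hx₁0, hx₁⟩ : ∃ x₁ : ℝ, x₁ ≠ 0 ∧ T (K y) = x₁ • pointSphere (ι p) := by
    obtain ⟨x₁, x₂, hx₁₂⟩ := Submodule.mem_span_pair.1 hc1
    have h1 := h4 (K y)
    rw [hKf y hyU, ← hx₁₂] at h1
    simp [pointSphere, orientedPlane] at h1
    rw [h1, zero_smul, add_zero] at hx₁₂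
    refine ⟨x₁, ?_, hx₁₂.symm⟩
    rintro rfl
    rw [zero_smul] at hx₁₂
    exact F.sphere_ne_zero hyO ((LinearEquiv.map_eq_zero_iff T).1 hx₁₂.symm)
  obtain ⟨hcaus, hβ0, hnull⟩ := causal_projection F hee hff hef hyO (hKe y hyU) (hKf y hyU)
  let δ := √(β y ^ 2 - α y ^ 2)
  have hδ2 : δ ^ 2 = β y ^ 2 - α y ^ 2 := Real.sq_sqrt (sub_nonneg.2 hcaus)
  -- At a pole `δ = 0`, so the normal `η'` drops out of this expression. This is why any slice point
  -- with the same `K` is good enough there.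
  obtain ⟨x₂, hx₂⟩ : ∃ x₂ : ℝ, T (Y y) = x₂ • pointSphere (ι p) -
      δ • (orientedPlane (ι p) (ι η') - e₄) + α y • ((0, 0, ê, 0) : LieSpace (c + 1 + 1))
      - β y • e₄ := by
    by_cases hlt : α y ^ 2 < β y ^ 2
    · obtain ⟨ν, q, r, h1, -, h3⟩ := hYv hlt
      have h5 := lieInclusion_mem_contactLine (τ := σ j) ι hP h1
      rw [hincl] at h5
      simp only [G] at h5
      rw [h3] at h5
      obtain ⟨x₂, x₃, hx₂₃⟩ := Submodule.mem_span_pair.1 h5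
      have h6 := h4 (Y y - α y • e + (β y - √(β y ^ 2 - α y ^ 2)) • f)
      rw [← hx₂₃] at h6
      simp only [lieForm_add_left, lieForm_sub_left, lieForm_smul_left, hef, hff] at h6
      have h7 : x₃ = - δ := by
        have h8 : x₃ = -(β y - α y * 0 + (β y - δ) * -1) := by
          refine Eq.trans ?_ h6
          simp [pointSphere, orientedPlane]
        rw [h8]; ring
      refine ⟨x₂, ?_⟩
      rw [map_add, map_sub, map_smul, map_smul, hTe, hTf, h7] at hx₂₃
      have h9 : T (Y y) = (T (Y y) - α y • ((0, 0, ê, 0) : LieSpace (c + 1 + 1))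
        + (β y - δ) • e₄) + α y • ((0, 0, ê, 0) : LieSpace (c + 1 + 1)) - (β y - δ) • e₄ := by abel
      rw [h9, ← hx₂₃]
      module
    · have heq : α y ^ 2 = β y ^ 2 := le_antisymm hcaus (not_lt.1 hlt)
      obtain ⟨q, hq⟩ := hnull heq
      have hδ0 : δ = 0 := by simp [δ, heq]
      refine ⟨q * x₁, ?_⟩
      have h1 := congrArg T hq
      rw [map_smul, map_add, map_sub, map_smul, map_smul, hTe, hTf] at h1
      change T (Y y) - α y • _ + β y • e₄ = q • T (K y) at h1
      rw [hx₁, smul_smul] at h1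
      rw [hδ0, zero_smul, sub_zero, ← h1]
      abel
  have hβ0' : β y ≠ 0 := hβ0
  -- Up to the factor `-β` and a multiple of the point sphere, `T (Y y)` is the oriented plane whose
  -- normal has components `δ / β` along `η'` and `-α / β` along the normal of the hyperplane. Their
  -- squares add up to `1` because `δ² = β² - α²`.
  obtain ⟨θ, hcos, hsin⟩ := exists_angle (x := δ / β y) (y := -α y / β y) (by
    rw [div_pow, div_pow, neg_sq, ← add_div, hδ2, sub_add_cancel, div_self (pow_ne_zero 2 hβ0')])
  let ν := Real.cos θ • ι η' + Real.sin θ • ê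
  have hêι : inner ℝ ê (ι η') = (0 : ℝ) := by rw [real_inner_comm, hιê]
  have hνν : inner ℝ ν ν = (1 : ℝ) := by
    simp only [ν, inner_add_left, inner_add_right, inner_smul_left, inner_smul_right, hη', hêê,
      hιê, hêι, conj_trivial]
    linear_combination Real.cos_sq_add_sin_sq θ
  have hop : orientedPlane (ι p) ν = Real.cos θ • orientedPlane (ι p) (ι η') +
      Real.sin θ • ((0, 0, ê, 0) : LieSpace (c + 1 + 1)) + (1 - Real.cos θ) • e₄ := by
    have h1 : inner ℝ (ι p) ν = Real.cos θ * inner ℝ (ι p) (ι η') := by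
      simp only [ν, inner_add_right, inner_smul_right, hιê, mul_zero, add_zero]
    rw [orientedPlane, h1]
    refine Prod.ext ?_ (Prod.ext ?_ (Prod.ext ?_ ?_)) <;> simp [orientedPlane, e₄, ν]
  refine ⟨Sheets.of n v, θ, ê, ν, hê, hιê, rfl,
    map_span_eq_contactLine (T := T.trans Tp) (τ := σ j) F hyO ?_ ?_⟩
  · rw [LinearEquiv.trans_apply, hTpv]
    refine parallelMap_mem_contactLine 1 hνν ?_
    change T (K y) ∈ _
    rw [hx₁]
    exact Submodule.smul_mem _ _ (Submodule.subset_span (Or.inl rfl))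
  · rw [LinearEquiv.trans_apply, hTpv]
    refine parallelMap_mem_contactLine 1 hνν (Submodule.mem_span_pair.2 ⟨x₂, -β y, ?_⟩)
    have h1 : β y * Real.cos θ = δ := by rw [hcos, mul_div_cancel₀ _ hβ0']
    have h2 : β y * Real.sin θ = - α y := by rw [hsin, mul_div_cancel₀ _ hβ0']
    rw [hx₂, hop, ← h1]
    have h3 : α y = - (β y * Real.sin θ) := by rw [h2, neg_neg]
    rw [h3]
    module

end

end LieSphere

/-! ### The exceptional case: a vector on a line of the submanifold orthogonal to all spheres of a
branch. -/

namespace LegendreFrame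

section TwoBranches
variable {V Λ : Type*} [NormedAddCommGroup V] [NormedSpace ℝ V] [FiniteDimensional ℝ V]
  [NormedAddCommGroup Λ] [NormedSpace ℝ Λ] [FiniteDimensional ℝ Λ]
  {B : Λ →L[ℝ] Λ →L[ℝ] ℝ} {O : Set V} {Y Z : V → Λ} {n₁ n₂ : Λ →L[ℝ] ℝ}
  {U : Set V} {σ τ : V → ℝ} {m k : ℕ}
  (F : LegendreFrame B O Y Z n₁ n₂) (hB : IsLieForm B)

include F hB in
/-- All lines through a common fixed vector that is orthogonal to a curvature sphere map determine
the other curvature spheres. -/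
theorem DupinBranch.coefficient_eq_zero (b : DupinBranch O Y Z U σ m) {y₀ : V} (hy₀ : y₀ ∈ U)
    {a t : ℝ} (hw : ∀ y ∈ U, B (sphere Y Z σ y) (a • Y y₀ + t • sphere Y Z σ y₀) = 0)
    {ρ : ℝ} {X : V} (hX0 : X ≠ 0) (hX : pencil Y Z ρ y₀ X = 0) (hρ : ρ ≠ σ y₀) :
    a + t * (σ y₀ - ρ) = 0 := by
  set K := sphere Y Z σ with hK
  set w := a • Y y₀ + t • K y₀ with hwdef
  have hO := b.subset hy₀
  have hKs : ∀ y ∈ U, ContDiffAt ℝ ∞ K y := fun y hy => F.smooth_sphere (b.subset hy) (b.smooth y hy)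
  have hdKw : ∀ y ∈ U, B (fderiv ℝ K y X) w = 0 := by
    intro y hy
    have h1 := bilinear_fderiv_eq_zero B (b.isOpen.mem_nhds hy)
      ((hKs y hy).differentiableAt (by simp)) (differentiableAt_const w) hw X
    rw [fderiv_fun_const] at h1
    simpa using h1
  have hW : ∀ y ∈ U, B (fderiv ℝ K y X) (a • Y y + t • K y - w) = 0 := by
    intro y hy
    rw [map_sub, map_add, map_smul, map_smul, hdKw y hy, b.fderiv_sphere_sphere F hB hy,
      hB.symm, F.Y_fderiv_sphere hB b hy]
    simp
  have hfd : DifferentiableAt ℝ (fun y => fderiv ℝ K y X) y₀ :=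
    (((hKs y₀ hy₀).fderiv_right (m := ∞) (by simp)).differentiableAt (by simp)).clm_apply
      (differentiableAt_const X)
  have hYd := F.diffY hO
  have hKd := (hKs y₀ hy₀).differentiableAt (by simp)
  have hWd : HasFDerivAt (fun y => a • Y y + t • K y - w)
      (a • fderiv ℝ Y y₀ + t • fderiv ℝ K y₀) y₀ :=
    ((hYd.hasFDerivAt.const_smul a).add (hKd.hasFDerivAt.const_smul t)).sub_const w
  -- The second factor `a Y + t K - w` vanishes at `y₀`, so only its derivative contributes. On a
  -- principal vector of `ρ` it equals `(a + t (σ - ρ)) dY X` up to a multiple of `Y`, which gives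
  -- the factor claimed.
  have h1 := bilinear_fderiv_eq_zero B (b.isOpen.mem_nhds hy₀) hfd hWd.differentiableAt hW X
  rw [hWd.fderiv, ← hwdef, sub_self, map_zero, zero_add] at h1
  have hdK : fderiv ℝ K y₀ X = (σ y₀ - ρ) • fderiv ℝ Y y₀ X + fderiv ℝ σ y₀ X • Y y₀ := by
    rw [hK, F.fderiv_sphere hO (b.smooth y₀ hy₀), pencil_sub (σ y₀) ρ, hX, zero_add]
  have hYdY : B (Y y₀) (fderiv ℝ Y y₀ X) = 0 := by rw [hB.symm, F.dY_Y hB hO]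
  have hpos := F.dY_dY_pos hB hO hX0
  rw [ContinuousLinearMap.add_apply, ContinuousLinearMap.smul_apply,
    ContinuousLinearMap.smul_apply, hdK] at h1
  simp only [map_add, map_smul, ContinuousLinearMap.add_apply, ContinuousLinearMap.smul_apply,
    smul_eq_mul, F.dY_Y hB hO, hYdY, F.YY _ hO] at h1
  have h2 : (σ y₀ - ρ) * (a + t * (σ y₀ - ρ)) * B (fderiv ℝ Y y₀ X) (fderiv ℝ Y y₀ X) = 0 := by
    linear_combination h1
  rcases mul_eq_zero.1 h2 with h3 | h3
  · exact (mul_eq_zero.1 h3).resolve_left (sub_ne_zero.2 hρ.symm)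
  · exact absurd h3 hpos.ne'

theorem LeafCoordinates.finrank_add {y₀ : V} {R D : Submodule ℝ Λ} {π : Λ →L[ℝ] R}
    {π' : Λ →L[ℝ] D} {e : OpenPartialHomeomorph V (R × D)} {r : ℝ}
    (L : LeafCoordinates Y Z σ y₀ U π π' e r) (F : LegendreFrame B O Y Z n₁ n₂)
    (b : DupinBranch O Y Z U σ m) : Module.finrank ℝ R + m = Module.finrank ℝ V := by
  have hy₀ := L.subset L.mem
  have hk : LinearMap.ker (π ∘L fderiv ℝ (sphere Y Z σ) y₀).toLinearMap =
      LinearMap.ker (fderiv ℝ (sphere Y Z σ) y₀).toLinearMap := by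
    ext X
    refine ⟨fun h => L.ker y₀ L.mem X h, fun h => ?_⟩
    change π (fderiv ℝ (sphere Y Z σ) y₀ X) = 0
    rw [show fderiv ℝ (sphere Y Z σ) y₀ X = 0 from h, map_zero]
  rw [← LinearMap.finrank_range_add_finrank_ker (π ∘L fderiv ℝ (sphere Y Z σ) y₀).toLinearMap,
    LinearMap.range_eq_top.2 (fun x => L.surj y₀ L.mem x), finrank_top, hk, ← b.rank y₀ hy₀,
    ← b.ker_fderiv_sphere F hy₀]

include F hB in
/-- If there are only two curvature sphere maps, then their values at different points are
orthogonal to each other. -/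
theorem DupinBranch.eventually_orthogonal (b₀ : DupinBranch O Y Z U σ m)
    (b₁ : DupinBranch O Y Z U τ k) {y₀ : V} (hy₀ : y₀ ∈ U) (hne : σ y₀ ≠ τ y₀)
    (hmk : m + k = Module.finrank ℝ V) :
    ∃ U' ⊆ U, IsOpen U' ∧ y₀ ∈ U' ∧ ∀ y ∈ U', ∀ z ∈ U',
      B (sphere Y Z σ y) (sphere Y Z τ z) = 0 := by
  obtain ⟨R₀, D₀, π₀, π₀', e₀, r₀, L₀'⟩ := b₀.exists_leafCoordinates F hy₀ univ univ_mem
  obtain ⟨R₁, D₁, π₁, π₁', e₁, r₁, L₁'⟩ := b₁.exists_leafCoordinates F hy₀ univ univ_mem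
  rw [inter_univ] at L₀' L₁'
  have L₀ := L₀'
  have L₁ := L₁'
  set K₀ := sphere Y Z σ with hK₀
  set K₁ := sphere Y Z τ with hK₁
  have hKs₀ : ∀ y ∈ U, ContDiffAt ℝ ∞ K₀ y := fun y hy =>
    F.smooth_sphere (b₀.subset hy) (b₀.smooth y hy)
  have hKs₁ : ∀ y ∈ U, ContDiffAt ℝ ∞ K₁ y := fun y hy =>
    F.smooth_sphere (b₁.subset hy) (b₁.smooth y hy)
  have hd₀ := L₀.finrank_add F b₀
  have hd₁ := L₁.finrank_add F b₁
  have hev : ∀ᶠ y in 𝓝 y₀, y ∈ e₀.source ∧ y ∈ e₁.source ∧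
      π₁ (K₁ y) ∈ Metric.ball (π₁ (K₁ y₀)) r₁ ∧ π₁' (Y y) ∈ Metric.ball (π₁' (Y y₀)) r₁ :=
    (e₀.open_source.eventually_mem L₀.mem).and ((e₁.open_source.eventually_mem L₁.mem).and
      (((π₁.continuous.continuousAt.comp (hKs₁ y₀ hy₀).continuousAt).eventually
        (Metric.ball_mem_nhds _ L₁.pos)).and
      ((π₁'.continuous.continuousAt.comp (F.diffY (b₁.subset hy₀)).continuousAt).eventually
        (Metric.ball_mem_nhds _ L₁.pos))))
  have hKd₁ : ∀ y ∈ U, HasFDerivAt (fun y => π₁ (K₁ y)) (π₁ ∘L fderiv ℝ K₁ y) y := fun y hy =>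
    π₁.hasFDerivAt.comp y ((hKs₁ y hy).differentiableAt (by simp)).hasFDerivAt
  -- The two leaf spaces have complementary dimensions and the leaves intersect transversally, so
  -- the labels of the two leaves through a point form coordinates.
  obtain ⟨E, hE₁, hEO, hEc, -, r, hr, htar, hconst⟩ := exists_constant_rank_coordinates K₀
    (fun y => π₁ (K₁ y)) π₀ y₀ _ hev (fun y hy => hKs₀ y (L₀.subset hy.1))
    (fun y hy => π₁.contDiff.contDiffAt.comp y (hKs₁ y (L₁.subset hy.2.1)))
    (by
      intro X h1 h2
      rw [(hKd₁ y₀ hy₀).fderiv] at h2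
      have h3 := (b₀.fderiv_sphere_eq_zero_iff F hy₀ X).1 (L₀.ker y₀ L₀.mem X h1)
      have h4 := (b₁.fderiv_sphere_eq_zero_iff F hy₀ X).1 (L₁.ker y₀ L₁.mem X h2)
      by_contra hX
      exact hne (F.eq_of_pencil (b₀.subset hy₀) hX h3 h4))
    (by omega) (fun y hy X h => L₀.ker y hy.1 X h)
  have hbox : ∀ᶠ y in 𝓝 y₀, y ∈ E.source ∧ π₀ (K₀ y) ∈ Metric.ball (π₀ (K₀ y₀)) r ∧
      π₁ (K₁ y) ∈ Metric.ball (π₁ (K₁ y₀)) r :=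
    (E.open_source.eventually_mem hE₁).and
      (((π₀.continuous.continuousAt.comp (hKs₀ y₀ hy₀).continuousAt).eventually
        (Metric.ball_mem_nhds _ hr)).and
      ((π₁.continuous.continuousAt.comp (hKs₁ y₀ hy₀).continuousAt).eventually
        (Metric.ball_mem_nhds _ hr)))
  obtain ⟨U', hU', hU'o, hyU'⟩ := mem_nhds_iff.1 hbox
  have hKleaf : ∀ y ∈ E.source, ∀ z ∈ E.source, π₁ (K₁ y) = π₁ (K₁ z) → K₁ y = K₁ z := by
    intro y hy z hz h
    obtain ⟨-, hy1, hy2, hy3⟩ := hEO hy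
    obtain ⟨-, hz1, hz2, hz3⟩ := hEO hz
    have e1 := L₁.sphere_symm hy2 hy3
    have e2 := L₁.sphere_symm hz2 hz3
    rw [← L₁.coe y hy1, e₁.left_inv hy1] at e1
    rw [← L₁.coe z hz1, e₁.left_inv hz1] at e2
    rw [hK₁, e1, e2, h]
  refine ⟨U', fun y hy => L₀.subset (hEO (hU' hy).1).1, hU'o, hyU', fun y hy z hz => ?_⟩
  obtain ⟨hy1, hy2, hy3⟩ := hU' hy
  obtain ⟨hz1, hz2, hz3⟩ := hU' hz
  -- The intersection of the first leaf of `y` with the second leaf of `z`. At `u` both spheres lie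
  -- on one isotropic line.
  set u := E.symm (π₀ (K₀ y), π₁ (K₁ z)) with hu
  have hut : (π₀ (K₀ y), π₁ (K₁ z)) ∈ E.target := htar ⟨hy2, hz3⟩
  have hus := E.map_target hut
  have huU := L₀.subset (hEO hus).1
  have hucoe : (π₀ (K₀ u), π₁ (K₁ u)) = (π₀ (K₀ y), π₁ (K₁ z)) := by
    rw [← hEc u hus, hu, E.right_inv hut]
  have e1 : K₀ u = K₀ y := by
    have h1 := hconst _ hy2 _ hz3 _ hy3
    rw [← hEc y hy1, E.left_inv hy1] at h1
    exact h1
  have e2 : K₁ u = K₁ z := hKleaf u hus z hz1 (congrArg Prod.snd hucoe)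
  have hO := b₀.subset huU
  rw [← e1, ← e2]
  simp only [hK₀, hK₁, sphere, map_add, map_smul,
    ContinuousLinearMap.add_apply, ContinuousLinearMap.smul_apply, smul_eq_mul,
    hB.symm (Z u) (Y u), F.YY u hO, F.YZ u hO, F.ZZ u hO]
  ring

include F hB in
/-- The values of a curvature sphere map span a plane that is not isotropic. -/
theorem DupinBranch.exists_form_ne_zero (b₀ : DupinBranch O Y Z U σ m)
    (b₁ : DupinBranch O Y Z U τ k) {y₀ : V} (hy₀ : y₀ ∈ U) (hne : σ y₀ ≠ τ y₀)
    (hort : ∀ y ∈ U, B (sphere Y Z τ y) (sphere Y Z σ y₀) = 0) :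
    ∃ y ∈ U, B (sphere Y Z τ y₀) (sphere Y Z τ y) ≠ 0 := by
  by_contra! h
  have hO := b₀.subset hy₀
  have hKs : ContDiffAt ℝ ∞ (sphere Y Z τ) y₀ := F.smooth_sphere hO (b₁.smooth y₀ hy₀)
  have hlin : LinearIndependent ℝ ![sphere Y Z σ y₀, sphere Y Z τ y₀] := by
    rw [LinearIndependent.pair_iff]
    intro p q hpq
    have e2 := congrArg n₂ hpq
    have e1 := congrArg n₁ hpq
    simp [sphere, F.n₁Y _ hO, F.n₁Z _ hO, F.n₂Y _ hO, F.n₂Z _ hO] at e1 e2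
    have hp : p * (σ y₀ - τ y₀) = 0 := by linear_combination e1 - τ y₀ * e2
    have hp0 := (mul_eq_zero.1 hp).resolve_right (sub_ne_zero.2 hne)
    exact ⟨hp0, by linarith⟩
  -- If all values are orthogonal to both spheres at `y₀`, they are null vectors in the complement
  -- of the line at `y₀` and so lie on this line. Then the derivative of the sphere is a multiple of
  -- `Y`, every vector is principal for `τ`, and nothing remains for `σ`.
  have hform : ∀ y ∈ U, sphere Y Z τ y = Z y₀ + n₁ (sphere Y Z τ y) • Y y₀ := by
    intro y hy
    obtain ⟨p, q, hpq⟩ := Submodule.mem_span_pair.1 ((hB.pos _ _ hlin (F.sphere_sphere hB hO)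
      (by rw [hB.symm, hort y₀ hy₀]) (F.sphere_sphere hB hO) (sphere Y Z τ y) (hort y hy)
      (by rw [hB.symm, h y hy])).2 (F.sphere_sphere hB (b₀.subset hy)))
    have e2 := congrArg n₂ hpq
    rw [F.n₂_sphere (b₀.subset hy), map_add, map_smul, map_smul, F.n₂_sphere hO, F.n₂_sphere hO,
      smul_eq_mul, smul_eq_mul, mul_one, mul_one] at e2
    have hp : p = 1 - q := by linarith
    rw [← hpq, hp]
    simp only [sphere, map_add, map_smul, F.n₁Y _ hO, F.n₁Z _ hO, smul_eq_mul]
    module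
  have hd : ∀ X, fderiv ℝ (sphere Y Z τ) y₀ X = n₁ (fderiv ℝ (sphere Y Z τ) y₀ X) • Y y₀ := by
    intro X
    have h1 : sphere Y Z τ =ᶠ[𝓝 y₀] fun y => Z y₀ + n₁ (sphere Y Z τ y) • Y y₀ := by
      filter_upwards [b₀.isOpen.mem_nhds hy₀] with y hy using hform y hy
    have h2 : HasFDerivAt (fun y => Z y₀ + n₁ (sphere Y Z τ y) • Y y₀)
        ((n₁ ∘L fderiv ℝ (sphere Y Z τ) y₀).smulRight (Y y₀)) y₀ :=
      ((n₁.hasFDerivAt.comp y₀ (hKs.differentiableAt (by simp)).hasFDerivAt).smul_const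
        (Y y₀)).const_add (Z y₀)
    conv_lhs => rw [h1.fderiv_eq, h2.fderiv]
    rfl
  have hpen : ∀ X, pencil Y Z (τ y₀) y₀ X = 0 := by
    intro X
    have h1 := hd X
    have h2 : n₁ (pencil Y Z (τ y₀) y₀ X) = 0 := by simp [F.n₁_dY hO, F.n₁_dZ hO]
    rw [F.fderiv_sphere hO (b₁.smooth y₀ hy₀), map_add, h2, map_smul, F.n₁Y _ hO, smul_eq_mul,
      mul_one, zero_add] at h1
    exact add_eq_right.1 h1
  obtain ⟨X, hX, hX0⟩ := (Submodule.ne_bot_iff (principal Y Z (σ y₀) y₀)).1 (fun h0 => by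
    have h2 := b₀.rank y₀ hy₀
    rw [h0, finrank_bot] at h2
    exact b₀.pos.ne h2)
  exact hne (F.eq_of_pencil hO hX0 hX (hpen X))

end TwoBranches

end LegendreFrame

/-! ### Sufficiency: the choice of the construction. -/

namespace LieSphere
open LegendreFrame

/-- The complement of `P` is two dimensional, so one more linear condition leaves a nonzero vector.
-/
theorem exists_orthogonal_ne_zero {n : ℕ} (P : Submodule ℝ (LieSpace n))
    (hP : Module.finrank ℝ P + 2 = Module.finrank ℝ (LieSpace n)) (ℓ : LieSpace n →ₗ[ℝ] ℝ) :
    ∃ e ≠ 0, ℓ e = 0 ∧ ∀ v ∈ P, lieForm v e = 0 := by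
  let ψ : LieSpace n →ₗ[ℝ] Module.Dual ℝ P := P.dualRestrict ∘ₗ
    ContinuousLinearMap.coeLM ℝ ∘ₗ (lieBilin n).toLinearMap
  have hker : LinearMap.ker (ψ.prod ℓ) ≠ ⊥ := by
    refine LinearMap.ker_ne_bot_of_finrank_lt ?_
    rw [Module.finrank_prod, Subspace.dual_finrank_eq, Module.finrank_self]
    omega
  obtain ⟨e, he, he0⟩ := (Submodule.ne_bot_iff _).1 hker
  rw [LinearMap.mem_ker] at he
  refine ⟨e, he0, congrArg Prod.snd he, fun v hv => ?_⟩
  rw [lieForm_comm]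
  exact congrArg (fun φ : Module.Dual ℝ P => φ ⟨v, hv⟩) (congrArg Prod.fst he)

theorem exists_smul_lieForm_eq {n : ℕ} {e : LieSpace n} {q : ℝ} (h : 0 < lieForm e e * q)
    (hq : q ^ 2 = 1) : ∃ r : ℝ, lieForm (r • e) (r • e) = q := by
  refine ⟨(√(lieForm e e * q))⁻¹, ?_⟩
  rw [lieForm_smul_left, lieForm_smul_right]
  have h1 := Real.mul_self_sqrt h.le
  have h2 : √(lieForm e e * q) ≠ 0 := (Real.sqrt_pos.2 h).ne'
  field_simp
  linear_combination (-q) * h1 - lieForm e e * hq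

section
variable {c : ℕ} {W : Type*} [TopologicalSpace W] [ChartedSpace (E (c + 1)) W]
  [IsManifold (𝓡 (c + 1)) ∞ W]
  {L : LegendreSubmanifold (c + 1) W} {x : W} {g : ℕ} {O : Set (E (c + 1))}
  {Y Z : E (c + 1) → LieSpace (c + 1 + 1)} {n₁ n₂ : LieSpace (c + 1 + 1) →L[ℝ] ℝ}
  {U : Set (E (c + 1))} {σ : Fin g → E (c + 1) → ℝ}

/-- Two null vectors that are not orthogonal span a hyperbolic plane. With the scale `t`, the sum
and difference of `w` and `t w'` have squares `1` and `-1`, which is the case of a tube. -/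
theorem LegendreSubmanifold.LocalFrame.isReducibleAt_of_null_pair
    (H : L.LocalFrame x g O Y Z n₁ n₂) (S : BranchSystem O Y Z U σ)
    (hx : chartAt (E (c + 1)) x x ∈ U) (j : Fin g) {w w' : LieSpace (c + 1 + 1)}
    (hw : lieForm w w = 0) (hw' : lieForm w' w' = 0) (hww : lieForm w w' ≠ 0)
    (hKw : ∀ y ∈ U, lieForm (LegendreFrame.sphere Y Z (σ j) y) w = 0)
    (hKw' : ∀ y ∈ U, lieForm (LegendreFrame.sphere Y Z (σ j) y) w' = 0) : L.IsReducibleAt x := by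
  set t := (2 * lieForm w w')⁻¹ with ht
  have ht1 : 2 * t * lieForm w w' = 1 := by rw [ht]; field_simp
  have hs := lieForm_comm w' w
  refine H.isReducibleAt_of_tube S hx j (e := w + t • w') (f := w - t • w') ?_ ?_ ?_
    (fun y hy => ?_) (fun y hy => ?_)
  · simp only [lieForm_add_left, lieForm_add_right, lieForm_smul_left, lieForm_smul_right, hw, hw',
      hs]
    linear_combination ht1
  · simp only [lieForm_sub_left, lieForm_sub_right, lieForm_smul_left, lieForm_smul_right, hw, hw',
      hs]
    linear_combination -ht1
  · simp only [lieForm_add_left, lieForm_sub_right, lieForm_smul_left, lieForm_smul_right, hw, hw',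
      hs]
    ring
  · rw [lieForm_add_right, lieForm_smul_right, hKw y hy, hKw' y hy]; ring
  · rw [lieForm_sub_right, lieForm_smul_right, hKw y hy, hKw' y hy]; ring

/-- A totally umbilic Legendre submanifold is a tube around a point of a hyperplane. -/
theorem LegendreSubmanifold.LocalFrame.isReducibleAt_of_subsingleton
    (H : L.LocalFrame x g O Y Z n₁ n₂) (S₀ : BranchSystem O Y Z U σ)
    (hx₀ : chartAt (E (c + 1)) x x ∈ U) (j : Fin g) (hj : ∀ p, p = j) : L.IsReducibleAt x := by
  set y₀ := chartAt (E (c + 1)) x x with hy₀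
  have F := H.frame
  have hB := isLieForm_lieBilin (c + 1 + 1)
  obtain ⟨r, hr, hrU⟩ := Metric.isOpen_iff.1 S₀.isOpen y₀ hx₀
  have S := S₀.mono Metric.isOpen_ball hrU
  have hx := Metric.mem_ball_self (x := y₀) hr
  obtain ⟨m, b⟩ := S.dupin j
  have hO₀ := S.subset hx
  set K := LegendreFrame.sphere Y Z (σ j) with hK
  have hm : m = Module.finrank ℝ (E (c + 1)) := by
    haveI : Subsingleton (Fin g) := ⟨fun p q => (hj p).trans (hj q).symm⟩
    have h1 := F.sum_finrank_principal hB (finrank_lieSpace_eq (c + 1)) hO₀ _ (S.inj y₀ hx)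
      (S.spec y₀ hx)
    rwa [Fintype.sum_subsingleton _ j, b.rank y₀ hx] at h1
  have hd : ∀ y ∈ Metric.ball y₀ r, fderiv ℝ K y = 0 := by
    intro y hy
    ext1 X
    refine (b.fderiv_sphere_eq_zero_iff F hy X).2 ?_
    have h1 : LegendreFrame.principal Y Z (σ j y) y = ⊤ :=
      Submodule.eq_top_of_finrank_eq ((b.rank y hy).trans hm)
    exact (h1.symm ▸ Submodule.mem_top : X ∈ LegendreFrame.principal Y Z (σ j y) y)
  have hconst : ∀ y ∈ Metric.ball y₀ r, K y = K y₀ := fun y hy =>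
    (convex_ball y₀ r).is_const_of_fderivWithin_eq_zero (𝕜 := ℝ)
      (fun z hz => ((F.smooth_sphere (S.subset hz) (b.smooth z hz)).differentiableAt
        (by simp)).differentiableWithinAt)
      (fun z hz => by rw [fderivWithin_of_isOpen Metric.isOpen_ball hz, hd z hz]) hy hx
  obtain ⟨ι, ê, π, hê, -⟩ := exists_hyperplane_model (c + 1)
  obtain ⟨T, hT, -, hTK⟩ := exists_isometry_family_null (Fin.elim0 : Fin 0 → LieSpace (c + 1 + 1))
    Fin.elim0 (fun i => i.elim0) (fun i => i.elim0) (fun i => i.elim0) (fun i => i.elim0)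
    (w := K y₀) (w' := (1, 1, 0, 0)) (F.sphere_ne_zero hO₀) (F.sphere_sphere hB hO₀)
    (fun i => i.elim0) (by simp) (by simp [lieForm]) (fun i => i.elim0)
  -- The only sphere is constant and corresponds to the origin, so any pair of standard vectors
  -- orthogonal to the origin's point sphere can serve as `e` and `f`.
  refine H.isReducibleAt_of_tube S hx j (e := T.symm (0, 0, ê, 0)) (f := T.symm (0, 0, 0, 1))
    ?_ ?_ ?_ (fun y hy => ?_) (fun y hy => ?_)
  · rw [← hT]; simp [lieForm, hê]
  · rw [← hT]; simp [lieForm]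
  · rw [← hT]; simp [lieForm]
  · rw [← hK, hconst y hy, ← hT, hTK]; simp [lieForm]
  · rw [← hK, hconst y hy, ← hT, hTK]; simp [lieForm]

/-- The case where a curvature sphere map is orthogonal to a vector on a line of the
submanifold. -/
theorem LegendreSubmanifold.LocalFrame.isReducibleAt_of_mem_line
    (H : L.LocalFrame x g O Y Z n₁ n₂) (S : BranchSystem O Y Z U σ)
    (hx : chartAt (E (c + 1)) x x ∈ U) (j : Fin g) {w : LieSpace (c + 1 + 1)} (hw0 : w ≠ 0)
    (hw : w ∈ Submodule.span ℝ {Y (chartAt (E (c + 1)) x x),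
      LegendreFrame.sphere Y Z (σ j) (chartAt (E (c + 1)) x x)})
    (hKw : ∀ y ∈ U, lieForm (LegendreFrame.sphere Y Z (σ j) y) w = 0) : L.IsReducibleAt x := by
  set y₀ := chartAt (E (c + 1)) x x with hy₀
  have F := H.frame
  have hB := isLieForm_lieBilin (c + 1 + 1)
  have hO₀ := S.subset hx
  by_cases hg : ∀ p, p = j
  · exact H.isReducibleAt_of_subsingleton S hx j hg
  push Not at hg
  obtain ⟨p, hpj⟩ := hg
  obtain ⟨a, t, rfl⟩ := Submodule.mem_span_pair.1 hw
  obtain ⟨m, b⟩ := S.dupin j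
  -- Every other curvature sphere at `y₀` satisfies the same affine equation, so there is exactly
  -- one, `σ p`, and `w` is a multiple of its sphere. The two families are then mutually orthogonal,
  -- and two values of the second family form the null pair.
  have hco : ∀ q, q ≠ j → a + t * (σ j y₀ - σ q y₀) = 0 := by
    intro q hq
    have h1 : σ q y₀ ∈ spec Y Z y₀ := by rw [S.spec y₀ hx]; exact mem_range_self q
    obtain ⟨X, hX0, hX⟩ := mem_spec.1 h1
    exact b.coefficient_eq_zero F hB hx hKw hX0 hX fun h => hq (S.inj y₀ hx h)
  have ht : t ≠ 0 := by
    rintro rfl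
    have h1 := hco p hpj
    rw [zero_mul, add_zero] at h1
    exact hw0 (by rw [h1, zero_smul, zero_smul, add_zero])
  have hp : ∀ q, q ≠ j → q = p := by
    intro q hq
    have h1 : t * (σ q y₀ - σ p y₀) = 0 := by linear_combination hco p hpj - hco q hq
    exact S.inj y₀ hx (sub_eq_zero.1 ((mul_eq_zero.1 h1).resolve_left ht))
  obtain ⟨k, b'⟩ := S.dupin p
  have hmk : m + k = Module.finrank ℝ (E (c + 1)) := by
    have h1 := F.sum_finrank_principal hB (finrank_lieSpace_eq (c + 1)) hO₀ _ (S.inj y₀ hx)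
      (S.spec y₀ hx)
    have h2 : (Finset.univ : Finset (Fin g)) = {j, p} := by
      ext q
      simp only [Finset.mem_univ, Finset.mem_insert, Finset.mem_singleton, true_iff]
      exact or_iff_not_imp_left.2 (hp q)
    rwa [h2, Finset.sum_pair hpj.symm, b.rank y₀ hx, b'.rank y₀ hx] at h1
  have hne : σ j y₀ ≠ σ p y₀ := fun h => hpj (S.inj y₀ hx h).symm
  obtain ⟨U', hU', hU'o, hxU', hort⟩ := b.eventually_orthogonal F hB b' hx hne hmk
  obtain ⟨y₁, hy₁, h₁⟩ := (b.mono hU'o hU').exists_form_ne_zero F hB (b'.mono hU'o hU') hxU' hne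
    (fun y hy => by rw [hB.symm]; exact hort y₀ hxU' y hy)
  exact H.isReducibleAt_of_null_pair (S.mono hU'o hU') hxU' j
    (F.sphere_sphere hB hO₀) (F.sphere_sphere hB (S.subset (hU' hy₁))) h₁
    (fun y hy => hort y hy y₀ hxU') (fun y hy => hort y hy y₁ hy₁)

/-- A vector of the complement of `P` that is orthogonal to `Y y₀` is orthogonal to the whole line
at `y₀`, hence spacelike or on that line. This settles `e` or leads to the exceptional case; the
sign of a second vector `f` orthogonal to `e` selects the construction. -/
theorem LegendreSubmanifold.LocalFrame.isReducibleAt_of_sphere_mem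
    (H : L.LocalFrame x g O Y Z n₁ n₂) (S : BranchSystem O Y Z U σ)
    (hx : chartAt (E (c + 1)) x x ∈ U) (j : Fin g) (P : Submodule ℝ (LieSpace (c + 1 + 1)))
    (hP : Module.finrank ℝ P + 2 = Module.finrank ℝ (LieSpace (c + 1 + 1)))
    (hK : ∀ y ∈ U, LegendreFrame.sphere Y Z (σ j) y ∈ P) : L.IsReducibleAt x := by
  set y₀ := chartAt (E (c + 1)) x x with hy₀
  have F := H.frame
  have hB := isLieForm_lieBilin (c + 1 + 1)
  have hO₀ := S.subset hx
  have hYY : lieForm (Y y₀) (Y y₀) = 0 := F.YY y₀ hO₀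
  have hYZ : lieForm (Y y₀) (Z y₀) = 0 := F.YZ y₀ hO₀
  have hlin : LinearIndependent ℝ ![Y y₀, LegendreFrame.sphere Y Z (σ j) y₀] := by
    rw [LinearIndependent.pair_iff]
    intro p q hpq
    have e2 := congrArg n₂ hpq
    have e1 := congrArg n₁ hpq
    simp [LegendreFrame.sphere, F.n₁Y _ hO₀, F.n₁Z _ hO₀, F.n₂Y _ hO₀, F.n₂Z _ hO₀] at e1 e2
    exact ⟨by rw [e2] at e1; linarith, e2⟩
  have hpos : ∀ v, (∀ u ∈ P, lieForm u v = 0) → lieForm (Y y₀) v = 0 → v ≠ 0 →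
      L.IsReducibleAt x ∨ 0 < lieForm v v := by
    intro v hv hYv hv0
    have h1 := hB.pos _ _ hlin hYY (by
        rw [lieBilin_apply, LegendreFrame.sphere, lieForm_add_right, lieForm_smul_right, hYY, hYZ]
        simp) (F.sphere_sphere hB hO₀) v (by rw [lieBilin_apply, lieForm_comm, hYv])
      (by rw [lieBilin_apply, lieForm_comm, hv _ (hK y₀ hx)])
    rcases h1.1.lt_or_eq with h2 | h2
    · exact Or.inr h2
    · exact Or.inl (H.isReducibleAt_of_mem_line S hx j hv0 (h1.2 h2.symm)
        fun y hy => hv _ (hK y hy))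
  obtain ⟨e₀, he0, hYe₀, hPe₀⟩ := exists_orthogonal_ne_zero P hP (lieBilin _ (Y y₀)).toLinearMap
  rcases hpos e₀ hPe₀ hYe₀ he0 with h | he₀
  · exact h
  obtain ⟨r, hee⟩ := exists_smul_lieForm_eq (q := 1) (by rwa [mul_one]) (one_pow 2)
  set e := r • e₀ with he
  have hYe : lieForm (Y y₀) e = 0 := by rw [he, lieForm_smul_right]; exact mul_eq_zero_of_right _ hYe₀
  have hPe : ∀ v ∈ P, lieForm v e = 0 := fun v hv => by
    rw [he, lieForm_smul_right, hPe₀ v hv, mul_zero]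
  obtain ⟨f, hf0, hef, hPf⟩ := exists_orthogonal_ne_zero P hP (lieBilin _ e).toLinearMap
  have hef' : lieForm e f = 0 := hef
  have hnorm : ∀ q : ℝ, 0 < lieForm f f * q → q ^ 2 = 1 → ∃ f', lieForm f' f' = q ∧
      lieForm e f' = 0 ∧ ∀ v ∈ P, lieForm v f' = 0 := by
    intro q h hq
    obtain ⟨s, hs⟩ := exists_smul_lieForm_eq h hq
    exact ⟨s • f, hs, by rw [lieForm_smul_right, hef', mul_zero],
      fun v hv => by rw [lieForm_smul_right, hPf v hv, mul_zero]⟩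
  rcases lt_trichotomy (lieForm f f) 0 with h | h | h
  · obtain ⟨f', hff, hef, hPf⟩ := hnorm (-1) (by linarith) (by norm_num)
    exact H.isReducibleAt_of_tube S hx j hee hff hef (fun y hy => hPe _ (hK y hy))
      (fun y hy => hPf _ (hK y hy))
  -- A null `f` orthogonal to `Y y₀` would lie on the line at `y₀`. Otherwise `f` serves as the
  -- improper point of a cylinder.
  · by_cases hYf : lieForm (Y y₀) f = 0
    · exact (hpos f hPf hYf hf0).resolve_right h.not_gt
    · exact H.isReducibleAt_of_cylinder S hx j hee h hef' (fun y hy => hPe _ (hK y hy))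
        (fun y hy => hPf _ (hK y hy)) hYe hYf
  · obtain ⟨f', hff, hef, hPf⟩ := hnorm 1 (by linarith) (by norm_num)
    exact H.isReducibleAt_of_revolution S hx j hee hff hef (fun y hy => hPe _ (hK y hy))
      (fun y hy => hPf _ (hK y hy)) hYe

end

theorem LegendreSubmanifold.isReducible_of_curvatureSphere_le {d : ℕ} (hd : 1 ≤ d) {W : Type*}
    [TopologicalSpace W] [T2Space W] [ChartedSpace (E d) W] [IsManifold (𝓡 d) ∞ W]
    (L : LegendreSubmanifold d W) (hL : L.IsProperDupin) (P : Submodule ℝ (LieSpace (d + 1)))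
    (hP : Module.finrank ℝ P + 2 = Module.finrank ℝ (LieSpace (d + 1)))
    (hK : ∀ x, ∃ K ∈ L.curvatureSpheres x, K.submodule ≤ P) : L.IsReducible := by
  obtain ⟨c, rfl⟩ := Nat.exists_eq_add_of_le' hd
  obtain ⟨hD, g, hg⟩ := hL
  intro x
  obtain ⟨O, Y, Z, n₁, n₂, H, ε, hε, σ, S⟩ := L.exists_localSystem hD hg x
  obtain ⟨j, hj⟩ := H.exists_sphere_mem S hε P
    (subset_closure (Eventually.of_forall fun y => hK y))
  exact H.isReducibleAt_of_sphere_mem S (Metric.mem_ball_self hε) j P hP hj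

end LieSphere

theorem theorem4p2p9 {d : ℕ} (hd : 1 ≤ d) {W : Type*} [TopologicalSpace W] [T2Space W]
    [SecondCountableTopology W] [ConnectedSpace W]
    [ChartedSpace (EuclideanSpace ℝ (Fin d)) W] [IsManifold (𝓡 d) ∞ W]
    (L : LieSphere.LegendreSubmanifold d W) (hL : L.IsProperDupin) :
    L.IsReducible ↔
      ∃ K : W → ℙ ℝ (LieSphere.LieSpace (d + 1)), L.IsCurvatureSphereMap K ∧
        ∃ P : Submodule ℝ (LieSphere.LieSpace (d + 1)),
          Module.finrank ℝ P + 2 = Module.finrank ℝ (LieSphere.LieSpace (d + 1)) ∧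
          ∀ x, (K x).submodule ≤ P :=
  ⟨LieSphere.LegendreSubmanifold.IsReducible.exists_curvatureSphereMap hd hL,
    fun ⟨K, hK, P, hP, hKP⟩ => L.isReducible_of_curvatureSphere_le hd hL P hP
      fun x => ⟨K x, hK.1 x, hKP x⟩⟩
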